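/- Let $k$ be a field of characteristic $0$. Operads are non-unital (given by partial compositions) and symmetric, in chain complexes over $k$ with homological grading; morphisms of operads have degree $0$ and commute with the differentials. For an element $x$ of given arity and degree, $[x]$ is the free graded operad on $x$, and $\vee$ is the coproduct of graded operads. Let $\mathrm{cL}_\infty$ be the free operad on generators $\ell_n$, $n\ge 0$, of arity $n$ and degree $-1$ which are invariant under the symmetric group $\mathbb S_n$, with differential $$d\ell_n=-\sum_{p+q=n}\ \sum_{\sigma}(\ell_{p+1}\circ_1\ell_q)^\sigma ,$$ where $\sigma$ runs over the unshuffles which distribute the $n$ inputs among the $q$ inputs of $\ell_q$ and the $p$ remaining inputs of $\ell_{p+1}$, preserving the order in both groups. Let $(\mathrm{cL}_\infty\downarrow\mathrm{Op})$ be the category of operads $\mathrm Q$ with a morphism $\mathrm{cL}_\infty\to \mathrm Q$; the images of the $\ell_n$ in $\mathrm Q$ are again written $\ell_n$. The category $\mathrm{Curv}_\infty$ of curved twisting structures has as objects the pairs of a morphism of operads $\mathrm{cL}_\infty\to \mathrm Q$ and a graded suboperad $\mathrm Q_0\subset \mathrm Q$ (not necessarily closed under $d$) such that (i) the natural map $[\ell_0]\vee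 \mathrm Q_0\to \mathrm Q$ is an isomorphism of graded operads; (ii) $\ell_n\in \mathrm Q_0$ for all $n>0$; (iii) every element of $d(\mathrm Q_0)$ is a sum of elements of degrees $0$ and $1$ in $\ell_0$. Its morphisms $(\mathrm Q,\mathrm Q_0)\to(\mathrm Q',\mathrm Q_0')$ are the morphisms $\mathrm Q\to \mathrm Q'$ under $\mathrm{cL}_\infty$ which map $\mathrm Q_0$ to $\mathrm Q'_0$. The curved twisting comonad $\mathrm{cTw}$ on $(\mathrm{cL}_\infty\downarrow\mathrm{Op})$ is the following. As a graded operad, $\mathrm{cTw}(\mathrm Q)=(\mathrm Q\,\hat\vee\,[\alpha])\vee[\kappa]$, with $\alpha$ of arity $0$ and degree $0$, $\kappa$ of arity $0$ and degree $-1$, and $\hat\vee$ the coproduct completed with respect to the filtration by the number of $\alpha$; thus its elements are series in $\alpha$ in which the number of $\kappa$ is bounded. The differential is the continuous extension of that of $\mathrm Q$ with $d\alpha=\kappa$. The morphism $\mathrm{cL}_\infty\to\mathrm{cTw}(\mathrm Q)$ sends $\ell_0$ to $\kappa+\ell_0^\alpha$ and $\ell_n$ to $\ell_n^\alpha$ for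 $n\ge 1$, where $\ell_n^\alpha=\sum_{t\ge 0}\frac1{t!}\ell_{n+t}(\alpha^t,-,\dots,-)$. On morphisms, $\mathrm{cTw}(f)=f\vee 1$. The counit $\mathrm{cTw}(\mathrm Q)\to \mathrm Q$ is the identity on $\mathrm Q$ and sends $\alpha,\kappa$ to $0$; the comultiplication $\mathrm{cTw}(\mathrm Q)\to\mathrm{cTw}(\mathrm{cTw}(\mathrm Q))$ is the continuous morphism with $\nu\mapsto\nu$ for $\nu\in \mathrm Q$, $\alpha\mapsto\alpha'+\alpha$ and $\kappa\mapsto\kappa'+\kappa$, where $\alpha',\kappa'$ are the elements adjoined by the second application of $\mathrm{cTw}$. **Theorem.** The forgetful functor $\mathrm{Curv}_\infty\to(\mathrm{cL}_\infty\downarrow\mathrm{Op})$, $(\mathrm Q,\mathrm Q_0)\mapsto \mathrm Q$, is comonadic: it has a right adjoint, and the comparison functor from $\mathrm{Curv}_\infty$ to the category of coalgebras over the comonad induced by the adjunction is an equivalence. The induced comonad is isomorphic to $\mathrm{cTw}$. The same holds for nonsymmetric operads, with $\mathrm{cL}_\infty$ replaced by the nonsymmetric operad $\mathrm{cA}_\infty$,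 which is free on generators $\mu_n$, $n\ge0$, of arity $n$ and degree $-1$, with differential $d\mu_n=-\sum_{p+q+r=n}\mu_{p+1+r}\circ_{p+1}\mu_q$, and with $\ell_n^\alpha$ replaced by $\mu_n^\alpha=\sum_{r_0,\dots,r_n\ge0}\mu_{n+r_0+\cdots+r_n}(\alpha^{r_0},-,\alpha^{r_1},-,\dots,-,\alpha^{r_n})$. -/

import Mathlib

open CategoryTheory

universe u

namespace CurvedTwisting

noncomputable section

/-! ## Operads

Operads are non-unital, given by partial compositions, in `ℤ`-graded vector spaces or in chain
complexes (homological grading) over a field `k`. Only homogeneous elements are used: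
`P.obj n a` is the space of operations of arity `n` and degree `a`. -/

/-- The two kinds of operads. -/
inductive Flavor
  | symmetric
  | nonsymmetric

/-- The permutations of the `n` inputs that act on an operad: all of them for symmetric
operads, only the identity for nonsymmetric ones. -/
def Flavor.perms (F : Flavor) (n : ℕ) : Subgroup (Equiv.Perm (Fin n)) :=
  match F with
  | .symmetric => ⊤
  | .nonsymmetric => ⊥

/-- The Koszul sign `(-1) ^ a`. -/
def ksign (k : Type u) [Field k] (a : ℤ) : k := if Even a then 1 else -1

/-- In `x ∘ y`, where the `n`-ary `y` is plugged into the input number `i` of `x` (counting from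
`0`), the input `s ≠ i` of `x` becomes the input number `outer i n s`. -/
def outer (i n s : ℕ) : ℕ := if s < i then s else s + n - 1

/-- `ρ` is the permutation of the inputs of `x ∘ y` (`y` of arity `n` in the input `i` of `x`)
induced by relabelling the inputs of `x` by `σ` and those of `y` by `τ`; here `i' = σ i`. -/
def IsInduced {m n p : ℕ} (i i' : ℕ) (σ : Equiv.Perm (Fin m)) (τ : Equiv.Perm (Fin n))
    (ρ : Equiv.Perm (Fin p)) : Prop :=
  (∀ s : Fin m, (s : ℕ) = i → (σ s : ℕ) = i') ∧
  (∀ (t : Fin n) (z : Fin p), (z : ℕ) = i + t → (ρ z : ℕ) = i' + τ t) ∧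
  (∀ (s : Fin m) (z : Fin p), (s : ℕ) ≠ i → (z : ℕ) = outer i n s → (ρ z : ℕ) = outer i' n (σ s))

/-- A graded operad. `comp i j` is the partial composition `∘_{i+1}`: it plugs an operation into
the input which has `i` inputs to its left and `j` inputs to its right. `act σ x` relabels the
input `s` of `x` as `σ s`, so it is `x ^ (σ⁻¹)` for the customary right action. -/
structure GrOperad (F : Flavor) (k : Type u) [Field k] where
  obj : ℕ → ℤ → Type u
  [ab : ∀ n a, AddCommGroup (obj n a)]
  [mod : ∀ n a, Module k (obj n a)]
  act : ∀ {n : ℕ} {a : ℤ}, F.perms n → obj n a →ₗ[k] obj n a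
  comp : ∀ {m n p : ℕ} {a b c : ℤ} (i j : ℕ), m = i + 1 + j → p = i + n + j → c = a + b →
    (obj m a →ₗ[k] obj n b →ₗ[k] obj p c)
  act_one : ∀ {n a} (x : obj n a), act 1 x = x
  act_mul : ∀ {n a} (σ τ : F.perms n) (x : obj n a), act (σ * τ) x = act σ (act τ x)
  comp_act : ∀ {m n p : ℕ} {a b c : ℤ} (i j i' j' : ℕ) (hm : m = i + 1 + j)
    (hp : p = i + n + j) (hc : c = a + b) (hm' : m = i' + 1 + j') (hp' : p = i' + n + j')
    (σ : F.perms m) (τ : F.perms n) (ρ : F.perms p), IsInduced i i' σ.1 τ.1 ρ.1 →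
    ∀ (x : obj m a) (y : obj n b),
      act ρ (comp i j hm hp hc x y) = comp i' j' hm' hp' hc (act σ x) (act τ y)
  comp_seq : ∀ {m n l p q r : ℕ} {a b c ab bc abc : ℤ} (i j i' j' : ℕ)
    (hm : m = i + 1 + j) (hn : n = i' + 1 + j') (hp : p = i + n + j)
    (hp' : p = (i + i') + 1 + (j' + j)) (hq : q = (i + i') + l + (j' + j))
    (hr : r = i' + l + j') (hq' : q = i + r + j)
    (h₁ : ab = a + b) (h₂ : abc = ab + c) (h₃ : bc = b + c) (h₄ : abc = a + bc)
    (x : obj m a) (y : obj n b) (z : obj l c),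
      comp (i + i') (j' + j) hp' hq h₂ (comp i j hm hp h₁ x y) z =
        comp i j hm hq' h₄ x (comp i' j' hn hr h₃ y z)
  comp_par : ∀ {m n l p q r : ℕ} {a b c ab ac abc : ℤ} (i j j' : ℕ)
    (hm : m = i + 1 + (j + 1 + j')) (hm' : m = (i + 1 + j) + 1 + j')
    (hp : p = i + n + (j + 1 + j')) (hp' : p = (i + n + j) + 1 + j')
    (hq : q = (i + n + j) + l + j')
    (hr : r = (i + 1 + j) + l + j') (hr' : r = i + 1 + (j + l + j'))
    (hq' : q = i + n + (j + l + j'))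
    (h₁ : ab = a + b) (h₂ : abc = ab + c) (h₃ : ac = a + c) (h₄ : abc = ac + b)
    (x : obj m a) (y : obj n b) (z : obj l c),
      comp (i + n + j) j' hp' hq h₂ (comp i (j + 1 + j') hm hp h₁ x y) z =
        ksign k (b * c) •
          comp i (j + l + j') hr' hq' h₄ (comp (i + 1 + j) j' hm' hr h₃ x z) y

attribute [instance] GrOperad.ab GrOperad.mod

/-- Morphisms of graded operads (of degree `0`). -/
@[ext]
structure GrHom {F : Flavor} {k : Type u} [Field k] (P Q : GrOperad F k) where
  map : ∀ {n : ℕ} {a : ℤ}, P.obj n a →ₗ[k] Q.obj n a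
  map_act : ∀ {n a} (σ : F.perms n) (x : P.obj n a), map (P.act σ x) = Q.act σ (map x)
  map_comp : ∀ {m n p : ℕ} {a b c : ℤ} (i j : ℕ) (hm : m = i + 1 + j) (hp : p = i + n + j)
    (hc : c = a + b) (x : P.obj m a) (y : P.obj n b),
      map (P.comp i j hm hp hc x y) = Q.comp i j hm hp hc (map x) (map y)

/-- A dg operad; the differential has degree `-1`. -/
structure DGOperad (F : Flavor) (k : Type u) [Field k] extends GrOperad F k where
  d : ∀ {n : ℕ} {a b : ℤ}, b + 1 = a → (obj n a →ₗ[k] obj n b)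
  d_d : ∀ {n a b c} (h : b + 1 = a) (h' : c + 1 = b) (x : obj n a), d h' (d h x) = 0
  d_act : ∀ {n a b} (h : b + 1 = a) (σ : F.perms n) (x : obj n a),
    d h (act σ x) = act σ (d h x)
  d_comp : ∀ {m n p : ℕ} {a b c a' b' c' : ℤ} (i j : ℕ) (hm : m = i + 1 + j)
    (hp : p = i + n + j) (hc : c = a + b) (hc' : c' + 1 = c) (ha' : a' + 1 = a) (hb' : b' + 1 = b)
    (h₁ : c' = a' + b) (h₂ : c' = a + b') (x : obj m a) (y : obj n b),
      d hc' (comp i j hm hp hc x y) =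
        comp i j hm hp h₁ (d ha' x) y + ksign k a • comp i j hm hp h₂ x (d hb' y)

/-- Morphisms of dg operads. -/
@[ext]
structure DGHom {F : Flavor} {k : Type u} [Field k] (P Q : DGOperad F k)
    extends GrHom P.toGrOperad Q.toGrOperad where
  map_d : ∀ {n a b} (h : b + 1 = a) (x : P.obj n a), map (P.d h x) = Q.d h (map x)

instance (F : Flavor) (k : Type u) [Field k] : Category.{u} (DGOperad F k) where
  Hom P Q := DGHom P Q
  id P :=
    { map := LinearMap.id
      map_act := fun _ _ => rfl
      map_comp := fun _ _ _ _ _ _ _ => rfl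
      map_d := fun _ _ => rfl }
  comp f g :=
    { map := g.map ∘ₗ f.map
      map_act := fun σ x => by simp [f.map_act, g.map_act]
      map_comp := fun i j hm hp hc x y => by simp [f.map_comp, g.map_comp]
      map_d := fun h x => by simp [f.map_d, g.map_d] }

/-- The underlying maps of a morphism in the category of dg operads. -/
abbrev app {F : Flavor} {k : Type u} [Field k] {P Q : DGOperad F k} (f : P ⟶ Q) {n : ℕ} {a : ℤ} :
    P.obj n a →ₗ[k] Q.obj n a :=
  f.toGrHom.map

/-! ## Dg operads given by generators and relations -/

section Presentation

variable {F : Flavor} {k : Type u} [Field k]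

/-- Formal expressions in the operations of a dg operad, with generators `G`. -/
inductive Term (F : Flavor) (k : Type u) [Field k] (G : ℕ → ℤ → Type u) : ℕ → ℤ → Type u
  | gen {n : ℕ} {a : ℤ} (g : G n a) : Term F k G n a
  | zero {n : ℕ} {a : ℤ} : Term F k G n a
  | add {n : ℕ} {a : ℤ} (x y : Term F k G n a) : Term F k G n a
  | smul {n : ℕ} {a : ℤ} (c : k) (x : Term F k G n a) : Term F k G n a
  | act {n : ℕ} {a : ℤ} (σ : F.perms n) (x : Term F k G n a) : Term F k G n a
  | comp {m n p : ℕ} {a b c : ℤ} (i j : ℕ) (hm : m = i + 1 + j) (hp : p = i + n + j)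
      (hc : c = a + b) (x : Term F k G m a) (y : Term F k G n b) : Term F k G p c
  | d {n : ℕ} {a b : ℤ} (h : b + 1 = a) (x : Term F k G n a) : Term F k G n b

/-- The formal sum of a list of expressions. -/
def Term.sum {G : ℕ → ℤ → Type u} {n : ℕ} {a : ℤ} (l : List (Term F k G n a)) : Term F k G n a :=
  l.foldr Term.add Term.zero

open Term in
/-- The congruence on expressions generated by the axioms of dg operads and the relations `r`. -/
inductive Cong {G : ℕ → ℤ → Type u}
    (r : ∀ {n : ℕ} {a : ℤ}, Term F k G n a → Term F k G n a → Prop) :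
    ∀ {n : ℕ} {a : ℤ}, Term F k G n a → Term F k G n a → Prop
  | rel {n a} {x y : Term F k G n a} : r x y → Cong r x y
  | refl {n a} (x : Term F k G n a) : Cong r x x
  | symm {n a} {x y : Term F k G n a} : Cong r x y → Cong r y x
  | trans {n a} {x y z : Term F k G n a} : Cong r x y → Cong r y z → Cong r x z
  | add_congr {n a} {x x' y y' : Term F k G n a} :
      Cong r x x' → Cong r y y' → Cong r (add x y) (add x' y')
  | smul_congr {n a} (c : k) {x x' : Term F k G n a} :
      Cong r x x' → Cong r (smul c x) (smul c x')
  | act_congr {n a} (σ : F.perms n) {x x' : Term F k G n a} :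
      Cong r x x' → Cong r (act σ x) (act σ x')
  | comp_congr {m n p a b c} (i j : ℕ) (hm : m = i + 1 + j) (hp : p = i + n + j) (hc : c = a + b)
      {x x' : Term F k G m a} {y y' : Term F k G n b} : Cong r x x' → Cong r y y' →
      Cong r (comp i j hm hp hc x y) (comp i j hm hp hc x' y')
  | d_congr {n a b} (h : b + 1 = a) {x x' : Term F k G n a} :
      Cong r x x' → Cong r (d h x) (d h x')
  | add_comm {n a} (x y : Term F k G n a) : Cong r (add x y) (add y x)
  | add_assoc {n a} (x y z : Term F k G n a) : Cong r (add (add x y) z) (add x (add y z))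
  | zero_add {n a} (x : Term F k G n a) : Cong r (add zero x) x
  | smul_add {n a} (c : k) (x y : Term F k G n a) :
      Cong r (smul c (add x y)) (add (smul c x) (smul c y))
  | add_smul {n a} (c c' : k) (x : Term F k G n a) :
      Cong r (smul (c + c') x) (add (smul c x) (smul c' x))
  | mul_smul {n a} (c c' : k) (x : Term F k G n a) : Cong r (smul (c * c') x) (smul c (smul c' x))
  | one_smul {n a} (x : Term F k G n a) : Cong r (smul 1 x) x
  | zero_smul {n a} (x : Term F k G n a) : Cong r (smul 0 x) zero
  | act_add {n a} (σ : F.perms n) (x y : Term F k G n a) :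
      Cong r (act σ (add x y)) (add (act σ x) (act σ y))
  | act_smul {n a} (σ : F.perms n) (c : k) (x : Term F k G n a) :
      Cong r (act σ (smul c x)) (smul c (act σ x))
  | act_one {n a} (x : Term F k G n a) : Cong r (act 1 x) x
  | act_mul {n a} (σ τ : F.perms n) (x : Term F k G n a) :
      Cong r (act (σ * τ) x) (act σ (act τ x))
  | comp_add_left {m n p a b c} (i j : ℕ) (hm : m = i + 1 + j) (hp : p = i + n + j)
      (hc : c = a + b) (x x' : Term F k G m a) (y : Term F k G n b) :
      Cong r (comp i j hm hp hc (add x x') y)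
        (add (comp i j hm hp hc x y) (comp i j hm hp hc x' y))
  | comp_smul_left {m n p a b c} (i j : ℕ) (hm : m = i + 1 + j) (hp : p = i + n + j)
      (hc : c = a + b) (e : k) (x : Term F k G m a) (y : Term F k G n b) :
      Cong r (comp i j hm hp hc (smul e x) y) (smul e (comp i j hm hp hc x y))
  | comp_add_right {m n p a b c} (i j : ℕ) (hm : m = i + 1 + j) (hp : p = i + n + j)
      (hc : c = a + b) (x : Term F k G m a) (y y' : Term F k G n b) :
      Cong r (comp i j hm hp hc x (add y y'))
        (add (comp i j hm hp hc x y) (comp i j hm hp hc x y'))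
  | comp_smul_right {m n p a b c} (i j : ℕ) (hm : m = i + 1 + j) (hp : p = i + n + j)
      (hc : c = a + b) (e : k) (x : Term F k G m a) (y : Term F k G n b) :
      Cong r (comp i j hm hp hc x (smul e y)) (smul e (comp i j hm hp hc x y))
  | comp_act {m n p a b c} (i j i' j' : ℕ) (hm : m = i + 1 + j) (hp : p = i + n + j)
      (hc : c = a + b) (hm' : m = i' + 1 + j') (hp' : p = i' + n + j')
      (σ : F.perms m) (τ : F.perms n) (ρ : F.perms p) (h : IsInduced i i' σ.1 τ.1 ρ.1)
      (x : Term F k G m a) (y : Term F k G n b) :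
      Cong r (act ρ (comp i j hm hp hc x y)) (comp i' j' hm' hp' hc (act σ x) (act τ y))
  | comp_seq {m n l p q s : ℕ} {a b c ab bc abc : ℤ} (i j i' j' : ℕ)
      (hm : m = i + 1 + j) (hn : n = i' + 1 + j') (hp : p = i + n + j)
      (hp' : p = (i + i') + 1 + (j' + j)) (hq : q = (i + i') + l + (j' + j))
      (hs : s = i' + l + j') (hq' : q = i + s + j)
      (h₁ : ab = a + b) (h₂ : abc = ab + c) (h₃ : bc = b + c) (h₄ : abc = a + bc)
      (x : Term F k G m a) (y : Term F k G n b) (z : Term F k G l c) :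
      Cong r (comp (i + i') (j' + j) hp' hq h₂ (comp i j hm hp h₁ x y) z)
        (comp i j hm hq' h₄ x (comp i' j' hn hs h₃ y z))
  | comp_par {m n l p q s : ℕ} {a b c ab ac abc : ℤ} (i j j' : ℕ)
      (hm : m = i + 1 + (j + 1 + j')) (hm' : m = (i + 1 + j) + 1 + j')
      (hp : p = i + n + (j + 1 + j')) (hp' : p = (i + n + j) + 1 + j')
      (hq : q = (i + n + j) + l + j')
      (hs : s = (i + 1 + j) + l + j') (hs' : s = i + 1 + (j + l + j'))
      (hq' : q = i + n + (j + l + j'))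
      (h₁ : ab = a + b) (h₂ : abc = ab + c) (h₃ : ac = a + c) (h₄ : abc = ac + b)
      (x : Term F k G m a) (y : Term F k G n b) (z : Term F k G l c) :
      Cong r (comp (i + n + j) j' hp' hq h₂ (comp i (j + 1 + j') hm hp h₁ x y) z)
        (smul (ksign k (b * c))
          (comp i (j + l + j') hs' hq' h₄ (comp (i + 1 + j) j' hm' hs h₃ x z) y))
  | d_add {n a b} (h : b + 1 = a) (x y : Term F k G n a) :
      Cong r (d h (add x y)) (add (d h x) (d h y))
  | d_smul {n a b} (h : b + 1 = a) (c : k) (x : Term F k G n a) :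
      Cong r (d h (smul c x)) (smul c (d h x))
  | d_d {n a b c} (h : b + 1 = a) (h' : c + 1 = b) (x : Term F k G n a) :
      Cong r (d h' (d h x)) zero
  | d_act {n a b} (h : b + 1 = a) (σ : F.perms n) (x : Term F k G n a) :
      Cong r (d h (act σ x)) (act σ (d h x))
  | d_comp {m n p : ℕ} {a b c a' b' c' : ℤ} (i j : ℕ) (hm : m = i + 1 + j)
      (hp : p = i + n + j) (hc : c = a + b) (hc' : c' + 1 = c) (ha' : a' + 1 = a)
      (hb' : b' + 1 = b) (h₁ : c' = a' + b) (h₂ : c' = a + b')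
      (x : Term F k G m a) (y : Term F k G n b) :
      Cong r (d hc' (comp i j hm hp hc x y))
        (add (comp i j hm hp h₁ (d ha' x) y)
          (smul (ksign k a) (comp i j hm hp h₂ x (d hb' y))))

variable {G : ℕ → ℤ → Type u} (r : ∀ {n : ℕ} {a : ℤ}, Term F k G n a → Term F k G n a → Prop)

/-- Expressions up to congruence. -/
def Pres (n : ℕ) (a : ℤ) : Type u := Quot (Cong (@r) (n := n) (a := a))

namespace Pres

variable {r}

/-- The class of an expression. -/
def mk {n : ℕ} {a : ℤ} (x : Term F k G n a) : Pres (@r) n a := Quot.mk _ x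

theorem sound {n : ℕ} {a : ℤ} {x y : Term F k G n a} (h : Cong (@r) x y) :
    (mk x : Pres (@r) n a) = mk y := Quot.sound h

instance (n : ℕ) (a : ℤ) : Zero (Pres (@r) n a) := ⟨mk .zero⟩

instance (n : ℕ) (a : ℤ) : Add (Pres (@r) n a) :=
  ⟨Quot.map₂ Term.add (fun _ _ _ h => .add_congr (.refl _) h)
    (fun _ _ _ h => .add_congr h (.refl _))⟩

instance (n : ℕ) (a : ℤ) : Neg (Pres (@r) n a) :=
  ⟨Quot.map (Term.smul (-1)) (fun _ _ h => .smul_congr _ h)⟩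

instance (n : ℕ) (a : ℤ) : AddCommGroup (Pres (@r) n a) where
  add_assoc := by rintro ⟨x⟩ ⟨y⟩ ⟨z⟩; exact sound (.add_assoc x y z)
  zero_add := by rintro ⟨x⟩; exact sound (.zero_add x)
  add_zero := by rintro ⟨x⟩; exact sound ((Cong.add_comm _ _).trans (.zero_add x))
  add_comm := by rintro ⟨x⟩ ⟨y⟩; exact sound (.add_comm x y)
  neg_add_cancel := by
    rintro ⟨x⟩
    refine sound (((Cong.add_congr (.refl _) (.symm (.one_smul x))).trans
      (.symm (.add_smul _ _ x))).trans ?_)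
    rw [neg_add_cancel]
    exact .zero_smul x
  nsmul := nsmulRec
  zsmul := zsmulRec

instance (n : ℕ) (a : ℤ) : Module k (Pres (@r) n a) where
  smul c := Quot.map (Term.smul c) (fun _ _ h => .smul_congr _ h)
  one_smul := by rintro ⟨x⟩; exact sound (.one_smul x)
  mul_smul := by rintro c c' ⟨x⟩; exact sound (.mul_smul c c' x)
  smul_add := by rintro c ⟨x⟩ ⟨y⟩; exact sound (.smul_add c x y)
  add_smul := by rintro c c' ⟨x⟩; exact sound (.add_smul c c' x)
  zero_smul := by rintro ⟨x⟩; exact sound (.zero_smul x)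
  smul_zero := by
    intro c
    refine sound (((Cong.smul_congr c (.symm (.zero_smul .zero))).trans
      (.symm (.mul_smul _ _ _))).trans ?_)
    rw [mul_zero]
    exact .zero_smul _

end Pres

/-- The dg operad with generators `G` and relations `r`. -/
def presented : DGOperad F k where
  obj := Pres (@r)
  act σ :=
    { toFun := Quot.map (Term.act σ) (fun _ _ h => .act_congr _ h)
      map_add' := by rintro ⟨x⟩ ⟨y⟩; exact Pres.sound (.act_add σ x y)
      map_smul' := by rintro c ⟨x⟩; exact Pres.sound (.act_smul σ c x) }
  comp i j hm hp hc := LinearMap.mk₂ k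
    (Quot.map₂ (Term.comp i j hm hp hc) (fun _ _ _ h => .comp_congr _ _ _ _ _ (.refl _) h)
      (fun _ _ _ h => .comp_congr _ _ _ _ _ h (.refl _)))
    (by rintro ⟨x⟩ ⟨x'⟩ ⟨y⟩; exact Pres.sound (.comp_add_left i j hm hp hc x x' y))
    (by rintro c ⟨x⟩ ⟨y⟩; exact Pres.sound (.comp_smul_left i j hm hp hc c x y))
    (by rintro ⟨x⟩ ⟨y⟩ ⟨y'⟩; exact Pres.sound (.comp_add_right i j hm hp hc x y y'))
    (by rintro c ⟨x⟩ ⟨y⟩; exact Pres.sound (.comp_smul_right i j hm hp hc c x y))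
  d h :=
    { toFun := Quot.map (Term.d h) (fun _ _ h => .d_congr _ h)
      map_add' := by rintro ⟨x⟩ ⟨y⟩; exact Pres.sound (.d_add h x y)
      map_smul' := by rintro c ⟨x⟩; exact Pres.sound (.d_smul h c x) }
  act_one := by rintro _ _ ⟨x⟩; exact Pres.sound (.act_one x)
  act_mul := by rintro _ _ σ τ ⟨x⟩; exact Pres.sound (.act_mul σ τ x)
  comp_act := by
    rintro _ _ _ _ _ _ i j i' j' hm hp hc hm' hp' σ τ ρ h ⟨x⟩ ⟨y⟩
    exact Pres.sound (.comp_act i j i' j' hm hp hc hm' hp' σ τ ρ h x y)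
  comp_seq := by
    rintro _ _ _ _ _ _ _ _ _ _ _ _ i j i' j' hm hn hp hp' hq hr hq' h₁ h₂ h₃ h₄ ⟨x⟩ ⟨y⟩ ⟨z⟩
    exact Pres.sound (.comp_seq i j i' j' hm hn hp hp' hq hr hq' h₁ h₂ h₃ h₄ x y z)
  comp_par := by
    rintro _ _ _ _ _ _ _ _ _ _ _ _ i j j' hm hm' hp hp' hq hr hr' hq' h₁ h₂ h₃ h₄ ⟨x⟩ ⟨y⟩ ⟨z⟩
    exact Pres.sound (.comp_par i j j' hm hm' hp hp' hq hr hr' hq' h₁ h₂ h₃ h₄ x y z)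
  d_d := by rintro _ _ _ _ h h' ⟨x⟩; exact Pres.sound (.d_d h h' x)
  d_act := by rintro _ _ _ h σ ⟨x⟩; exact Pres.sound (.d_act h σ x)
  d_comp := by
    rintro _ _ _ _ _ _ _ _ _ i j hm hp hc hc' ha' hb' h₁ h₂ ⟨x⟩ ⟨y⟩
    exact Pres.sound (.d_comp i j hm hp hc hc' ha' hb' h₁ h₂ x y)

/-- The value of an expression in a dg operad, given the values of the generators. -/
def Term.eval (P : DGOperad F k) (v : ∀ {n : ℕ} {a : ℤ}, G n a → P.obj n a) :
    ∀ {n : ℕ} {a : ℤ}, Term F k G n a → P.obj n a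
  | _, _, .gen g => v g
  | _, _, .zero => 0
  | _, _, .add x y => x.eval P v + y.eval P v
  | _, _, .smul c x => c • x.eval P v
  | _, _, .act σ x => P.act σ (x.eval P v)
  | _, _, .comp i j hm hp hc x y => P.comp i j hm hp hc (x.eval P v) (y.eval P v)
  | _, _, .d h x => P.d h (x.eval P v)

theorem Cong.eval_eq {P : DGOperad F k} {v : ∀ {n : ℕ} {a : ℤ}, G n a → P.obj n a}
    (hv : ∀ {n : ℕ} {a : ℤ} (x y : Term F k G n a), r x y → x.eval P v = y.eval P v)
    {n : ℕ} {a : ℤ} {x y : Term F k G n a} (h : Cong (@r) x y) : x.eval P v = y.eval P v := by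
  induction h with
  | rel h => exact hv _ _ h
  | refl => rfl
  | symm _ ih => exact ih.symm
  | trans _ _ ih₁ ih₂ => exact ih₁.trans ih₂
  | comp_act i j i' j' hm hp hc hm' hp' σ τ ρ h x y =>
    exact P.comp_act i j i' j' hm hp hc hm' hp' σ τ ρ h _ _
  | comp_seq i j i' j' hm hn hp hp' hq hr hq' h₁ h₂ h₃ h₄ x y z =>
    exact P.comp_seq i j i' j' hm hn hp hp' hq hr hq' h₁ h₂ h₃ h₄ _ _ _
  | comp_par i j j' hm hm' hp hp' hq hr hr' hq' h₁ h₂ h₃ h₄ x y z =>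
    exact P.comp_par i j j' hm hm' hp hp' hq hr hr' hq' h₁ h₂ h₃ h₄ _ _ _
  | d_comp i j hm hp hc hc' ha' hb' h₁ h₂ x y =>
    exact P.d_comp i j hm hp hc hc' ha' hb' h₁ h₂ _ _
  | d_d h h' x => exact P.d_d h h' _
  | d_act h σ x => exact P.d_act h σ _
  | act_one x => exact P.act_one _
  | act_mul σ τ x => exact P.act_mul σ τ _
  | add_comm x y => exact _root_.add_comm _ _
  | add_assoc x y z => exact _root_.add_assoc _ _ _
  | add_smul c c' x => exact _root_.add_smul _ _ _
  | mul_smul c c' x => exact SemigroupAction.mul_smul _ _ _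
  | _ => simp_all [Term.eval]

/-- The morphism out of `presented r` given by values of the generators which satisfy the
relations. -/
def presented.lift {P : DGOperad F k} (v : ∀ {n : ℕ} {a : ℤ}, G n a → P.obj n a)
    (hv : ∀ {n : ℕ} {a : ℤ} (x y : Term F k G n a), r x y → x.eval P v = y.eval P v) :
    presented (@r) ⟶ P where
  map :=
    { toFun := Quot.lift (fun x => x.eval P v) (fun _ _ h => h.eval_eq (@r) hv)
      map_add' := by rintro ⟨x⟩ ⟨y⟩; rfl
      map_smul' := by rintro c ⟨x⟩; rfl }
  map_act := by rintro _ _ σ ⟨x⟩; rfl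
  map_comp := by rintro _ _ _ _ _ _ i j hm hp hc ⟨x⟩ ⟨y⟩; rfl
  map_d := by rintro _ _ _ h ⟨x⟩; rfl

end Presentation

/-! ## The operads `cL_∞` and `cA_∞` -/

section Curved

variable (F : Flavor) (k : Type u) [Field k]

/-- One generator of every arity `n ≥ 0`, of degree `-1`. -/
inductive CurvGen : ℕ → ℤ → Type u
  | ell (n : ℕ) : CurvGen n (-1)

/-- Permutations which are increasing on the first `q` and on the last `n - q` elements. They
relabel the inputs of `ℓ_{n-q+1} ∘_1 ℓ_q`, in which the first `q` inputs are those of `ℓ_q`; their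
inverses are the unshuffles. -/
def IsShuffle (n q : ℕ) (σ : Equiv.Perm (Fin n)) : Prop :=
  (∀ x y : Fin n, x < y → (y : ℕ) < q → σ x < σ y) ∧
  (∀ x y : Fin n, q ≤ (x : ℕ) → x < y → σ x < σ y)

/-- The set of these permutations, as relabellings acting on symmetric operads. -/
def shuffles (n q : ℕ) : Finset (Flavor.symmetric.perms n) :=
  (Set.toFinite {σ : Flavor.symmetric.perms n | IsShuffle n q σ.1}).toFinset

/-- The differential of the generator of arity `n`:
`- ∑_{p+q=n} ∑_σ (ℓ_{p+1} ∘_1 ℓ_q)^σ` over the unshuffles `σ` in the symmetric case and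
`- ∑_{p+q+r=n} μ_{p+1+r} ∘_{p+1} μ_q` in the nonsymmetric case. -/
def curvDiff : ∀ (F : Flavor) (n : ℕ), Term F k CurvGen n (-2)
  | .symmetric, n => .smul (-1) (.sum ((List.finRange (n + 1)).map fun q : Fin (n + 1) =>
      .sum ((shuffles n q).toList.map fun σ => .act σ
        (.comp 0 (n - q) (by omega) (by have := q.2; omega) (by norm_num)
          (.gen (.ell (n - q + 1))) (.gen (.ell q))))))
  | .nonsymmetric, n => .smul (-1) (.sum ((List.finRange (n + 1)).map fun p : Fin (n + 1) =>
      .sum ((List.finRange (n - p + 1)).map fun q : Fin (n - p + 1) =>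
        .comp p (n - p - q) rfl (by have := p.2; have := q.2; omega) (by norm_num)
          (.gen (.ell (p + 1 + (n - p - q)))) (.gen (.ell q)))))

/-- The relations: the generators are invariant under relabellings (which says nothing in the
nonsymmetric case), and their differentials are as prescribed. -/
inductive CurvRel : ∀ {n : ℕ} {a : ℤ}, Term F k CurvGen n a → Term F k CurvGen n a → Prop
  | act (n : ℕ) (σ : F.perms n) : CurvRel (.act σ (.gen (.ell n))) (.gen (.ell n))
  | diff (n : ℕ) : CurvRel (.d (by norm_num) (.gen (.ell n))) (curvDiff k F n)

/-- The operad `cL_∞` (symmetric case) or `cA_∞` (nonsymmetric case): the dg operad freely generated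
by invariant operations `ℓ_n`, `n ≥ 0`, with the prescribed differential. -/
def cInf : DGOperad F k := presented (CurvRel F k)

/-- The generator `ℓ_n` of `cL_∞`, resp. `μ_n` of `cA_∞`. -/
def ell (n : ℕ) : (cInf F k).obj n (-1) := Pres.mk (.gen (.ell n))

variable {F k}

/-- The image of `ℓ_n` in an operad under `cL_∞`, resp. of `μ_n` in an operad under `cA_∞`. -/
def ellOf (Q : Under (cInf F k)) (n : ℕ) : Q.right.obj n (-1) := app Q.hom (ell F k n)

end Curved

/-! ## Curved twisting structures -/

section Curv

variable {F : Flavor} {k : Type u} [Field k]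

/-- A graded suboperad. -/
structure SubOperad (P : GrOperad F k) where
  carrier : ∀ (n : ℕ) (a : ℤ), Submodule k (P.obj n a)
  act_mem : ∀ {n a} (σ : F.perms n) {x : P.obj n a}, x ∈ carrier n a → P.act σ x ∈ carrier n a
  comp_mem : ∀ {m n p : ℕ} {a b c : ℤ} (i j : ℕ) (hm : m = i + 1 + j) (hp : p = i + n + j)
    (hc : c = a + b) {x : P.obj m a} {y : P.obj n b}, x ∈ carrier m a → y ∈ carrier n b →
      P.comp i j hm hp hc x y ∈ carrier p c

/-- A suboperad as an operad. -/
def SubOperad.toGrOperad {P : GrOperad F k} (S : SubOperad P) : GrOperad F k where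
  obj n a := S.carrier n a
  act σ := (P.act σ).restrict (fun _ hx => S.act_mem σ hx)
  comp i j hm hp hc := LinearMap.mk₂ k
    (fun x y => ⟨P.comp i j hm hp hc x.1 y.1, S.comp_mem i j hm hp hc x.2 y.2⟩)
    (fun _ _ _ => Subtype.ext (by simp)) (fun _ _ _ => Subtype.ext (by simp))
    (fun _ _ _ => Subtype.ext (by simp)) (fun _ _ _ => Subtype.ext (by simp))
  act_one x := Subtype.ext (P.act_one x.1)
  act_mul σ τ x := Subtype.ext (P.act_mul σ τ x.1)
  comp_act i j i' j' hm hp hc hm' hp' σ τ ρ h x y :=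
    Subtype.ext (P.comp_act i j i' j' hm hp hc hm' hp' σ τ ρ h x.1 y.1)
  comp_seq i j i' j' hm hn hp hp' hq hr hq' h₁ h₂ h₃ h₄ x y z :=
    Subtype.ext (P.comp_seq i j i' j' hm hn hp hp' hq hr hq' h₁ h₂ h₃ h₄ x.1 y.1 z.1)
  comp_par i j j' hm hm' hp hp' hq hr hr' hq' h₁ h₂ h₃ h₄ x y z :=
    Subtype.ext (P.comp_par i j j' hm hm' hp hp' hq hr hr' hq' h₁ h₂ h₃ h₄ x.1 y.1 z.1)

/-- `P` is the coproduct `[x] ∨ S` of its suboperad `S` and the free operad on the element `x` of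
arity `0` and degree `a`: a morphism out of `P` is the same as a morphism out of `S` and an
element of arity `0` and degree `a`. -/
def IsCoproduct {P : GrOperad F k} (S : SubOperad P) {a : ℤ} (x : P.obj 0 a) : Prop :=
  ∀ (R : GrOperad F k) (g : GrHom S.toGrOperad R) (y : R.obj 0 a),
    ∃! h : GrHom P R, (∀ {n : ℕ} {b : ℤ} (s : S.carrier n b), h.map s.1 = g.map s) ∧ h.map x = y

/-- The elements of degree `t` in `x` of an operad generated by a suboperad `S` and an element `x`
of arity `0`. -/
inductive HasDegree {P : GrOperad F k} (S : SubOperad P) {e : ℤ} (x : P.obj 0 e) :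
    ℕ → ∀ {n : ℕ} {a : ℤ}, P.obj n a → Prop
  | of {n a} (s : P.obj n a) : s ∈ S.carrier n a → HasDegree S x 0 s
  | gen : HasDegree S x 1 x
  | zero {t n a} : HasDegree S x t (0 : P.obj n a)
  | add {t n a} {y z : P.obj n a} : HasDegree S x t y → HasDegree S x t z → HasDegree S x t (y + z)
  | smul {t n a} (c : k) {y : P.obj n a} : HasDegree S x t y → HasDegree S x t (c • y)
  | act {t n a} (σ : F.perms n) {y : P.obj n a} : HasDegree S x t y → HasDegree S x t (P.act σ y)
  | comp {t t' m n p a b c} (i j : ℕ) (hm : m = i + 1 + j) (hp : p = i + n + j) (hc : c = a + b)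
      {y : P.obj m a} {z : P.obj n b} : HasDegree S x t y → HasDegree S x t' z →
      HasDegree S x (t + t') (P.comp i j hm hp hc y z)

variable (F k) in
/-- Curved twisting structures: an operad `Q` under `cL_∞` (resp. `cA_∞`) with a graded suboperad
`Q₀`. -/
structure Curv where
  Q : Under (cInf F k)
  Q₀ : SubOperad Q.right.toGrOperad
  coproduct : IsCoproduct Q₀ (ellOf Q 0)
  ell_mem : ∀ n : ℕ, 0 < n → ellOf Q n ∈ Q₀.carrier n (-1)
  d_degree : ∀ {n : ℕ} {a b : ℤ} (h : b + 1 = a) (x : Q.right.obj n a), x ∈ Q₀.carrier n a →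
    ∃ y z : Q.right.obj n b, HasDegree Q₀ (ellOf Q 0) 0 y ∧ HasDegree Q₀ (ellOf Q 0) 1 z ∧
      Q.right.d h x = y + z

/-- Morphisms of curved twisting structures. -/
@[ext]
structure Curv.Hom (X Y : Curv F k) where
  hom : X.Q ⟶ Y.Q
  map_mem : ∀ {n : ℕ} {a : ℤ} (x : X.Q.right.obj n a), x ∈ X.Q₀.carrier n a →
    app hom.right x ∈ Y.Q₀.carrier n a

instance : Category.{u} (Curv F k) where
  Hom X Y := Curv.Hom X Y
  id X := ⟨𝟙 X.Q, fun _ hx => hx⟩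
  comp f g := ⟨f.hom ≫ g.hom, fun x hx => g.map_mem _ (f.map_mem x hx)⟩
  id_comp f := Curv.Hom.ext (Category.id_comp f.hom)
  comp_id f := Curv.Hom.ext (Category.comp_id f.hom)
  assoc f g h := Curv.Hom.ext (Category.assoc f.hom g.hom h.hom)

variable (F k) in
/-- The functor which forgets `Q₀`. -/
def Curv.forget : Curv F k ⥤ Under (cInf F k) where
  obj X := X.Q
  map f := f.hom

end Curv

/-! ## The curved twisting construction -/

section CTw

variable {F : Flavor} {k : Type u} [Field k]

/-- The generators of `adjoin Q`: the elements of `Q` and `α`. -/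
inductive AdjGen (Q : DGOperad F k) : ℕ → ℤ → Type u
  | of {n : ℕ} {a : ℤ} (x : Q.obj n a) : AdjGen Q n a
  | alpha : AdjGen Q 0 0

open Term in
/-- The relations of `adjoin Q`: those which hold in `Q`. -/
inductive AdjRel (Q : DGOperad F k) :
    ∀ {n : ℕ} {a : ℤ}, Term F k (AdjGen Q) n a → Term F k (AdjGen Q) n a → Prop
  | add {n a} (x y : Q.obj n a) :
      AdjRel Q (gen (.of (x + y))) (add (gen (.of x)) (gen (.of y)))
  | smul {n a} (c : k) (x : Q.obj n a) : AdjRel Q (gen (.of (c • x))) (smul c (gen (.of x)))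
  | act {n a} (σ : F.perms n) (x : Q.obj n a) :
      AdjRel Q (gen (.of (Q.act σ x))) (act σ (gen (.of x)))
  | comp {m n p a b c} (i j : ℕ) (hm : m = i + 1 + j) (hp : p = i + n + j) (hc : c = a + b)
      (x : Q.obj m a) (y : Q.obj n b) : AdjRel Q (gen (.of (Q.comp i j hm hp hc x y)))
        (comp i j hm hp hc (gen (.of x)) (gen (.of y)))
  | d {n a b} (h : b + 1 = a) (x : Q.obj n a) :
      AdjRel Q (gen (.of (Q.d h x))) (d h (gen (.of x)))

/-- The uncompleted operad `Q ∨ [κ] ∨ [α]` with the differential which extends that of `Q` and has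
`d α = κ`: the dg operad obtained from `Q` by freely adjoining an element `α` of arity `0` and
degree `0`, with `κ := d α`. -/
def adjoin (Q : DGOperad F k) : DGOperad F k := presented (AdjRel Q)

/-- The morphism `Q ⟶ Q ∨ [κ] ∨ [α]`. -/
def incl (Q : DGOperad F k) : Q ⟶ adjoin Q where
  map :=
    { toFun := fun x => Pres.mk (.gen (.of x))
      map_add' := fun x y => Pres.sound (.rel (.add x y))
      map_smul' := fun c x => Pres.sound (.rel (.smul c x)) }
  map_act σ x := Pres.sound (.rel (.act σ x))
  map_comp i j hm hp hc x y := Pres.sound (.rel (.comp i j hm hp hc x y))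
  map_d h x := Pres.sound (.rel (.d h x))

/-- The element `α`. -/
def alpha (Q : DGOperad F k) : (adjoin Q).obj 0 0 := Pres.mk (.gen .alpha)

/-- The element `κ = d α`. -/
def kappa (Q : DGOperad F k) : (adjoin Q).obj 0 (-1) := (adjoin Q).d (by norm_num) (alpha Q)

/-- The morphism out of `adjoin Q` which is `f` on `Q` and sends `α` to `x`. -/
def adjoin.lift {Q P : DGOperad F k} (f : Q ⟶ P) (x : P.obj 0 0) : adjoin Q ⟶ P :=
  presented.lift (AdjRel Q) (fun {_ _} g => match g with
    | .of y => app f y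
    | .alpha => x) (by
    intro _ _ _ _ h
    cases h with
    | add x y => exact map_add _ _ _
    | smul c x => exact map_smul _ _ _
    | act σ x => exact f.map_act σ x
    | comp i j hm hp hc x y => exact f.map_comp i j hm hp hc x y
    | d h x => exact f.map_d h x)

/-- `Weight Q N t x`: the element `x` of `Q ∨ [κ] ∨ [α]` is a linear combination of composites of
elements of `Q` with `t` copies of `α` and `κ` in total, at most `N` of which are copies of `κ`. -/
inductive Weight (Q : DGOperad F k) : ℕ → ℕ → ∀ {n : ℕ} {a : ℤ}, (adjoin Q).obj n a → Prop
  | of {n a} (x : Q.obj n a) : Weight Q 0 0 (app (incl Q) x)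
  | alpha : Weight Q 0 1 (alpha Q)
  | kappa : Weight Q 1 1 (kappa Q)
  | mono {N N' t n a} {x : (adjoin Q).obj n a} : N ≤ N' → Weight Q N t x → Weight Q N' t x
  | zero {N t n a} : Weight Q N t (0 : (adjoin Q).obj n a)
  | add {N t n a} {x y : (adjoin Q).obj n a} :
      Weight Q N t x → Weight Q N t y → Weight Q N t (x + y)
  | smul {N t n a} (c : k) {x : (adjoin Q).obj n a} : Weight Q N t x → Weight Q N t (c • x)
  | act {N t n a} (σ : F.perms n) {x : (adjoin Q).obj n a} :
      Weight Q N t x → Weight Q N t ((adjoin Q).act σ x)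
  | comp {N t N' t' m n p a b c} (i j : ℕ) (hm : m = i + 1 + j) (hp : p = i + n + j)
      (hc : c = a + b) {x : (adjoin Q).obj m a} {y : (adjoin Q).obj n b} :
      Weight Q N t x → Weight Q N' t' y →
      Weight Q (N + N') (t + t') ((adjoin Q).comp i j hm hp hc x y)

theorem Weight.sum {Q : DGOperad F k} {N t n : ℕ} {a : ℤ} {ι : Type*} (s : Finset ι)
    (f : ι → (adjoin Q).obj n a) (h : ∀ i ∈ s, Weight Q N t (f i)) :
    Weight Q N t (∑ i ∈ s, f i) := by
  classical
  induction s using Finset.induction_on with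
  | empty => simpa using Weight.zero
  | insert i s hi ih =>
    rw [Finset.sum_insert hi]
    exact .add (h i (by simp)) (ih fun j hj => h j (by simp [hj]))

theorem Weight.diff {Q : DGOperad F k} {N t n : ℕ} {a b : ℤ} (h : b + 1 = a)
    {x : (adjoin Q).obj n a} (hx : Weight Q N t x) : Weight Q (N + 1) t ((adjoin Q).d h x) := by
  induction hx generalizing b with
  | of x =>
    rw [← (incl Q).map_d h x]
    exact .mono (Nat.zero_le _) (.of _)
  | alpha => obtain rfl : b = -1 := by omega
             exact .kappa
  | kappa =>
    have : (adjoin Q).d h (CurvedTwisting.kappa Q) = 0 := (adjoin Q).d_d _ h _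
    rw [this]
    exact .zero
  | mono hN _ ih => exact .mono (Nat.succ_le_succ hN) (ih h)
  | zero => rw [map_zero]; exact .zero
  | add _ _ ih₁ ih₂ => rw [map_add]; exact .add (ih₁ h) (ih₂ h)
  | smul c _ ih => rw [map_smul]; exact .smul c (ih h)
  | act σ _ ih => rw [(adjoin Q).d_act]; exact .act σ (ih h)
  | @comp N t N' t' m n p a' b' c i j hm hp hc x y hx hy ih₁ ih₂ =>
    rw [(adjoin Q).d_comp i j hm hp hc h (a' := a' - 1) (b' := b' - 1) (by omega) (by omega)
      (by omega) (by omega)]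
    refine .add (.mono ?_ (.comp i j hm hp _ (ih₁ _) hy))
      (.smul _ (.mono ?_ (.comp i j hm hp _ hx (ih₂ _)))) <;> omega

theorem Weight.map {Q P : DGOperad F k} (f : Q ⟶ P) {N t n : ℕ} {a : ℤ}
    {x : (adjoin Q).obj n a} (hx : Weight Q N t x) :
    Weight P N t (app (adjoin.lift (f ≫ incl P) (CurvedTwisting.alpha P)) x) := by
  induction hx with
  | of x => exact .of (app f x)
  | alpha => exact .alpha
  | kappa => exact .kappa
  | mono hN _ ih => exact .mono hN ih
  | zero => rw [map_zero]; exact .zero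
  | add _ _ ih₁ ih₂ => rw [map_add]; exact .add ih₁ ih₂
  | smul c _ ih => rw [map_smul]; exact .smul c ih
  | act σ _ ih => rw [GrHom.map_act]; exact .act σ ih
  | comp i j hm hp hc _ _ ih₁ ih₂ => rw [GrHom.map_comp]; exact .comp i j hm hp hc ih₁ ih₂

/-- The elements of the completed coproduct `(Q ∨̂ [α]) ∨ [κ]`: formal series `∑ f t`, where `f t`
is of weight `t` in `α` and `κ` together, and the number of `κ` is bounded independently of `t`. -/
def series (Q : DGOperad F k) (n : ℕ) (a : ℤ) : Submodule k (ℕ → (adjoin Q).obj n a) where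
  carrier := {f | ∃ N, ∀ t, Weight Q N t (f t)}
  zero_mem' := ⟨0, fun _ => .zero⟩
  add_mem' := by
    rintro f g ⟨N, hf⟩ ⟨N', hg⟩
    exact ⟨max N N', fun t => .add (.mono (le_max_left _ _) (hf t)) (.mono (le_max_right _ _) (hg t))⟩
  smul_mem' := by
    rintro c f ⟨N, hf⟩
    exact ⟨N, fun t => .smul c (hf t)⟩

open Finset in
theorem sum_antidiagonal_assoc {M : Type*} [AddCommMonoid M] (t : ℕ) (f : ℕ → ℕ → ℕ → M) :
    ∑ p ∈ HasAntidiagonal.antidiagonal t, ∑ q ∈ HasAntidiagonal.antidiagonal p.1, f q.1 q.2 p.2 =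
      ∑ p ∈ HasAntidiagonal.antidiagonal t, ∑ q ∈ HasAntidiagonal.antidiagonal p.2, f p.1 q.1 q.2 := by
  rw [sum_sigma', sum_sigma']
  refine sum_nbij' (fun x => ⟨(x.2.1, x.2.2 + x.1.2), (x.2.2, x.1.2)⟩)
    (fun x => ⟨(x.1.1 + x.2.1, x.2.2), (x.1.1, x.2.1)⟩) ?_ ?_ ?_ ?_ ?_ <;>
  · rintro ⟨⟨a, b⟩, ⟨c, d⟩⟩ h
    simp only [mem_sigma, HasAntidiagonal.mem_antidiagonal] at h
    obtain ⟨rfl, rfl⟩ := h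
    simp [HasAntidiagonal.mem_antidiagonal, add_assoc]

open Finset in
theorem sum_antidiagonal_swap {M : Type*} [AddCommMonoid M] (t : ℕ) (f : ℕ → ℕ → ℕ → M) :
    ∑ p ∈ HasAntidiagonal.antidiagonal t, ∑ q ∈ HasAntidiagonal.antidiagonal p.1, f q.1 q.2 p.2 =
      ∑ p ∈ HasAntidiagonal.antidiagonal t, ∑ q ∈ HasAntidiagonal.antidiagonal p.1, f q.1 p.2 q.2 := by
  rw [sum_sigma', sum_sigma']
  refine sum_nbij' (fun x => ⟨(x.2.1 + x.1.2, x.2.2), (x.2.1, x.1.2)⟩)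
    (fun x => ⟨(x.2.1 + x.1.2, x.2.2), (x.2.1, x.1.2)⟩) ?_ ?_ ?_ ?_ ?_ <;>
  · rintro ⟨⟨a, b⟩, ⟨c, d⟩⟩ h
    simp only [mem_sigma, HasAntidiagonal.mem_antidiagonal] at h
    obtain ⟨rfl, rfl⟩ := h
    simp [HasAntidiagonal.mem_antidiagonal, add_right_comm]

/-- The Cauchy product of series. -/
def series.comp {Q : DGOperad F k} {m n p : ℕ} {a b c : ℤ} (i j : ℕ) (hm : m = i + 1 + j)
    (hp : p = i + n + j) (hc : c = a + b) (f : series Q m a) (g : series Q n b) : series Q p c :=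
  ⟨fun t => ∑ q ∈ Finset.HasAntidiagonal.antidiagonal t,
      (adjoin Q).comp i j hm hp hc (f.1 q.1) (g.1 q.2), by
    obtain ⟨N, hf⟩ := f.2
    obtain ⟨N', hg⟩ := g.2
    refine ⟨N + N', fun t => .sum _ _ fun q hq => ?_⟩
    rw [← Finset.HasAntidiagonal.mem_antidiagonal.1 hq]
    exact .comp i j hm hp hc (hf _) (hg _)⟩

/-- A linear map applied termwise to series. -/
def series.map {Q P : DGOperad F k} {n m : ℕ} {a b : ℤ}
    (φ : (adjoin Q).obj n a →ₗ[k] (adjoin P).obj m b) (e : ℕ)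
    (hφ : ∀ {N t : ℕ} {x : (adjoin Q).obj n a}, Weight Q N t x → Weight P (N + e) t (φ x)) :
    series Q n a →ₗ[k] series P m b where
  toFun f := ⟨fun t => φ (f.1 t), by
    obtain ⟨N, hf⟩ := f.2
    exact ⟨N + e, fun t => hφ (hf t)⟩⟩
  map_add' f g := Subtype.ext (funext fun t => map_add φ (f.1 t) (g.1 t))
  map_smul' c f := Subtype.ext (funext fun t => map_smul φ c (f.1 t))

theorem series.map_coe {Q P : DGOperad F k} {n m : ℕ} {a b : ℤ}
    (φ : (adjoin Q).obj n a →ₗ[k] (adjoin P).obj m b) (e : ℕ)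
    (hφ : ∀ {N t : ℕ} {x : (adjoin Q).obj n a}, Weight Q N t x → Weight P (N + e) t (φ x))
    (f : series Q n a) (t : ℕ) : (series.map φ e hφ f).1 t = φ (f.1 t) := rfl

/-- The dg operad `cTw(Q) = Q ∨ [κ] ∨̂ [α]`: composition is the Cauchy product of series, the
differential is applied termwise. -/
def cTw (Q : DGOperad F k) : DGOperad F k where
  obj n a := series Q n a
  act σ := series.map ((adjoin Q).act σ) 0 (fun h => .act σ h)
  comp i j hm hp hc := LinearMap.mk₂ k (series.comp i j hm hp hc)
    (fun f f' g => Subtype.ext (funext fun t => by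
      simp [series.comp, Finset.sum_add_distrib]))
    (fun c f g => Subtype.ext (funext fun t => by simp [series.comp, Finset.smul_sum]))
    (fun f g g' => Subtype.ext (funext fun t => by
      simp [series.comp, Finset.sum_add_distrib]))
    (fun c f g => Subtype.ext (funext fun t => by simp [series.comp, Finset.smul_sum]))
  d h := series.map ((adjoin Q).d h) 1 (fun hx => .diff h hx)
  act_one f := Subtype.ext (funext fun t => (adjoin Q).act_one (f.1 t))
  act_mul σ τ f := Subtype.ext (funext fun t => (adjoin Q).act_mul σ τ (f.1 t))
  comp_act i j i' j' hm hp hc hm' hp' σ τ ρ h f g := Subtype.ext (funext fun t => by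
    simp only [LinearMap.mk₂_apply, series.comp, series.map_coe, map_sum]
    exact Finset.sum_congr rfl fun q _ =>
      (adjoin Q).comp_act i j i' j' hm hp hc hm' hp' σ τ ρ h (f.1 q.1) (g.1 q.2))
  comp_seq i j i' j' hm hn hp hp' hq hr hq' h₁ h₂ h₃ h₄ f g e := Subtype.ext (funext fun t => by
    simp only [LinearMap.mk₂_apply, series.comp, map_sum, LinearMap.sum_apply]
    rw [sum_antidiagonal_assoc t (fun x y z => (adjoin Q).comp (i + i') (j' + j) hp' hq h₂
      ((adjoin Q).comp i j hm hp h₁ (f.1 x) (g.1 y)) (e.1 z))]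
    exact Finset.sum_congr rfl fun p _ => Finset.sum_congr rfl fun q _ =>
      (adjoin Q).comp_seq i j i' j' hm hn hp hp' hq hr hq' h₁ h₂ h₃ h₄ _ _ _)
  comp_par i j j' hm hm' hp hp' hq hr hr' hq' h₁ h₂ h₃ h₄ f g e := Subtype.ext (funext fun t => by
    simp only [LinearMap.mk₂_apply, series.comp, map_sum, LinearMap.sum_apply, SetLike.val_smul,
      Pi.smul_apply, Finset.smul_sum]
    rw [sum_antidiagonal_swap t (fun x y z => (adjoin Q).comp (i + _ + j) j' hp' hq h₂
      ((adjoin Q).comp i (j + 1 + j') hm hp h₁ (f.1 x) (g.1 y)) (e.1 z))]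
    exact Finset.sum_congr rfl fun p _ => Finset.sum_congr rfl fun q _ =>
      (adjoin Q).comp_par i j j' hm hm' hp hp' hq hr hr' hq' h₁ h₂ h₃ h₄ _ _ _)
  d_d h h' f := Subtype.ext (funext fun t => (adjoin Q).d_d h h' (f.1 t))
  d_act h σ f := Subtype.ext (funext fun t => (adjoin Q).d_act h σ (f.1 t))
  d_comp i j hm hp hc hc' ha' hb' h₁ h₂ f g := Subtype.ext (funext fun t => by
    simp only [LinearMap.mk₂_apply, series.comp, series.map_coe, map_sum, Submodule.coe_add, Pi.add_apply,
      SetLike.val_smul, Pi.smul_apply, Finset.smul_sum]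
    rw [← Finset.sum_add_distrib]
    exact Finset.sum_congr rfl fun q _ =>
      (adjoin Q).d_comp i j hm hp hc hc' ha' hb' h₁ h₂ (f.1 q.1) (g.1 q.2))

/-- The term of weight `t` of an element of `cTw(Q)`. -/
def coeff {Q : DGOperad F k} {n : ℕ} {a : ℤ} (f : (cTw Q).obj n a) (t : ℕ) : (adjoin Q).obj n a :=
  f.1 t

/-- An element of weight `s` (and with at most `N` copies of `κ`) as an element of `cTw(Q)`. -/
def single {Q : DGOperad F k} {n : ℕ} {a : ℤ} (s : ℕ) (x : (adjoin Q).obj n a) {N : ℕ}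
    (hx : Weight Q N s x) : (cTw Q).obj n a :=
  ⟨Pi.single s x, N, fun t => by
    rcases eq_or_ne t s with rfl | h
    · simpa using hx
    · simpa [h] using Weight.zero⟩

/-- An element of `Q` as an element of `cTw(Q)`. -/
def const {Q : DGOperad F k} {n : ℕ} {a : ℤ} (x : Q.obj n a) : (cTw Q).obj n a :=
  single 0 (app (incl Q) x) (.of x)

/-- The element `α` of `cTw(Q)`. -/
def alphaHat (Q : DGOperad F k) : (cTw Q).obj 0 0 := single 1 (alpha Q) .alpha

/-- The element `κ` of `cTw(Q)`. -/
def kappaHat (Q : DGOperad F k) : (cTw Q).obj 0 (-1) := single 1 (kappa Q) .kappa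

/-- The morphism `cTw(f) = f ∨ 1`, termwise. -/
def cTwMap {Q P : DGOperad F k} (f : Q ⟶ P) : cTw Q ⟶ cTw P where
  map := series.map (app (adjoin.lift (f ≫ incl P) (alpha P))) 0 (fun h => .map f h)
  map_act σ g := Subtype.ext (funext fun t =>
    (adjoin.lift (f ≫ incl P) (alpha P)).map_act σ (g.1 t))
  map_comp i j hm hp hc g e := Subtype.ext (funext fun t => by
    change app (adjoin.lift (f ≫ incl P) (alpha P)) (∑ q ∈ Finset.HasAntidiagonal.antidiagonal t,
      (adjoin Q).comp i j hm hp hc (g.1 q.1) (e.1 q.2)) = ∑ q ∈ Finset.HasAntidiagonal.antidiagonal t,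
      (adjoin P).comp i j hm hp hc (app (adjoin.lift (f ≫ incl P) (alpha P)) (g.1 q.1))
        (app (adjoin.lift (f ≫ incl P) (alpha P)) (e.1 q.2))
    rw [map_sum]
    exact Finset.sum_congr rfl fun q _ =>
      (adjoin.lift (f ≫ incl P) (alpha P)).map_comp i j hm hp hc (g.1 q.1) (e.1 q.2))
  map_d h g := Subtype.ext (funext fun t =>
    (adjoin.lift (f ≫ incl P) (alpha P)).map_d h (g.1 t))

/-- A morphism out of `adjoin Q` is determined by its values on `Q` and `α`. -/
theorem adjoin.hom_ext {Q P : DGOperad F k} {f g : adjoin Q ⟶ P}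
    (h : ∀ {n : ℕ} {a : ℤ} (x : Q.obj n a), app f (app (incl Q) x) = app g (app (incl Q) x))
    (hα : app f (alpha Q) = app g (alpha Q)) {n : ℕ} {a : ℤ} (x : (adjoin Q).obj n a) :
    app f x = app g x := by
  suffices H : ∀ {n : ℕ} {a : ℤ} (x : Term F k (AdjGen Q) n a),
      app f (Pres.mk x : (adjoin Q).obj n a) = app g (Pres.mk x : (adjoin Q).obj n a) by
    obtain ⟨x⟩ := x
    exact H x
  clear x
  intro n a x
  induction x with
  | gen y =>
    cases y with
    | of y => exact h y
    | alpha => exact hα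
  | zero => exact (map_zero (app f)).trans (map_zero (app g)).symm
  | add x y ihx ihy =>
    exact (map_add (app f) (Pres.mk x) (Pres.mk y)).trans
      ((congrArg₂ _ ihx ihy).trans (map_add (app g) (Pres.mk x) (Pres.mk y)).symm)
  | smul c x ih =>
    exact (map_smul (app f) c (Pres.mk x)).trans
      ((congrArg _ ih).trans (map_smul (app g) c (Pres.mk x)).symm)
  | act σ x ih =>
    exact (f.map_act σ (Pres.mk x)).trans ((congrArg _ ih).trans (g.map_act σ (Pres.mk x)).symm)
  | comp i j hm hp hc x y ihx ihy =>
    exact (f.map_comp i j hm hp hc (Pres.mk x) (Pres.mk y)).trans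
      ((congrArg₂ (fun u v => P.comp i j hm hp hc u v) ihx ihy).trans
        (g.map_comp i j hm hp hc (Pres.mk x) (Pres.mk y)).symm)
  | d h' x ih =>
    exact (f.map_d h' (Pres.mk x)).trans ((congrArg _ ih).trans (g.map_d h' (Pres.mk x)).symm)

theorem hom_ext' {P Q : DGOperad F k} {f g : P ⟶ Q}
    (h : ∀ {n : ℕ} {a : ℤ} (x : P.obj n a), app f x = app g x) : f = g := by
  refine DGHom.ext ?_
  funext n a
  exact LinearMap.ext h

variable (F k) in
/-- The endofunctor `cTw` of dg operads. -/
def cTwFunctor : DGOperad F k ⥤ DGOperad F k where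
  obj := cTw
  map := cTwMap
  map_id Q := hom_ext' fun f => Subtype.ext (funext fun t =>
    adjoin.hom_ext (f := adjoin.lift (𝟙 Q ≫ incl Q) (alpha Q)) (g := 𝟙 (adjoin Q))
      (fun _ => rfl) rfl (f.1 t))
  map_comp {_ Q R} f g := hom_ext' fun e => Subtype.ext (funext fun t =>
    adjoin.hom_ext (f := adjoin.lift ((f ≫ g) ≫ incl R) (alpha R))
      (g := adjoin.lift (f ≫ incl Q) (alpha Q) ≫ adjoin.lift (g ≫ incl R) (alpha R))
      (fun _ => rfl) rfl (e.1 t))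

/-- The morphism `cTw(Q) ⟶ Q` which is the identity on `Q` and sends `α` and `κ` to `0`. It kills
all terms of positive weight. -/
def cTwCounit (Q : DGOperad F k) : cTw Q ⟶ Q where
  map :=
    { toFun := fun f => app (adjoin.lift (𝟙 Q) 0) (f.1 0)
      map_add' := fun f g => map_add (app (adjoin.lift (𝟙 Q) 0)) (f.1 0) (g.1 0)
      map_smul' := fun c f => map_smul (app (adjoin.lift (𝟙 Q) 0)) c (f.1 0) }
  map_act σ f := (adjoin.lift (𝟙 Q) 0).map_act σ (f.1 0)
  map_comp i j hm hp hc f g :=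
    (congrArg (app (adjoin.lift (𝟙 Q) 0)) (Finset.sum_singleton _ _)).trans
      ((adjoin.lift (𝟙 Q) 0).map_comp i j hm hp hc (f.1 0) (g.1 0))
  map_d h f := (adjoin.lift (𝟙 Q) 0).map_d h (f.1 0)

/-- `x(α, …, α, -, …, -)` with `t` copies of `α` in the first inputs. -/
def fillFirst {Q : DGOperad F k} {n : ℕ} {a : ℤ} :
    ∀ t : ℕ, (adjoin Q).obj (n + t) a → (adjoin Q).obj n a
  | 0, x => x
  | t + 1, x => fillFirst t
      ((adjoin Q).comp 0 (n + t) (by omega) (by omega) (add_zero a).symm x (alpha Q))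

/-- The sum of all `x(α^{r₀}, -, α^{r₁}, -, …, -, α^{rₙ})` with `r₀ + ⋯ + rₙ = t` and `r_g = 0` for
`g < g₀`: one chooses the number `g` of free inputs to the left of the first copy of `α`, plugs
in this `α`, and goes on with the copies of `α` to the right of it. -/
def fillGaps {Q : DGOperad F k} {n : ℕ} {a : ℤ} :
    ∀ t : ℕ, ℕ → (adjoin Q).obj (n + t) a → (adjoin Q).obj n a
  | 0, _, x => x
  | t + 1, g₀, x => ∑ g : Fin (n + 1), if g₀ ≤ g then
      fillGaps t g ((adjoin Q).comp g (n + t - g) (by omega) (by omega) (add_zero a).symm x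
        (alpha Q)) else 0

theorem Weight.fillFirst {Q : DGOperad F k} {n : ℕ} {a : ℤ} (t : ℕ) :
    ∀ {s : ℕ} (x : (adjoin Q).obj (n + t) a), Weight Q 0 s x →
      Weight Q 0 (s + t) (CurvedTwisting.fillFirst t x) := by
  induction t with
  | zero => exact fun x hx => hx
  | succ t ih =>
    intro s x hx
    have := ih _ (Weight.comp 0 (n + t) (by omega) (by omega) (add_zero a).symm hx
      (Weight.alpha (Q := Q)))
    rwa [add_assoc, add_comm 1 t] at this

theorem Weight.fillGaps {Q : DGOperad F k} {n : ℕ} {a : ℤ} (t : ℕ) :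
    ∀ {s : ℕ} (g₀ : ℕ) (x : (adjoin Q).obj (n + t) a), Weight Q 0 s x →
      Weight Q 0 (s + t) (CurvedTwisting.fillGaps t g₀ x) := by
  induction t with
  | zero => exact fun _ x hx => hx
  | succ t ih =>
    intro s g₀ x hx
    refine Weight.sum _ _ fun g _ => ?_
    split_ifs
    · have := ih (g : ℕ) _ (Weight.comp (g : ℕ) (n + t - g) (by omega) (by omega)
        (add_zero a).symm hx (Weight.alpha (Q := Q)))
      rwa [add_assoc, add_comm 1 t] at this
    · exact .zero

/-- The weight `t` term of `ℓ_n^α = ∑_t (1/t!) ℓ_{n+t}(α^t, -, …, -)`, respectively of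
`μ_n^α = ∑ μ_{n+r₀+⋯+rₙ}(α^{r₀}, -, α^{r₁}, …, -, α^{rₙ})`. -/
def twistedTerm (n t : ℕ) : ∀ {F : Flavor} (Q : Under (cInf F k)), (adjoin Q.right).obj n (-1)
  | .symmetric, Q => (t.factorial : k)⁻¹ • fillFirst t (app (incl Q.right) (ellOf Q (n + t)))
  | .nonsymmetric, Q => fillGaps t 0 (app (incl Q.right) (ellOf Q (n + t)))

/-- The twisted operation `ℓ_n^α`, resp. `μ_n^α`, in `cTw(Q)`. -/
def twisted (Q : Under (cInf F k)) (n : ℕ) : (cTw Q.right).obj n (-1) :=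
  ⟨fun t => twistedTerm n t Q, 0, fun t => by
    cases F
    · have := Weight.fillFirst t _ (Weight.of (ellOf Q (n + t)))
      rw [zero_add] at this
      exact .smul _ this
    · have := Weight.fillGaps t 0 _ (Weight.of (ellOf Q (n + t)))
      rwa [zero_add] at this⟩

/-- The `α`-filtration of `cTw(Q)`: series which start in weight `s`. -/
def Order {Q : DGOperad F k} {n : ℕ} {a : ℤ} (s : ℕ) (f : (cTw Q).obj n a) : Prop :=
  ∀ t < s, coeff f t = 0

/-- The total filtration of `cTw(Q) ∨ [κ'] ∨ [α']`, in which `α'` and `κ'` have filtration degree `1`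
and the filtration degree of elements of `cTw(Q)` is that by weight in `α` and `κ`. -/
inductive TotalOrder (Q : DGOperad F k) :
    ℕ → ∀ {n : ℕ} {a : ℤ}, (adjoin (cTw Q)).obj n a → Prop
  | of {s n a} (f : (cTw Q).obj n a) : Order s f → TotalOrder Q s (app (incl (cTw Q)) f)
  | alpha : TotalOrder Q 1 (alpha (cTw Q))
  | kappa : TotalOrder Q 1 (kappa (cTw Q))
  | mono {s s' n a} {x : (adjoin (cTw Q)).obj n a} : s' ≤ s → TotalOrder Q s x → TotalOrder Q s' x
  | add {s n a} {x y : (adjoin (cTw Q)).obj n a} :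
      TotalOrder Q s x → TotalOrder Q s y → TotalOrder Q s (x + y)
  | smul {s n a} (c : k) {x : (adjoin (cTw Q)).obj n a} :
      TotalOrder Q s x → TotalOrder Q s (c • x)
  | act {s n a} (σ : F.perms n) {x : (adjoin (cTw Q)).obj n a} :
      TotalOrder Q s x → TotalOrder Q s ((adjoin (cTw Q)).act σ x)
  | comp {s s' m n p a b c} (i j : ℕ) (hm : m = i + 1 + j) (hp : p = i + n + j)
      (hc : c = a + b) {x : (adjoin (cTw Q)).obj m a} {y : (adjoin (cTw Q)).obj n b} :
      TotalOrder Q s x → TotalOrder Q s' y →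
      TotalOrder Q (s + s') ((adjoin (cTw Q)).comp i j hm hp hc x y)

/-- `δ : cTw(Q) ⟶ cTw(cTw(Q))` is the comultiplication of `cTw`: the morphism which is continuous
for the filtrations and sends `ν ∈ Q` to `ν`, `α` to `α' + α` and `κ` to `κ' + κ`. -/
structure IsComultiplication {Q : DGOperad F k} (δ : cTw Q ⟶ cTw (cTw Q)) : Prop where
  const : ∀ {n : ℕ} {a : ℤ} (x : Q.obj n a), app δ (const x) = const (const x)
  alpha : app δ (alphaHat Q) = alphaHat (cTw Q) + CurvedTwisting.const (alphaHat Q)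
  kappa : app δ (kappaHat Q) = kappaHat (cTw Q) + CurvedTwisting.const (kappaHat Q)
  continuous : ∀ {n : ℕ} {a : ℤ} (s : ℕ) (f : (cTw Q).obj n a), Order s f →
    ∀ t, TotalOrder Q s (coeff (app δ f) t)

/-- The comultiplication of a comonad `T`, seen as `cTw(Q) ⟶ cTw(cTw(Q))` through an identification
of `T` with `cTw`. -/
def transportedComult (T : Comonad (Under (cInf F k)))
    (iso : T.toFunctor ⋙ Under.forget (cInf F k) ≅ Under.forget (cInf F k) ⋙ cTwFunctor F k)
    (Q : Under (cInf F k)) : cTw Q.right ⟶ cTw (cTw Q.right) :=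
  (show cTw Q.right ⟶ (T.obj Q).right from iso.inv.app Q) ≫ (T.δ.app Q).right ≫
    (show (T.obj (T.obj Q)).right ⟶ cTw (T.obj Q).right from iso.hom.app (T.obj Q)) ≫
    cTwMap (show (T.obj Q).right ⟶ cTw Q.right from iso.hom.app Q)

/-- An identification of a comonad `T` on operads under `cL_∞` (resp. `cA_∞`) with the curved
twisting comonad. -/
structure CTwComonad (T : Comonad (Under (cInf F k))) where
  /-- `T(Q)` is `cTw(Q)` as a dg operad, and `T(f)` is `f ∨ 1`. -/
  iso : T.toFunctor ⋙ Under.forget (cInf F k) ≅ Under.forget (cInf F k) ⋙ cTwFunctor F k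
  /-- The structure morphism of `T(Q)` sends `ℓ_0` to `κ + ℓ_0^α` … -/
  ell_zero : ∀ Q, app (iso.hom.app Q) (ellOf (T.obj Q) 0) = kappaHat Q.right + twisted Q 0
  /-- … and `ℓ_n` to `ℓ_n^α` for `n ≥ 1`. -/
  ell_pos : ∀ Q (n : ℕ), 0 < n → app (iso.hom.app Q) (ellOf (T.obj Q) n) = twisted Q n
  /-- The counit of `T` is that of `cTw`. -/
  counit : ∀ Q, (T.ε.app Q).right = iso.hom.app Q ≫ cTwCounit Q.right
  /-- The comultiplication of `T` is that of `cTw`. -/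
  comult : ∀ Q, IsComultiplication (transportedComult T iso Q)

end CTw

end

end CurvedTwisting

namespace CurvedTwisting

noncomputable section

/-! ## Signs and sums -/

section Signs

variable {k : Type u} [Field k]

/-! The right adjoint sends Q to cTw(Q) together with the suboperad `noKappa` of the series in α
which contain no κ. As ℓ_0^α contains no κ, passing from κ to ℓ_0 = κ + ℓ_0^α is a change of free
generator, so the coproduct condition says that cTw(Q) is free on κ over `noKappa`. Since the series
are infinite, morphisms out of cTw(Q) cannot be defined on generators of Q and α. Instead they are
Taylor expansions at κ = 0: derivatives in κ are operations with a marked input (`markedMod`), the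
terms of the expansion satisfy the Leibniz rule for divided powers (`MarkedDerivation.taylor_comp`),
and the sum is finite because the number of κ is bounded (`cTwDeriv_taylor_eq_zero`). This gives
`isCoproduct_noKappa`. Condition (iii) holds for cTw(Q) because d creates at most one κ
(`noKappa_d`).

All morphisms into cTw are exponentials. Let D : P → P ∨ [κ] ∨ [α] be a derivation of degree 0 which
commutes with d, extended by Dα = 0. In characteristic 0 its divided powers assemble to a dg
morphism exp D : P → cTw(P), provided that the number of κ stays bounded (`Flow.exp`). On cL_∞ take
Dℓ_n = ℓ_{n+1}(α, -, …, -), plus κ if n = 0; for cA_∞ sum over all inputs. Compatibility with the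
relations has to be checked to first order only (`d_ellVariation`), and it says that inserting α is
a derivation of the quadratic expression dℓ_n (`curvSum_insertAll`). Exponentiating gives exactly
the twisted operations (`Flow.pow_ell`), hence the structure morphism of cTw(Q).

For a curved twisting structure (Q, Q_0) let ι be the derivation of degree 1 which vanishes on Q_0
and sends ℓ_0 to α. Then D = dι + ιd commutes with d, has the above values on the ℓ_n
(`Curv.flow_ell`), and by (iii) sends Q_0 to elements linear in α without κ (`Curv.flow_mem`). Its
exponential is the unit of the adjunction. For the structure on cTw(Q) itself this D sends α to α'
and κ to κ' and kills Q, so the unit is the comultiplication α ↦ α' + α, κ ↦ κ' + κ. One triangle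
identity is read off in weight 0; the other is checked on polynomials in α and κ and extended to
series by continuity (`comult_cTwMap_counit`).

For comonadicity let ρ : A → cTw(A) be a coalgebra and put A_0 = ρ⁻¹(`noKappa`). Setting α = 0 and κ
= -ℓ_0 after ρ gives a projection of A onto A_0 which kills ℓ_0 (`retraction_mem`). Following ρ by
this projection on the coefficients, with α = 0 and κ = ℓ_0, gives back the identity
(`evaluation_retraction`), whence A = [ℓ_0] ∨ A_0. By naturality the unit of (A, A_0) is ρ
(`coalgebraUnit_eq`). Conversely Q_0 is the preimage of `noKappa` under the unit
(`Curv.mem_of_unit_mem`), so coalgebra morphisms preserve the suboperads. -/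

theorem ksign_congr {a b : ℤ} (h : Even a ↔ Even b) : ksign k a = ksign k b := by
  simp [ksign, h]

theorem ksign_of_even {a : ℤ} (h : Even a) : ksign k a = 1 := if_pos h

theorem ksign_of_odd {a : ℤ} (h : ¬ Even a) : ksign k a = -1 := if_neg h

theorem ksign_add (a b : ℤ) : ksign k (a + b) = ksign k a * ksign k b := by
  by_cases ha : Even a <;> by_cases hb : Even b <;> simp [ksign, Int.even_add, ha, hb]

theorem ksign_mul_self (a : ℤ) : ksign k a * ksign k a = 1 := by
  by_cases ha : Even a <;> simp [ksign, ha]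

theorem ksign_sub_one (a : ℤ) : ksign k (a - 1) = -ksign k a := by
  by_cases ha : Even a <;> simp [ksign, ha, -Int.not_even_iff_odd]

end Signs

open Finset in
-- A term with p.1 + p.2 = j + 1 is counted p.1 times by the first summand and p.2 times by the
-- second. This is the induction step by which a product rule for D becomes a Cauchy product rule
-- for D^j / j!.
theorem sum_antidiagonal_leibniz {M : Type*} [AddCommMonoid M] (j : ℕ) (f : ℕ → ℕ → M) :
    ∑ p ∈ HasAntidiagonal.antidiagonal j,
        ((p.1 + 1) • f (p.1 + 1) p.2 + (p.2 + 1) • f p.1 (p.2 + 1)) =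
      (j + 1) • ∑ p ∈ HasAntidiagonal.antidiagonal (j + 1), f p.1 p.2 := by
  have h1 : ∑ p ∈ HasAntidiagonal.antidiagonal (j + 1), p.1 • f p.1 p.2 =
      ∑ p ∈ HasAntidiagonal.antidiagonal j, (p.1 + 1) • f (p.1 + 1) p.2 := by
    rw [Finset.Nat.sum_antidiagonal_succ]; simp
  have h2 : ∑ p ∈ HasAntidiagonal.antidiagonal (j + 1), p.2 • f p.1 p.2 =
      ∑ p ∈ HasAntidiagonal.antidiagonal j, (p.2 + 1) • f p.1 (p.2 + 1) := by
    rw [Finset.Nat.sum_antidiagonal_succ']; simp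
  rw [sum_add_distrib, ← h1, ← h2, ← sum_add_distrib, smul_sum]
  refine sum_congr rfl fun p hp => ?_
  rw [← add_smul, HasAntidiagonal.mem_antidiagonal.1 hp]

/-! ## Morphisms of graded operads -/

section GrHom

variable {F : Flavor} {k : Type u} [Field k]

theorem GrHom.ext' {P Q : GrOperad F k} {f g : GrHom P Q}
    (h : ∀ {n : ℕ} {a : ℤ} (x : P.obj n a), f.map x = g.map x) : f = g := by
  refine GrHom.ext ?_
  funext n a
  exact LinearMap.ext h

/-- The identity morphism of a graded operad. -/
def GrHom.id (P : GrOperad F k) : GrHom P P where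
  map := LinearMap.id
  map_act _ _ := rfl
  map_comp _ _ _ _ _ _ _ := rfl

/-- The composition of morphisms of graded operads. -/
def GrHom.comp {P Q R : GrOperad F k} (g : GrHom Q R) (f : GrHom P Q) : GrHom P R where
  map := g.map ∘ₗ f.map
  map_act σ x := by simp [f.map_act, g.map_act]
  map_comp i j hm hp hc x y := by simp [f.map_comp, g.map_comp]

theorem GrHom.comp_map {P Q R : GrOperad F k} (g : GrHom Q R) (f : GrHom P Q) {n : ℕ} {a : ℤ}
    (x : P.obj n a) : (g.comp f).map x = g.map (f.map x) := rfl

/-- The inclusion of a suboperad. -/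
def SubOperad.incl {P : GrOperad F k} (S : SubOperad P) : GrHom S.toGrOperad P where
  map := (S.carrier _ _).subtype
  map_act _ _ := rfl
  map_comp _ _ _ _ _ _ _ := rfl

/-- A morphism with values in a suboperad. -/
def SubOperad.codRestrict {P R : GrOperad F k} (S : SubOperad P) (f : GrHom R P)
    (hf : ∀ {n : ℕ} {a : ℤ} (x : R.obj n a), f.map x ∈ S.carrier n a) :
    GrHom R S.toGrOperad where
  map := f.map.codRestrict (S.carrier _ _) hf
  map_act σ x := Subtype.ext (f.map_act σ x)
  map_comp i j hm hp hc x y := Subtype.ext (f.map_comp i j hm hp hc x y)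

/-- The preimage of a suboperad. -/
def SubOperad.comap {P R : GrOperad F k} (S : SubOperad R) (f : GrHom P R) : SubOperad P where
  carrier n a := (S.carrier n a).comap f.map
  act_mem σ x hx := by
    simp only [Submodule.mem_comap, f.map_act] at hx ⊢
    exact S.act_mem σ hx
  comp_mem i j hm hp hc x y hx hy := by
    simp only [Submodule.mem_comap, f.map_comp] at hx hy ⊢
    exact S.comp_mem i j hm hp hc hx hy

/-- A coproduct `[x] ∨ S` is generated by `S` and `x`. -/
theorem IsCoproduct.mem {P : GrOperad F k} {S : SubOperad P} {a : ℤ} {x : P.obj 0 a}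
    (h : IsCoproduct S x) (T : SubOperad P)
    (hS : ∀ {n : ℕ} {b : ℤ} (s : P.obj n b), s ∈ S.carrier n b → s ∈ T.carrier n b)
    (hx : x ∈ T.carrier 0 a) {n : ℕ} {b : ℤ} (y : P.obj n b) : y ∈ T.carrier n b := by
  obtain ⟨f, ⟨hf, hfx⟩, -⟩ := h T.toGrOperad (T.codRestrict S.incl fun s => hS s.1 s.2) ⟨x, hx⟩
  obtain ⟨g, -, hg⟩ := h P S.incl x
  -- The corestriction to T followed by the inclusion, and the identity, are both endomorphisms of P
  -- which extend the inclusion of S and fix x. By uniqueness they agree, so every y lies in T.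
  have h1 := hg (T.incl.comp f) ⟨fun s => congrArg Subtype.val (hf s), congrArg Subtype.val hfx⟩
  have h2 := hg (GrHom.id P) ⟨fun s => rfl, rfl⟩
  have h3 : y = (f.map y).1 := by
    have := congrArg (fun e : GrHom P P => e.map y) (h2.trans h1.symm)
    exact this
  rw [h3]
  exact (f.map y).2

/-- Morphisms out of a coproduct `[x] ∨ S` are determined by their values on `S` and `x`. -/
theorem IsCoproduct.hom_ext {P R : GrOperad F k} {S : SubOperad P} {a : ℤ} {x : P.obj 0 a}
    (h : IsCoproduct S x) {f g : GrHom P R}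
    (hS : ∀ {n : ℕ} {b : ℤ} (s : P.obj n b), s ∈ S.carrier n b → f.map s = g.map s)
    (hx : f.map x = g.map x) : f = g := by
  obtain ⟨e, -, he⟩ := h R (g.comp S.incl) (g.map x)
  exact (he f ⟨fun s => hS s.1 s.2, hx⟩).trans (he g ⟨fun s => rfl, rfl⟩).symm

end GrHom

/-! ## Infinitesimal bimodules and square-zero extensions -/

section SquareZero

variable {F : Flavor} {k : Type u} [Field k]

/-- An infinitesimal bimodule over a graded operad. -/
structure InfMod (A : GrOperad F k) where
  obj : ℕ → ℤ → Type u
  [ab : ∀ n a, AddCommGroup (obj n a)]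
  [mod : ∀ n a, Module k (obj n a)]
  act : ∀ {n : ℕ} {a : ℤ}, F.perms n → obj n a →ₗ[k] obj n a
  lcomp : ∀ {m n p : ℕ} {a b c : ℤ} (i j : ℕ), m = i + 1 + j → p = i + n + j → c = a + b →
    (A.obj m a →ₗ[k] obj n b →ₗ[k] obj p c)
  rcomp : ∀ {m n p : ℕ} {a b c : ℤ} (i j : ℕ), m = i + 1 + j → p = i + n + j → c = a + b →
    (obj m a →ₗ[k] A.obj n b →ₗ[k] obj p c)
  act_one : ∀ {n a} (x : obj n a), act 1 x = x
  act_mul : ∀ {n a} (σ τ : F.perms n) (x : obj n a), act (σ * τ) x = act σ (act τ x)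
  lcomp_act : ∀ {m n p : ℕ} {a b c : ℤ} (i j i' j' : ℕ) (hm : m = i + 1 + j)
    (hp : p = i + n + j) (hc : c = a + b) (hm' : m = i' + 1 + j') (hp' : p = i' + n + j')
    (σ : F.perms m) (τ : F.perms n) (ρ : F.perms p), IsInduced i i' σ.1 τ.1 ρ.1 →
    ∀ (x : A.obj m a) (y : obj n b),
      act ρ (lcomp i j hm hp hc x y) = lcomp i' j' hm' hp' hc (A.act σ x) (act τ y)
  rcomp_act : ∀ {m n p : ℕ} {a b c : ℤ} (i j i' j' : ℕ) (hm : m = i + 1 + j)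
    (hp : p = i + n + j) (hc : c = a + b) (hm' : m = i' + 1 + j') (hp' : p = i' + n + j')
    (σ : F.perms m) (τ : F.perms n) (ρ : F.perms p), IsInduced i i' σ.1 τ.1 ρ.1 →
    ∀ (x : obj m a) (y : A.obj n b),
      act ρ (rcomp i j hm hp hc x y) = rcomp i' j' hm' hp' hc (act σ x) (A.act τ y)
  seq_first : ∀ {m n l p q r : ℕ} {a b c ab bc abc : ℤ} (i j i' j' : ℕ)
    (hm : m = i + 1 + j) (hn : n = i' + 1 + j') (hp : p = i + n + j)
    (hp' : p = (i + i') + 1 + (j' + j)) (hq : q = (i + i') + l + (j' + j))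
    (hr : r = i' + l + j') (hq' : q = i + r + j)
    (h₁ : ab = a + b) (h₂ : abc = ab + c) (h₃ : bc = b + c) (h₄ : abc = a + bc)
    (x : obj m a) (y : A.obj n b) (z : A.obj l c),
      rcomp (i + i') (j' + j) hp' hq h₂ (rcomp i j hm hp h₁ x y) z =
        rcomp i j hm hq' h₄ x (A.comp i' j' hn hr h₃ y z)
  seq_second : ∀ {m n l p q r : ℕ} {a b c ab bc abc : ℤ} (i j i' j' : ℕ)
    (hm : m = i + 1 + j) (hn : n = i' + 1 + j') (hp : p = i + n + j)
    (hp' : p = (i + i') + 1 + (j' + j)) (hq : q = (i + i') + l + (j' + j))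
    (hr : r = i' + l + j') (hq' : q = i + r + j)
    (h₁ : ab = a + b) (h₂ : abc = ab + c) (h₃ : bc = b + c) (h₄ : abc = a + bc)
    (x : A.obj m a) (y : obj n b) (z : A.obj l c),
      rcomp (i + i') (j' + j) hp' hq h₂ (lcomp i j hm hp h₁ x y) z =
        lcomp i j hm hq' h₄ x (rcomp i' j' hn hr h₃ y z)
  seq_third : ∀ {m n l p q r : ℕ} {a b c ab bc abc : ℤ} (i j i' j' : ℕ)
    (hm : m = i + 1 + j) (hn : n = i' + 1 + j') (hp : p = i + n + j)
    (hp' : p = (i + i') + 1 + (j' + j)) (hq : q = (i + i') + l + (j' + j))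
    (hr : r = i' + l + j') (hq' : q = i + r + j)
    (h₁ : ab = a + b) (h₂ : abc = ab + c) (h₃ : bc = b + c) (h₄ : abc = a + bc)
    (x : A.obj m a) (y : A.obj n b) (z : obj l c),
      lcomp (i + i') (j' + j) hp' hq h₂ (A.comp i j hm hp h₁ x y) z =
        lcomp i j hm hq' h₄ x (lcomp i' j' hn hr h₃ y z)
  par_first : ∀ {m n l p q r : ℕ} {a b c ab ac abc : ℤ} (i j j' : ℕ)
    (hm : m = i + 1 + (j + 1 + j')) (hm' : m = (i + 1 + j) + 1 + j')
    (hp : p = i + n + (j + 1 + j')) (hp' : p = (i + n + j) + 1 + j')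
    (hq : q = (i + n + j) + l + j')
    (hr : r = (i + 1 + j) + l + j') (hr' : r = i + 1 + (j + l + j'))
    (hq' : q = i + n + (j + l + j'))
    (h₁ : ab = a + b) (h₂ : abc = ab + c) (h₃ : ac = a + c) (h₄ : abc = ac + b)
    (x : obj m a) (y : A.obj n b) (z : A.obj l c),
      rcomp (i + n + j) j' hp' hq h₂ (rcomp i (j + 1 + j') hm hp h₁ x y) z =
        ksign k (b * c) •
          rcomp i (j + l + j') hr' hq' h₄ (rcomp (i + 1 + j) j' hm' hr h₃ x z) y
  par_second : ∀ {m n l p q r : ℕ} {a b c ab ac abc : ℤ} (i j j' : ℕ)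
    (hm : m = i + 1 + (j + 1 + j')) (hm' : m = (i + 1 + j) + 1 + j')
    (hp : p = i + n + (j + 1 + j')) (hp' : p = (i + n + j) + 1 + j')
    (hq : q = (i + n + j) + l + j')
    (hr : r = (i + 1 + j) + l + j') (hr' : r = i + 1 + (j + l + j'))
    (hq' : q = i + n + (j + l + j'))
    (h₁ : ab = a + b) (h₂ : abc = ab + c) (h₃ : ac = a + c) (h₄ : abc = ac + b)
    (x : A.obj m a) (y : obj n b) (z : A.obj l c),
      rcomp (i + n + j) j' hp' hq h₂ (lcomp i (j + 1 + j') hm hp h₁ x y) z =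
        ksign k (b * c) •
          lcomp i (j + l + j') hr' hq' h₄ (A.comp (i + 1 + j) j' hm' hr h₃ x z) y
  par_third : ∀ {m n l p q r : ℕ} {a b c ab ac abc : ℤ} (i j j' : ℕ)
    (hm : m = i + 1 + (j + 1 + j')) (hm' : m = (i + 1 + j) + 1 + j')
    (hp : p = i + n + (j + 1 + j')) (hp' : p = (i + n + j) + 1 + j')
    (hq : q = (i + n + j) + l + j')
    (hr : r = (i + 1 + j) + l + j') (hr' : r = i + 1 + (j + l + j'))
    (hq' : q = i + n + (j + l + j'))
    (h₁ : ab = a + b) (h₂ : abc = ab + c) (h₃ : ac = a + c) (h₄ : abc = ac + b)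
    (x : A.obj m a) (y : A.obj n b) (z : obj l c),
      lcomp (i + n + j) j' hp' hq h₂ (A.comp i (j + 1 + j') hm hp h₁ x y) z =
        ksign k (b * c) •
          rcomp i (j + l + j') hr' hq' h₄ (lcomp (i + 1 + j) j' hm' hr h₃ x z) y

attribute [instance] InfMod.ab InfMod.mod

/-- The square-zero extension of a graded operad by an infinitesimal bimodule. -/
def squareZero {A : GrOperad F k} (M : InfMod A) : GrOperad F k where
  obj n a := A.obj n a × M.obj n a
  act σ := (A.act σ).prodMap (M.act σ)
  comp i j hm hp hc := LinearMap.mk₂ k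
    (fun x y => (A.comp i j hm hp hc x.1 y.1,
      M.rcomp i j hm hp hc x.2 y.1 + M.lcomp i j hm hp hc x.1 y.2))
    (fun x x' y => by ext <;> simp; abel)
    (fun c x y => by ext <;> simp)
    (fun x y y' => by ext <;> simp; abel)
    (fun c x y => by ext <;> simp)
  act_one x := Prod.ext (A.act_one x.1) (M.act_one x.2)
  act_mul σ τ x := Prod.ext (A.act_mul σ τ x.1) (M.act_mul σ τ x.2)
  comp_act i j i' j' hm hp hc hm' hp' σ τ ρ h x y :=
    Prod.ext (A.comp_act i j i' j' hm hp hc hm' hp' σ τ ρ h x.1 y.1) <| by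
      simp only [LinearMap.mk₂_apply, LinearMap.prodMap_apply, map_add]
      rw [M.rcomp_act i j i' j' hm hp hc hm' hp' σ τ ρ h,
        M.lcomp_act i j i' j' hm hp hc hm' hp' σ τ ρ h]
  comp_seq i j i' j' hm hn hp hp' hq hr hq' h₁ h₂ h₃ h₄ x y z :=
    Prod.ext (A.comp_seq i j i' j' hm hn hp hp' hq hr hq' h₁ h₂ h₃ h₄ x.1 y.1 z.1) <| by
      simp only [LinearMap.mk₂_apply, map_add, LinearMap.add_apply]
      rw [M.seq_first i j i' j' hm hn hp hp' hq hr hq' h₁ h₂ h₃ h₄,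
        M.seq_second i j i' j' hm hn hp hp' hq hr hq' h₁ h₂ h₃ h₄,
        M.seq_third i j i' j' hm hn hp hp' hq hr hq' h₁ h₂ h₃ h₄, add_assoc]
  comp_par i j j' hm hm' hp hp' hq hr hr' hq' h₁ h₂ h₃ h₄ x y z :=
    Prod.ext (A.comp_par i j j' hm hm' hp hp' hq hr hr' hq' h₁ h₂ h₃ h₄ x.1 y.1 z.1) <| by
      simp only [LinearMap.mk₂_apply, map_add, LinearMap.add_apply, Prod.smul_snd, smul_add]
      rw [M.par_first i j j' hm hm' hp hp' hq hr hr' hq' h₁ h₂ h₃ h₄,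
        M.par_second i j j' hm hm' hp hp' hq hr hr' hq' h₁ h₂ h₃ h₄,
        M.par_third i j j' hm hm' hp hp' hq hr hr' hq' h₁ h₂ h₃ h₄]
      abel

theorem squareZero_comp_snd {A : GrOperad F k} (M : InfMod A) {m n p : ℕ} {a b c : ℤ} (i j : ℕ)
    (hm : m = i + 1 + j) (hp : p = i + n + j) (hc : c = a + b) (x : (squareZero M).obj m a)
    (y : (squareZero M).obj n b) :
    ((squareZero M).comp i j hm hp hc x y).2 =
      M.rcomp i j hm hp hc x.2 y.1 + M.lcomp i j hm hp hc x.1 y.2 := rfl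

/-- The projection of a square-zero extension. -/
def squareZero.fst {A : GrOperad F k} (M : InfMod A) : GrHom (squareZero M) A where
  map := LinearMap.fst k _ _
  map_act _ _ := rfl
  map_comp _ _ _ _ _ _ _ := rfl

/-- The inclusion into a square-zero extension. -/
def squareZero.inl {A : GrOperad F k} (M : InfMod A) : GrHom A (squareZero M) where
  map := LinearMap.inl k _ _
  map_act σ x := Prod.ext rfl (map_zero (M.act σ)).symm
  map_comp i j hm hp hc x y := Prod.ext rfl (by
    change 0 = M.rcomp i j hm hp hc 0 y + M.lcomp i j hm hp hc x 0
    simp)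

/-- An operad as an infinitesimal bimodule over itself, with degrees raised by `e`; here
`f a = a - e`. The square-zero extension by it is the operad of dual numbers over `A`. -/
def shiftMod (A : GrOperad F k) (e : ℤ) (f : ℤ → ℤ) (hf : ∀ a, f a = a - e) : InfMod A where
  obj n a := A.obj n (f a)
  act σ := A.act σ
  lcomp {m n p a b c} i j hm hp hc :=
    -- The parameter of degree e is written on the left, so it passes the first factor of a
    -- composite but never the second.
    ksign k (e * a) • A.comp i j hm hp (by rw [hf, hf]; omega)
  rcomp {m n p a b c} i j hm hp hc := A.comp i j hm hp (by rw [hf, hf]; omega)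
  act_one x := A.act_one x
  act_mul σ τ x := A.act_mul σ τ x
  lcomp_act {m n p a b c} i j i' j' hm hp hc hm' hp' σ τ ρ h x y := by
    simp only [LinearMap.smul_apply, map_smul]
    rw [A.comp_act i j i' j' hm hp _ hm' hp' σ τ ρ h]
  rcomp_act i j i' j' hm hp hc hm' hp' σ τ ρ h x y := by
    rw [A.comp_act i j i' j' hm hp _ hm' hp' σ τ ρ h]
  seq_first i j i' j' hm hn hp hp' hq hr hq' h₁ h₂ h₃ h₄ x y z := by
    rw [A.comp_seq i j i' j' hm hn hp hp' hq hr hq']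
  seq_second i j i' j' hm hn hp hp' hq hr hq' h₁ h₂ h₃ h₄ x y z := by
    simp only [LinearMap.smul_apply, map_smul]
    rw [A.comp_seq i j i' j' hm hn hp hp' hq hr hq']
  seq_third {m n l p q r a b c ab bc abc} i j i' j' hm hn hp hp' hq hr hq' h₁ h₂ h₃ h₄ x y z := by
    simp only [LinearMap.smul_apply, map_smul, smul_smul]
    rw [A.comp_seq i j i' j' hm hn hp hp' hq hr hq', ← ksign_add, h₁, ← mul_add, add_comm b a]
  par_first {m n l p q r a b c ab ac abc} i j j' hm hm' hp hp' hq hr hr' hq' h₁ h₂ h₃ h₄ x y z := by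
    rw [A.comp_par i j j' hm hm' hp hp' hq hr hr' hq']
  par_second {m n l p q r a b c ab ac abc} i j j' hm hm' hp hp' hq hr hr' hq' h₁ h₂ h₃ h₄ x y z := by
    simp only [LinearMap.smul_apply, map_smul, smul_smul]
    rw [A.comp_par i j j' hm hm' hp hp' hq hr hr' hq' (h₃ := h₃), smul_smul, ← ksign_add,
      ← ksign_add]
    · congr 1
      apply ksign_congr
      rw [hf, h₃]
      simp only [Int.even_add, Int.even_mul, Int.even_sub]
      tauto
    · rw [hf, hf]; omega
  par_third {m n l p q r a b c ab ac abc} i j j' hm hm' hp hp' hq hr hr' hq' h₁ h₂ h₃ h₄ x y z := by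
    simp only [LinearMap.smul_apply, map_smul, smul_smul]
    rw [A.comp_par i j j' hm hm' hp hp' hq hr hr' hq' (ac := f ac), smul_smul, ← ksign_add,
      ← ksign_add]
    · congr 1
      apply ksign_congr
      rw [hf, h₁]
      simp only [Int.even_add, Int.even_mul, Int.even_sub]
      tauto
    · rw [hf, hf]; omega
    · rw [hf, hf]; omega

/-- The identification of the components in equal degrees. -/
def GrOperad.castDeg (A : GrOperad F k) {n : ℕ} {a b : ℤ} (h : a = b) :
    A.obj n a →ₗ[k] A.obj n b := h ▸ LinearMap.id

theorem GrOperad.castDeg_act (A : GrOperad F k) {n : ℕ} {a b : ℤ} (h : a = b) (σ : F.perms n)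
    (x : A.obj n a) : A.castDeg h (A.act σ x) = A.act σ (A.castDeg h x) := by
  subst h; rfl

end SquareZero

/-! ## The graded universal property of `adjoin` -/

section Cofree

variable {F : Flavor} {k : Type u} [Field k]

/-- The cofree dg operad on a graded operad. -/
def cofree (S : GrOperad F k) : DGOperad F k where
  toGrOperad := squareZero (shiftMod S 1 (fun a => a - 1) fun _ => rfl)
  d {n a b} h :=
    -- The second component is the slot for the value of the differential: d(x, y) = (y, 0). A
    -- graded morphism g then lifts to x ↦ (g x, g (d x)).
    { toFun := fun x => (S.castDeg (show a - 1 = b by omega) x.2, 0)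
      map_add' := fun x y => Prod.ext (map_add (S.castDeg _) x.2 y.2) (add_zero 0).symm
      map_smul' := fun c x => Prod.ext (map_smul (S.castDeg _) c x.2) (smul_zero c).symm }
  d_d h h' x := by
    refine Prod.ext ?_ rfl
    exact map_zero (S.castDeg _)
  d_act h σ x := by
    refine Prod.ext ?_ ?_
    · exact S.castDeg_act _ σ x.2
    · exact (map_zero (S.act σ)).symm
  d_comp {m n p a b c a' b' c'} i j hm hp hc hc' ha' hb' h₁ h₂ x y := by
    obtain rfl : a' = a - 1 := by omega
    obtain rfl : b' = b - 1 := by omega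
    obtain rfl : c' = c - 1 := by omega
    refine Prod.ext ?_ ?_
    · change S.comp i j hm hp _ x.2 y.1 + ksign k (1 * a) • S.comp i j hm hp _ x.1 y.2 =
        S.comp i j hm hp _ x.2 y.1 + ksign k a • S.comp i j hm hp _ x.1 y.2
      rw [one_mul]
    · have h3 : c - 1 - 1 = a - 1 + (b - 1) := by omega
      have h : ∀ z : S.obj p (c - 1 - 1), 0 = (0 + ksign k (1 * (a - 1)) • z) +
          ksign k a • (z + ksign k (1 * a) • 0) := fun z => by
        rw [one_mul, ksign_sub_one]
        simp
      refine (h (S.comp i j hm hp h3 x.2 y.2)).trans ?_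
      have e1 : S.comp i j hm hp (show c - 1 - 1 = a - 1 - 1 + b by omega) 0 y.1 = 0 := by simp
      have e2 : S.comp i j hm hp (show c - 1 - 1 = a + (b - 1 - 1) by omega) x.1 0 = 0 := by simp
      exact (congrArg₂ (fun u v => (u + ksign k (1 * (a - 1)) • S.comp i j hm hp h3 x.2 y.2) +
        ksign k a • (S.comp i j hm hp h3 x.2 y.2 + ksign k (1 * a) • v)) e1 e2).symm

/-- The morphism of dg operads to a cofree dg operad given by a graded morphism. -/
def cofree.lift {P : DGOperad F k} {S : GrOperad F k} (g : GrHom P.toGrOperad S) :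
    P ⟶ cofree S where
  map {n a} := g.map.prod (g.map ∘ₗ P.d (a := a) (b := a - 1) (by omega))
  map_act σ x := Prod.ext (g.map_act σ x) ((congrArg _ (P.d_act _ σ x)).trans (g.map_act σ _))
  map_comp {m n p a b c} i j hm hp hc x y := by
    refine Prod.ext (g.map_comp i j hm hp hc x y) ?_
    change g.map (P.d _ (P.comp i j hm hp hc x y)) = S.comp i j hm hp _ (g.map (P.d _ x)) (g.map y)
      + ksign k (1 * a) • S.comp i j hm hp _ (g.map x) (g.map (P.d _ y))
    rw [P.d_comp i j hm hp hc (show c - 1 + 1 = c by omega) (a' := a - 1) (b' := b - 1)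
      (by omega) (by omega) (by omega) (by omega), map_add, map_smul, g.map_comp, g.map_comp,
      one_mul]
    rfl
  map_d {n a b} h x := by
    obtain rfl : b = a - 1 := by omega
    refine Prod.ext rfl ?_
    exact (congrArg _ (P.d_d _ _ x)).trans (map_zero g.map)

/-- The morphism of graded operads out of `Q ∨ [κ] ∨ [α]` which is `g` on `Q` and sends `α` to `x`
and `κ` to `y`. -/
def adjoin.grLift {Q : DGOperad F k} {S : GrOperad F k} (g : GrHom Q.toGrOperad S)
    (x : S.obj 0 0) (y : S.obj 0 (-1)) : GrHom (adjoin Q).toGrOperad S :=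
  -- Here α goes to the pair (x, y). As κ = dα goes to (y, 0), the projection to the first component
  -- sends α to x and κ to y independently of each other.
  (squareZero.fst _).comp (adjoin.lift (P := cofree S) (cofree.lift g) (x, y)).toGrHom

/-- The class of an expression in `Q ∨ [κ] ∨ [α]`. -/
def adjoinMk {Q : DGOperad F k} {n : ℕ} {a : ℤ} (x : Term F k (AdjGen Q) n a) :
    (adjoin Q).obj n a := Pres.mk x

/-- As a graded operad, `Q ∨ [κ] ∨ [α]` is generated by `Q`, `α` and `κ`. -/
theorem adjoin.mem {Q : DGOperad F k} (S : SubOperad (adjoin Q).toGrOperad)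
    (h : ∀ {n : ℕ} {a : ℤ} (x : Q.obj n a), app (incl Q) x ∈ S.carrier n a)
    (hα : alpha Q ∈ S.carrier 0 0) (hκ : kappa Q ∈ S.carrier 0 (-1)) {n : ℕ} {a : ℤ}
    (x : (adjoin Q).obj n a) : x ∈ S.carrier n a := by
  -- The suboperad is not assumed closed under d, while expressions may contain d anywhere. The
  -- induction therefore also carries the membership of the differential of each expression; it
  -- closes because d² = 0.
  suffices H : ∀ {n : ℕ} {a : ℤ} (x : Term F k (AdjGen Q) n a),
      adjoinMk x ∈ S.carrier n a ∧ ∀ {b : ℤ} (hb : b + 1 = a),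
        (adjoin Q).d hb (adjoinMk x) ∈ S.carrier n b by
    obtain ⟨x⟩ := x
    exact (H x).1
  clear x n a
  intro n a x
  induction x with
  | gen y =>
    cases y with
    | of y =>
      refine ⟨h y, fun {b} hb => ?_⟩
      have := h (Q.d hb y)
      rw [(incl Q).map_d] at this
      exact this
    | alpha =>
      refine ⟨hα, fun {b} hb => ?_⟩
      obtain rfl : b = -1 := by omega
      exact hκ
  | @zero n a =>
    have h0 : (adjoinMk .zero : (adjoin Q).obj n a) = 0 := rfl
    rw [h0]
    refine ⟨Submodule.zero_mem _, fun {b} hb => ?_⟩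
    rw [map_zero]; exact Submodule.zero_mem _
  | @add n a x y ihx ihy =>
    have h0 : (adjoinMk (.add x y) : (adjoin Q).obj n a) = adjoinMk x + adjoinMk y := rfl
    rw [h0]
    refine ⟨Submodule.add_mem _ ihx.1 ihy.1, fun {b} hb => ?_⟩
    rw [map_add]
    exact Submodule.add_mem _ (ihx.2 hb) (ihy.2 hb)
  | @smul n a c x ih =>
    have h0 : (adjoinMk (.smul c x) : (adjoin Q).obj n a) = c • adjoinMk x := rfl
    rw [h0]
    refine ⟨Submodule.smul_mem _ c ih.1, fun {b} hb => ?_⟩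
    rw [map_smul]
    exact Submodule.smul_mem _ c (ih.2 hb)
  | @act n a σ x ih =>
    have h0 : (adjoinMk (.act σ x) : (adjoin Q).obj n a) = (adjoin Q).act σ (adjoinMk x) := rfl
    rw [h0]
    refine ⟨S.act_mem σ ih.1, fun {b} hb => ?_⟩
    rw [(adjoin Q).d_act]
    exact S.act_mem σ (ih.2 hb)
  | @comp m n p a b c i j hm hp hc x y ihx ihy =>
    have h0 : (adjoinMk (.comp i j hm hp hc x y) : (adjoin Q).obj p c) =
      (adjoin Q).comp i j hm hp hc (adjoinMk x) (adjoinMk y) := rfl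
    rw [h0]
    refine ⟨S.comp_mem i j hm hp hc ihx.1 ihy.1, fun {c'} hb => ?_⟩
    rw [(adjoin Q).d_comp i j hm hp hc hb (a' := a - 1) (b' := b - 1) (by omega) (by omega)
      (by omega) (by omega)]
    exact Submodule.add_mem _ (S.comp_mem i j hm hp _ (ihx.2 _) ihy.1)
        (Submodule.smul_mem _ _ (S.comp_mem i j hm hp _ ihx.1 (ihy.2 _)))
  | @d n a b hb x ih =>
    have h0 : (adjoinMk (.d hb x) : (adjoin Q).obj n b) = (adjoin Q).d hb (adjoinMk x) := rfl
    rw [h0]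
    refine ⟨ih.2 hb, fun {c} hc => ?_⟩
    rw [(adjoin Q).d_d]; exact Submodule.zero_mem _

/-- The suboperad on which two morphisms agree. -/
def equalizer {P R : GrOperad F k} (f g : GrHom P R) : SubOperad P where
  carrier n a := LinearMap.eqLocus f.map g.map
  act_mem σ x hx := by
    simp only [LinearMap.mem_eqLocus, f.map_act, g.map_act] at hx ⊢
    rw [hx]
  comp_mem i j hm hp hc x y hx hy := by
    simp only [LinearMap.mem_eqLocus, f.map_comp, g.map_comp] at hx hy ⊢
    rw [hx, hy]

theorem adjoin.grHom_ext {Q : DGOperad F k} {S : GrOperad F k}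
    {f g : GrHom (adjoin Q).toGrOperad S}
    (h : ∀ {n : ℕ} {a : ℤ} (x : Q.obj n a), f.map (app (incl Q) x) = g.map (app (incl Q) x))
    (hα : f.map (alpha Q) = g.map (alpha Q)) (hκ : f.map (kappa Q) = g.map (kappa Q)) :
    f = g :=
  GrHom.ext' fun x => adjoin.mem (equalizer f g) h hα hκ x

end Cofree

end

end CurvedTwisting

namespace CurvedTwisting

noncomputable section

/-! ## Derivations and their exponentials -/

section Flow

variable {F : Flavor} {k : Type u} [Field k]

/-- The dg operad `A[ε]` of dual numbers, with `ε` a cycle of degree `0`. -/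
def dualNumbers (A : DGOperad F k) : DGOperad F k where
  toGrOperad := squareZero (shiftMod A.toGrOperad 0 (fun a => a) fun a => (sub_zero a).symm)
  d {n a b} h :=
    { toFun := fun x => (A.d h x.1, A.d h x.2)
      map_add' := fun x y => Prod.ext (map_add (A.d h) x.1 y.1) (map_add (A.d h) x.2 y.2)
      map_smul' := fun c x => Prod.ext (map_smul (A.d h) c x.1) (map_smul (A.d h) c x.2) }
  d_d h h' x := Prod.ext (A.d_d h h' x.1) (A.d_d h h' x.2)
  d_act h σ x := Prod.ext (A.d_act h σ x.1) (A.d_act h σ x.2)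
  d_comp {m n p a b c a' b' c'} i j hm hp hc hc' ha' hb' h₁ h₂ x y := by
    refine Prod.ext (A.d_comp i j hm hp hc hc' ha' hb' h₁ h₂ x.1 y.1) ?_
    have h : ∀ a, ksign k (0 * a) = 1 := fun a => by rw [zero_mul]; exact ksign_of_even Even.zero
    have key : ∀ (x x' : A.obj m a) (y y' : A.obj n b),
        A.d hc' (A.comp i j hm hp hc x' y + ksign k (0 * a) • A.comp i j hm hp hc x y') =
      (A.comp i j hm hp h₁ (A.d ha' x') y +
        ksign k (0 * a') • A.comp i j hm hp h₁ (A.d ha' x) y') +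
      ksign k a • (A.comp i j hm hp h₂ x' (A.d hb' y) +
        ksign k (0 * a) • A.comp i j hm hp h₂ x (A.d hb' y')) := by
      intro x x' y y'
      rw [h, h, one_smul, one_smul, one_smul, map_add, A.d_comp i j hm hp hc hc' ha' hb' h₁ h₂,
        A.d_comp i j hm hp hc hc' ha' hb' h₁ h₂, smul_add]
      abel
    exact key x.1 x.2 y.1 y.2

theorem dualNumbers_comp_snd {A : DGOperad F k} {m n p : ℕ} {a b c : ℤ} (i j : ℕ)
    (hm : m = i + 1 + j) (hp : p = i + n + j) (hc : c = a + b) (x : (dualNumbers A).obj m a)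
    (y : (dualNumbers A).obj n b) :
    ((dualNumbers A).comp i j hm hp hc x y).2 =
      A.comp i j hm hp hc x.2 y.1 + A.comp i j hm hp hc x.1 y.2 := by
  have h : ksign k (0 * a) = 1 := by rw [zero_mul]; exact ksign_of_even Even.zero
  change A.comp i j hm hp hc x.2 y.1 + ksign k (0 * a) • A.comp i j hm hp hc x.1 y.2 = _
  rw [h, one_smul]

/-- A derivation `P → P ∨ [κ] ∨ [α]` of degree `0` which commutes with the differentials. -/
structure Flow (P : DGOperad F k) where
  D : ∀ {n : ℕ} {a : ℤ}, P.obj n a →ₗ[k] (adjoin P).obj n a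
  D_act : ∀ {n a} (σ : F.perms n) (x : P.obj n a), D (P.act σ x) = (adjoin P).act σ (D x)
  D_comp : ∀ {m n p : ℕ} {a b c : ℤ} (i j : ℕ) (hm : m = i + 1 + j) (hp : p = i + n + j)
    (hc : c = a + b) (x : P.obj m a) (y : P.obj n b),
      D (P.comp i j hm hp hc x y) = (adjoin P).comp i j hm hp hc (D x) (app (incl P) y) +
        (adjoin P).comp i j hm hp hc (app (incl P) x) (D y)
  D_d : ∀ {n a b} (h : b + 1 = a) (x : P.obj n a), D (P.d h x) = (adjoin P).d h (D x)

namespace Flow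

variable {P : DGOperad F k} (φ : Flow P)

/-- A derivation as a morphism to dual numbers. -/
def hom : P ⟶ dualNumbers (adjoin P) where
  map :=
    { toFun := fun x => (app (incl P) x, φ.D x)
      map_add' := fun x y => Prod.ext (map_add _ x y) (map_add _ x y)
      map_smul' := fun c x => Prod.ext (map_smul _ c x) (map_smul _ c x) }
  map_act σ x := Prod.ext ((incl P).map_act σ x) (φ.D_act σ x)
  map_comp i j hm hp hc x y := Prod.ext ((incl P).map_comp i j hm hp hc x y)
    ((φ.D_comp i j hm hp hc x y).trans (dualNumbers_comp_snd (A := adjoin P) i j hm hp hc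
      (app (incl P) x, φ.D x) (app (incl P) y, φ.D y)).symm)
  map_d h x := Prod.ext ((incl P).map_d h x) (φ.D_d h x)

/-- The morphism `adjoin P ⟶ (adjoin P)[ε]` which extends a derivation and sends `α` to `α`. -/
def homExt : adjoin P ⟶ dualNumbers (adjoin P) :=
  adjoin.lift (P := dualNumbers (adjoin P)) φ.hom (alpha P, 0)

/-- The projection from dual numbers. -/
def dualFst (A : DGOperad F k) : dualNumbers A ⟶ A where
  map := { toFun := fun x => x.1, map_add' := fun _ _ => rfl, map_smul' := fun _ _ => rfl }
  map_act _ _ := rfl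
  map_comp _ _ _ _ _ _ _ := rfl
  map_d _ _ := rfl

theorem homExt_fst {n : ℕ} {a : ℤ} (x : (adjoin P).obj n a) : (app φ.homExt x).1 = x :=
  adjoin.hom_ext (f := φ.homExt ≫ dualFst (adjoin P)) (g := 𝟙 (adjoin P)) (fun _ => rfl) rfl x

/-- The extension of a derivation to `adjoin P` which kills `α`. -/
def ext {n : ℕ} {a : ℤ} : (adjoin P).obj n a →ₗ[k] (adjoin P).obj n a where
  toFun x := (app φ.homExt x).2
  map_add' x y := congrArg Prod.snd (map_add (app φ.homExt) x y)
  map_smul' c x := congrArg Prod.snd (map_smul (app φ.homExt) c x)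

theorem ext_incl {n : ℕ} {a : ℤ} (x : P.obj n a) : φ.ext (app (incl P) x) = φ.D x := rfl

theorem ext_alpha : φ.ext (alpha P) = 0 := rfl

theorem ext_act {n : ℕ} {a : ℤ} (σ : F.perms n) (x : (adjoin P).obj n a) :
    φ.ext ((adjoin P).act σ x) = (adjoin P).act σ (φ.ext x) :=
  congrArg Prod.snd (φ.homExt.map_act σ x)

theorem ext_d {n : ℕ} {a b : ℤ} (h : b + 1 = a) (x : (adjoin P).obj n a) :
    φ.ext ((adjoin P).d h x) = (adjoin P).d h (φ.ext x) :=
  congrArg Prod.snd (φ.homExt.map_d h x)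

theorem ext_kappa : φ.ext (kappa P) = 0 := by
  rw [kappa, φ.ext_d, ext_alpha, map_zero]

theorem ext_comp {m n p : ℕ} {a b c : ℤ} (i j : ℕ) (hm : m = i + 1 + j) (hp : p = i + n + j)
    (hc : c = a + b) (x : (adjoin P).obj m a) (y : (adjoin P).obj n b) :
    φ.ext ((adjoin P).comp i j hm hp hc x y) = (adjoin P).comp i j hm hp hc (φ.ext x) y +
      (adjoin P).comp i j hm hp hc x (φ.ext y) := by
  have := (congrArg Prod.snd (φ.homExt.map_comp i j hm hp hc x y)).trans
    (dualNumbers_comp_snd i j hm hp hc _ _)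
  have h1 := φ.homExt_fst x
  have h2 := φ.homExt_fst y
  rw [show app φ.homExt = φ.homExt.map from rfl] at h1 h2
  rw [h1, h2] at this
  exact this

/-- The divided powers `D ^ t / t!` of a derivation. -/
def pow : ∀ (_ : ℕ) {n : ℕ} {a : ℤ}, (adjoin P).obj n a →ₗ[k] (adjoin P).obj n a
  | 0, _, _ => LinearMap.id
  | t + 1, _, _ => ((t + 1 : ℕ) : k)⁻¹ • (φ.ext ∘ₗ pow t)

theorem pow_zero {n : ℕ} {a : ℤ} (x : (adjoin P).obj n a) : φ.pow 0 x = x := rfl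

theorem pow_succ (t : ℕ) {n : ℕ} {a : ℤ} (x : (adjoin P).obj n a) :
    φ.pow (t + 1) x = ((t + 1 : ℕ) : k)⁻¹ • φ.ext (φ.pow t x) := rfl

theorem pow_act (t : ℕ) {n : ℕ} {a : ℤ} (σ : F.perms n) (x : (adjoin P).obj n a) :
    φ.pow t ((adjoin P).act σ x) = (adjoin P).act σ (φ.pow t x) := by
  induction t with
  | zero => rfl
  | succ t ih => rw [pow_succ, pow_succ, ih, ext_act, map_smul]

theorem pow_d (t : ℕ) {n : ℕ} {a b : ℤ} (h : b + 1 = a) (x : (adjoin P).obj n a) :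
    φ.pow t ((adjoin P).d h x) = (adjoin P).d h (φ.pow t x) := by
  induction t with
  | zero => rfl
  | succ t ih => rw [pow_succ, pow_succ, ih, ext_d, map_smul]

variable [CharZero k]

theorem succ_smul_pow (t : ℕ) {n : ℕ} {a : ℤ} (x : (adjoin P).obj n a) :
    (t + 1) • φ.pow (t + 1) x = φ.ext (φ.pow t x) := by
  rw [pow_succ, ← Nat.cast_smul_eq_nsmul k, smul_smul, mul_inv_cancel₀, one_smul]
  exact Nat.cast_ne_zero.2 t.succ_ne_zero

/-- Leibniz rule for divided powers. It matches the Cauchy product of series weight by weight, and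
so makes the exponential of a derivation multiplicative. -/
theorem pow_comp (t : ℕ) {m n p : ℕ} {a b c : ℤ} (i j : ℕ) (hm : m = i + 1 + j)
    (hp : p = i + n + j) (hc : c = a + b) (x : (adjoin P).obj m a) (y : (adjoin P).obj n b) :
    φ.pow t ((adjoin P).comp i j hm hp hc x y) = ∑ q ∈ Finset.HasAntidiagonal.antidiagonal t,
      (adjoin P).comp i j hm hp hc (φ.pow q.1 x) (φ.pow q.2 y) := by
  induction t with
  | zero => simp [pow_zero]
  | succ t ih =>
    have h := sum_antidiagonal_leibniz t
      (fun r s => (adjoin P).comp i j hm hp hc (φ.pow r x) (φ.pow s y))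
    have h' : φ.ext (φ.pow t ((adjoin P).comp i j hm hp hc x y)) =
        (t + 1) • ∑ q ∈ Finset.HasAntidiagonal.antidiagonal (t + 1),
          (adjoin P).comp i j hm hp hc (φ.pow q.1 x) (φ.pow q.2 y) := by
      rw [ih, ← h, map_sum]
      refine Finset.sum_congr rfl fun q _ => ?_
      rw [ext_comp, ← succ_smul_pow, ← succ_smul_pow, map_nsmul, map_nsmul, LinearMap.smul_apply]
    rw [pow_succ, h', ← Nat.cast_smul_eq_nsmul k, smul_smul, inv_mul_cancel₀, one_smul]
    exact Nat.cast_ne_zero.2 t.succ_ne_zero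

/-- The elements on which the exponential of a derivation is defined. -/
def bounded : SubOperad P.toGrOperad where
  carrier n a :=
    { carrier := {x | ∃ N, ∀ t, Weight P N t (φ.pow t (app (incl P) x))}
      zero_mem' := ⟨0, fun t => by rw [map_zero, map_zero]; exact .zero⟩
      add_mem' := by
        rintro x y ⟨N, hx⟩ ⟨N', hy⟩
        refine ⟨max N N', fun t => ?_⟩
        rw [map_add, map_add]
        exact .add (.mono (le_max_left _ _) (hx t)) (.mono (le_max_right _ _) (hy t))
      smul_mem' := by
        rintro c x ⟨N, hx⟩
        refine ⟨N, fun t => ?_⟩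
        rw [map_smul, map_smul]
        exact .smul c (hx t) }
  act_mem := by
    rintro n a σ x ⟨N, hx⟩
    refine ⟨N, fun t => ?_⟩
    rw [(incl P).map_act, φ.pow_act]
    exact .act σ (hx t)
  comp_mem := by
    rintro m n p a b c i j hm hp hc x y ⟨N, hx⟩ ⟨N', hy⟩
    refine ⟨N + N', fun t => ?_⟩
    rw [(incl P).map_comp, φ.pow_comp]
    refine .sum _ _ fun q hq => ?_
    rw [← Finset.HasAntidiagonal.mem_antidiagonal.1 hq]
    exact .comp i j hm hp hc (hx _) (hy _)

/-- The powers of D commute with d, and d turns at most one α of a composite into κ; so the bound on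
the number of κ grows by one, uniformly in t. -/
theorem bounded_d {n : ℕ} {a b : ℤ} (h : b + 1 = a) {x : P.obj n a}
    (hx : x ∈ φ.bounded.carrier n a) : P.d h x ∈ φ.bounded.carrier n b := by
  obtain ⟨N, hx⟩ := hx
  refine ⟨N + 1, fun t => ?_⟩
  rw [(incl P).map_d, φ.pow_d]
  exact .diff h (hx t)

/-- The exponential `exp D : P ⟶ cTw P` of a derivation. -/
def exp (h : ∀ {n : ℕ} {a : ℤ} (x : P.obj n a), x ∈ φ.bounded.carrier n a) : P ⟶ cTw P where
  map :=
    { toFun := fun x => ⟨fun t => φ.pow t (app (incl P) x), h x⟩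
      map_add' := fun x y => Subtype.ext (funext fun t => by
        change φ.pow t (app (incl P) (x + y)) = φ.pow t (app (incl P) x) + φ.pow t (app (incl P) y)
        rw [map_add, map_add])
      map_smul' := fun c x => Subtype.ext (funext fun t => by
        change φ.pow t (app (incl P) (c • x)) = c • φ.pow t (app (incl P) x)
        rw [map_smul, map_smul]) }
  map_act σ x := Subtype.ext (funext fun t => by
    change φ.pow t (app (incl P) (P.act σ x)) = (adjoin P).act σ (φ.pow t (app (incl P) x))
    rw [(incl P).map_act, pow_act])
  map_comp i j hm hp hc x y := Subtype.ext (funext fun t => by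
    change φ.pow t (app (incl P) (P.comp i j hm hp hc x y)) =
      ∑ q ∈ Finset.HasAntidiagonal.antidiagonal t, (adjoin P).comp i j hm hp hc
        (φ.pow q.1 (app (incl P) x)) (φ.pow q.2 (app (incl P) y))
    rw [(incl P).map_comp, pow_comp])
  map_d h x := Subtype.ext (funext fun t => by
    change φ.pow t (app (incl P) (P.d h x)) = (adjoin P).d h (φ.pow t (app (incl P) x))
    rw [(incl P).map_d, pow_d])

end Flow

end Flow

end

end CurvedTwisting

namespace CurvedTwisting

noncomputable section

/-! ## Extending permutations by one input -/

section Extend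

theorem succAbove_val {n : ℕ} (s : Fin (n + 1)) (z : Fin n) :
    (s.succAbove z : ℕ) = if (z : ℕ) < s then (z : ℕ) else z + 1 := by
  rw [Fin.succAbove]
  simp only [Fin.lt_def, Fin.val_castSucc]
  split_ifs <;> rfl

theorem outer_succAbove {n : ℕ} (s : Fin (n + 1)) (z : Fin n) :
    outer s 0 (s.succAbove z) = z := by
  rw [outer, succAbove_val]
  split_ifs <;> omega

/-- Plugging in a nullary operation deletes an input. The relabelling ρ then has to send the deleted
input to the deleted input and to act as σ on the others, which `Fin.succAbove` expresses without
the arithmetic of `outer`. -/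
theorem isInduced_zero_iff {n : ℕ} (s s' : Fin (n + 1)) (ρ : Equiv.Perm (Fin (n + 1)))
    (τ : Equiv.Perm (Fin 0)) (σ : Equiv.Perm (Fin n)) :
    IsInduced (s : ℕ) (s' : ℕ) ρ τ σ ↔
      ρ s = s' ∧ ∀ z, ρ (s.succAbove z) = s'.succAbove (σ z) := by
  constructor
  · rintro ⟨h1, -, h3⟩
    have hs : ρ s = s' := Fin.ext (h1 s rfl)
    refine ⟨hs, fun z => ?_⟩
    have h := h3 (s.succAbove z) z (fun h => Fin.succAbove_ne s z (Fin.ext h))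
      (outer_succAbove s z).symm
    have hne : ρ (s.succAbove z) ≠ s' := by
      rw [← hs]; exact fun h => Fin.succAbove_ne s z (ρ.injective h)
    obtain ⟨w, hw⟩ := Fin.exists_succAbove_eq hne
    rw [← hw, outer_succAbove] at h
    rw [← hw, Fin.ext h]
  · rintro ⟨hs, h⟩
    refine ⟨fun t ht => ?_, fun t => t.elim0, fun t z ht hz => ?_⟩
    · rw [Fin.ext ht, hs]
    · obtain ⟨w, rfl⟩ := Fin.exists_succAbove_eq (x := t) (y := s) (fun e => ht (congrArg _ e))
      rw [outer_succAbove] at hz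
      rw [Fin.ext hz, h, outer_succAbove]

/-- The permutation which sends `s` to `s'` and acts by `σ` on the other elements. -/
def extPerm {n : ℕ} (s s' : Fin (n + 1)) (σ : Equiv.Perm (Fin n)) : Equiv.Perm (Fin (n + 1)) :=
  ((finSuccEquiv' s).trans (Equiv.optionCongr σ)).trans (finSuccEquiv' s').symm

theorem extPerm_self {n : ℕ} (s s' : Fin (n + 1)) (σ : Equiv.Perm (Fin n)) :
    extPerm s s' σ s = s' := by
  simp [extPerm]

theorem extPerm_succAbove {n : ℕ} (s s' : Fin (n + 1)) (σ : Equiv.Perm (Fin n)) (z : Fin n) :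
    extPerm s s' σ (s.succAbove z) = s'.succAbove (σ z) := by
  simp [extPerm]

theorem isInduced_extPerm {n : ℕ} (s s' : Fin (n + 1)) (τ : Equiv.Perm (Fin 0))
    (σ : Equiv.Perm (Fin n)) : IsInduced (s : ℕ) (s' : ℕ) (extPerm s s' σ) τ σ :=
  (isInduced_zero_iff s s' _ τ σ).2 ⟨extPerm_self s s' σ, extPerm_succAbove s s' σ⟩

theorem extPerm_injective {n : ℕ} (s s' : Fin (n + 1)) :
    Function.Injective (extPerm s s') := fun σ σ' h => Equiv.ext fun z => by
  have := congrArg (fun ρ : Equiv.Perm (Fin (n + 1)) => ρ (s.succAbove z)) h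
  simpa [extPerm_succAbove] using this

theorem exists_extPerm_eq {n : ℕ} (s s' : Fin (n + 1)) (ρ : Equiv.Perm (Fin (n + 1)))
    (h : ρ s = s') : ∃ σ, extPerm s s' σ = ρ := by
  have hne : ∀ z, ρ (s.succAbove z) ≠ s' := fun z e => by
    rw [← h] at e
    exact Fin.succAbove_ne s z (ρ.injective e)
  choose f hf using fun z => Fin.exists_succAbove_eq (hne z)
  have hinj : Function.Injective f := fun z z' e => by
    have : ρ (s.succAbove z) = ρ (s.succAbove z') := by rw [← hf, ← hf, e]
    exact Fin.succAbove_right_injective (ρ.injective this)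
  refine ⟨Equiv.ofBijective f (Finite.injective_iff_bijective.1 hinj), Equiv.ext fun t => ?_⟩
  rcases eq_or_ne t s with rfl | ht
  · rw [extPerm_self, h]
  · obtain ⟨w, rfl⟩ := Fin.exists_succAbove_eq ht
    rw [extPerm_succAbove, Equiv.ofBijective_apply, hf]

theorem Flavor.perms_eq_one {n : ℕ} (σ : Flavor.nonsymmetric.perms n) : σ = 1 :=
  Subtype.ext (Subgroup.mem_bot.1 σ.2)

/-- The relabelling of a symmetric operad which sends `s` to `s'` and acts by `σ` on the other
inputs. -/
def extSym {n : ℕ} (s s' : Fin (n + 1)) (σ : Flavor.symmetric.perms n) :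
    Flavor.symmetric.perms (n + 1) := ⟨extPerm s s' σ.1, Subgroup.mem_top _⟩

end Extend

/-! ## Shuffles -/

section Shuffles

open Finset

theorem mem_shuffles {n q : ℕ} {σ : Flavor.symmetric.perms n} :
    σ ∈ shuffles n q ↔ IsShuffle n q σ.1 := by
  simp [shuffles]

theorem succAbove_lt_iff {n : ℕ} (s : Fin (n + 1)) (x y : Fin n) :
    s.succAbove x < s.succAbove y ↔ x < y := Fin.succAbove_lt_succAbove_iff

theorem eq_one_of_isShuffle_zero {n : ℕ} {σ : Equiv.Perm (Fin n)} (h : IsShuffle n 0 σ) :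
    σ = 1 := by
  have hm : StrictMono σ := fun x y hxy => h.2 x y (Nat.zero_le _) hxy
  have := (hm.orderIsoOfSurjective σ σ.surjective)
  ext x
  have e := Subsingleton.elim (hm.orderIsoOfSurjective σ σ.surjective) (OrderIso.refl _)
  exact congrArg (fun f : Fin n ≃o Fin n => (f x : ℕ)) e

theorem shuffles_zero (n : ℕ) : shuffles n 0 = {1} := by
  ext σ
  rw [mem_shuffles, mem_singleton]
  constructor
  · intro h
    exact Subtype.ext (eq_one_of_isShuffle_zero h)
  · rintro rfl
    exact ⟨fun x y h _ => h, fun x y _ h => h⟩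

/-- A new minimum, sent to the minimum, can always be added in front of the first block: the new
monotonicity conditions hold automatically. -/
theorem isShuffle_extPerm_zero {n q : ℕ} (σ : Equiv.Perm (Fin n)) :
    IsShuffle (n + 1) (q + 1) (extPerm 0 0 σ) ↔ IsShuffle n q σ := by
  have hv : ∀ z : Fin n, (((0 : Fin (n + 1)).succAbove z : Fin (n + 1)) : ℕ) = z + 1 :=
    fun z => by rw [succAbove_val]; simp
  constructor
  · rintro ⟨h1, h2⟩
    refine ⟨fun x y hxy hy => ?_, fun x y hx hxy => ?_⟩
    · have := h1 (Fin.succAbove 0 x) (Fin.succAbove 0 y) ((succAbove_lt_iff _ _ _).2 hxy)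
        (by rw [hv]; omega)
      rwa [extPerm_succAbove, extPerm_succAbove, succAbove_lt_iff] at this
    · have := h2 (Fin.succAbove 0 x) (Fin.succAbove 0 y) (by rw [hv]; omega)
        ((succAbove_lt_iff _ _ _).2 hxy)
      rwa [extPerm_succAbove, extPerm_succAbove, succAbove_lt_iff] at this
  · rintro ⟨h1, h2⟩
    refine ⟨fun x y hxy hy => ?_, fun x y hx hxy => ?_⟩
    · obtain ⟨y, rfl⟩ := Fin.exists_succAbove_eq (Fin.pos_iff_ne_zero.1 (lt_of_le_of_lt x.zero_le hxy))
      rcases eq_or_ne x 0 with rfl | hx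
      · rw [extPerm_self, extPerm_succAbove]
        exact Fin.pos_iff_ne_zero.2 (Fin.succAbove_ne _ _)
      · obtain ⟨x, rfl⟩ := Fin.exists_succAbove_eq hx
        rw [extPerm_succAbove, extPerm_succAbove, succAbove_lt_iff]
        rw [hv] at hy
        exact h1 x y ((succAbove_lt_iff _ _ _).1 hxy) (by omega)
    · obtain ⟨y, rfl⟩ := Fin.exists_succAbove_eq (Fin.pos_iff_ne_zero.1 (lt_of_le_of_lt x.zero_le hxy))
      obtain ⟨x, rfl⟩ := Fin.exists_succAbove_eq (x := x) (y := 0)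
        (fun e => by rw [e] at hx; simp at hx)
      rw [hv] at hx
      rw [extPerm_succAbove, extPerm_succAbove, succAbove_lt_iff]
      exact h2 x y (by omega) ((succAbove_lt_iff _ _ _).1 hxy)

/-- The inserted element q is the first one of the second block and is sent to 0, so it imposes no
new condition either. -/
theorem isShuffle_extPerm_of_le {n q : ℕ} (hq : q < n + 1) (σ : Equiv.Perm (Fin n)) :
    IsShuffle (n + 1) q (extPerm ⟨q, hq⟩ 0 σ) ↔ IsShuffle n q σ := by
  have hv : ∀ z : Fin n, (((⟨q, hq⟩ : Fin (n + 1)).succAbove z : Fin (n + 1)) : ℕ) =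
      if (z : ℕ) < q then (z : ℕ) else z + 1 := fun z => succAbove_val _ z
  constructor
  · rintro ⟨h1, h2⟩
    refine ⟨fun x y hxy hy => ?_, fun x y hx hxy => ?_⟩
    · have := h1 (Fin.succAbove ⟨q, hq⟩ x) (Fin.succAbove ⟨q, hq⟩ y)
        ((succAbove_lt_iff _ _ _).2 hxy) (by rw [hv, if_pos hy]; exact hy)
      rwa [extPerm_succAbove, extPerm_succAbove, succAbove_lt_iff] at this
    · have := h2 (Fin.succAbove ⟨q, hq⟩ x) (Fin.succAbove ⟨q, hq⟩ y)
        (by rw [hv, if_neg (by omega)]; omega) ((succAbove_lt_iff _ _ _).2 hxy)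
      rwa [extPerm_succAbove, extPerm_succAbove, succAbove_lt_iff] at this
  · rintro ⟨h1, h2⟩
    refine ⟨fun x y hxy hy => ?_, fun x y hx hxy => ?_⟩
    · have hxy' : (x : ℕ) < y := hxy
      obtain ⟨y, rfl⟩ := Fin.exists_succAbove_eq (x := y) (y := ⟨q, hq⟩)
        (fun e => by rw [e] at hy; simp at hy)
      obtain ⟨x, rfl⟩ := Fin.exists_succAbove_eq (x := x) (y := ⟨q, hq⟩)
        (fun e => by rw [e] at hxy'; simp at hxy'; omega)
      rw [extPerm_succAbove, extPerm_succAbove, succAbove_lt_iff]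
      rw [hv] at hy
      refine h1 x y ((succAbove_lt_iff _ _ _).1 hxy) ?_
      split_ifs at hy <;> omega
    · have hxy' : (x : ℕ) < y := hxy
      obtain ⟨y, rfl⟩ := Fin.exists_succAbove_eq (x := y) (y := ⟨q, hq⟩)
        (fun e => by rw [e] at hxy'; simp at hxy'; omega)
      rcases eq_or_ne x ⟨q, hq⟩ with rfl | hne
      · rw [extPerm_self, extPerm_succAbove]
        exact Fin.pos_iff_ne_zero.2 (Fin.succAbove_ne _ _)
      · obtain ⟨x, rfl⟩ := Fin.exists_succAbove_eq hne
        rw [extPerm_succAbove, extPerm_succAbove, succAbove_lt_iff]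
        rw [hv] at hx
        refine h2 x y ?_ ((succAbove_lt_iff _ _ _).1 hxy)
        split_ifs at hx <;> omega

/-- A shuffle moves `0` or `q` to `0`. -/
theorem IsShuffle.preimage_zero {n q : ℕ} {ρ : Equiv.Perm (Fin (n + 1))}
    (h : IsShuffle (n + 1) q ρ) {t : Fin (n + 1)} (ht : ρ t = 0) : t = 0 ∨ (t : ℕ) = q := by
  by_contra hc
  push Not at hc
  obtain ⟨h0, hq⟩ := hc
  have h0' : 0 < (t : ℕ) := Nat.pos_of_ne_zero fun e => h0 (Fin.ext e)
  rcases lt_or_gt_of_ne hq with hlt | hgt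
  · have := h.1 0 t (Fin.pos_iff_ne_zero.2 h0) hlt
    rw [ht] at this
    exact absurd this (Fin.not_lt_zero _)
  · have := h.2 ⟨q, by omega⟩ t (le_refl q) hgt
    rw [ht] at this
    exact absurd this (Fin.not_lt_zero _)

theorem sum_shuffles_filter {M : Type*} [AddCommMonoid M] {n q q' : ℕ} (s : Fin (n + 1))
    (f : Flavor.symmetric.perms (n + 1) → M)
    (h : ∀ σ, IsShuffle (n + 1) q (extPerm s 0 σ) ↔ IsShuffle n q' σ) :
    ∑ ρ ∈ shuffles (n + 1) q with ρ.1 s = 0, f ρ = ∑ σ ∈ shuffles n q', f (extSym s 0 σ) := by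
  symm
  refine sum_nbij (extSym s 0) (fun σ hσ => ?_) (fun σ _ σ' _ e => ?_) (fun ρ hρ => ?_)
    (fun _ _ => rfl)
  · rw [mem_filter, mem_shuffles]
    exact ⟨(h _).2 (mem_shuffles.1 hσ), extPerm_self s 0 _⟩
  · exact Subtype.ext (extPerm_injective s 0 (congrArg Subtype.val e))
  · have hρ' := mem_filter.1 (mem_coe.1 hρ)
    obtain ⟨σ, hσ⟩ := exists_extPerm_eq s 0 ρ.1 hρ'.2
    refine ⟨⟨σ, Subgroup.mem_top _⟩, ?_, Subtype.ext hσ⟩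
    rw [mem_coe, mem_shuffles, ← h σ, hσ]
    exact mem_shuffles.1 hρ'.1

theorem sum_shuffles_first {M : Type*} [AddCommMonoid M] (n : ℕ)
    (f : Flavor.symmetric.perms (n + 1) → M) :
    ∑ ρ ∈ shuffles (n + 1) 0, f ρ = ∑ σ ∈ shuffles n 0, f (extSym 0 0 σ) := by
  rw [← sum_shuffles_filter (q := 0) 0 f (isShuffle_extPerm_of_le (Nat.succ_pos n)),
    filter_true_of_mem]
  intro ρ hρ
  have := (mem_shuffles.1 hρ).preimage_zero (ρ.1.apply_symm_apply 0)
  have h0 : ρ.1.symm 0 = 0 := this.elim id (fun e => Fin.ext e)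
  rw [Equiv.symm_apply_eq] at h0
  exact h0.symm

/-- Pascal's recursion for shuffles: the element sent to 0 is the first one of one of the two
blocks. For an α in the first input of a shuffled composite, this decides whether α enters the inner
or the outer operation. -/
theorem sum_shuffles_succ {M : Type*} [AddCommMonoid M] (n q : ℕ) (hq : q + 1 < n + 1)
    (f : Flavor.symmetric.perms (n + 1) → M) :
    ∑ ρ ∈ shuffles (n + 1) (q + 1), f ρ = ∑ σ ∈ shuffles n q, f (extSym 0 0 σ) +
      ∑ σ ∈ shuffles n (q + 1), f (extSym ⟨q + 1, hq⟩ 0 σ) := by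
  rw [← sum_shuffles_filter (q := q + 1) 0 f isShuffle_extPerm_zero,
    ← sum_shuffles_filter (q := q + 1) _ f (isShuffle_extPerm_of_le hq),
    ← sum_filter_add_sum_filter_not (shuffles (n + 1) (q + 1)) (fun ρ => ρ.1 0 = 0)]
  congr 1
  refine sum_congr (filter_congr fun ρ hρ => ?_) fun _ _ => rfl
  have h := (mem_shuffles.1 hρ).preimage_zero (ρ.1.apply_symm_apply 0)
  constructor
  · intro h0
    rcases h with e | e
    · rw [Equiv.symm_apply_eq] at e
      exact absurd e.symm h0
    · have e' : ρ.1.symm 0 = ⟨q + 1, hq⟩ := Fin.ext e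
      rw [Equiv.symm_apply_eq] at e'
      exact e'.symm
  · intro h1 h0
    have := congrArg Fin.val (ρ.1.injective (h1.trans h0.symm))
    simp at this

theorem sum_shuffles_last {M : Type*} [AddCommMonoid M] (n : ℕ)
    (f : Flavor.symmetric.perms (n + 1) → M) :
    ∑ ρ ∈ shuffles (n + 1) (n + 1), f ρ = ∑ σ ∈ shuffles n n, f (extSym 0 0 σ) := by
  rw [← sum_shuffles_filter (q := n + 1) 0 f isShuffle_extPerm_zero, filter_true_of_mem]
  intro ρ hρ
  have := (mem_shuffles.1 hρ).preimage_zero (ρ.1.apply_symm_apply 0)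
  have h0 : ρ.1.symm 0 = 0 := this.elim id (fun e => by have := (ρ.1.symm 0).2; omega)
  rw [Equiv.symm_apply_eq] at h0
  exact h0.symm

end Shuffles

end

end CurvedTwisting

namespace CurvedTwisting

noncomputable section

/-! ## The quadratic expressions in the differential of the generators -/

section CurvSum

variable {k : Type u} [Field k]

/-- The composite `x_{i+1+j} ∘_{i+1} y_q` for families `x` and `y`. -/
def compFam {F : Flavor} (P : GrOperad F k) {a b c : ℤ} (hc : c = a + b) (x : ∀ n, P.obj n a)
    (y : ∀ n, P.obj n b) {p : ℕ} (i q j : ℕ) (hp : p = i + q + j) : P.obj p c :=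
  P.comp i j rfl hp hc (x (i + 1 + j)) (y q)

theorem compFam_congr {F : Flavor} (P : GrOperad F k) {a b c : ℤ} (hc : c = a + b)
    (x : ∀ n, P.obj n a) (y : ∀ n, P.obj n b) {p i q j i' q' j' : ℕ} (hp : p = i + q + j)
    (hp' : p = i' + q' + j') (hi : i = i') (hq : q = q') :
    compFam P hc x y i q j hp = compFam P hc x y i' q' j' hp' := by
  subst hi hq
  obtain rfl : j = j' := by omega
  rfl

theorem comp_eq_compFam {F : Flavor} (P : GrOperad F k) {a b c : ℤ} (hc : c = a + b)
    (x : ∀ n, P.obj n a) (y : ∀ n, P.obj n b) {p m i q j : ℕ} (hm : m = i + 1 + j)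
    (hp : p = i + q + j) :
    P.comp i j hm hp hc (x m) (y q) = compFam P hc x y i q j hp := by
  subst hm; rfl

/-- The sum of all composites `x_{p+1} ∘ y_q` with `n` inputs over shuffles, respectively of all
`x_{p+1+r} ∘_{p+1} y_q`. -/
def curvSum : ∀ {F : Flavor} (P : GrOperad F k) {a b c : ℤ} (_ : c = a + b)
    (_ : ∀ n, P.obj n a) (_ : ∀ n, P.obj n b) (n : ℕ), P.obj n c
  | .symmetric, P, _, _, _, hc, x, y, n => ∑ q : Fin (n + 1), ∑ σ ∈ shuffles n q,
      P.act σ (compFam P hc x y 0 q (n - q) (by omega))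
  | .nonsymmetric, P, _, _, _, hc, x, y, n => ∑ p : Fin (n + 1), ∑ q : Fin (n - p + 1),
      compFam P hc x y p q (n - p - q) (by omega)

/-- `x_{n+1}(y, -, …, -)`, respectively the sum of all `x_{n+1}(-, …, y, …, -)`. -/
def insertAll : ∀ {F : Flavor} (P : GrOperad F k) {a b c : ℤ} (_ : c = a + b)
    (_ : ∀ n, P.obj n a) (_ : P.obj 0 b) (n : ℕ), P.obj n c
  | .symmetric, P, _, _, _, hc, x, y, n => P.comp 0 n (by omega) (by omega) hc (x (n + 1)) y
  | .nonsymmetric, P, _, _, _, hc, x, y, n => ∑ i : Fin (n + 1),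
      P.comp i (n - i) (by omega) (by omega) hc (x (n + 1)) y

/-- The family which is `y` in arity `0` and vanishes otherwise. -/
def nullary {F : Flavor} {P : GrOperad F k} {b : ℤ} (y : P.obj 0 b) : ∀ n, P.obj n b
  | 0 => y
  | _ + 1 => 0

theorem eval_sum {F : Flavor} {G : ℕ → ℤ → Type u} (P : DGOperad F k)
    (v : ∀ {n : ℕ} {a : ℤ}, G n a → P.obj n a) {n : ℕ} {a : ℤ} (l : List (Term F k G n a)) :
    (Term.sum l).eval P v = (l.map fun x => x.eval P v).sum := by
  induction l with
  | nil => rfl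
  | cons x l ih =>
    rw [List.map_cons, List.sum_cons, ← ih]
    rfl

theorem eval_curvDiff : ∀ {F : Flavor} (P : DGOperad F k)
    (v : ∀ {n : ℕ} {a : ℤ}, CurvGen n a → P.obj n a) (n : ℕ),
    (curvDiff k F n).eval P v = -curvSum P.toGrOperad (c := -2) (by norm_num)
      (fun n => v (.ell n)) (fun n => v (.ell n)) n
  | .symmetric, P, v, n => by
    rw [curvDiff, Term.eval, neg_one_smul, eval_sum, List.map_map, curvSum, Fin.sum_univ_def]
    refine congrArg (fun l : List (P.obj n (-2)) => -l.sum) (List.map_congr_left fun q _ => ?_)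
    rw [Function.comp_apply, eval_sum, List.map_map, ← Finset.sum_map_toList]
    refine congrArg List.sum (List.map_congr_left fun σ _ => ?_)
    exact congrArg (P.act σ) (comp_eq_compFam P.toGrOperad _ (fun n => v (.ell n))
      (fun n => v (.ell n)) _ _)
  | .nonsymmetric, P, v, n => by
    rw [curvDiff, Term.eval, neg_one_smul, eval_sum, List.map_map, curvSum, Fin.sum_univ_def]
    refine congrArg (fun l : List (P.obj n (-2)) => -l.sum) (List.map_congr_left fun q _ => ?_)
    rw [Function.comp_apply, eval_sum, List.map_map, Fin.sum_univ_def]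
    refine congrArg List.sum (List.map_congr_left fun σ _ => ?_)
    rfl

variable {F : Flavor}

theorem curvSum_add_left : ∀ {F : Flavor} (P : GrOperad F k) {a b c : ℤ} (hc : c = a + b)
    (x x' : ∀ n, P.obj n a) (y : ∀ n, P.obj n b) (n : ℕ),
    curvSum P hc (fun n => x n + x' n) y n = curvSum P hc x y n + curvSum P hc x' y n
  | .symmetric, P, _, _, _, hc, x, x', y, n => by
    simp [curvSum, compFam, Finset.sum_add_distrib]
  | .nonsymmetric, P, _, _, _, hc, x, x', y, n => by
    simp [curvSum, compFam, Finset.sum_add_distrib]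

theorem curvSum_add_right : ∀ {F : Flavor} (P : GrOperad F k) {a b c : ℤ} (hc : c = a + b)
    (x : ∀ n, P.obj n a) (y y' : ∀ n, P.obj n b) (n : ℕ),
    curvSum P hc x (fun n => y n + y' n) n = curvSum P hc x y n + curvSum P hc x y' n
  | .symmetric, P, _, _, _, hc, x, x', y, n => by
    simp [curvSum, compFam, Finset.sum_add_distrib]
  | .nonsymmetric, P, _, _, _, hc, x, x', y, n => by
    simp [curvSum, compFam, Finset.sum_add_distrib]

/-- The outer operation of a composite has at least one input, so a family concentrated in arity 0
cannot occur there. -/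
theorem curvSum_nullary_left : ∀ {F : Flavor} (P : GrOperad F k) {a b c : ℤ} (hc : c = a + b)
    (x : P.obj 0 a) (y : ∀ n, P.obj n b) (n : ℕ), curvSum P hc (nullary x) y n = 0
  | .symmetric, P, _, _, _, hc, x, y, n => by
    refine Finset.sum_eq_zero fun q _ => Finset.sum_eq_zero fun σ _ => ?_
    have : ∀ j, nullary x (0 + 1 + j) = 0 := fun j => by
      rw [show 0 + 1 + j = j + 1 by omega]; rfl
    rw [compFam, this, map_zero, LinearMap.zero_apply, map_zero]
  | .nonsymmetric, P, _, _, _, hc, x, y, n => by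
    refine Finset.sum_eq_zero fun p _ => Finset.sum_eq_zero fun q _ => ?_
    have : ∀ i j, nullary x (i + 1 + j) = 0 := fun i j => by
      rw [show i + 1 + j = (i + j) + 1 by omega]; rfl
    rw [compFam, this, map_zero, LinearMap.zero_apply]

/-- Only the summands with inner operation of arity 0 survive; in the symmetric case there is just
one, since the only shuffle with empty first block is the identity. -/
theorem curvSum_nullary_right : ∀ {F : Flavor} (P : GrOperad F k) {a b c : ℤ} (hc : c = a + b)
    (x : ∀ n, P.obj n a) (y : P.obj 0 b) (n : ℕ),
    curvSum P hc x (nullary y) n = insertAll P hc x y n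
  | .symmetric, P, _, _, _, hc, x, y, n => by
    rw [curvSum, Fin.sum_univ_succ, Finset.sum_eq_zero (s := Finset.univ), add_zero]
    · simp only [Fin.val_zero]
      rw [shuffles_zero, Finset.sum_singleton, P.act_one, insertAll, compFam]
      exact (comp_eq_compFam P hc x (nullary y) (m := n + 1) (q := 0) (by omega) _).symm
    · intro q _
      refine Finset.sum_eq_zero fun σ _ => ?_
      have : nullary y q.succ = 0 := rfl
      rw [compFam, this, map_zero, map_zero]
  | .nonsymmetric, P, _, _, _, hc, x, y, n => by
    rw [curvSum, insertAll]
    refine Finset.sum_congr rfl fun p _ => ?_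
    rw [Fin.sum_univ_succ, Finset.sum_eq_zero (s := Finset.univ), add_zero]
    · exact (compFam_congr P hc x (nullary y) _ _ rfl rfl).trans
        (comp_eq_compFam P hc x (nullary y) (m := n + 1) (i := p) (q := 0) (j := n - p)
          (by omega) (by omega)).symm
    · intro q _
      have : nullary y q.succ = 0 := rfl
      rw [compFam, this, map_zero]

theorem insertAll_neg : ∀ {F : Flavor} (P : GrOperad F k) {a b c : ℤ} (hc : c = a + b)
    (x : ∀ n, P.obj n a) (y : P.obj 0 b) (n : ℕ),
    insertAll P hc (fun n => -x n) y n = -insertAll P hc x y n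
  | .symmetric, P, _, _, _, hc, x, y, n => by simp [insertAll]
  | .nonsymmetric, P, _, _, _, hc, x, y, n => by simp [insertAll]

theorem d_insertAll : ∀ {F : Flavor} (P : DGOperad F k) {a b c a' b' c' : ℤ} (hc : c = a + b)
    (hc' : c' + 1 = c) (ha' : a' + 1 = a) (hb' : b' + 1 = b)
    (h₁ : c' = a' + b) (h₂ : c' = a + b') (x : ∀ n, P.obj n a) (y : P.obj 0 b) (n : ℕ),
    P.d hc' (insertAll P.toGrOperad hc x y n) =
      insertAll P.toGrOperad h₁ (fun n => P.d ha' (x n)) y n +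
        ksign k a • insertAll P.toGrOperad h₂ x (P.d hb' y) n
  | .symmetric, P, _, _, _, _, _, _, hc, hc', ha', hb', h₁, h₂, x, y, n => by
    rw [insertAll, P.d_comp _ _ _ _ hc hc' ha' hb' h₁ h₂]; rfl
  | .nonsymmetric, P, _, _, _, _, _, _, hc, hc', ha', hb', h₁, h₂, x, y, n => by
    simp only [insertAll, map_sum, Finset.smul_sum]
    rw [← Finset.sum_add_distrib]
    exact Finset.sum_congr rfl fun i _ => P.d_comp _ _ _ _ hc hc' ha' hb' h₁ h₂ _ _

theorem act_insertAll : ∀ {F : Flavor} (P : GrOperad F k) {a b c : ℤ} (hc : c = a + b)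
    (x : ∀ n, P.obj n a) (_ : ∀ n (σ : F.perms n), P.act σ (x n) = x n) (y : P.obj 0 b) (n : ℕ)
    (σ : F.perms n), P.act σ (insertAll P hc x y n) = insertAll P hc x y n
  | .symmetric, P, _, _, _, hc, x, hx, y, n, σ => by
    rw [insertAll, P.comp_act 0 n 0 n (by omega) (by omega) hc (by omega) (by omega)
      (extSym 0 0 σ) 1 σ (isInduced_extPerm 0 0 _ _), hx, P.act_one]
  | .nonsymmetric, P, _, _, _, hc, x, hx, y, n, σ => by
    rw [Flavor.perms_eq_one σ, P.act_one]

theorem act_nullary (P : GrOperad F k) {b : ℤ} (y : P.obj 0 b) :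
    ∀ (n : ℕ) (σ : F.perms n), P.act σ (nullary y n) = nullary y n
  | 0, σ => by
    rw [show σ = 1 from Subtype.ext (Subsingleton.elim _ _), P.act_one]
  | n + 1, σ => map_zero _

/-! ### Sums over decompositions n = p + q + r, and plugging in nullary operations -/

section Nonsymmetric

open Finset

/-- The sum over all `p + q + r = n`. -/
def tripleSum {M : Type*} [AddCommMonoid M] (n : ℕ) (f : ℕ → ℕ → ℕ → M) : M :=
  ∑ x ∈ HasAntidiagonal.antidiagonal n, ∑ y ∈ HasAntidiagonal.antidiagonal x.2, f x.1 y.1 y.2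

theorem tripleSum_congr {M : Type*} [AddCommMonoid M] {n : ℕ} {f g : ℕ → ℕ → ℕ → M}
    (h : ∀ p q r, p + q + r = n → f p q r = g p q r) : tripleSum n f = tripleSum n g := by
  refine sum_congr rfl fun x hx => sum_congr rfl fun y hy => h _ _ _ ?_
  rw [HasAntidiagonal.mem_antidiagonal] at hx hy
  omega

theorem tripleSum_add {M : Type*} [AddCommMonoid M] {n : ℕ} (f g : ℕ → ℕ → ℕ → M) :
    tripleSum n (fun p q r => f p q r + g p q r) = tripleSum n f + tripleSum n g := by
  simp [tripleSum, sum_add_distrib]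

/-- This and its two companions are applied to terms which are sums over the inputs in one of the
three blocks. Such a sum is empty when the block has length 0, so the length can be shifted by one.
-/
theorem tripleSum_succ_first {M : Type*} [AddCommMonoid M] {n : ℕ} {f : ℕ → ℕ → ℕ → M}
    (h : ∀ q r, f 0 q r = 0) : tripleSum (n + 1) f = tripleSum n (fun p q r => f (p + 1) q r) := by
  rw [tripleSum, Nat.sum_antidiagonal_succ]
  simp [h, tripleSum]

theorem tripleSum_succ_second {M : Type*} [AddCommMonoid M] {n : ℕ} {f : ℕ → ℕ → ℕ → M}
    (h : ∀ p r, f p 0 r = 0) : tripleSum (n + 1) f = tripleSum n (fun p q r => f p (q + 1) r) := by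
  rw [tripleSum, Nat.sum_antidiagonal_succ']
  simp [h, tripleSum, Nat.sum_antidiagonal_succ]

theorem tripleSum_succ_third {M : Type*} [AddCommMonoid M] {n : ℕ} {f : ℕ → ℕ → ℕ → M}
    (h : ∀ p q, f p q 0 = 0) : tripleSum (n + 1) f = tripleSum n (fun p q r => f p q (r + 1)) := by
  rw [tripleSum, Nat.sum_antidiagonal_succ']
  simp [h, tripleSum, Nat.sum_antidiagonal_succ']

theorem sum_fin_eq_tripleSum {M : Type*} [AddCommMonoid M] (n : ℕ) (f : ℕ → ℕ → ℕ → M) :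
    ∑ p : Fin (n + 1), ∑ q : Fin (n - p + 1), f p q (n - p - q) = tripleSum n f := by
  rw [tripleSum, Nat.sum_antidiagonal_eq_sum_range_succ_mk, sum_range]
  refine sum_congr rfl fun p _ => ?_
  rw [Nat.sum_antidiagonal_eq_sum_range_succ_mk, sum_range]

/-- `compFam` as a function of all triples. -/
def compTriple (P : GrOperad F k) {a b c : ℤ} (hc : c = a + b) (x : ∀ n, P.obj n a)
    (y : ∀ n, P.obj n b) (n i q j : ℕ) : P.obj n c :=
  if hp : n = i + q + j then compFam P hc x y i q j hp else 0

theorem curvSum_nonsymmetric (P : GrOperad .nonsymmetric k) {a b c : ℤ} (hc : c = a + b)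
    (x : ∀ n, P.obj n a) (y : ∀ n, P.obj n b) (n : ℕ) :
    curvSum P hc x y n = tripleSum n (compTriple P hc x y n) := by
  rw [← sum_fin_eq_tripleSum, curvSum]
  refine sum_congr rfl fun p _ => sum_congr rfl fun q _ => ?_
  rw [compTriple, dif_pos]

/-- Composition with a fixed operation of arity `0` in the input `i`, or `0` if there is none. -/
def plug (P : GrOperad F k) {a b c : ℤ} (hc : c = a + b) (n i : ℕ) (y : P.obj 0 b) :
    P.obj (n + 1) a →ₗ[k] P.obj n c :=
  if h : i ≤ n then (P.comp i (n - i) (by omega) (by omega) hc).flip y else 0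

/-- A normal form for plugging in a nullary operation: the number of inputs to the right is
determined by the others, so positions can be rewritten without transporting arithmetic proofs. -/
theorem comp_eq_plug (P : GrOperad F k) {a b c : ℤ} (hc : c = a + b) {n i j : ℕ}
    (hm : n + 1 = i + 1 + j) (hp : n = i + 0 + j) (y : P.obj 0 b) (x : P.obj (n + 1) a) :
    P.comp i j hm hp hc x y = plug P hc n i y x := by
  obtain rfl : j = n - i := by omega
  rw [plug, dif_pos (by omega)]
  rfl

theorem insertAll_nonsymmetric (P : GrOperad .nonsymmetric k) {a b c : ℤ} (hc : c = a + b)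
    (x : ∀ n, P.obj n a) (y : P.obj 0 b) (n : ℕ) :
    insertAll P hc x y n = ∑ i ∈ range (n + 1), plug P hc n i y (x (n + 1)) := by
  rw [sum_range, insertAll]
  exact sum_congr rfl fun i _ => comp_eq_plug P hc _ _ _ _

/-- The inputs of x_{p+1+r} ∘_{p+1} y_q are p inputs of x, then q of y, then r of x. The inputs of x
are grouped together on the right-hand side. -/
theorem sum_range_three {M : Type*} [AddCommMonoid M] (p q r : ℕ) (f : ℕ → M) :
    ∑ i ∈ range (p + q + r), f i = ∑ i ∈ range p, f i + ∑ i ∈ range r, f (p + q + i) +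
      ∑ i ∈ range q, f (p + i) := by
  rw [sum_range_add, sum_range_add]
  abel

end Nonsymmetric

/-- This and the next two statements treat the three places of α in a composite of x and y: in x to
the left of y, in x to the right of y, and in y. The first two are the parallel axiom, the third is
the sequential one; α has degree 0, so there are no signs. -/
theorem comp_plug_below (P : GrOperad F k) {a b c : ℤ} (hc : c = a + b)
    (x : ∀ n, P.obj n a) (y : ∀ n, P.obj n b) (α : P.obj 0 0) {n p q r s : ℕ}
    (hn : n = p + q + r) (hs : s ≤ p) :
    P.comp p r rfl hn hc (plug P (add_zero a).symm (p + 1 + r) s α (x (p + 1 + r + 1))) (y q) =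
      plug P (add_zero c).symm n s α (compTriple P hc x y (n + 1) (p + 1) q r) := by
  obtain ⟨j, rfl⟩ := Nat.exists_eq_add_of_le hs
  have e := P.comp_par (b := 0) (ab := a) (abc := c) s j r (m := s + j + 1 + r + 1) (n := 0) (l := q)
    (p := s + j + 1 + r) (q := n) (r := n + 1) (by omega) (by omega) (by omega) (by omega) (by omega)
    (by omega) (by omega) (by omega) (add_zero a).symm hc hc (add_zero c).symm
    (x (s + j + 1 + r + 1)) α (y q)
  rw [comp_eq_plug, comp_eq_plug, zero_mul, ksign_of_even Even.zero, one_smul] at e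
  refine e.trans ?_
  rw [compTriple, dif_pos (by omega), ← comp_eq_compFam (m := s + j + 1 + r + 1) (hm := by omega)]
  congr 1
  simp only [show s + 1 + j = s + j + 1 by omega]

theorem comp_plug_above (P : GrOperad F k) {a b c : ℤ} (hc : c = a + b)
    (x : ∀ n, P.obj n a) (y : ∀ n, P.obj n b) (α : P.obj 0 0) {n p q r s : ℕ}
    (hn : n = p + q + r) (hs : s ≤ r) :
    P.comp p r rfl hn hc (plug P (add_zero a).symm (p + 1 + r) (p + 1 + s) α (x (p + 1 + r + 1)))
      (y q) = plug P (add_zero c).symm n (p + q + s) α (compTriple P hc x y (n + 1) p q (r + 1)) := by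
  obtain ⟨j, rfl⟩ := Nat.exists_eq_add_of_le hs
  have e := P.comp_par (c := 0) (ac := a) (abc := c) p s j (m := p + 1 + (s + j) + 1) (n := q) (l := 0)
    (p := n + 1) (q := n) (r := p + 1 + (s + j)) (by omega) (by omega) (by omega) (by omega)
    (by omega) (by omega) (by omega) (by omega) hc (add_zero c).symm (add_zero a).symm hc
    (x (p + 1 + (s + j) + 1)) (y q) α
  rw [comp_eq_plug, comp_eq_plug, mul_zero, ksign_of_even Even.zero, one_smul] at e
  refine Eq.trans ?_ (e.symm.trans ?_)
  · simp only [add_zero]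
  rw [compTriple, dif_pos (by omega),
    ← comp_eq_compFam (m := p + 1 + (s + j) + 1) (hm := by omega)]
  congr 1
  simp only [show s + 1 + j = s + j + 1 by omega]

theorem comp_plug_inner (P : GrOperad F k) {a b c : ℤ} (hc : c = a + b)
    (x : ∀ n, P.obj n a) (y : ∀ n, P.obj n b) (α : P.obj 0 0) {n p q r s : ℕ}
    (hn : n = p + q + r) (hs : s ≤ q) :
    P.comp p r rfl hn hc (x (p + 1 + r)) (plug P (add_zero b).symm q s α (y (q + 1))) =
      plug P (add_zero c).symm n (p + s) α (compTriple P hc x y (n + 1) p (q + 1) r) := by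
  obtain ⟨j, rfl⟩ := Nat.exists_eq_add_of_le hs
  have e := P.comp_seq (c := 0) (bc := b) (abc := c) p r s j (m := p + 1 + r) (n := s + j + 1) (l := 0)
    (p := n + 1) (q := n) (r := s + j) (by omega) (by omega) (by omega) (by omega)
    (by omega) (by omega) (by omega) hc (add_zero c).symm (add_zero b).symm hc
    (x (p + 1 + r)) (y (s + j + 1)) α
  rw [comp_eq_plug, comp_eq_plug] at e
  rw [compTriple, dif_pos (by omega)]
  exact e.symm

theorem compTriple_eq (P : GrOperad F k) {a b c : ℤ} (hc : c = a + b) (x : ∀ n, P.obj n a)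
    (y : ∀ n, P.obj n b) {n i q j : ℕ} (hn : n = i + q + j) :
    compTriple P hc x y n i q j = P.comp i j rfl hn hc (x (i + 1 + j)) (y q) :=
  dif_pos hn

theorem curvSum_symmetric (P : GrOperad .symmetric k) {a b c : ℤ} (hc : c = a + b)
    (x : ∀ n, P.obj n a) (y : ∀ n, P.obj n b) (n : ℕ) :
    curvSum P hc x y n = ∑ q ∈ Finset.range (n + 1), ∑ σ ∈ shuffles n q,
      P.act σ (compTriple P hc x y n 0 q (n - q)) := by
  rw [curvSum, Finset.sum_range]
  refine Finset.sum_congr rfl fun q _ => Finset.sum_congr rfl fun σ _ => ?_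
  rw [compTriple, dif_pos]

theorem plug_act_extSym (P : GrOperad .symmetric k) {a b c : ℤ} (hc : c = a + b) {n : ℕ}
    (s : Fin (n + 1)) (σ : Flavor.symmetric.perms n) (y : P.obj 0 b) (w : P.obj (n + 1) a) :
    plug P hc n 0 y (P.act (extSym s 0 σ) w) = P.act σ (plug P hc n s y w) := by
  rw [← comp_eq_plug P hc (i := 0) (j := n) (by omega) (by omega),
    ← comp_eq_plug P hc (i := s) (j := n - s) (by omega) (by omega),
    P.comp_act s (n - s) 0 n (by omega) (by omega) hc (by omega) (by omega) (extSym s 0 σ) 1 σ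
      (isInduced_extPerm s 0 _ _), P.act_one]

theorem plug_eq_of_invariant (P : GrOperad .symmetric k) {a b c : ℤ} (hc : c = a + b) {n : ℕ}
    (s : ℕ) (hs : s ≤ n) (y : P.obj 0 b) (w : P.obj (n + 1) a) (hw : ∀ σ, P.act σ w = w) :
    plug P hc n s y w = plug P hc n 0 y w := by
  have := plug_act_extSym P hc ⟨s, by omega⟩ 1 y w
  rw [hw, P.act_one] at this
  exact this.symm

/-- Inserting α is a derivation of the shuffled composition: an α in the first input of a composite
belongs to the inner or to the outer operation, and the recursion for shuffles separates the two
cases. -/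
theorem curvSum_insertAll_symmetric (P : GrOperad .symmetric k) {a b c : ℤ} (hc : c = a + b)
    (x : ∀ n, P.obj n a) (y : ∀ n, P.obj n b) (hx : ∀ n σ, P.act σ (x n) = x n)
    (α : P.obj 0 0) (n : ℕ) :
    curvSum P hc (insertAll P (add_zero a).symm x α) y n +
      curvSum P hc x (insertAll P (add_zero b).symm y α) n =
      insertAll P (add_zero c).symm (curvSum P hc x y) α n := by
  have hins : ∀ {a : ℤ} (z : ∀ n, P.obj n a) n, insertAll P (add_zero a).symm z α n =
      plug P (add_zero a).symm n 0 α (z (n + 1)) := fun z n => comp_eq_plug _ _ _ _ _ _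
  have h1 : ∀ q ≤ n, compTriple P hc x (insertAll P (add_zero b).symm y α) n 0 q (n - q) =
      plug P (add_zero c).symm n 0 α (compTriple P hc x y (n + 1) 0 (q + 1) (n - q)) := by
    intro q hq
    rw [compTriple_eq P hc _ _ (by omega), hins, comp_plug_inner P hc x y α _ (Nat.zero_le _)]
  have h2 : ∀ q ≤ n, compTriple P hc (insertAll P (add_zero a).symm x α) y n 0 q (n - q) =
      plug P (add_zero c).symm n q α (compTriple P hc x y (n + 1) 0 q (n - q + 1)) := by
    intro q hq
    -- Input 0 of the outer operation is where y is plugged in, so α has to be moved to input 1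
    -- first; this uses the invariance of x.
    rw [compTriple_eq P hc _ _ (by omega), hins, ← plug_eq_of_invariant P _ (0 + 1 + 0) (by omega)
      _ _ (hx _), comp_plug_above P hc x y α _ (Nat.zero_le _)]
    simp
  rw [hins, curvSum_symmetric, curvSum_symmetric, curvSum_symmetric, map_sum]
  simp only [map_sum]
  -- In the extreme cases only one place is possible: α enters the inner operation if that takes all
  -- n + 1 inputs, and the outer one if the inner operation takes none. In between both occur.
  have hlast : ∑ ρ ∈ shuffles (n + 1) (n + 1), plug P (add_zero c).symm n 0 α
      (P.act ρ (compTriple P hc x y (n + 1) 0 (n + 1) (n + 1 - (n + 1)))) =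
      ∑ σ ∈ shuffles n n, P.act σ
        (compTriple P hc x (insertAll P (add_zero b).symm y α) n 0 n (n - n)) := by
    rw [sum_shuffles_last]
    refine Finset.sum_congr rfl fun σ _ => ?_
    rw [plug_act_extSym, h1 n le_rfl, Fin.val_zero, Nat.sub_self, Nat.sub_self]
  have hfirst : ∑ σ ∈ shuffles n 0, plug P (add_zero c).symm n 0 α
      (P.act (extSym 0 0 σ) (compTriple P hc x y (n + 1) 0 0 (n + 1 - 0))) =
      ∑ σ ∈ shuffles n 0, P.act σ
        (compTriple P hc (insertAll P (add_zero a).symm x α) y n 0 0 (n - 0)) := by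
    refine Finset.sum_congr rfl fun σ _ => ?_
    rw [plug_act_extSym, h2 0 (Nat.zero_le _), Fin.val_zero, Nat.sub_zero, Nat.sub_zero]
  have hmid : ∀ q ∈ Finset.range n, ∑ ρ ∈ shuffles (n + 1) (q + 1), plug P (add_zero c).symm n 0 α
      (P.act ρ (compTriple P hc x y (n + 1) 0 (q + 1) (n + 1 - (q + 1)))) =
      ∑ σ ∈ shuffles n q, P.act σ
        (compTriple P hc x (insertAll P (add_zero b).symm y α) n 0 q (n - q)) +
      ∑ σ ∈ shuffles n (q + 1), P.act σ
        (compTriple P hc (insertAll P (add_zero a).symm x α) y n 0 (q + 1) (n - (q + 1))) := by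
    intro q hq
    have hq := Finset.mem_range.1 hq
    rw [sum_shuffles_succ n q (by omega)]
    refine congrArg₂ (· + ·) (Finset.sum_congr rfl fun σ _ => ?_)
      (Finset.sum_congr rfl fun σ _ => ?_)
    · rw [plug_act_extSym, h1 q (by omega), Fin.val_zero, Nat.add_sub_add_right]
    · rw [plug_act_extSym, h2 (q + 1) (by omega)]
      simp only [show n - (q + 1) + 1 = n + 1 - (q + 1) by omega]
  rw [Finset.sum_range_succ _ (n + 1), Finset.sum_range_succ' _ n, Finset.sum_range_succ _ n,
    Finset.sum_range_succ' _ n, Finset.sum_congr rfl hmid, sum_shuffles_first, hfirst, hlast,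
    Finset.sum_add_distrib]
  abel

/-- Here α runs over all inputs of all composites on the right-hand side. The inputs left and right
of the inner operation give the first sum on the left, those of the inner operation the second. -/
theorem curvSum_insertAll_nonsymmetric (P : GrOperad .nonsymmetric k) {a b c : ℤ} (hc : c = a + b)
    (x : ∀ n, P.obj n a) (y : ∀ n, P.obj n b) (α : P.obj 0 0) (n : ℕ) :
    curvSum P hc (insertAll P (add_zero a).symm x α) y n +
      curvSum P hc x (insertAll P (add_zero b).symm y α) n =
      insertAll P (add_zero c).symm (curvSum P hc x y) α n := by
  have hR : insertAll P (add_zero c).symm (curvSum P hc x y) α n = tripleSum (n + 1)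
      (fun p q r => ∑ i ∈ Finset.range (p + q + r),
        plug P (add_zero c).symm n i α (compTriple P hc x y (n + 1) p q r)) := by
    rw [insertAll_nonsymmetric, curvSum_nonsymmetric]
    simp only [tripleSum, map_sum]
    rw [Finset.sum_comm]
    refine Finset.sum_congr rfl fun u hu => ?_
    rw [Finset.sum_comm]
    refine Finset.sum_congr rfl fun v hv => ?_
    rw [Finset.HasAntidiagonal.mem_antidiagonal] at hu hv
    rw [show u.1 + v.1 + v.2 = n + 1 by omega]
  rw [hR, curvSum_nonsymmetric, curvSum_nonsymmetric]
  simp only [sum_range_three]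
  rw [tripleSum_add, tripleSum_add, tripleSum_succ_first (by simp),
    tripleSum_succ_third (by simp), tripleSum_succ_second (by simp)]
  refine congrArg₂ (fun u v : P.obj n c => u + v) (Eq.trans ?_ (tripleSum_add _ _)) ?_
  · refine tripleSum_congr fun p q r hn => ?_
    -- The operation y is plugged into input p after α. An α in one of the inputs 0, …, p of the
    -- original operation lies to the left of y, one in a later input to the right.
    have hsplit : ∀ f : ℕ → P.obj (p + 1 + r) a, ∑ i ∈ Finset.range (p + 1 + r + 1), f i =
        ∑ i ∈ Finset.range (p + 1), f i + ∑ i ∈ Finset.range (r + 1), f (p + 1 + i) :=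
      fun f => Finset.sum_range_add f (p + 1) (r + 1)
    rw [compTriple_eq P hc _ _ hn.symm, insertAll_nonsymmetric, hsplit, map_add,
      LinearMap.add_apply, map_sum, map_sum, LinearMap.sum_apply, LinearMap.sum_apply]
    congr 1
    · exact Finset.sum_congr rfl fun s hs => comp_plug_below P hc x y α hn.symm
        (by have := Finset.mem_range.1 hs; omega)
    · exact Finset.sum_congr rfl fun s hs => comp_plug_above P hc x y α hn.symm
        (by have := Finset.mem_range.1 hs; omega)
  · refine tripleSum_congr fun p q r hn => ?_
    rw [compTriple_eq P hc _ _ hn.symm, insertAll_nonsymmetric, map_sum]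
    exact Finset.sum_congr rfl fun s hs => comp_plug_inner P hc x y α hn.symm
        (by have := Finset.mem_range.1 hs; omega)

theorem curvSum_insertAll : ∀ {F : Flavor} (P : GrOperad F k) {a b c : ℤ} (hc : c = a + b)
    (x : ∀ n, P.obj n a) (y : ∀ n, P.obj n b) (_ : ∀ n (σ : F.perms n), P.act σ (x n) = x n)
    (α : P.obj 0 0) (n : ℕ),
    curvSum P hc (insertAll P (add_zero a).symm x α) y n +
      curvSum P hc x (insertAll P (add_zero b).symm y α) n =
      insertAll P (add_zero c).symm (curvSum P hc x y) α n
  | .symmetric, P, _, _, _, hc, x, y, hx, α, n => curvSum_insertAll_symmetric P hc x y hx α n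
  | .nonsymmetric, P, _, _, _, hc, x, y, _, α, n => curvSum_insertAll_nonsymmetric P hc x y α n

end CurvSum

end

end CurvedTwisting

namespace CurvedTwisting

noncomputable section

/-! ## Operads under `cL_∞`, respectively `cA_∞` -/

section Under

variable {F : Flavor} {k : Type u} [Field k]

/-- The class of an expression in `cL_∞`, respectively `cA_∞`. -/
def cInfMk {n : ℕ} {a : ℤ} (x : Term F k CurvGen n a) : (cInf F k).obj n a := Pres.mk x

theorem cInf_mem (S : SubOperad (cInf F k).toGrOperad)
    (hd : ∀ {n : ℕ} {a b : ℤ} (h : b + 1 = a) {x : (cInf F k).obj n a}, x ∈ S.carrier n a →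
      (cInf F k).d h x ∈ S.carrier n b)
    (hell : ∀ n, ell F k n ∈ S.carrier n (-1)) {n : ℕ} {a : ℤ} (x : (cInf F k).obj n a) :
    x ∈ S.carrier n a := by
  suffices H : ∀ {n : ℕ} {a : ℤ} (x : Term F k CurvGen n a), cInfMk x ∈ S.carrier n a by
    obtain ⟨x⟩ := x
    exact H x
  clear x n a
  intro n a x
  induction x with
  | gen y => cases y with | ell => exact hell _
  | @zero n a => exact (S.carrier n a).zero_mem
  | add x y ihx ihy => exact Submodule.add_mem _ ihx ihy
  | smul c x ih => exact Submodule.smul_mem _ c ih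
  | act σ x ih => exact S.act_mem σ ih
  | comp i j hm hp hc x y ihx ihy => exact S.comp_mem i j hm hp hc ihx ihy
  | d h x ih => exact hd h ih

theorem cInf_hom_ext {P : DGOperad F k} {f g : cInf F k ⟶ P}
    (h : ∀ n, app f (ell F k n) = app g (ell F k n)) : f = g :=
  hom_ext' fun x => cInf_mem (equalizer f.toGrHom g.toGrHom) (fun {_ _ _} hb {x} hx => by
    have hx' : f.map x = g.map x := hx
    change f.map _ = g.map _
    rw [f.map_d, g.map_d, hx']) h x

theorem ell_act (n : ℕ) (σ : F.perms n) : (cInf F k).act σ (ell F k n) = ell F k n :=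
  Pres.sound (.rel (.act n σ))

/-- The generators as a map to an operad with a family of elements of degree `-1`. -/
def ellValues {P : GrOperad F k} (l : ∀ n, P.obj n (-1)) :
    ∀ {n : ℕ} {a : ℤ}, CurvGen n a → P.obj n a
  | _, _, .ell n => l n

/-- The morphism out of `cL_∞`, resp. `cA_∞`, given by the images of the generators. -/
def cInfLift {P : DGOperad F k} (l : ∀ n, P.obj n (-1))
    (hact : ∀ n (σ : F.perms n), P.act σ (l n) = l n)
    (hd : ∀ n, P.d (by norm_num) (l n) =
      -curvSum P.toGrOperad (c := -2) (by norm_num) l l n) : cInf F k ⟶ P :=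
  presented.lift (CurvRel F k) (ellValues l) (by
    intro _ _ _ _ h
    cases h with
    | act σ => exact hact _ σ
    | diff => exact (hd _).trans (eval_curvDiff P (ellValues l) _).symm)

/-- Morphisms commute with `curvSum`. -/
theorem map_curvSum : ∀ {F : Flavor} {P R : GrOperad F k} (f : GrHom P R) {a b c : ℤ}
    (hc : c = a + b) (x : ∀ n, P.obj n a) (y : ∀ n, P.obj n b) (n : ℕ),
    f.map (curvSum P hc x y n) =
      curvSum R hc (fun n => f.map (x n)) (fun n => f.map (y n)) n
  | .symmetric, P, R, f, _, _, _, hc, x, y, n => by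
    simp only [curvSum, map_sum, f.map_act, compFam, f.map_comp]
  | .nonsymmetric, P, R, f, _, _, _, hc, x, y, n => by
    simp only [curvSum, map_sum, compFam, f.map_comp]

theorem map_nullary {P R : GrOperad F k} (f : GrHom P R) {b : ℤ} (y : P.obj 0 b) :
    ∀ n, f.map (nullary y n) = nullary (f.map y) n
  | 0 => rfl
  | _ + 1 => map_zero _

theorem ell_d (n : ℕ) : (cInf F k).d (by norm_num) (ell F k n) =
    -curvSum (cInf F k).toGrOperad (c := -2) (by norm_num) (ell F k) (ell F k) n := by
  refine Eq.trans ?_ (eval_curvDiff (cInf F k) (ellValues (ell F k)) n)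
  have h : ∀ {n : ℕ} {a : ℤ} (x : Term F k CurvGen n a),
      cInfMk x = x.eval (cInf F k) (ellValues (ell F k)) := by
    intro n a x
    induction x with
    | gen y => cases y with | ell => rfl
    | zero => rfl
    | add x y ihx ihy => exact congrArg₂ (· + ·) ihx ihy
    | smul c x ih => exact congrArg (c • ·) ih
    | act σ x ih => exact congrArg ((cInf F k).act σ) ih
    | comp i j hm hp hc x y ihx ihy =>
      exact congrArg₂ (fun u v => (cInf F k).comp i j hm hp hc u v) ihx ihy
    | d h x ih => exact congrArg ((cInf F k).d h) ih
  rw [← h]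
  exact Pres.sound (.rel (.diff n))

theorem ellOf_d (Q : Under (cInf F k)) (n : ℕ) : Q.right.d (by norm_num) (ellOf Q n) =
    -curvSum Q.right.toGrOperad (c := -2) (by norm_num) (ellOf Q) (ellOf Q) n := by
  rw [ellOf, ← Q.hom.map_d, ell_d, map_neg, map_curvSum]
  rfl

theorem app_ellOf {Q Q' : Under (cInf F k)} (f : Q ⟶ Q') (n : ℕ) :
    app f.right (ellOf Q n) = ellOf Q' n := by
  rw [ellOf, ellOf, ← Under.w f]
  rfl

/-- A morphism of dg operads which preserves the `ℓ_n` is a morphism under `cL_∞`. -/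
def underHom {Q Q' : Under (cInf F k)} (f : Q.right ⟶ Q'.right)
    (h : ∀ n, app f (ellOf Q n) = ellOf Q' n) : Q ⟶ Q' :=
  Under.homMk f (cInf_hom_ext h)

theorem snd_curvSum : ∀ {F : Flavor} {A : DGOperad F k} {a b c : ℤ} (hc : c = a + b)
    (x : ∀ n, (dualNumbers A).obj n a) (y : ∀ n, (dualNumbers A).obj n b) (n : ℕ),
    (curvSum (dualNumbers A).toGrOperad hc x y n).2 =
      (curvSum A.toGrOperad hc (fun n => (x n).2) (fun n => (y n).1) n +
        curvSum A.toGrOperad hc (fun n => (x n).1) (fun n => (y n).2) n : A.obj n c)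
  | .symmetric, A, a, b, c, hc, x, y, n => by
    simp only [curvSum]
    rw [← Finset.sum_add_distrib]
    refine (map_sum (LinearMap.snd k (A.obj n c) (A.obj n c)) _ _).trans ?_
    refine Finset.sum_congr rfl fun q _ => ?_
    rw [← Finset.sum_add_distrib]
    refine (map_sum (LinearMap.snd k (A.obj n c) (A.obj n c)) _ _).trans ?_
    refine Finset.sum_congr rfl fun σ _ => ?_
    rw [← map_add]
    exact congrArg (A.act σ) (dualNumbers_comp_snd _ _ _ _ hc _ _)
  | .nonsymmetric, A, a, b, c, hc, x, y, n => by
    simp only [curvSum]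
    rw [← Finset.sum_add_distrib]
    refine (map_sum (LinearMap.snd k (A.obj n c) (A.obj n c)) _ _).trans ?_
    refine Finset.sum_congr rfl fun q _ => ?_
    rw [← Finset.sum_add_distrib]
    refine (map_sum (LinearMap.snd k (A.obj n c) (A.obj n c)) _ _).trans ?_
    exact Finset.sum_congr rfl fun σ _ => dualNumbers_comp_snd _ _ _ _ hc _ _

/-- The first-order deformation of the `ℓ_n` in the direction of `α`. -/
def ellVariation {A : DGOperad F k} (l : ∀ n, A.obj n (-1)) (α : A.obj 0 0) (n : ℕ) :
    A.obj n (-1) :=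
  insertAll A.toGrOperad (add_zero _).symm l α n + nullary (A.d (by norm_num) α) n

theorem d_nullary_d {A : DGOperad F k} (α : A.obj 0 0) : ∀ n,
    A.d (show (-2 : ℤ) + 1 = -1 by norm_num)
      (nullary (P := A.toGrOperad) (A.d (show (-1 : ℤ) + 1 = 0 by norm_num) α) n) = 0
  | 0 => A.d_d _ _ _
  | _ + 1 => map_zero _

/-- The first-order deformation is compatible with the relations of `cL_∞`, resp. `cA_∞`. -/
theorem d_ellVariation {A : DGOperad F k} (l : ∀ n, A.obj n (-1))
    (hact : ∀ n (σ : F.perms n), A.act σ (l n) = l n)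
    (hd : ∀ n, A.d (by norm_num) (l n) =
      -curvSum A.toGrOperad (c := -2) (by norm_num) l l n) (α : A.obj 0 0) (n : ℕ) :
    A.d (by norm_num) (ellVariation l α n) =
      -(curvSum A.toGrOperad (c := -2) (by norm_num) (ellVariation l α) l n +
        curvSum A.toGrOperad (c := -2) (by norm_num) l (ellVariation l α) n) := by
  -- The correction dα of the variation lives in arity 0, so it contributes nothing as outer
  -- operation and an insertion of dα into ℓ as inner operation.
  have e1 : curvSum A.toGrOperad (c := -2) (by norm_num) (ellVariation l α) l n =
      curvSum A.toGrOperad (c := -2) (by norm_num)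
        (insertAll A.toGrOperad (add_zero _).symm l α) l n := by
    refine (curvSum_add_left A.toGrOperad _ _ _ _ n).trans ?_
    rw [curvSum_nullary_left, add_zero]
  have e2 : curvSum A.toGrOperad (c := -2) (by norm_num) l (ellVariation l α) n =
      curvSum A.toGrOperad (c := -2) (by norm_num) l
        (insertAll A.toGrOperad (add_zero _).symm l α) n +
      insertAll A.toGrOperad (c := -2) (by norm_num) l (A.d (b := -1) (by norm_num) α) n := by
    refine (curvSum_add_right A.toGrOperad _ _ _ _ n).trans ?_
    rw [curvSum_nullary_right]
  -- The two insertions of α combine to an insertion into dℓ_n. The remaining insertion of dα is the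
  -- other half of d applied to ℓ_{n+1}(α, …), where the degree -1 of ℓ produces the sign.
  rw [e1, e2, ← add_assoc, curvSum_insertAll _ _ _ _ hact, ellVariation, map_add, d_nullary_d,
    add_zero, d_insertAll A (c' := -2) (a' := -2) (b' := -1) _ (by norm_num) (by norm_num)
      (by norm_num) (by norm_num) (by norm_num), ksign_of_odd (by decide), neg_one_smul]
  simp only [hd]
  rw [insertAll_neg, neg_add]

/-- The flow on `cL_∞`, resp. `cA_∞`. -/
def cInfHom : cInf F k ⟶ dualNumbers (adjoin (cInf F k)) :=
  cInfLift (P := dualNumbers (adjoin (cInf F k)))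
    (fun n => (app (incl (cInf F k)) (ell F k n),
      ellVariation (fun n => app (incl (cInf F k)) (ell F k n)) (alpha (cInf F k)) n))
    (fun n σ => by
      have h : ∀ n (σ : F.perms n), (adjoin (cInf F k)).act σ (app (incl (cInf F k)) (ell F k n)) =
          app (incl (cInf F k)) (ell F k n) := fun n σ => by
        rw [← (incl (cInf F k)).map_act, ell_act]
      refine Prod.ext (h n σ) ?_
      refine (map_add ((adjoin (cInf F k)).act σ) _ _).trans ?_
      exact congrArg₂ (· + ·) (act_insertAll _ _ _ h _ _ _) (act_nullary _ _ _ _))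
    (fun n => by
      have h1 : ∀ n (σ : F.perms n), (adjoin (cInf F k)).act σ (app (incl (cInf F k)) (ell F k n)) =
          app (incl (cInf F k)) (ell F k n) := fun n σ => by
        rw [← (incl (cInf F k)).map_act, ell_act]
      have h2 : ∀ n, (adjoin (cInf F k)).d (by norm_num) (app (incl (cInf F k)) (ell F k n)) =
          -curvSum (adjoin (cInf F k)).toGrOperad (c := -2) (by norm_num)
            (fun n => app (incl (cInf F k)) (ell F k n))
            (fun n => app (incl (cInf F k)) (ell F k n)) n := fun n => by
        rw [← (incl (cInf F k)).map_d, ell_d, map_neg, map_curvSum]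
      refine Prod.ext ?_ ?_
      · refine (h2 n).trans (congrArg Neg.neg ?_)
        exact (map_curvSum (Flow.dualFst (adjoin (cInf F k))).toGrHom (by norm_num)
          (fun n => (app (incl (cInf F k)) (ell F k n), ellVariation
            (fun n => app (incl (cInf F k)) (ell F k n)) (alpha (cInf F k)) n))
          (fun n => (app (incl (cInf F k)) (ell F k n), ellVariation
            (fun n => app (incl (cInf F k)) (ell F k n)) (alpha (cInf F k)) n)) n).symm
      · refine (d_ellVariation _ h1 h2 _ n).trans (congrArg Neg.neg ?_)
        exact (snd_curvSum (A := adjoin (cInf F k)) (by norm_num)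
          (fun n => (app (incl (cInf F k)) (ell F k n), ellVariation
            (fun n => app (incl (cInf F k)) (ell F k n)) (alpha (cInf F k)) n))
          (fun n => (app (incl (cInf F k)) (ell F k n), ellVariation
            (fun n => app (incl (cInf F k)) (ell F k n)) (alpha (cInf F k)) n)) n).symm)

/-- The derivation on `cL_∞`, resp. `cA_∞`, given by first-order twisting. -/
def cInfFlow (F : Flavor) (k : Type u) [Field k] : Flow (cInf F k) where
  D :=
    { toFun := fun x => (app cInfHom x).2
      map_add' := fun x y => congrArg Prod.snd (map_add (app cInfHom) x y)
      map_smul' := fun c x => congrArg Prod.snd (map_smul (app cInfHom) c x) }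
  D_act σ x := congrArg Prod.snd (cInfHom.map_act σ x)
  D_comp i j hm hp hc x y := by
    have h : cInfHom ≫ Flow.dualFst (adjoin (cInf F k)) = incl (cInf F k) :=
      cInf_hom_ext fun n => rfl
    have h1 : ∀ {n : ℕ} {a : ℤ} (x : (cInf F k).obj n a), app (incl (cInf F k)) x =
        (app cInfHom x).1 := fun x => by rw [← h]; rfl
    rw [h1, h1]
    exact (congrArg Prod.snd (cInfHom.map_comp i j hm hp hc x y)).trans
      (dualNumbers_comp_snd i j hm hp hc _ _)
  D_d h x := congrArg Prod.snd (cInfHom.map_d h x)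

end Under

end

end CurvedTwisting

namespace CurvedTwisting

noncomputable section

/-! ## The twisted operations -/

section Twisted

variable {F : Flavor} {k : Type u} [Field k]

theorem fillFirst_succ {Q : DGOperad F k} {n : ℕ} {a : ℤ} (t : ℕ) (x : (adjoin Q).obj (n + t + 1) a) :
    fillFirst (n := n) (t + 1) x = fillFirst t
      ((adjoin Q).comp 0 (n + t) (by omega) (by omega) (add_zero a).symm x (alpha Q)) := rfl

open Finset in
theorem fillGaps_succ {Q : DGOperad F k} {n : ℕ} {a : ℤ} (t g : ℕ)
    (x : (adjoin Q).obj (n + t + 1) a) :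
    fillGaps (n := n) (t + 1) g x = ∑ h ∈ Ico g (n + 1),
      fillGaps t h (plug (adjoin Q).toGrOperad (add_zero a).symm (n + t) h (alpha Q) x) := by
  have h1 : Ico g (n + 1) = (range (n + 1)).filter (g ≤ ·) := by
    ext i; simp [and_comm]
  rw [h1, sum_filter, sum_range, fillGaps]
  refine sum_congr rfl fun h _ => ?_
  rw [comp_eq_plug]

/-- `fillFirst` is linear. -/
theorem fillFirst_linear {Q P : DGOperad F k} {n : ℕ} {a : ℤ} (t : ℕ)
    (φ : ∀ {n : ℕ} {a : ℤ}, (adjoin Q).obj n a → (adjoin P).obj n a)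
    (hφ : ∀ {n : ℕ} {a : ℤ} (i j : ℕ) (hm : n + 1 = i + 1 + j) (hp : n = i + 0 + j)
      (x : (adjoin Q).obj (n + 1) a),
      φ ((adjoin Q).comp i j hm hp (add_zero a).symm x (alpha Q)) =
        (adjoin P).comp i j hm hp (add_zero a).symm (φ x) (alpha P))
    (x : (adjoin Q).obj (n + t) a) : φ (fillFirst t x) = fillFirst t (φ x) := by
  induction t with
  | zero => rfl
  | succ t ih => rw [fillFirst, fillFirst, ih, hφ]

theorem fillGaps_linear {Q P : DGOperad F k} {n : ℕ} {a : ℤ} (t g : ℕ)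
    (φ : ∀ {n : ℕ} {a : ℤ}, (adjoin Q).obj n a →ₗ[k] (adjoin P).obj n a)
    (hφ : ∀ {n : ℕ} {a : ℤ} (i j : ℕ) (hm : n + 1 = i + 1 + j) (hp : n = i + 0 + j)
      (x : (adjoin Q).obj (n + 1) a),
      φ ((adjoin Q).comp i j hm hp (add_zero a).symm x (alpha Q)) =
        (adjoin P).comp i j hm hp (add_zero a).symm (φ x) (alpha P))
    (x : (adjoin Q).obj (n + t) a) : φ (fillGaps t g x) = fillGaps t g (φ x) := by
  induction t generalizing g with
  | zero => rfl
  | succ t ih =>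
    rw [fillGaps, fillGaps, map_sum]
    refine Finset.sum_congr rfl fun h _ => ?_
    split_ifs
    · rw [ih, hφ]
    · rw [map_zero]

theorem fillFirst_add {Q : DGOperad F k} {n : ℕ} {a : ℤ} (t : ℕ) (x y : (adjoin Q).obj (n + t) a) :
    fillFirst t (x + y) = fillFirst t x + fillFirst t y := by
  induction t with
  | zero => rfl
  | succ t ih => rw [fillFirst, fillFirst, fillFirst, ← ih, map_add, LinearMap.add_apply]

theorem fillGaps_add {Q : DGOperad F k} {n : ℕ} {a : ℤ} (t g : ℕ) (x y : (adjoin Q).obj (n + t) a) :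
    fillGaps t g (x + y) = fillGaps t g x + fillGaps t g y := by
  induction t generalizing g with
  | zero => rfl
  | succ t ih =>
    rw [fillGaps, fillGaps, fillGaps, ← Finset.sum_add_distrib]
    refine Finset.sum_congr rfl fun h _ => ?_
    split_ifs
    · rw [← ih, map_add, LinearMap.add_apply]
    · rw [add_zero]

/-- `fillGaps` as a homomorphism. -/
def fillGapsHom {Q : DGOperad F k} {n : ℕ} {a : ℤ} (t g : ℕ) :
    (adjoin Q).obj (n + t) a →+ (adjoin Q).obj n a :=
  AddMonoidHom.mk' (fillGaps t g) (fillGaps_add t g)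

theorem fillFirst_zero {Q : DGOperad F k} {n : ℕ} {a : ℤ} (t : ℕ) :
    fillFirst t (0 : (adjoin Q).obj (n + t) a) = (0 : (adjoin Q).obj n a) := by
  have := fillFirst_add t (0 : (adjoin Q).obj (n + t) a) 0
  rwa [add_zero, left_eq_add] at this

theorem fillGaps_zero {Q : DGOperad F k} {n : ℕ} {a : ℤ} (t g : ℕ) :
    fillGaps t g (0 : (adjoin Q).obj (n + t) a) = (0 : (adjoin Q).obj n a) :=
  map_zero (fillGapsHom t g)

open Finset in
theorem fillGaps_sum {Q : DGOperad F k} {n : ℕ} {a : ℤ} (t g : ℕ) (s : Finset ℕ)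
    (x : ℕ → (adjoin Q).obj (n + t) a) :
    fillGaps t g (∑ i ∈ s, x i) = ∑ i ∈ s, fillGaps t g (x i) :=
  map_sum (fillGapsHom t g) x s

/-- Two copies of α in different inputs commute: the parallel axiom, without sign in degree 0. The
input i + 1 becomes the input i once an input h ≤ i has been filled. -/
theorem plug_plug {Q : DGOperad F k} {n h i : ℕ} {a : ℤ} (hi : h ≤ i) (hn : i ≤ n)
    (x : (adjoin Q).obj (n + 1 + 1) a) :
    plug (adjoin Q).toGrOperad (add_zero a).symm n h (alpha Q)
      (plug (adjoin Q).toGrOperad (add_zero a).symm (n + 1) (i + 1) (alpha Q) x) =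
    plug (adjoin Q).toGrOperad (add_zero a).symm n i (alpha Q)
      (plug (adjoin Q).toGrOperad (add_zero a).symm (n + 1) h (alpha Q) x) := by
  obtain ⟨j, rfl⟩ := Nat.exists_eq_add_of_le hi
  obtain ⟨r, rfl⟩ := Nat.exists_eq_add_of_le hn
  have e := (adjoin Q).comp_par (a := a) (b := 0) (c := 0) (ab := a) (ac := a) (abc := a) h j r
    (m := h + j + r + 1 + 1) (n := 0) (l := 0) (p := h + j + r + 1) (q := h + j + r)
    (r := h + j + r + 1) (by omega) (by omega) (by omega) (by omega) (by omega)
    (by omega) (by omega) (by omega) (add_zero a).symm (add_zero a).symm (add_zero a).symm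
    (add_zero a).symm x (alpha Q) (alpha Q)
  rw [comp_eq_plug, comp_eq_plug, comp_eq_plug, comp_eq_plug, mul_zero, ksign_of_even Even.zero,
    one_smul] at e
  rw [show h + j + 1 = h + 1 + j by omega]
  exact e.symm

open Finset in
-- `fillGaps (t + 1) g` fills every set of t + 1 inputs from position g on exactly once, from left
-- to right. On the left-hand side one of these copies of α is distinguished by being inserted
-- first, hence the factor t + 1.
theorem sum_fillGaps_plug {Q : DGOperad F k} {n : ℕ} {a : ℤ} (t g : ℕ)
    (x : (adjoin Q).obj (n + t + 1) a) :
    ∑ i ∈ Ico g (n + t + 1), fillGaps (n := n) t g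
        (plug (adjoin Q).toGrOperad (add_zero a).symm (n + t) i (alpha Q) x) =
      (t + 1) • fillGaps (n := n) (t + 1) g x := by
  induction t generalizing g with
  | zero => rw [fillGaps_succ, zero_add, one_smul]; rfl
  | succ t ih =>
    -- Let h be the gap of the leftmost of the copies inserted afterwards. If the distinguished copy
    -- is at i > h, it can be inserted after that copy, and the induction hypothesis counts these
    -- terms.
    have key : ∀ h ∈ Ico g (n + 1), ∑ i ∈ Ico g (n + (t + 1) + 1), fillGaps (n := n) t h
        (plug (adjoin Q).toGrOperad (add_zero a).symm (n + t) h (alpha Q)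
          (plug (adjoin Q).toGrOperad (add_zero a).symm (n + (t + 1)) i (alpha Q) x)) =
        ∑ i ∈ Ico g (h + 1), fillGaps (n := n) t h
          (plug (adjoin Q).toGrOperad (add_zero a).symm (n + t) h (alpha Q)
            (plug (adjoin Q).toGrOperad (add_zero a).symm (n + (t + 1)) i (alpha Q) x)) +
        (t + 1) • fillGaps (n := n) (t + 1) h
          (plug (adjoin Q).toGrOperad (add_zero a).symm (n + (t + 1)) h (alpha Q) x) := by
      intro h hh
      rw [mem_Ico] at hh
      rw [← ih, ← sum_Ico_consecutive _ (show g ≤ h + 1 by omega)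
        (show h + 1 ≤ n + (t + 1) + 1 by omega)]
      congr 1
      refine (sum_Ico_add' (fun i => fillGaps (n := n) t h
        (plug (adjoin Q).toGrOperad (add_zero a).symm (n + t) h (alpha Q)
          (plug (adjoin Q).toGrOperad (add_zero a).symm (n + (t + 1)) i (alpha Q) x)))
        h (n + t + 1) 1).symm.trans ?_
      refine sum_congr rfl fun i hi => ?_
      rw [mem_Ico] at hi
      congr 1
      exact plug_plug hi.1 (show i ≤ n + t by omega) x
    -- The terms with i > h sum to t + 1 times the required expression. Those with i ≤ h, summed in
    -- the other order, insert the distinguished copy as leftmost one and give the expression once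
    -- more.
    simp only [fillGaps_succ (n := n) t g]
    rw [sum_comm, sum_congr rfl key, sum_add_distrib, ← smul_sum, ← fillGaps_succ (t + 1) g x,
      sum_sigma', add_smul (t + 1) 1, one_smul, add_comm]
    congr 1
    rw [fillGaps_succ (t + 1) g x]
    simp only [fillGaps_succ (n := n) t]
    rw [sum_sigma']
    refine sum_nbij' (fun p => ⟨p.2, p.1⟩) (fun p => ⟨p.2, p.1⟩) ?_ ?_ ?_ ?_ ?_
    · rintro ⟨p, q⟩ h
      simp only [mem_sigma, mem_Ico] at h ⊢
      omega
    · rintro ⟨p, q⟩ h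
      simp only [mem_sigma, mem_Ico] at h ⊢
      omega
    · exact fun _ _ => rfl
    · exact fun _ _ => rfl
    · exact fun _ _ => rfl

/-- The weight `t` term of the twisting of a family of operations. -/
def twistTerm {Q : DGOperad F k} (l : ∀ n, Q.obj n (-1)) (n t : ℕ) : (adjoin Q).obj n (-1) :=
  match F with
  | .symmetric => (t.factorial : k)⁻¹ • fillFirst t (app (incl Q) (l (n + t)))
  | .nonsymmetric => fillGaps t 0 (app (incl Q) (l (n + t)))

theorem twistedTerm_eq : ∀ {F : Flavor} (n t : ℕ) (Q : Under (cInf F k)),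
    twistedTerm n t Q = twistTerm (ellOf Q) n t
  | .symmetric, _, _, _ => rfl
  | .nonsymmetric, _, _, _ => rfl

theorem twistTerm_weight : ∀ {F : Flavor} {Q : DGOperad F k} (l : ∀ n, Q.obj n (-1)) (n t : ℕ),
    Weight Q 0 t (twistTerm l n t)
  | .symmetric, Q, l, n, t => by
    have := Weight.fillFirst t _ (Weight.of (l (n + t)))
    rw [zero_add] at this
    exact .smul _ this
  | .nonsymmetric, Q, l, n, t => by
    have := Weight.fillGaps t 0 _ (Weight.of (l (n + t)))
    rwa [zero_add] at this

theorem twistTerm_zero : ∀ {F : Flavor} {Q : DGOperad F k} (l : ∀ n, Q.obj n (-1)) (n : ℕ),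
    twistTerm l n 0 = app (incl Q) (l n)
  | .symmetric, Q, l, n => by
    rw [twistTerm, Nat.factorial_zero, Nat.cast_one, inv_one, one_smul]
    rfl
  | .nonsymmetric, Q, l, n => rfl

theorem twistTerm_map : ∀ {F : Flavor} {Q P : DGOperad F k} (f : Q ⟶ P) (l : ∀ n, Q.obj n (-1))
    (n t : ℕ), app (adjoin.lift (f ≫ incl P) (alpha P)) (twistTerm l n t) =
      twistTerm (fun n => app f (l n)) n t
  | .symmetric, Q, P, f, l, n, t => by
    rw [twistTerm, twistTerm, map_smul, fillFirst_linear t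
      (fun x => app (adjoin.lift (f ≫ incl P) (alpha P)) x) (fun i j hm hp x => ?_)]
    · rfl
    · exact (adjoin.lift (f ≫ incl P) (alpha P)).map_comp i j hm hp _ x (alpha Q)
  | .nonsymmetric, Q, P, f, l, n, t => by
    rw [twistTerm, twistTerm, fillGaps_linear t 0
      (app (adjoin.lift (f ≫ incl P) (alpha P))) (fun i j hm hp x => ?_)]
    · rfl
    · exact (adjoin.lift (f ≫ incl P) (alpha P)).map_comp i j hm hp _ x (alpha Q)

theorem Flow.ext_comp_alpha {P : DGOperad F k} (φ : Flow P) {n : ℕ} {a : ℤ} (i j : ℕ)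
    (hm : n + 1 = i + 1 + j) (hp : n = i + 0 + j) (x : (adjoin P).obj (n + 1) a) :
    φ.ext ((adjoin P).comp i j hm hp (add_zero a).symm x (alpha P)) =
      (adjoin P).comp i j hm hp (add_zero a).symm (φ.ext x) (alpha P) := by
  rw [φ.ext_comp, φ.ext_alpha, map_zero, add_zero]

theorem nullary_add_succ {P : GrOperad F k} {b : ℤ} (y : P.obj 0 b) (n t : ℕ) :
    nullary y (n + (t + 1)) = 0 := rfl

theorem Flow.ext_nullary_kappa {P : DGOperad F k} (φ : Flow P) : ∀ n,
    φ.ext (nullary (P := (adjoin P).toGrOperad) (kappa P) n) = 0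
  | 0 => φ.ext_kappa
  | _ + 1 => map_zero _

theorem cInfFlow_ell (n : ℕ) : (cInfFlow F k).D (ell F k n) =
    ellVariation (fun n => app (incl (cInf F k)) (ell F k n)) (alpha (cInf F k)) n := rfl

theorem cTw_ext {Q : DGOperad F k} {n : ℕ} {a : ℤ} {f g : (cTw Q).obj n a}
    (h : ∀ t, coeff f t = coeff g t) : f = g := Subtype.ext (funext h)

variable [CharZero k]

/-- The derivation kills the copies of α already present, so it only inserts one more α into
ℓ_{n+t}. The factor t + 1 is (t + 1)! / t! in the symmetric case and the count of
`sum_fillGaps_plug` in the nonsymmetric one. As κ occurs only in the derivative of ℓ_0, it appears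
for n = t = 0 only. -/
theorem Flow.ext_twistTerm : ∀ {F : Flavor} {P : DGOperad F k} (φ : Flow P) (l : ∀ n, P.obj n (-1))
    (_ : ∀ n, φ.D (l n) = ellVariation (fun n => app (incl P) (l n)) (alpha P) n) (n t : ℕ),
    φ.ext (twistTerm l n t) = (t + 1) • twistTerm l n (t + 1) +
      if t = 0 then nullary (P := (adjoin P).toGrOperad) (kappa P) n else 0
  | .symmetric, P, φ, l, hφ, n, t => by
    rw [twistTerm, twistTerm, map_smul, fillFirst_linear t (fun x => φ.ext x)
      (fun i j hm hp x => φ.ext_comp_alpha i j hm hp x), ext_incl, hφ, ellVariation,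
      fillFirst_add, smul_add, insertAll]
    congr 1
    · rw [← fillFirst_succ, ← Nat.cast_smul_eq_nsmul k, smul_smul, Nat.factorial_succ, Nat.cast_mul,
        mul_inv, ← mul_assoc, mul_inv_cancel₀ (Nat.cast_ne_zero.2 t.succ_ne_zero), one_mul]
      rfl
    · cases t with
      | zero =>
        rw [Nat.factorial_zero, Nat.cast_one, inv_one, one_smul, if_pos rfl]
        rfl
      | succ t => rw [if_neg t.succ_ne_zero, nullary_add_succ, fillFirst_zero, smul_zero]
  | .nonsymmetric, P, φ, l, hφ, n, t => by
    rw [twistTerm, twistTerm, fillGaps_linear t 0 φ.ext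
      (fun i j hm hp x => φ.ext_comp_alpha i j hm hp x), ext_incl, hφ, ellVariation,
      fillGaps_add, insertAll_nonsymmetric, fillGaps_sum, Finset.range_eq_Ico]
    congr 1
    · exact sum_fillGaps_plug t 0 _
    · cases t with
      | zero => rfl
      | succ t => rw [if_neg t.succ_ne_zero, nullary_add_succ, fillGaps_zero]

/-- The exponential of a flow with the prescribed first-order values on the l_n yields the twisted
operations: induction on t, dividing by t + 1. The summand κ appears in weight 1 and is killed
afterwards. -/
theorem Flow.pow_ell {P : DGOperad F k} (φ : Flow P) (l : ∀ n, P.obj n (-1))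
    (hφ : ∀ n, φ.D (l n) = ellVariation (fun n => app (incl P) (l n)) (alpha P) n) (n t : ℕ) :
    φ.pow t (app (incl P) (l n)) = twistTerm l n t +
      if t = 1 then nullary (P := (adjoin P).toGrOperad) (kappa P) n else 0 := by
  induction t with
  | zero => rw [if_neg (by omega), add_zero, twistTerm_zero]; rfl
  | succ t ih =>
    have h : (t + 1) • φ.pow (t + 1) (app (incl P) (l n)) = (t + 1) • (twistTerm l n (t + 1) +
      if t + 1 = 1 then nullary (P := (adjoin P).toGrOperad) (kappa P) n else 0) := by
      rw [succ_smul_pow, ih, map_add, φ.ext_twistTerm l hφ, smul_add, add_assoc]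
      congr 1
      rcases t with _ | t
      · simp
      · rw [if_neg (by omega), if_neg (by omega : ¬ t + 1 + 1 = 1), zero_add, smul_zero]
        split_ifs
        · exact φ.ext_nullary_kappa n
        · exact map_zero _
    rw [← Nat.cast_smul_eq_nsmul k, ← Nat.cast_smul_eq_nsmul k] at h
    exact smul_right_injective _ (Nat.cast_ne_zero.2 t.succ_ne_zero) h

theorem Flow.mem_bounded_ell {P : DGOperad F k} (φ : Flow P) (l : ∀ n, P.obj n (-1))
    (hφ : ∀ n, φ.D (l n) = ellVariation (fun n => app (incl P) (l n)) (alpha P) n) (n : ℕ) :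
    l n ∈ φ.bounded.carrier n (-1) := by
  refine ⟨1, fun t => ?_⟩
  rw [φ.pow_ell l hφ]
  refine .add (.mono (Nat.zero_le _) (twistTerm_weight l n t)) ?_
  split_ifs with h
  · subst h
    cases n with
    | zero => exact .kappa
    | succ n => exact .zero
  · exact .zero

theorem cInf_bounded {n : ℕ} {a : ℤ} (x : (cInf F k).obj n a) :
    x ∈ (cInfFlow F k).bounded.carrier n a :=
  cInf_mem _ (fun {_ _ _} h {_} hx => (cInfFlow F k).bounded_d h hx)
    ((cInfFlow F k).mem_bounded_ell (ell F k) cInfFlow_ell) x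

/-- `cTw(Q)` as an operad under `cL_∞`, resp. `cA_∞`. -/
def cTwUnder (Q : Under (cInf F k)) : Under (cInf F k) :=
  Under.mk ((cInfFlow F k).exp cInf_bounded ≫ cTwMap Q.hom)

theorem coeff_ellOf_cTwUnder (Q : Under (cInf F k)) (n t : ℕ) :
    coeff (Q := Q.right) (ellOf (cTwUnder Q) n) t = twistTerm (ellOf Q) n t +
      if t = 1 then nullary (P := (adjoin Q.right).toGrOperad) (kappa Q.right) n else 0 := by
  change app (adjoin.lift (Q.hom ≫ incl Q.right) (alpha Q.right))
    ((cInfFlow F k).pow t (app (incl (cInf F k)) (ell F k n))) = _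
  rw [(cInfFlow F k).pow_ell (ell F k) cInfFlow_ell, map_add, twistTerm_map]
  congr 1
  split_ifs
  · exact map_nullary _ _ n
  · exact map_zero _

theorem ellOf_cTwUnder_zero (Q : Under (cInf F k)) :
    ellOf (cTwUnder Q) 0 = kappaHat Q.right + twisted Q 0 := by
  refine cTw_ext (Q := Q.right) fun t => (coeff_ellOf_cTwUnder Q 0 t).trans ?_
  rw [add_comm]
  refine congrArg₂ (· + ·) ?_ (twistedTerm_eq _ _ _).symm
  change _ = (Pi.single 1 (kappa Q.right) : ℕ → _) t
  rw [Pi.single_apply]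
  rfl

theorem ellOf_cTwUnder_pos (Q : Under (cInf F k)) (n : ℕ) (hn : 0 < n) :
    ellOf (cTwUnder Q) n = twisted Q n := by
  refine cTw_ext (Q := Q.right) fun t => (coeff_ellOf_cTwUnder Q n t).trans ?_
  obtain ⟨m, rfl⟩ := Nat.exists_eq_succ_of_ne_zero hn.ne'
  have : (if t = 1 then nullary (P := (adjoin Q.right).toGrOperad) (kappa Q.right) (m + 1)
    else 0) = 0 := by split_ifs <;> rfl
  rw [this, add_zero]
  exact (twistedTerm_eq _ _ _).symm

end Twisted

end

end CurvedTwisting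

namespace CurvedTwisting

noncomputable section

/-! ## Marked operations -/

section MarkedInputs

/-- The position of the input `z` after a new input `s` has been inserted. -/
def raise (s z : ℕ) : ℕ := if z < s then z else z + 1

theorem IsInduced.one {m n p : ℕ} (i : ℕ) :
    IsInduced i i (1 : Equiv.Perm (Fin m)) (1 : Equiv.Perm (Fin n)) (1 : Equiv.Perm (Fin p)) :=
  ⟨fun _ h => h, fun _ _ h => h, fun _ _ _ h => h⟩

theorem IsInduced.raise_eq {n s s' : ℕ} {ρ : Equiv.Perm (Fin (n + 1))} {τ : Equiv.Perm (Fin 0)}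
    {σ : Equiv.Perm (Fin n)} (hs : s ≤ n) (hs' : s' ≤ n) (h : IsInduced s s' ρ τ σ)
    (z : Fin n) (t : Fin (n + 1)) (ht : (t : ℕ) = raise s z) : (ρ t : ℕ) = raise s' (σ z) := by
  have h' := ((isInduced_zero_iff ⟨s, by omega⟩ ⟨s', by omega⟩ ρ τ σ).1 h).2 z
  have e : t = (⟨s, by omega⟩ : Fin (n + 1)).succAbove z := Fin.ext (by
    rw [ht, succAbove_val]; rfl)
  rw [e, h', succAbove_val]
  rfl

theorem IsInduced.unique {n s s' : ℕ} {ρ ρ' : Equiv.Perm (Fin (n + 1))} {τ τ' : Equiv.Perm (Fin 0)}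
    {σ : Equiv.Perm (Fin n)} (hs : s ≤ n) (hs' : s' ≤ n) (h : IsInduced s s' ρ τ σ)
    (h' : IsInduced s s' ρ' τ' σ) : ρ = ρ' := by
  have e := (isInduced_zero_iff ⟨s, by omega⟩ ⟨s', by omega⟩ ρ τ σ).1 h
  have e' := (isInduced_zero_iff ⟨s, by omega⟩ ⟨s', by omega⟩ ρ' τ' σ).1 h'
  refine Equiv.ext fun t => ?_
  rcases eq_or_ne t ⟨s, by omega⟩ with rfl | ht
  · rw [e.1, e'.1]
  · obtain ⟨w, rfl⟩ := Fin.exists_succAbove_eq ht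
    rw [e.2, e'.2]

theorem IsInduced.mul {n s s' s'' : ℕ} {ρ ρ' : Equiv.Perm (Fin (n + 1))}
    {τ τ' τ'' : Equiv.Perm (Fin 0)} {σ σ' : Equiv.Perm (Fin n)} (hs : s ≤ n) (hs' : s' ≤ n)
    (hs'' : s'' ≤ n) (h : IsInduced s s' ρ τ σ) (h' : IsInduced s' s'' ρ' τ' σ') :
    IsInduced s s'' (ρ' * ρ) τ'' (σ' * σ) := by
  have e := (isInduced_zero_iff ⟨s, by omega⟩ ⟨s', by omega⟩ ρ τ σ).1 h
  have e' := (isInduced_zero_iff ⟨s', by omega⟩ ⟨s'', by omega⟩ ρ' τ' σ').1 h'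
  refine (isInduced_zero_iff ⟨s, by omega⟩ ⟨s'', by omega⟩ _ _ _).2 ⟨?_, fun z => ?_⟩
  · rw [Equiv.Perm.mul_apply, e.1, e'.1]
  · rw [Equiv.Perm.mul_apply, e.2, e'.2, Equiv.Perm.mul_apply]

theorem isInduced_extSym {n s s' : ℕ} (hs : s ≤ n) (hs' : s' ≤ n) (τ : Equiv.Perm (Fin 0))
    (σ : Flavor.symmetric.perms n) :
    IsInduced s s' (extSym ⟨s, by omega⟩ ⟨s', by omega⟩ σ).1 τ σ.1 :=
  isInduced_extPerm ⟨s, by omega⟩ ⟨s', by omega⟩ τ σ.1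

/-- The relabelling of a composite whose second factor has a marked input. -/
theorem exists_isInduced_inner : ∀ {F : Flavor} {m n p : ℕ} {i j i' j' s s' : ℕ}
    (_ : m = i + 1 + j) (_ : p = i + n + j) (_ : m = i' + 1 + j') (_ : p = i' + n + j')
    (_ : s ≤ n) (_ : s' ≤ n) (σ : F.perms m) (τ : F.perms n) (υ : F.perms p) (ρ : F.perms (n + 1))
    (π : F.perms 0) (_ : IsInduced i i' σ.1 τ.1 υ.1) (_ : IsInduced s s' ρ.1 π.1 τ.1),
    ∃ υ' : F.perms (p + 1), IsInduced (i + s) (i' + s') υ'.1 π.1 υ.1 ∧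
      IsInduced i i' σ.1 ρ.1 υ'.1
  | .nonsymmetric, m, n, p, i, j, i', j', s, s', hm, hp, hm', hp', hs, hs', σ, τ, υ, ρ, π, h, h' => by
    obtain rfl := Flavor.perms_eq_one σ
    obtain rfl := Flavor.perms_eq_one τ
    obtain rfl := Flavor.perms_eq_one υ
    obtain rfl := Flavor.perms_eq_one ρ
    obtain rfl := Flavor.perms_eq_one π
    obtain rfl : i = i' := h.1 ⟨i, by omega⟩ rfl
    obtain rfl : s = s' := h'.1 ⟨s, by omega⟩ rfl
    exact ⟨1, IsInduced.one _, IsInduced.one _⟩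
  | .symmetric, m, n, p, i, j, i', j', s, s', hm, hp, hm', hp', hs, hs', σ, τ, υ, ρ, π, h, h' => by
    -- The relabelling is forced: it sends the marked input to the marked input and acts by υ on the
    -- others. What remains is to compare positions, for the marked input, the other inputs of the
    -- inner operation and those of the outer one.
    have hu := isInduced_extSym (n := p) (s := i + s) (s' := i' + s') (by omega) (by omega) π.1 υ
    refine ⟨_, hu, ?_⟩
    generalize (extSym (⟨i + s, by omega⟩ : Fin (p + 1)) ⟨i' + s', by omega⟩ υ) = υ' at hu ⊢
    obtain ⟨h1, h2, h3⟩ := h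
    refine ⟨h1, fun t z hz => ?_, fun t z ht hz => ?_⟩
    · by_cases hts : (t : ℕ) = s
      · rw [hu.1 z (by omega), h'.1 t hts]
      · obtain ⟨t0, ht0⟩ : ∃ t0 : Fin n, (t : ℕ) = raise s t0 := by
          by_cases hlt : (t : ℕ) < s
          · exact ⟨⟨t, by omega⟩, by simp [raise, hlt]⟩
          · exact ⟨⟨t - 1, by omega⟩, by simp only [raise]; split_ifs <;> omega⟩
        have e1 := h'.raise_eq hs hs' t0 t ht0
        have e2 := h2 t0 ⟨i + t0, by omega⟩ rfl
        have e3 := hu.raise_eq (by omega) (by omega) ⟨i + t0, by omega⟩ z (by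
          simp only [raise] at ht0 ⊢
          split_ifs at ht0 ⊢ <;> omega)
        rw [e3, e2, e1]
        simp only [raise]
        split_ifs <;> omega
    · have hti : (σ.1 t : ℕ) ≠ i' := fun e => by
        have := h1 ⟨i, by omega⟩ rfl
        have h4 : σ.1 t = σ.1 ⟨i, by omega⟩ := Fin.ext (e.trans this.symm)
        exact ht (congrArg Fin.val (σ.1.injective h4))
      have hlt := t.2
      have hlt' := (σ.1 t).2
      have hz0 : outer i n t < p := by
        rw [outer]; split_ifs <;> omega
      have e1 := h3 t ⟨outer i n t, hz0⟩ ht rfl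
      have e3 := hu.raise_eq (by omega) (by omega) ⟨outer i n t, hz0⟩ z (by
        rw [hz]
        simp only [raise, outer]
        split_ifs <;> omega)
      rw [e3, e1]
      simp only [raise, outer]
      split_ifs <;> omega

/-- The position of a marked input after an operation of arity `n` has been plugged into another
input, the one which is number `i` if the marked one is not counted. -/
def markPos (s i n : ℕ) : ℕ := if s ≤ i then s else s + n - 1

/-- The relabelling of a composite whose first factor has a marked input. -/
theorem exists_isInduced_outer : ∀ {F : Flavor} {m n p : ℕ} {i j i' j' s s' : ℕ}
    (_ : m = i + 1 + j) (_ : p = i + n + j) (_ : m = i' + 1 + j') (_ : p = i' + n + j')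
    (_ : s ≤ m) (_ : s' ≤ m) (σ : F.perms m) (τ : F.perms n) (υ : F.perms p) (ρ : F.perms (m + 1))
    (π : F.perms 0) (_ : IsInduced i i' σ.1 τ.1 υ.1) (_ : IsInduced s s' ρ.1 π.1 σ.1),
    ∃ υ' : F.perms (p + 1), IsInduced (markPos s i n) (markPos s' i' n) υ'.1 π.1 υ.1 ∧
      IsInduced (raise s i) (raise s' i') ρ.1 τ.1 υ'.1
  | .nonsymmetric, m, n, p, i, j, i', j', s, s', hm, hp, hm', hp', hs, hs', σ, τ, υ, ρ, π, h, h' => by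
    obtain rfl := Flavor.perms_eq_one σ
    obtain rfl := Flavor.perms_eq_one τ
    obtain rfl := Flavor.perms_eq_one υ
    obtain rfl := Flavor.perms_eq_one ρ
    obtain rfl := Flavor.perms_eq_one π
    obtain rfl : i = i' := h.1 ⟨i, by omega⟩ rfl
    obtain rfl : s = s' := h'.1 ⟨s, by omega⟩ rfl
    exact ⟨1, IsInduced.one _, IsInduced.one _⟩
  | .symmetric, m, n, p, i, j, i', j', s, s', hm, hp, hm', hp', hs, hs', σ, τ, υ, ρ, π, h, h' => by
    have hle : markPos s i n ≤ p := by rw [markPos]; split_ifs <;> omega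
    have hle' : markPos s' i' n ≤ p := by rw [markPos]; split_ifs <;> omega
    have hu := isInduced_extSym hle hle' π.1 υ
    refine ⟨_, hu, ?_⟩
    generalize (extSym (⟨markPos s i n, by omega⟩ : Fin (p + 1)) ⟨markPos s' i' n, by omega⟩ υ) =
      υ' at hu ⊢
    obtain ⟨h1, h2, h3⟩ := h
    have hi : (σ.1 ⟨i, by omega⟩ : ℕ) = i' := h1 ⟨i, by omega⟩ rfl
    refine ⟨fun t ht => ?_, fun t z hz => ?_, fun t z ht hz => ?_⟩
    · rw [h'.raise_eq hs hs' ⟨i, by omega⟩ t ht, hi]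
    · have e2 := h2 t ⟨i + t, by omega⟩ rfl
      have e3 := hu.raise_eq hle hle' ⟨i + t, by omega⟩ z (by
        simp only [raise, markPos] at hz ⊢
        split_ifs at hz ⊢ <;> omega)
      have := (τ.1 t).2
      rw [e3, e2]
      simp only [raise, markPos]
      split_ifs <;> omega
    · by_cases hts : (t : ℕ) = s
      · rw [hu.1 z (by
          rw [hz]
          simp only [raise, markPos, outer]
          split_ifs <;> omega), h'.1 t hts]
        simp only [raise, markPos, outer]
        split_ifs <;> omega
      · obtain ⟨t0, ht0⟩ : ∃ t0 : Fin m, (t : ℕ) = raise s t0 := by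
          by_cases hlt : (t : ℕ) < s
          · exact ⟨⟨t, by omega⟩, by simp [raise, hlt]⟩
          · exact ⟨⟨t - 1, by omega⟩, by simp only [raise]; split_ifs <;> omega⟩
        have hne : (t0 : ℕ) ≠ i := fun e => ht (by rw [ht0, e])
        have hti : (σ.1 t0 : ℕ) ≠ i' := fun e => by
          have h4 : σ.1 t0 = σ.1 ⟨i, by omega⟩ := Fin.ext (e.trans hi.symm)
          exact hne (congrArg Fin.val (σ.1.injective h4))
        have hlt := t0.2
        have hlt' := (σ.1 t0).2
        have e1 := h'.raise_eq hs hs' t0 t ht0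
        have hz0 : outer i n t0 < p := by
          rw [outer]; split_ifs <;> omega
        have e2 := h3 t0 ⟨outer i n t0, hz0⟩ hne rfl
        have e3 := hu.raise_eq hle hle' ⟨outer i n t0, hz0⟩ z (by
          rw [hz, ht0]
          simp only [raise, outer, markPos]
          split_ifs <;> omega)
        rw [e3, e2, e1]
        simp only [raise, outer, markPos]
        split_ifs <;> omega

/-- The positions of a marked input up to relabelling. -/
def Idx : Flavor → ℕ → Type
  | .symmetric, _ => Unit
  | .nonsymmetric, n => Fin (n + 1)

instance : ∀ (F : Flavor) (n : ℕ), Fintype (Idx F n)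
  | .symmetric, _ => inferInstanceAs (Fintype Unit)
  | .nonsymmetric, n => inferInstanceAs (Fintype (Fin (n + 1)))

instance : ∀ (F : Flavor) (n : ℕ), DecidableEq (Idx F n)
  | .symmetric, _ => inferInstanceAs (DecidableEq Unit)
  | .nonsymmetric, n => inferInstanceAs (DecidableEq (Fin (n + 1)))

namespace Idx

/-- The standard position in a class. -/
def emb : ∀ {F : Flavor} {n : ℕ}, Idx F n → ℕ
  | .symmetric, _, _ => 0
  | .nonsymmetric, _, i => Fin.val i

theorem emb_le : ∀ {F : Flavor} {n : ℕ} (i : Idx F n), i.emb ≤ n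
  | .symmetric, _, _ => Nat.zero_le _
  | .nonsymmetric, _, i => Nat.le_of_lt_succ (Fin.isLt i)

/-- The class of a position. -/
def norm : ∀ {F : Flavor} {n : ℕ} (s : ℕ) (_ : s ≤ n), Idx F n
  | .symmetric, _, _, _ => ()
  | .nonsymmetric, n, s, hs => (⟨s, by omega⟩ : Fin (n + 1))

/-- The relabelling which moves a position to the standard one. -/
def std : ∀ {F : Flavor} {n : ℕ} (s : ℕ) (_ : s ≤ n), F.perms (n + 1)
  | .symmetric, _, s, hs => extSym ⟨s, by omega⟩ ⟨0, by omega⟩ 1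
  | .nonsymmetric, _, _, _ => 1

theorem isInduced_std : ∀ {F : Flavor} {n : ℕ} (s : ℕ) (hs : s ≤ n) (π : Equiv.Perm (Fin 0)),
    IsInduced s (norm s hs : Idx F n).emb (std (F := F) s hs).1 π (1 : F.perms n).1
  | .symmetric, _, s, hs, π => isInduced_extSym hs (Nat.zero_le _) π 1
  | .nonsymmetric, _, s, hs, π => by
    rw [Subsingleton.elim π 1]
    exact IsInduced.one s

/-- The relabelling which fixes a standard position. -/
def fix : ∀ {F : Flavor} {n : ℕ} (_ : Idx F n) (_ : F.perms n), F.perms (n + 1)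
  | .symmetric, _, _, σ => extSym ⟨0, by omega⟩ ⟨0, by omega⟩ σ
  | .nonsymmetric, _, _, _ => 1

theorem isInduced_fix : ∀ {F : Flavor} {n : ℕ} (i : Idx F n) (σ : F.perms n)
    (π : Equiv.Perm (Fin 0)), IsInduced i.emb i.emb (fix i σ).1 π σ.1
  | .symmetric, _, i, σ, π => isInduced_extSym (Nat.zero_le _) (Nat.zero_le _) π σ
  | .nonsymmetric, _, i, σ, π => by
    rw [Subsingleton.elim π 1, Flavor.perms_eq_one σ]
    exact IsInduced.one _

theorem norm_emb : ∀ {F : Flavor} {n : ℕ} (i : Idx F n), norm i.emb i.emb_le = i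
  | .symmetric, _, _ => rfl
  | .nonsymmetric, _, _ => rfl

theorem norm_congr : ∀ {F : Flavor} {n : ℕ} {s s' : ℕ} (hs : s ≤ n) (hs' : s' ≤ n)
    {ρ : F.perms (n + 1)} {π : Equiv.Perm (Fin 0)} {σ : F.perms n},
    IsInduced s s' ρ.1 π σ.1 → (norm s hs : Idx F n) = norm s' hs'
  | .symmetric, _, _, _, _, _, _, _, _, _ => rfl
  | .nonsymmetric, n, s, s', hs, hs', ρ, _, _, h => by
    obtain rfl := Flavor.perms_eq_one ρ
    obtain rfl : s = s' := h.1 ⟨s, by omega⟩ rfl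
    rfl

end Idx

end MarkedInputs

end

end CurvedTwisting

namespace CurvedTwisting

noncomputable section

/-! ### The infinitesimal bimodule of operations with a marked input -/

section Marked

variable {F : Flavor} {k : Type u} [Field k]

theorem GrOperad.comp_congr (A : GrOperad F k) {m n p : ℕ} {a b c : ℤ} {i j i' j' : ℕ}
    {hm : m = i + 1 + j} {hp : p = i + n + j} {hm' : m = i' + 1 + j'} {hp' : p = i' + n + j'}
    {hc : c = a + b} (x : A.obj m a) (y : A.obj n b) (hi : i = i') :
    A.comp i j hm hp hc x y = A.comp i' j' hm' hp' hc x y := by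
  subst hi
  obtain rfl : j = j' := by omega
  rfl

/-- The parallel axiom with positions constrained by relations instead of being given as sums, so
that it applies to positions written with `raise` and `markPos`. -/
theorem GrOperad.comp_par_congr (A : GrOperad F k) {m n l p q r : ℕ} {a b c ab ac abc : ℤ}
    {i₁ j₁ i₂ j₂ i₃ j₃ i₄ j₄ : ℕ} {hm : m = i₁ + 1 + j₁} {hp : p = i₁ + n + j₁} {h₁ : ab = a + b}
    {hp' : p = i₂ + 1 + j₂} {hq : q = i₂ + l + j₂} {h₂ : abc = ab + c}
    (x : A.obj m a) (y : A.obj n b) (z : A.obj l c)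
    (hm' : m = i₃ + 1 + j₃) (hr : r = i₃ + l + j₃) (h₃ : ac = a + c)
    (hr' : r = i₄ + 1 + j₄) (hq' : q = i₄ + n + j₄) (h₄ : abc = ac + b)
    (h : i₁ < i₃) (h' : i₂ + 1 = i₃ + n) (h'' : i₄ = i₁) :
    A.comp i₂ j₂ hp' hq h₂ (A.comp i₁ j₁ hm hp h₁ x y) z =
      ksign k (b * c) • A.comp i₄ j₄ hr' hq' h₄ (A.comp i₃ j₃ hm' hr h₃ x z) y := by
  subst h''
  obtain ⟨j, rfl⟩ : ∃ j, i₃ = i₄ + 1 + j := Nat.exists_eq_add_of_le (by omega)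
  obtain rfl : i₂ = i₄ + n + j := by omega
  obtain rfl : j₂ = j₃ := by omega
  obtain rfl : j₁ = j + 1 + j₂ := by omega
  obtain rfl : j₄ = j + l + j₂ := by omega
  exact A.comp_par i₄ j j₂ hm hm' hp hp' hq hr hr' hq' h₁ h₂ h₃ h₄ x y z

/-- Operations with a marked input of degree `e`. -/
abbrev Marked (A : GrOperad F k) (e : ℤ) (n : ℕ) (a : ℤ) : Type u := Idx F n → A.obj (n + 1) (a - e)

namespace Marked

variable {A : GrOperad F k} {e : ℤ}

/-- The operation `x` with its input `s` marked. -/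
def mark {n : ℕ} {a : ℤ} (s : ℕ) : A.obj (n + 1) (a - e) →ₗ[k] Marked A e n a :=
  if hs : s ≤ n then
    LinearMap.single k (fun _ => A.obj (n + 1) (a - e)) (Idx.norm s hs) ∘ₗ A.act (Idx.std s hs)
  else 0

theorem mark_eq {n : ℕ} {a : ℤ} {s : ℕ} (hs : s ≤ n) (x : A.obj (n + 1) (a - e)) :
    (mark s x : Marked A e n a) = Pi.single (Idx.norm s hs) (A.act (Idx.std s hs) x) := by
  rw [mark, dif_pos hs]
  rfl

/-- Relabelling of the unmarked inputs. -/
def act {n : ℕ} {a : ℤ} (σ : F.perms n) : Marked A e n a →ₗ[k] Marked A e n a :=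
  LinearMap.pi fun i => A.act (i.fix σ) ∘ₗ LinearMap.proj i

/-- After moving the marked inputs to their standard position, both sides involve relabellings
induced by the same relabelling of the unmarked inputs. By `IsInduced.unique` these relabellings
coincide. -/
theorem act_mark {n : ℕ} {a : ℤ} {s s' : ℕ} (hs : s ≤ n) (hs' : s' ≤ n) {ρ : F.perms (n + 1)}
    {σ : F.perms n} {π : Equiv.Perm (Fin 0)} (h : IsInduced s s' ρ.1 π σ.1)
    (x : A.obj (n + 1) (a - e)) :
    act σ (mark s x : Marked A e n a) = mark s' (A.act ρ x) := by
  rw [mark_eq hs, mark_eq hs', ← Idx.norm_congr hs hs' h]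
  have e1 := IsInduced.mul (τ'' := π) hs (Idx.emb_le _) (Idx.emb_le _)
    (Idx.isInduced_std (F := F) s hs π) (Idx.isInduced_fix (Idx.norm s hs) σ π)
  have e2 := IsInduced.mul (τ'' := π) hs hs' (Idx.emb_le _) h
    (Idx.isInduced_std (F := F) s' hs' π)
  rw [← Idx.norm_congr hs hs' h] at e2
  have e3 : (Idx.fix (Idx.norm s hs) σ).1 * (Idx.std (F := F) s hs).1 =
      (Idx.std (F := F) s' hs').1 * ρ.1 := by
    refine IsInduced.unique (τ' := π) hs (Idx.emb_le _) e1 ?_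
    have e4 : σ.1 * (1 : F.perms n).1 = (1 : F.perms n).1 * σ.1 := by
      change σ.1 * 1 = 1 * σ.1
      rw [mul_one, one_mul]
    rw [e4]
    exact e2
  have e5 : Idx.fix (Idx.norm s hs) σ * Idx.std s hs = Idx.std s' hs' * ρ := Subtype.ext e3
  funext i
  change A.act (i.fix σ) (Pi.single (M := fun _ => A.obj (n + 1) (a - e)) (Idx.norm s hs)
    (A.act (Idx.std s hs) x) i) = _
  by_cases hi : i = Idx.norm s hs
  · subst hi
    rw [Pi.single_eq_same, Pi.single_eq_same, ← A.act_mul, e5, A.act_mul]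
  · rw [Pi.single_eq_of_ne hi, Pi.single_eq_of_ne hi, map_zero]

theorem act_one {n : ℕ} {a : ℤ} (m : Marked A e n a) : act 1 m = m := by
  funext i
  have : i.fix (1 : F.perms n) = 1 := Subtype.ext (IsInduced.unique i.emb_le i.emb_le
    (Idx.isInduced_fix i 1 1) (IsInduced.one _))
  change A.act (i.fix 1) (m i) = m i
  rw [this, A.act_one]

theorem act_mul {n : ℕ} {a : ℤ} (σ τ : F.perms n) (m : Marked A e n a) :
    act (σ * τ) m = act σ (act τ m) := by
  funext i
  have : i.fix (σ * τ) = i.fix σ * i.fix τ := Subtype.ext (IsInduced.unique i.emb_le i.emb_le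
    (Idx.isInduced_fix i (σ * τ) 1) (IsInduced.mul (τ'' := 1) i.emb_le i.emb_le i.emb_le
      (Idx.isInduced_fix i τ 1) (Idx.isInduced_fix i σ 1)))
  change A.act (i.fix (σ * τ)) (m i) = A.act (i.fix σ) (A.act (i.fix τ) (m i))
  rw [this, A.act_mul]

theorem mark_emb {n : ℕ} {a : ℤ} (i : Idx F n) (x : A.obj (n + 1) (a - e)) :
    (mark i.emb x : Marked A e n a) = Pi.single i x := by
  have h := Idx.isInduced_std (F := F) i.emb i.emb_le 1
  rw [Idx.norm_emb] at h
  have : (Idx.std i.emb i.emb_le : F.perms (n + 1)) = 1 := Subtype.ext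
    (IsInduced.unique i.emb_le i.emb_le h (IsInduced.one _))
  rw [mark_eq i.emb_le, this, A.act_one, Idx.norm_emb]

theorem sum_mark {n : ℕ} {a : ℤ} (m : Marked A e n a) : ∑ i, mark i.emb (m i) = m := by
  simp only [mark_emb]
  exact Finset.univ_sum_single m

/-- Reduces additive statements about marked operations to `mark s x` with arbitrary s, for which
compositions are given by explicit formulas and no standard position has to be chosen. -/
theorem induction {n : ℕ} {a : ℤ} {P : Marked A e n a → Prop} (zero : P 0)
    (add : ∀ m m', P m → P m' → P (m + m'))
    (mark : ∀ s ≤ n, ∀ x, P (Marked.mark s x)) (m : Marked A e n a) : P m := by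
  rw [← sum_mark m]
  exact Finset.sum_induction _ P add zero fun i _ => mark _ i.emb_le _

/-- The linear map out of marked operations which is `φ s` on operations whose input `s` is
marked. -/
def desc {n : ℕ} {a : ℤ} {B : Type*} [AddCommGroup B] [Module k B]
    (φ : ℕ → A.obj (n + 1) (a - e) →ₗ[k] B) : Marked A e n a →ₗ[k] B :=
  ∑ i : Idx F n, φ i.emb ∘ₗ LinearMap.proj i

theorem desc_apply {n : ℕ} {a : ℤ} {B : Type*} [AddCommGroup B] [Module k B]
    (φ : ℕ → A.obj (n + 1) (a - e) →ₗ[k] B) (m : Marked A e n a) :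
    desc φ m = ∑ i, φ i.emb (m i) := by
  simp [desc]

/-- An operation is stored with its marked input moved to the standard position. The hypothesis on φ
says that its value does not change under this move. -/
theorem desc_mark {n : ℕ} {a : ℤ} {B : Type*} [AddCommGroup B] [Module k B]
    (φ : ℕ → A.obj (n + 1) (a - e) →ₗ[k] B)
    (hφ : ∀ s s' (ρ : F.perms (n + 1)), s ≤ n → s' ≤ n →
      IsInduced s s' ρ.1 (1 : F.perms 0).1 (1 : F.perms n).1 → ∀ x, φ s' (A.act ρ x) = φ s x)
    {s : ℕ} (hs : s ≤ n) (x : A.obj (n + 1) (a - e)) : desc φ (mark s x) = φ s x := by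
  rw [desc_apply, mark_eq hs, Finset.sum_eq_single (Idx.norm s hs)]
  · rw [Pi.single_eq_same]
    exact hφ _ _ _ hs (Idx.emb_le _) (Idx.isInduced_std s hs _) x
  · intro i _ hi
    rw [Pi.single_eq_of_ne hi, map_zero]
  · intro h
    exact absurd (Finset.mem_univ _) h

/-- Composition of an operation with a marked operation. -/
def lcomp {m n p : ℕ} {a b c : ℤ} (i j : ℕ) (hm : m = i + 1 + j) (hp : p = i + n + j)
    (hc : c = a + b) : A.obj m a →ₗ[k] Marked A e n b →ₗ[k] Marked A e p c :=
  (desc fun s => (A.comp i j hm (show p + 1 = i + (n + 1) + j by omega)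
    (show c - e = a + (b - e) by omega)).flip.compr₂ (mark (i + s))).flip

/-- Composition of a marked operation with an operation. -/
def rcomp {m n p : ℕ} {a b c : ℤ} (i j : ℕ) (hm : m = i + 1 + j) (hp : p = i + n + j)
    (hc : c = a + b) : Marked A e m a →ₗ[k] A.obj n b →ₗ[k] Marked A e p c :=
  desc fun s => ksign k (e * b) • (A.comp (raise s i) (m - raise s i)
    (show m + 1 = _ by rw [raise]; split_ifs <;> omega)
    (show p + 1 = _ by rw [raise]; split_ifs <;> omega)
    (show c - e = a - e + b by omega)).compr₂ (mark (markPos s i n))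

theorem lcomp_mark {m n p : ℕ} {a b c : ℤ} (i j : ℕ) (hm : m = i + 1 + j) (hp : p = i + n + j)
    (hc : c = a + b) (x : A.obj m a) {s : ℕ} (hs : s ≤ n) (w : A.obj (n + 1) (b - e)) :
    lcomp i j hm hp hc x (mark s w) = mark (i + s) (A.comp i j hm
      (show p + 1 = i + (n + 1) + j by omega) (show c - e = a + (b - e) by omega) x w) := by
  rw [lcomp, LinearMap.flip_apply, desc_mark _ ?_ hs]
  · rfl
  intro s s' ρ hs hs' h w
  refine LinearMap.ext fun x => ?_
  obtain ⟨υ', h1, h2⟩ := exists_isInduced_inner hm hp hm hp hs hs' 1 1 1 ρ 1 (IsInduced.one i) h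
  change mark (i + s') (A.comp i j hm _ _ x (A.act ρ w)) = mark (i + s) (A.comp i j hm _ _ x w)
  have e1 := A.comp_act i j i j hm (show p + 1 = i + (n + 1) + j by omega)
    (show c - e = a + (b - e) by omega) hm (show p + 1 = i + (n + 1) + j by omega) 1 ρ υ' h2 x w
  rw [A.act_one] at e1
  rw [← e1, ← act_mark (by omega) (by omega) h1, act_one]

theorem rcomp_mark {m n p : ℕ} {a b c : ℤ} (i j : ℕ) (hm : m = i + 1 + j) (hp : p = i + n + j)
    (hc : c = a + b) {s : ℕ} (hs : s ≤ m) (w : A.obj (m + 1) (a - e)) (z : A.obj n b) :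
    rcomp i j hm hp hc (mark s w) z = ksign k (e * b) • mark (markPos s i n)
      (A.comp (raise s i) (m - raise s i)
        (show m + 1 = _ by rw [raise]; split_ifs <;> omega)
        (show p + 1 = _ by rw [raise]; split_ifs <;> omega)
        (show c - e = a - e + b by omega) w z) := by
  rw [rcomp, desc_mark _ ?_ hs]
  · rfl
  intro s s' ρ hs hs' h w
  refine LinearMap.ext fun z => ?_
  obtain ⟨υ', h1, h2⟩ := exists_isInduced_outer hm hp hm hp hs hs' 1 1 1 ρ 1 (IsInduced.one i) h
  change ksign k (e * b) • mark _ (A.comp (raise s' i) (m - raise s' i) _ _ _ (A.act ρ w) z) =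
    ksign k (e * b) • mark _ (A.comp (raise s i) (m - raise s i) _ _ _ w z)
  have e1 := A.comp_act (raise s i) (m - raise s i) (raise s' i) (m - raise s' i)
    (show m + 1 = _ by rw [raise]; split_ifs <;> omega)
    (show p + 1 = _ by rw [raise]; split_ifs <;> omega)
    (show c - e = a - e + b by omega)
    (show m + 1 = _ by rw [raise]; split_ifs <;> omega)
    (show p + 1 = _ by rw [raise]; split_ifs <;> omega) ρ 1 υ' h2 w z
  rw [A.act_one] at e1
  rw [← e1, ← act_mark (by rw [markPos]; split_ifs <;> omega)
    (by rw [markPos]; split_ifs <;> omega) h1, act_one]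

theorem exists_isInduced : ∀ {F : Flavor} {n : ℕ} (s : ℕ) (_ : s ≤ n) (σ : F.perms n),
    ∃ ρ : F.perms (n + 1), IsInduced s s ρ.1 (1 : F.perms 0).1 σ.1
  | .symmetric, _, _, hs, σ => ⟨_, isInduced_extSym hs hs 1 σ⟩
  | .nonsymmetric, _, s, _, σ => ⟨1, by rw [Flavor.perms_eq_one σ]; exact IsInduced.one s⟩

theorem lcomp_act {m n p : ℕ} {a b c : ℤ} (i j i' j' : ℕ) (hm : m = i + 1 + j)
    (hp : p = i + n + j) (hc : c = a + b) (hm' : m = i' + 1 + j') (hp' : p = i' + n + j')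
    (σ : F.perms m) (τ : F.perms n) (υ : F.perms p) (h : IsInduced i i' σ.1 τ.1 υ.1)
    (x : A.obj m a) (y : Marked A e n b) :
    act υ (lcomp i j hm hp hc x y) = lcomp i' j' hm' hp' hc (A.act σ x) (act τ y) := by
  induction y using induction with
  | zero => simp
  | add y y' ih ih' => simp only [map_add, ih, ih']
  | mark s hs w =>
    obtain ⟨ρ, hρ⟩ := exists_isInduced s hs τ
    obtain ⟨υ', h1, h2⟩ := exists_isInduced_inner hm hp hm' hp' hs hs σ τ υ ρ 1 h hρ
    rw [lcomp_mark _ _ _ _ _ _ hs, act_mark hs hs hρ, lcomp_mark _ _ _ _ _ _ hs,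
      act_mark (by omega) (by omega) h1, A.comp_act i j i' j' _ _ _ hm' _ σ ρ υ' h2]

theorem rcomp_act {m n p : ℕ} {a b c : ℤ} (i j i' j' : ℕ) (hm : m = i + 1 + j)
    (hp : p = i + n + j) (hc : c = a + b) (hm' : m = i' + 1 + j') (hp' : p = i' + n + j')
    (σ : F.perms m) (τ : F.perms n) (υ : F.perms p) (h : IsInduced i i' σ.1 τ.1 υ.1)
    (x : Marked A e m a) (y : A.obj n b) :
    act υ (rcomp i j hm hp hc x y) = rcomp i' j' hm' hp' hc (act σ x) (A.act τ y) := by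
  induction x using induction with
  | zero => simp
  | add y y' ih ih' => simp only [map_add, LinearMap.add_apply, ih, ih']
  | mark s hs w =>
    obtain ⟨ρ, hρ⟩ := exists_isInduced s hs σ
    obtain ⟨υ', h1, h2⟩ := exists_isInduced_outer hm hp hm' hp' hs hs σ τ υ ρ 1 h hρ
    rw [rcomp_mark _ _ _ _ _ hs, act_mark hs hs hρ, rcomp_mark _ _ _ _ _ hs, map_smul,
      act_mark _ _ h1, A.comp_act _ _ (raise s i') (m - raise s i') _ _ _ _ _ ρ τ υ' h2]
    all_goals simp only [markPos]; split_ifs <;> omega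

/-- As in the five laws which follow, on `mark s w` the statement is an axiom of the operad A once
the positions on both sides have been identified by cases on the place of the marked input. -/
theorem seq_first {m n l p q r : ℕ} {a b c ab bc abc : ℤ} (i j i' j' : ℕ)
    (hm : m = i + 1 + j) (hn : n = i' + 1 + j') (hp : p = i + n + j)
    (hp' : p = (i + i') + 1 + (j' + j)) (hq : q = (i + i') + l + (j' + j))
    (hr : r = i' + l + j') (hq' : q = i + r + j)
    (h₁ : ab = a + b) (h₂ : abc = ab + c) (h₃ : bc = b + c) (h₄ : abc = a + bc)
    (x : Marked A e m a) (y : A.obj n b) (z : A.obj l c) :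
    rcomp (i + i') (j' + j) hp' hq h₂ (rcomp i j hm hp h₁ x y) z =
      rcomp i j hm hq' h₄ x (A.comp i' j' hn hr h₃ y z) := by
  induction x using induction with
  | zero => simp
  | add y y' ih ih' => simp only [map_add, LinearMap.add_apply, ih, ih']
  | mark s hs w =>
    have e1 : markPos (markPos s i n) (i + i') l = markPos s i r := by
      simp only [markPos]; split_ifs <;> omega
    have e2 : raise (markPos s i n) (i + i') = raise s i + i' := by
      simp only [markPos, raise]; split_ifs <;> omega
    have e3 : ksign k (e * bc) = ksign k (e * b + e * c) := by rw [h₃, mul_add]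
    rw [rcomp_mark _ _ _ _ _ hs, rcomp_mark _ _ _ _ _ hs, map_smul, LinearMap.smul_apply,
      rcomp_mark _ _ _ _ _ (by rw [markPos]; split_ifs <;> omega), smul_smul, ← ksign_add,
      e3, e1, A.comp_congr _ _ e2, A.comp_seq (raise s i) (m - raise s i) i' j']
    all_goals first
      | omega
      | (simp only [raise]; split_ifs <;> omega)

theorem seq_second {m n l p q r : ℕ} {a b c ab bc abc : ℤ} (i j i' j' : ℕ)
    (hm : m = i + 1 + j) (hn : n = i' + 1 + j') (hp : p = i + n + j)
    (hp' : p = (i + i') + 1 + (j' + j)) (hq : q = (i + i') + l + (j' + j))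
    (hr : r = i' + l + j') (hq' : q = i + r + j)
    (h₁ : ab = a + b) (h₂ : abc = ab + c) (h₃ : bc = b + c) (h₄ : abc = a + bc)
    (x : A.obj m a) (y : Marked A e n b) (z : A.obj l c) :
    rcomp (i + i') (j' + j) hp' hq h₂ (lcomp i j hm hp h₁ x y) z =
      lcomp i j hm hq' h₄ x (rcomp i' j' hn hr h₃ y z) := by
  induction y using induction with
  | zero => simp
  | add y y' ih ih' => simp only [map_add, LinearMap.add_apply, ih, ih']
  | mark s hs w =>
    have e1 : markPos (i + s) (i + i') l = i + markPos s i' l := by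
      simp only [markPos]; split_ifs <;> omega
    have e2 : raise (i + s) (i + i') = i + raise s i' := by
      simp only [raise]; split_ifs <;> omega
    rw [lcomp_mark _ _ _ _ _ _ hs, rcomp_mark _ _ _ _ _ hs, map_smul,
      rcomp_mark _ _ _ _ _ (by omega), lcomp_mark _ _ _ _ _ _ (by
        simp only [markPos]; split_ifs <;> omega), e1, A.comp_congr _ _ e2,
      A.comp_seq i j (raise s i') (n - raise s i')]
    all_goals first
      | omega
      | (simp only [raise]; split_ifs <;> omega)

theorem seq_third {m n l p q r : ℕ} {a b c ab bc abc : ℤ} (i j i' j' : ℕ)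
    (hm : m = i + 1 + j) (hn : n = i' + 1 + j') (hp : p = i + n + j)
    (hp' : p = (i + i') + 1 + (j' + j)) (hq : q = (i + i') + l + (j' + j))
    (hr : r = i' + l + j') (hq' : q = i + r + j)
    (h₁ : ab = a + b) (h₂ : abc = ab + c) (h₃ : bc = b + c) (h₄ : abc = a + bc)
    (x : A.obj m a) (y : A.obj n b) (z : Marked A e l c) :
    lcomp (i + i') (j' + j) hp' hq h₂ (A.comp i j hm hp h₁ x y) z =
      lcomp i j hm hq' h₄ x (lcomp i' j' hn hr h₃ y z) := by
  induction z using induction with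
  | zero => simp
  | add y y' ih ih' => simp only [map_add, ih, ih']
  | mark s hs w =>
    rw [lcomp_mark _ _ _ _ _ _ hs, lcomp_mark _ _ _ _ _ _ hs, lcomp_mark _ _ _ _ _ _ (by omega),
      A.comp_seq i j i' j', add_assoc]

theorem par_first {m n l p q r : ℕ} {a b c ab ac abc : ℤ} (i j j' : ℕ)
    (hm : m = i + 1 + (j + 1 + j')) (hm' : m = (i + 1 + j) + 1 + j')
    (hp : p = i + n + (j + 1 + j')) (hp' : p = (i + n + j) + 1 + j')
    (hq : q = (i + n + j) + l + j')
    (hr : r = (i + 1 + j) + l + j') (hr' : r = i + 1 + (j + l + j'))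
    (hq' : q = i + n + (j + l + j'))
    (h₁ : ab = a + b) (h₂ : abc = ab + c) (h₃ : ac = a + c) (h₄ : abc = ac + b)
    (x : Marked A e m a) (y : A.obj n b) (z : A.obj l c) :
    rcomp (i + n + j) j' hp' hq h₂ (rcomp i (j + 1 + j') hm hp h₁ x y) z =
      ksign k (b * c) •
        rcomp i (j + l + j') hr' hq' h₄ (rcomp (i + 1 + j) j' hm' hr h₃ x z) y := by
  induction x using induction with
  | zero => simp
  | add y y' ih ih' => simp only [map_add, LinearMap.add_apply, ih, ih', smul_add]
  | mark s hs w =>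
    have e1 : markPos (markPos s i n) (i + n + j) l = markPos (markPos s (i + 1 + j) l) i n := by
      simp only [markPos]; split_ifs <;> omega
    rw [rcomp_mark _ _ _ _ _ hs, rcomp_mark _ _ _ _ _ hs, map_smul, map_smul, LinearMap.smul_apply,
      LinearMap.smul_apply, rcomp_mark _ _ _ _ _ (by rw [markPos]; split_ifs <;> omega),
      rcomp_mark _ _ _ _ _ (by rw [markPos]; split_ifs <;> omega), smul_smul, smul_smul, e1,
      A.comp_par_congr (r := r + 1) (ac := ac - e) (i₃ := raise s (i + 1 + j))
        (j₃ := m - raise s (i + 1 + j)) (i₄ := raise (markPos s (i + 1 + j) l) i)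
        (j₄ := r - raise (markPos s (i + 1 + j) l) i), map_smul, smul_smul, smul_smul]
    · congr 1
      ring
    all_goals first
      | omega
      | (simp only [markPos, raise]; split_ifs <;> omega)

theorem par_second {m n l p q r : ℕ} {a b c ab ac abc : ℤ} (i j j' : ℕ)
    (hm : m = i + 1 + (j + 1 + j')) (hm' : m = (i + 1 + j) + 1 + j')
    (hp : p = i + n + (j + 1 + j')) (hp' : p = (i + n + j) + 1 + j')
    (hq : q = (i + n + j) + l + j')
    (hr : r = (i + 1 + j) + l + j') (hr' : r = i + 1 + (j + l + j'))
    (hq' : q = i + n + (j + l + j'))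
    (h₁ : ab = a + b) (h₂ : abc = ab + c) (h₃ : ac = a + c) (h₄ : abc = ac + b)
    (x : A.obj m a) (y : Marked A e n b) (z : A.obj l c) :
    rcomp (i + n + j) j' hp' hq h₂ (lcomp i (j + 1 + j') hm hp h₁ x y) z =
      ksign k (b * c) •
        lcomp i (j + l + j') hr' hq' h₄ (A.comp (i + 1 + j) j' hm' hr h₃ x z) y := by
  induction y using induction with
  | zero => simp
  | add y y' ih ih' => simp only [map_add, LinearMap.add_apply, ih, ih', smul_add]
  | mark s hs w =>
    have e1 : markPos (i + s) (i + n + j) l = i + s := by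
      simp only [markPos]; split_ifs <;> omega
    have e2 : ksign k (e * c) * ksign k ((b - e) * c) = ksign k (b * c) := by
      rw [← ksign_add]
      congr 1
      ring
    rw [lcomp_mark _ _ _ _ _ _ hs, lcomp_mark _ _ _ _ _ _ hs, rcomp_mark _ _ _ _ _ (by omega), e1,
      A.comp_par_congr (r := r) (ac := ac) (i₃ := i + 1 + j) (j₃ := j') (i₄ := i)
        (j₄ := j + l + j'), map_smul, smul_smul, e2]
    all_goals first
      | omega
      | (simp only [raise]; split_ifs <;> omega)

theorem par_third {m n l p q r : ℕ} {a b c ab ac abc : ℤ} (i j j' : ℕ)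
    (hm : m = i + 1 + (j + 1 + j')) (hm' : m = (i + 1 + j) + 1 + j')
    (hp : p = i + n + (j + 1 + j')) (hp' : p = (i + n + j) + 1 + j')
    (hq : q = (i + n + j) + l + j')
    (hr : r = (i + 1 + j) + l + j') (hr' : r = i + 1 + (j + l + j'))
    (hq' : q = i + n + (j + l + j'))
    (h₁ : ab = a + b) (h₂ : abc = ab + c) (h₃ : ac = a + c) (h₄ : abc = ac + b)
    (x : A.obj m a) (y : A.obj n b) (z : Marked A e l c) :
    lcomp (i + n + j) j' hp' hq h₂ (A.comp i (j + 1 + j') hm hp h₁ x y) z =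
      ksign k (b * c) •
        rcomp i (j + l + j') hr' hq' h₄ (lcomp (i + 1 + j) j' hm' hr h₃ x z) y := by
  induction z using induction with
  | zero => simp
  | add y y' ih ih' => simp only [map_add, LinearMap.add_apply, ih, ih', smul_add]
  | mark s hs w =>
    have e1 : markPos (i + 1 + j + s) i n = i + n + j + s := by
      simp only [markPos]; split_ifs <;> omega
    have e2 : ksign k (b * c) * ksign k (e * b) = ksign k (b * (c - e)) := by
      rw [← ksign_add]
      apply ksign_congr
      rw [mul_sub, mul_comm e b, Int.even_add, Int.even_sub]
    rw [lcomp_mark _ _ _ _ _ _ hs, lcomp_mark _ _ _ _ _ _ hs, rcomp_mark _ _ _ _ _ (by omega), e1,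
      A.comp_par_congr (r := r + 1) (ac := ac - e) (i₃ := i + 1 + j) (j₃ := j')
        (i₄ := raise (i + 1 + j + s) i) (j₄ := r - raise (i + 1 + j + s) i), map_smul, smul_smul, e2]
    all_goals first
      | omega
      | (simp only [raise]; split_ifs <;> omega)

/-! ### The infinitesimal bimodule of marked operations -/

/-- The scalar multiples of the trivial marked operation, which has no other inputs. -/
abbrev Scalars (k : Type u) (e : ℤ) (n : ℕ) (a : ℤ) : Type u := PLift (n = 0 ∧ a = e) → k

/-- An operation in equal arity and degree. -/
def _root_.CurvedTwisting.GrOperad.cast (A : GrOperad F k) {m m' : ℕ} {a a' : ℤ} (hm : m = m')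
    (ha : a = a') : A.obj m a →ₗ[k] A.obj m' a' := by
  subst hm ha
  exact LinearMap.id

/-- The composition with a trivial marked operation: the input `i` gets marked. -/
def lcompScalar {m n p : ℕ} {a b c : ℤ} (i j : ℕ) (hm : m = i + 1 + j) (hp : p = i + n + j)
    (hc : c = a + b) : A.obj m a →ₗ[k] Scalars k e n b →ₗ[k] Marked A e p c :=
  if h : n = 0 ∧ b = e then
    LinearMap.mk₂ k (fun x u => u ⟨h⟩ • mark i (A.cast (show m = p + 1 by omega)
      (show a = c - e by omega) x))
      (fun x x' u => by rw [map_add, map_add, smul_add])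
      (fun r x u => by rw [map_smul, map_smul, smul_comm])
      (fun x u u' => by rw [Pi.add_apply, add_smul])
      (fun r x u => by rw [Pi.smul_apply, smul_assoc])
  else 0

theorem lcompScalar_of_not {m n p : ℕ} {a b c : ℤ} (i j : ℕ) (hm : m = i + 1 + j)
    (hp : p = i + n + j) (hc : c = a + b) (h : ¬(n = 0 ∧ b = e)) (x : A.obj m a)
    (u : Scalars k e n b) : (lcompScalar i j hm hp hc x u : Marked A e p c) = 0 := by
  rw [lcompScalar, dif_neg h]
  rfl

theorem lcompScalar_apply {p : ℕ} {c : ℤ} (i j : ℕ) (hm : p + 1 = i + 1 + j)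
    (hp : p = i + 0 + j) (hc : c = c - e + e) (x : A.obj (p + 1) (c - e)) (u : Scalars k e 0 e) :
    (lcompScalar i j hm hp hc x u : Marked A e p c) = u ⟨rfl, rfl⟩ • mark i x := by
  rw [lcompScalar, dif_pos ⟨rfl, rfl⟩]
  rfl

theorem lcompScalar_act {m n p : ℕ} {a b c : ℤ} (i j i' j' : ℕ) (hm : m = i + 1 + j)
    (hp : p = i + n + j) (hc : c = a + b) (hm' : m = i' + 1 + j') (hp' : p = i' + n + j')
    (σ : F.perms m) (τ : F.perms n) (υ : F.perms p) (h : IsInduced i i' σ.1 τ.1 υ.1)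
    (x : A.obj m a) (u : Scalars k e n b) :
    act υ (lcompScalar i j hm hp hc x u : Marked A e p c) =
      lcompScalar i' j' hm' hp' hc (A.act σ x) u := by
  by_cases hn : n = 0 ∧ b = e
  · obtain ⟨rfl, rfl⟩ := hn
    obtain rfl : m = p + 1 := by omega
    obtain rfl : a = c - b := by omega
    rw [lcompScalar_apply, lcompScalar_apply, map_smul, act_mark (by omega) (by omega) h]
  · rw [lcompScalar_of_not _ _ _ _ _ hn, lcompScalar_of_not _ _ _ _ _ hn, map_zero]

theorem lcompScalar_seq {m n l p q r : ℕ} {a b c ab bc abc : ℤ} (i j i' j' : ℕ)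
    (hm : m = i + 1 + j) (hn : n = i' + 1 + j') (hp : p = i + n + j)
    (hp' : p = (i + i') + 1 + (j' + j)) (hq : q = (i + i') + l + (j' + j))
    (hr : r = i' + l + j') (hq' : q = i + r + j)
    (h₁ : ab = a + b) (h₂ : abc = ab + c) (h₃ : bc = b + c) (h₄ : abc = a + bc)
    (x : A.obj m a) (y : A.obj n b) (u : Scalars k e l c) :
    lcompScalar (i + i') (j' + j) hp' hq h₂ (A.comp i j hm hp h₁ x y) u =
      (lcomp i j hm hq' h₄ x (lcompScalar i' j' hn hr h₃ y u) : Marked A e q abc) := by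
  by_cases hl : l = 0 ∧ c = e
  · obtain ⟨rfl, rfl⟩ := hl
    obtain rfl : n = r + 1 := by omega
    obtain rfl : p = q + 1 := by omega
    obtain rfl : b = bc - c := by omega
    obtain rfl : ab = abc - c := by omega
    rw [lcompScalar_apply, lcompScalar_apply, map_smul, lcomp_mark _ _ _ _ _ _ (by omega)]
  · rw [lcompScalar_of_not _ _ _ _ _ hl, lcompScalar_of_not _ _ _ _ _ hl, map_zero]

theorem lcompScalar_par_second {m n l p q r : ℕ} {a b c ab ac abc : ℤ} (i j j' : ℕ)
    (hm : m = i + 1 + (j + 1 + j')) (hm' : m = (i + 1 + j) + 1 + j')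
    (hp : p = i + n + (j + 1 + j')) (hp' : p = (i + n + j) + 1 + j')
    (hq : q = (i + n + j) + l + j')
    (hr : r = (i + 1 + j) + l + j') (hr' : r = i + 1 + (j + l + j'))
    (hq' : q = i + n + (j + l + j'))
    (h₁ : ab = a + b) (h₂ : abc = ab + c) (h₃ : ac = a + c) (h₄ : abc = ac + b)
    (x : A.obj m a) (u : Scalars k e n b) (z : A.obj l c) :
    (rcomp (i + n + j) j' hp' hq h₂ (lcompScalar i (j + 1 + j') hm hp h₁ x u) z :
      Marked A e q abc) = ksign k (b * c) •
        lcompScalar i (j + l + j') hr' hq' h₄ (A.comp (i + 1 + j) j' hm' hr h₃ x z) u := by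
  by_cases hn : n = 0 ∧ b = e
  · obtain ⟨rfl, rfl⟩ := hn
    obtain rfl : m = p + 1 := by omega
    obtain rfl : r = q + 1 := by omega
    obtain rfl : a = ab - b := by omega
    obtain rfl : ac = abc - b := by omega
    have e1 : markPos i (i + 0 + j) l = i := by
      simp only [markPos]; split_ifs <;> omega
    have e2 : raise i (i + 0 + j) = i + 1 + j := by
      simp only [raise]; split_ifs <;> omega
    rw [lcompScalar_apply, lcompScalar_apply, map_smul, LinearMap.smul_apply,
      rcomp_mark _ _ _ _ _ (by omega), e1, smul_comm, A.comp_congr _ _ e2]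
  · rw [lcompScalar_of_not _ _ _ _ _ hn, lcompScalar_of_not _ _ _ _ _ hn, map_zero, smul_zero,
      LinearMap.zero_apply]

theorem lcompScalar_par_third {m n l p q r : ℕ} {a b c ab ac abc : ℤ} (i j j' : ℕ)
    (hm : m = i + 1 + (j + 1 + j')) (hm' : m = (i + 1 + j) + 1 + j')
    (hp : p = i + n + (j + 1 + j')) (hp' : p = (i + n + j) + 1 + j')
    (hq : q = (i + n + j) + l + j')
    (hr : r = (i + 1 + j) + l + j') (hr' : r = i + 1 + (j + l + j'))
    (hq' : q = i + n + (j + l + j'))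
    (h₁ : ab = a + b) (h₂ : abc = ab + c) (h₃ : ac = a + c) (h₄ : abc = ac + b)
    (x : A.obj m a) (y : A.obj n b) (u : Scalars k e l c) :
    (lcompScalar (i + n + j) j' hp' hq h₂ (A.comp i (j + 1 + j') hm hp h₁ x y) u :
      Marked A e q abc) = ksign k (b * c) •
        rcomp i (j + l + j') hr' hq' h₄ (lcompScalar (i + 1 + j) j' hm' hr h₃ x u) y := by
  by_cases hl : l = 0 ∧ c = e
  · obtain ⟨rfl, rfl⟩ := hl
    obtain rfl : m = r + 1 := by omega
    obtain rfl : p = q + 1 := by omega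
    obtain rfl : a = ac - c := by omega
    obtain rfl : ab = abc - c := by omega
    have e1 : markPos (i + 1 + j) i n = i + n + j := by
      simp only [markPos]; split_ifs <;> omega
    have e2 : i = raise (i + 1 + j) i := by
      simp only [raise]; split_ifs <;> omega
    rw [lcompScalar_apply, lcompScalar_apply, map_smul, LinearMap.smul_apply,
      rcomp_mark _ _ _ _ _ (by omega), e1, smul_smul, smul_smul, mul_comm c b, mul_right_comm,
      ksign_mul_self, one_mul, A.comp_congr _ _ e2]
  · rw [lcompScalar_of_not _ _ _ _ _ hl, lcompScalar_of_not _ _ _ _ _ hl, map_zero,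
      LinearMap.zero_apply, smul_zero]

end Marked

/-- The infinitesimal bimodule of operations with a marked input of degree `e`, including the
trivial one. -/
def markedMod (A : GrOperad F k) (e : ℤ) : InfMod A where
  -- Non-unital operads contain no identity operation, so the derivative of the variable with
  -- respect to itself has to be added by hand, as a scalar in arity 0 and degree e.
  obj n a := Marked A e n a × Marked.Scalars k e n a
  act σ := (Marked.act σ).prodMap LinearMap.id
  lcomp i j hm hp hc := LinearMap.mk₂ k
    (fun x y => (Marked.lcomp i j hm hp hc x y.1 + Marked.lcompScalar i j hm hp hc x y.2, 0))
    (fun x x' y => Prod.ext (by simp; abel) (by simp))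
    (fun c x y => Prod.ext (by simp) (by simp))
    (fun x y y' => Prod.ext (by simp; abel) (by simp))
    (fun c x y => Prod.ext (by simp) (by simp))
  rcomp i j hm hp hc := LinearMap.mk₂ k (fun x y => (Marked.rcomp i j hm hp hc x.1 y, 0))
    (fun x x' y => Prod.ext (by simp) (by simp))
    (fun c x y => Prod.ext (by simp) (by simp))
    (fun x y y' => Prod.ext (by simp) (by simp))
    (fun c x y => Prod.ext (by simp) (by simp))
  act_one x := Prod.ext (Marked.act_one x.1) rfl
  act_mul σ τ x := Prod.ext (Marked.act_mul σ τ x.1) rfl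
  lcomp_act i j i' j' hm hp hc hm' hp' σ τ ρ h x y := Prod.ext (by
    simp only [LinearMap.mk₂_apply, LinearMap.prodMap_apply, map_add, LinearMap.id_apply]
    rw [Marked.lcomp_act i j i' j' hm hp hc hm' hp' σ τ ρ h,
      Marked.lcompScalar_act i j i' j' hm hp hc hm' hp' σ τ ρ h]) rfl
  rcomp_act i j i' j' hm hp hc hm' hp' σ τ ρ h x y :=
    Prod.ext (Marked.rcomp_act i j i' j' hm hp hc hm' hp' σ τ ρ h x.1 y) rfl
  seq_first i j i' j' hm hn hp hp' hq hr hq' h₁ h₂ h₃ h₄ x y z :=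
    Prod.ext (Marked.seq_first i j i' j' hm hn hp hp' hq hr hq' h₁ h₂ h₃ h₄ x.1 y z) rfl
  seq_second i j i' j' hm hn hp hp' hq hr hq' h₁ h₂ h₃ h₄ x y z := Prod.ext (by
    simp only [LinearMap.mk₂_apply, map_zero, add_zero]
    -- The factor y receives z in one of its inputs, so its arity is not 0 and its scalar part does
    -- not contribute.
    rw [Marked.lcompScalar_of_not _ _ _ _ _ (by omega), add_zero,
      Marked.seq_second i j i' j' hm hn hp hp' hq hr hq' h₁ h₂ h₃ h₄]) rfl
  seq_third i j i' j' hm hn hp hp' hq hr hq' h₁ h₂ h₃ h₄ x y z := Prod.ext (by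
    simp only [LinearMap.mk₂_apply, map_zero, map_add, add_zero]
    rw [Marked.seq_third i j i' j' hm hn hp hp' hq hr hq' h₁ h₂ h₃ h₄,
      Marked.lcompScalar_seq i j i' j' hm hn hp hp' hq hr hq' h₁ h₂ h₃ h₄]) rfl
  par_first i j j' hm hm' hp hp' hq hr hr' hq' h₁ h₂ h₃ h₄ x y z := Prod.ext
    (Marked.par_first i j j' hm hm' hp hp' hq hr hr' hq' h₁ h₂ h₃ h₄ x.1 y z) (smul_zero _).symm
  par_second i j j' hm hm' hp hp' hq hr hr' hq' h₁ h₂ h₃ h₄ x y z := Prod.ext (by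
    simp only [LinearMap.mk₂_apply, map_add, LinearMap.add_apply, Prod.smul_fst, smul_add]
    rw [Marked.par_second i j j' hm hm' hp hp' hq hr hr' hq' h₁ h₂ h₃ h₄,
      Marked.lcompScalar_par_second i j j' hm hm' hp hp' hq hr hr' hq' h₁ h₂ h₃ h₄])
      (smul_zero _).symm
  par_third i j j' hm hm' hp hp' hq hr hr' hq' h₁ h₂ h₃ h₄ x y z := Prod.ext (by
    simp only [LinearMap.mk₂_apply, map_add, LinearMap.add_apply, Prod.smul_fst, smul_add]
    rw [Marked.par_third i j j' hm hm' hp hp' hq hr hr' hq' h₁ h₂ h₃ h₄,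
      Marked.lcompScalar_par_third i j j' hm hm' hp hp' hq hr hr' hq' h₁ h₂ h₃ h₄])
      (smul_zero _).symm

end Marked

end

end CurvedTwisting

namespace CurvedTwisting

noncomputable section

/-! ## Taylor expansions -/

section Taylor

variable {F : Flavor} {k : Type u} [Field k]

/-- Filling the marked input commutes with composition on the right. This is the parallel axiom,
read in one direction or the other according to the side of the marked input on which z is plugged
in; the sign cancels that of `Marked.rcomp`. -/
theorem plug_comp_outer (R : GrOperad F k) {e : ℤ} (y : R.obj 0 e) {m n p : ℕ} {a b c : ℤ} (i j : ℕ)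
    (hm : m = i + 1 + j) (hp : p = i + n + j) (hc : c = a + b) {s : ℕ} (hs : s ≤ m)
    (w : R.obj (m + 1) (a - e)) (z : R.obj n b) :
    ksign k (e * b) • plug R (show c = c - e + e by omega) p (markPos s i n) y
      (R.comp (raise s i) (m - raise s i)
        (show m + 1 = _ by rw [raise]; split_ifs <;> omega)
        (show p + 1 = _ by rw [raise]; split_ifs <;> omega)
        (show c - e = a - e + b by omega) w z) =
      R.comp i j hm hp hc (plug R (show a = a - e + e by omega) m s y w) z := by
  have hle : markPos s i n ≤ p := by rw [markPos]; split_ifs <;> omega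
  rw [← comp_eq_plug R _ (i := markPos s i n) (j := p - markPos s i n) (by omega) (by omega),
    ← comp_eq_plug R _ (i := s) (j := m - s) (by omega) (by omega)]
  by_cases h : s ≤ i
  · symm
    rw [R.comp_par_congr (r := p + 1) (ac := c - e) (i₃ := raise s i) (j₃ := m - raise s i)
      (i₄ := markPos s i n) (j₄ := p - markPos s i n)]
    all_goals first
      | omega
      | (simp only [markPos, raise]; split_ifs <;> omega)
  · rw [R.comp_par_congr (r := m) (ac := a) (i₃ := s) (j₃ := m - s) (i₄ := i) (j₄ := j),
      smul_smul, mul_comm b e, ksign_mul_self, one_smul]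
    all_goals first
      | omega
      | (simp only [markPos, raise]; split_ifs <;> omega)

theorem plug_comp_inner (R : GrOperad F k) {e : ℤ} (y : R.obj 0 e) {m n p : ℕ} {a b c : ℤ} (i j : ℕ)
    (hm : m = i + 1 + j) (hp : p = i + n + j) (hc : c = a + b) {s : ℕ} (hs : s ≤ n)
    (x : R.obj m a) (w : R.obj (n + 1) (b - e)) :
    plug R (show c = c - e + e by omega) p (i + s) y
      (R.comp i j hm (show p + 1 = i + (n + 1) + j by omega)
        (show c - e = a + (b - e) by omega) x w) =
      R.comp i j hm hp hc x (plug R (show b = b - e + e by omega) n s y w) := by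
  rw [← comp_eq_plug R _ (i := i + s) (j := (n - s) + j) (by omega) (by omega),
    ← comp_eq_plug R _ (i := s) (j := n - s) (by omega) (by omega),
    R.comp_seq i j s (n - s)]

/-- The value of a multiple of the trivial marked operation at `y`. -/
def scalarValue (R : GrOperad F k) {e : ℤ} (y : R.obj 0 e) {n : ℕ} {a : ℤ} :
    Marked.Scalars k e n a →ₗ[k] R.obj n a :=
  if h : n = 0 ∧ a = e then
    (LinearMap.proj ⟨h⟩ : Marked.Scalars k e n a →ₗ[k] k).smulRight
      (R.cast h.1.symm h.2.symm y)
  else 0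

theorem scalarValue_apply (R : GrOperad F k) {e : ℤ} (y : R.obj 0 e)
    (u : Marked.Scalars k e 0 e) : scalarValue R y u = u ⟨rfl, rfl⟩ • y := by
  rw [scalarValue, dif_pos ⟨rfl, rfl⟩]
  rfl

theorem scalarValue_of_not (R : GrOperad F k) {e : ℤ} (y : R.obj 0 e) {n : ℕ} {a : ℤ}
    (h : ¬(n = 0 ∧ a = e)) (u : Marked.Scalars k e n a) : scalarValue R y u = 0 := by
  rw [scalarValue, dif_neg h]
  rfl

theorem act_scalarValue (R : GrOperad F k) {e : ℤ} (y : R.obj 0 e) {n : ℕ} {a : ℤ}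
    (σ : F.perms n) (u : Marked.Scalars k e n a) :
    R.act σ (scalarValue R y u) = scalarValue R y u := by
  by_cases h : n = 0 ∧ a = e
  · obtain ⟨rfl, rfl⟩ := h
    rw [Subsingleton.elim σ 1, R.act_one]
  · rw [scalarValue_of_not R y h, map_zero]

/-- A derivation with values in marked operations. -/
structure MarkedDerivation (B : GrOperad F k) (e : ℤ) where
  D : ∀ {n : ℕ} {a : ℤ}, B.obj n a →ₗ[k] Marked B e n a
  scalar : ∀ {n : ℕ} {a : ℤ}, B.obj n a →ₗ[k] Marked.Scalars k e n a
  D_act : ∀ {n a} (σ : F.perms n) (x : B.obj n a), D (B.act σ x) = Marked.act σ (D x)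
  scalar_act : ∀ {n a} (σ : F.perms n) (x : B.obj n a), scalar (B.act σ x) = scalar x
  D_comp : ∀ {m n p : ℕ} {a b c : ℤ} (i j : ℕ) (hm : m = i + 1 + j) (hp : p = i + n + j)
    (hc : c = a + b) (x : B.obj m a) (y : B.obj n b),
      D (B.comp i j hm hp hc x y) = Marked.rcomp i j hm hp hc (D x) y +
        (Marked.lcomp i j hm hp hc x (D y) + Marked.lcompScalar i j hm hp hc x (scalar y))
  scalar_comp : ∀ {m n p : ℕ} {a b c : ℤ} (i j : ℕ) (hm : m = i + 1 + j) (hp : p = i + n + j)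
    (hc : c = a + b) (x : B.obj m a) (y : B.obj n b), scalar (B.comp i j hm hp hc x y) = 0

/-- The substitution of `y` for the marked input, after applying `φ`. -/
def fillMark {B R : GrOperad F k} {e : ℤ} (y : R.obj 0 e)
    (φ : ∀ {n : ℕ} {a : ℤ}, B.obj n a →ₗ[k] R.obj n a) {n : ℕ} {a : ℤ} :
    Marked B e n a →ₗ[k] R.obj n a :=
  Marked.desc fun s => plug R (show a = a - e + e by omega) n s y ∘ₗ φ

theorem plug_act (R : GrOperad F k) {e : ℤ} (y : R.obj 0 e) {n : ℕ} {a c : ℤ} (hc : c = a + e)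
    {s s' : ℕ} (hs : s ≤ n) (hs' : s' ≤ n) {ρ : F.perms (n + 1)} {σ : F.perms n}
    (h : IsInduced s s' ρ.1 (1 : F.perms 0).1 σ.1) (w : R.obj (n + 1) a) :
    plug R hc n s' y (R.act ρ w) = R.act σ (plug R hc n s y w) := by
  rw [← comp_eq_plug R hc (i := s') (j := n - s') (by omega) (by omega),
    ← comp_eq_plug R hc (i := s) (j := n - s) (by omega) (by omega),
    R.comp_act s (n - s) s' (n - s') (by omega) (by omega) hc (by omega) (by omega) ρ 1 σ h,
    R.act_one]

/-! ### Substitution for the marked input -/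

section Fill

variable {B R : GrOperad F k} {e : ℤ} (y : R.obj 0 e)
  (φ : ∀ {n : ℕ} {a : ℤ}, B.obj n a →ₗ[k] R.obj n a)

theorem fillMark_apply {n : ℕ} {a : ℤ} (m : Marked B e n a) : fillMark y φ m =
    ∑ i, plug R (show a = a - e + e by omega) n i.emb y (φ (m i)) :=
  Marked.desc_apply _ _

theorem fillMark_mark
    (hφ : ∀ {n : ℕ} {a : ℤ} (σ : F.perms n) (x : B.obj n a), φ (B.act σ x) = R.act σ (φ x))
    {n : ℕ} {a : ℤ} {s : ℕ} (hs : s ≤ n) (w : B.obj (n + 1) (a - e)) :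
    fillMark y φ (Marked.mark s w) = plug R (show a = a - e + e by omega) n s y (φ w) := by
  rw [fillMark, Marked.desc_mark _ ?_ hs]
  · rfl
  intro s s' ρ hs hs' h x
  rw [LinearMap.comp_apply, LinearMap.comp_apply, hφ, plug_act R y _ hs hs' h, R.act_one]

theorem fillMark_act
    (hφ : ∀ {n : ℕ} {a : ℤ} (σ : F.perms n) (x : B.obj n a), φ (B.act σ x) = R.act σ (φ x))
    {n : ℕ} {a : ℤ} (σ : F.perms n) (m : Marked B e n a) :
    fillMark y φ (Marked.act σ m) = R.act σ (fillMark y φ m) := by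
  induction m using Marked.induction with
  | zero => simp
  | add m m' ih ih' => simp only [map_add, ih, ih']
  | mark s hs w =>
    obtain ⟨ρ, hρ⟩ := Marked.exists_isInduced s hs σ
    rw [Marked.act_mark hs hs hρ, fillMark_mark y φ hφ hs, fillMark_mark y φ hφ hs, hφ,
      plug_act R y _ hs hs hρ]

end Fill

/-! ### Terms of the Taylor expansion and their Leibniz rule -/

namespace MarkedDerivation

variable {B R : GrOperad F k} {e : ℤ} (δ : MarkedDerivation B e) (G : GrHom B R) (y : R.obj 0 e)

/-- The terms of the Taylor expansion at the morphism `G`, evaluated at `y`. -/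
def taylor : ∀ (_ : ℕ) {n : ℕ} {a : ℤ}, B.obj n a →ₗ[k] R.obj n a
  | 0, _, _ => G.map
  | j + 1, _, _ => ((j + 1 : ℕ) : k)⁻¹ • (fillMark y (taylor j) ∘ₗ δ.D +
      if j = 0 then scalarValue R y ∘ₗ δ.scalar else 0)

theorem taylor_zero {n : ℕ} {a : ℤ} (x : B.obj n a) : δ.taylor G y 0 x = G.map x := rfl

theorem taylor_succ (j : ℕ) {n : ℕ} {a : ℤ} (x : B.obj n a) :
    δ.taylor G y (j + 1) x = ((j + 1 : ℕ) : k)⁻¹ • (fillMark y (δ.taylor G y j) (δ.D x) +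
      if j = 0 then scalarValue R y (δ.scalar x) else 0) := by
  rw [taylor]
  split_ifs <;> rfl

theorem taylor_act (j : ℕ) {n : ℕ} {a : ℤ} (σ : F.perms n) (x : B.obj n a) :
    δ.taylor G y j (B.act σ x) = R.act σ (δ.taylor G y j x) := by
  induction j generalizing n a with
  | zero => exact G.map_act σ x
  | succ j ih =>
    rw [taylor_succ, taylor_succ, δ.D_act, δ.scalar_act, fillMark_act y _ (fun σ x => ih σ x),
      map_smul, map_add]
    congr 2
    split_ifs
    · rw [act_scalarValue]
    · rw [map_zero]

theorem taylor_eq_zero {n : ℕ} {a : ℤ} (x : B.obj n a) (hD : δ.D x = 0) (hs : δ.scalar x = 0)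
    (j : ℕ) : δ.taylor G y (j + 1) x = 0 := by
  rw [taylor_succ, hD, hs]
  simp

theorem fillMark_lcompScalar (j : ℕ) {m n p : ℕ} {a b c : ℤ} (i i' : ℕ) (hm : m = i + 1 + i')
    (hp : p = i + n + i') (hc : c = a + b) (x : B.obj m a) (u : Marked.Scalars k e n b) :
    fillMark y (δ.taylor G y j) (Marked.lcompScalar i i' hm hp hc x u) =
      R.comp i i' hm hp hc (δ.taylor G y j x) (scalarValue R y u) := by
  by_cases hn : n = 0 ∧ b = e
  · obtain ⟨rfl, rfl⟩ := hn
    obtain rfl : m = p + 1 := by omega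
    obtain rfl : a = c - b := by omega
    rw [Marked.lcompScalar_apply, map_smul, fillMark_mark y _ (δ.taylor_act G y j) (by omega),
      scalarValue_apply, map_smul, comp_eq_plug]
  · rw [Marked.lcompScalar_of_not _ _ _ _ _ hn, scalarValue_of_not _ _ hn, map_zero, map_zero]

variable [CharZero k]

theorem succ_smul_taylor (j : ℕ) {n : ℕ} {a : ℤ} (x : B.obj n a) :
    (j + 1) • δ.taylor G y (j + 1) x = fillMark y (δ.taylor G y j) (δ.D x) +
      if j = 0 then scalarValue R y (δ.scalar x) else 0 := by
  rw [taylor_succ, ← Nat.cast_smul_eq_nsmul k, smul_smul, mul_inv_cancel₀, one_smul]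
  exact Nat.cast_ne_zero.2 j.succ_ne_zero

open Finset in
-- Leibniz rule for divided powers, by induction on the order: differentiate x or z once, apply the
-- induction hypothesis to the result and fill the new marked input. It makes the sum of the
-- expansion multiplicative.
theorem taylor_comp (j : ℕ) {m n p : ℕ} {a b c : ℤ} (i i' : ℕ) (hm : m = i + 1 + i')
    (hp : p = i + n + i') (hc : c = a + b) (x : B.obj m a) (z : B.obj n b) :
    δ.taylor G y j (B.comp i i' hm hp hc x z) = ∑ q ∈ HasAntidiagonal.antidiagonal j,
      R.comp i i' hm hp hc (δ.taylor G y q.1 x) (δ.taylor G y q.2 z) := by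
  induction j generalizing m n p a b c i i' with
  | zero =>
    rw [Finset.Nat.antidiagonal_zero, sum_singleton]
    exact G.map_comp i i' hm hp hc x z
  | succ j ih =>
    have h1 : ∀ w : Marked B e m a, fillMark y (δ.taylor G y j) (Marked.rcomp i i' hm hp hc w z) =
        ∑ q ∈ HasAntidiagonal.antidiagonal j,
          R.comp i i' hm hp hc (fillMark y (δ.taylor G y q.1) w) (δ.taylor G y q.2 z) := by
      intro w
      induction w using Marked.induction with
      | zero => simp
      | add w w' hw hw' => simp only [map_add, LinearMap.add_apply, hw, hw', sum_add_distrib]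
      | mark s hs w =>
        rw [Marked.rcomp_mark _ _ _ _ _ hs, map_smul, fillMark_mark y _ (δ.taylor_act G y j)
          (by rw [markPos]; split_ifs <;> omega), ih, map_sum, smul_sum]
        refine sum_congr rfl fun q _ => ?_
        rw [fillMark_mark y _ (δ.taylor_act G y _) hs, plug_comp_outer R y i i' hm hp hc hs]
    have h2 : ∀ w : Marked B e n b, fillMark y (δ.taylor G y j) (Marked.lcomp i i' hm hp hc x w) =
        ∑ q ∈ HasAntidiagonal.antidiagonal j,
          R.comp i i' hm hp hc (δ.taylor G y q.1 x) (fillMark y (δ.taylor G y q.2) w) := by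
      intro w
      induction w using Marked.induction with
      | zero => simp
      | add w w' hw hw' => simp only [map_add, hw, hw', sum_add_distrib]
      | mark s hs w =>
        rw [Marked.lcomp_mark _ _ _ _ _ _ hs, fillMark_mark y _ (δ.taylor_act G y j)
          (by omega), ih, map_sum]
        refine sum_congr rfl fun q _ => ?_
        rw [fillMark_mark y _ (δ.taylor_act G y _) hs, plug_comp_inner R y i i' hm hp hc hs]
    -- The trivial marked operation contributes to the term of order 1 of z only, which is the
    -- summand with q.2 = 0 before the order is raised.
    have h3 : ∑ q ∈ HasAntidiagonal.antidiagonal j, R.comp i i' hm hp hc (δ.taylor G y q.1 x)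
        (if q.2 = 0 then scalarValue R y (δ.scalar z) else 0) =
        R.comp i i' hm hp hc (δ.taylor G y j x) (scalarValue R y (δ.scalar z)) := by
      rw [sum_eq_single (j, 0)]
      · rw [if_pos rfl]
      · rintro ⟨q, q'⟩ hq hne
        rw [HasAntidiagonal.mem_antidiagonal] at hq
        rw [if_neg, map_zero]
        rintro rfl
        exact hne (Prod.ext hq rfl)
      · intro h
        exact absurd (HasAntidiagonal.mem_antidiagonal.2 (add_zero j)) h
    have h : (j + 1) • δ.taylor G y (j + 1) (B.comp i i' hm hp hc x z) = (j + 1) •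
        ∑ q ∈ HasAntidiagonal.antidiagonal (j + 1),
          R.comp i i' hm hp hc (δ.taylor G y q.1 x) (δ.taylor G y q.2 z) := by
      rw [succ_smul_taylor, ← sum_antidiagonal_leibniz j (fun q r =>
        R.comp i i' hm hp hc (δ.taylor G y q x) (δ.taylor G y r z)), δ.D_comp, δ.scalar_comp,
        map_zero, ite_self, add_zero, map_add, map_add, h1, h2, fillMark_lcompScalar, ← h3,
        ← sum_add_distrib, ← sum_add_distrib]
      refine sum_congr rfl fun q _ => ?_
      have e1 : (q.1 + 1) • R.comp i i' hm hp hc (δ.taylor G y (q.1 + 1) x) (δ.taylor G y q.2 z) =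
          R.comp i i' hm hp hc ((q.1 + 1) • δ.taylor G y (q.1 + 1) x) (δ.taylor G y q.2 z) := by
        rw [map_nsmul, LinearMap.smul_apply]
      -- The factor x has an input, hence no scalar part; only z can contribute a trivial marked
      -- operation.
      rw [e1, succ_smul_taylor, ← map_nsmul, succ_smul_taylor,
        scalarValue_of_not R y (by omega) (δ.scalar x), ite_self, add_zero, map_add]
    rw [← Nat.cast_smul_eq_nsmul k, ← Nat.cast_smul_eq_nsmul k] at h
    exact smul_right_injective _ (Nat.cast_ne_zero.2 j.succ_ne_zero) h

end MarkedDerivation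

open Finset in
theorem sum_range_antidiagonal {M : Type*} [AddCommMonoid M] (N N' : ℕ) (f : ℕ → ℕ → M)
    (h : ∀ i j, N ≤ i → f i j = 0) (h' : ∀ i j, N' ≤ j → f i j = 0) :
    ∑ t ∈ range (N + N'), ∑ q ∈ HasAntidiagonal.antidiagonal t, f q.1 q.2 =
      ∑ i ∈ range N, ∑ j ∈ range N', f i j := by
  rw [← sum_product' (range N) (range N') f,
    ← sum_fiberwise_of_maps_to (s := range N ×ˢ range N') (t := range (N + N'))
      (g := fun q => q.1 + q.2) (fun q hq => by
        simp only [mem_product, mem_range] at hq ⊢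
        omega)]
  refine sum_congr rfl fun t _ => (sum_subset (fun q hq => ?_) fun q hq hq' => ?_).symm
  · exact HasAntidiagonal.mem_antidiagonal.2 (mem_filter.1 hq).2
  · rw [HasAntidiagonal.mem_antidiagonal] at hq
    simp only [mem_filter, mem_product, mem_range, not_and] at hq'
    by_cases h1 : q.1 < N
    · by_cases h2 : q.2 < N'
      · exact absurd hq (hq' ⟨h1, h2⟩)
      · exact h' _ _ (not_lt.1 h2)
    · exact h _ _ (not_lt.1 h1)

open Finset in
/-- The sum of a family of linear maps which is finite on each element. -/
def locallyFiniteSum {M N : Type*} [AddCommGroup M] [Module k M] [AddCommGroup N] [Module k N]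
    (f : ℕ → M →ₗ[k] N) (h : ∀ x, ∃ K, ∀ j, K ≤ j → f j x = 0) : M →ₗ[k] N where
  toFun x := ∑ j ∈ range (h x).choose, f j x
  map_add' x y := by
    have key : ∀ x K, (h x).choose ≤ K → ∑ j ∈ range (h x).choose, f j x = ∑ j ∈ range K, f j x :=
      fun x K hK => sum_subset (range_subset_range.2 hK) fun j _ hj =>
        (h x).choose_spec j (by simpa using hj)
    rw [key (x + y) ((h (x + y)).choose + (h x).choose + (h y).choose) (by omega),
      key x ((h (x + y)).choose + (h x).choose + (h y).choose) (by omega),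
      key y ((h (x + y)).choose + (h x).choose + (h y).choose) (by omega), ← sum_add_distrib]
    simp only [map_add]
  map_smul' c x := by
    have key : ∀ x K, (h x).choose ≤ K → ∑ j ∈ range (h x).choose, f j x = ∑ j ∈ range K, f j x :=
      fun x K hK => sum_subset (range_subset_range.2 hK) fun j _ hj =>
        (h x).choose_spec j (by simpa using hj)
    rw [key (c • x) ((h (c • x)).choose + (h x).choose) (by omega),
      key x ((h (c • x)).choose + (h x).choose) (by omega), RingHom.id_apply, smul_sum]
    simp only [map_smul]

open Finset in
theorem locallyFiniteSum_eq {M N : Type*} [AddCommGroup M] [Module k M] [AddCommGroup N]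
    [Module k N] (f : ℕ → M →ₗ[k] N) (h : ∀ x, ∃ K, ∀ j, K ≤ j → f j x = 0) (x : M) (K : ℕ)
    (hK : ∀ j, K ≤ j → f j x = 0) : locallyFiniteSum f h x = ∑ j ∈ range K, f j x := by
  change ∑ j ∈ range (h x).choose, f j x = _
  have e1 : ∑ j ∈ range (h x).choose, f j x = ∑ j ∈ range ((h x).choose + K), f j x :=
    sum_subset (range_subset_range.2 (by omega)) fun j _ hj =>
      (h x).choose_spec j (by simpa using hj)
  have e2 : ∑ j ∈ range K, f j x = ∑ j ∈ range ((h x).choose + K), f j x :=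
    sum_subset (range_subset_range.2 (by omega)) fun j _ hj => hK j (by simpa using hj)
  rw [e1, e2]

/-! ### The sum of a locally finite Taylor expansion -/

namespace MarkedDerivation

variable {B R : GrOperad F k} {e : ℤ} (δ : MarkedDerivation B e) (G : GrHom B R) (y : R.obj 0 e)
  [CharZero k]
  (h : ∀ {n : ℕ} {a : ℤ} (x : B.obj n a), ∃ K, ∀ j, K ≤ j → δ.taylor G y j x = 0)

open Finset in
/-- The sum of the Taylor expansion. -/
def taylorHom : GrHom B R where
  map := locallyFiniteSum (fun j => δ.taylor G y j) h
  map_act σ x := by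
    obtain ⟨K, hK⟩ := h x
    rw [locallyFiniteSum_eq _ h _ K hK, locallyFiniteSum_eq _ h _ K (fun j hj => by
      rw [taylor_act, hK j hj, map_zero]), map_sum]
    simp only [taylor_act]
  map_comp i j hm hp hc x z := by
    obtain ⟨K, hK⟩ := h x
    obtain ⟨K', hK'⟩ := h z
    have h1 : ∀ q r, K ≤ q → R.comp i j hm hp hc (δ.taylor G y q x) (δ.taylor G y r z) = 0 :=
      fun q r hq => by rw [hK q hq, map_zero, LinearMap.zero_apply]
    have h2 : ∀ q r, K' ≤ r → R.comp i j hm hp hc (δ.taylor G y q x) (δ.taylor G y r z) = 0 :=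
      fun q r hr => by rw [hK' r hr, map_zero]
    rw [locallyFiniteSum_eq _ h _ K hK, locallyFiniteSum_eq _ h _ K' hK',
      locallyFiniteSum_eq _ h _ (K + K') fun t ht => ?_]
    · simp only [taylor_comp]
      rw [sum_range_antidiagonal K K' (fun q r => R.comp i j hm hp hc (δ.taylor G y q x)
        (δ.taylor G y r z)) h1 h2]
      simp only [map_sum, LinearMap.sum_apply]
      rw [sum_comm]
    · rw [taylor_comp]
      refine sum_eq_zero fun q hq => ?_
      rw [HasAntidiagonal.mem_antidiagonal] at hq
      by_cases hq1 : K ≤ q.1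
      · exact h1 _ _ hq1
      · exact h2 _ _ (by omega)

open Finset in
theorem taylorHom_eq {n : ℕ} {a : ℤ} (x : B.obj n a) (K : ℕ)
    (hK : ∀ j, K ≤ j → δ.taylor G y j x = 0) :
    (δ.taylorHom G y h).map x = ∑ j ∈ range K, δ.taylor G y j x :=
  locallyFiniteSum_eq _ h x K hK

theorem taylorHom_of_D_eq_zero {n : ℕ} {a : ℤ} (x : B.obj n a) (hD : δ.D x = 0)
    (hs : δ.scalar x = 0) : (δ.taylorHom G y h).map x = G.map x := by
  rw [taylorHom_eq _ _ _ _ x 1 fun j hj => ?_, Finset.sum_range_one, taylor_zero]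
  obtain ⟨j, rfl⟩ := Nat.exists_eq_succ_of_ne_zero (by omega : j ≠ 0)
  exact δ.taylor_eq_zero G y x hD hs j

/-- The variable itself has a Taylor expansion with two terms, of orders 0 and 1: its derivative is
the trivial marked operation. -/
theorem taylorHom_generator (x : B.obj 0 e) (hD : δ.D x = 0) (hs : δ.scalar x ⟨rfl, rfl⟩ = 1) :
    (δ.taylorHom G y h).map x = G.map x + y := by
  rw [taylorHom_eq _ _ _ _ x 2 fun j hj => ?_, Finset.sum_range_succ, Finset.sum_range_one,
    taylor_zero, taylor_succ, hD, map_zero, if_pos rfl, scalarValue_apply, hs]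
  · simp
  obtain ⟨j, rfl⟩ := Nat.exists_eq_add_of_le hj
  rw [show 2 + j = j + 1 + 1 by omega, taylor_succ, hD, map_zero, if_neg (by omega)]
  simp

end MarkedDerivation

end Taylor

end

end CurvedTwisting

namespace CurvedTwisting

noncomputable section

/-! ## The derivative with respect to `κ` -/

section Kappa

variable {F : Flavor} {k : Type u} [Field k]

/-- The derivative of elements of `Q ∨ [κ] ∨ [α]` with respect to `κ`, as a morphism to a square-zero
extension. -/
def kappaHom (Q : DGOperad F k) :
    GrHom (adjoin Q).toGrOperad (squareZero (markedMod (adjoin Q).toGrOperad (-1))) :=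
  adjoin.grLift ((squareZero.inl (markedMod (adjoin Q).toGrOperad (-1))).comp (incl Q).toGrHom)
    (alpha Q, 0) (kappa Q, (0, fun _ => 1))

theorem kappaHom_fst (Q : DGOperad F k) {n : ℕ} {a : ℤ} (x : (adjoin Q).obj n a) :
    ((kappaHom Q).map x).1 = x := by
  have h : (squareZero.fst _).comp (kappaHom Q) = GrHom.id _ :=
    adjoin.grHom_ext (fun _ => rfl) rfl rfl
  exact congrArg (fun f : GrHom (adjoin Q).toGrOperad (adjoin Q).toGrOperad => f.map x) h

/-- The derivative of elements of `Q ∨ [κ] ∨ [α]` with respect to `κ`. -/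
def kappaDeriv (Q : DGOperad F k) : MarkedDerivation (adjoin Q).toGrOperad (-1) where
  D :=
    { toFun := fun x => ((kappaHom Q).map x).2.1
      map_add' := fun x y => congrArg (fun z => z.2.1) (map_add (kappaHom Q).map x y)
      map_smul' := fun c x => congrArg (fun z => z.2.1) (map_smul (kappaHom Q).map c x) }
  scalar :=
    { toFun := fun x => ((kappaHom Q).map x).2.2
      map_add' := fun x y => congrArg (fun z => z.2.2) (map_add (kappaHom Q).map x y)
      map_smul' := fun c x => congrArg (fun z => z.2.2) (map_smul (kappaHom Q).map c x) }
  D_act σ x := congrArg (fun z => z.2.1) ((kappaHom Q).map_act σ x)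
  scalar_act σ x := congrArg (fun z => z.2.2) ((kappaHom Q).map_act σ x)
  D_comp i j hm hp hc x y := by
    refine (congrArg (fun z => z.2.1) ((kappaHom Q).map_comp i j hm hp hc x y)).trans ?_
    change Marked.rcomp i j hm hp hc ((kappaHom Q).map x).2.1 ((kappaHom Q).map y).1 +
      (Marked.lcomp i j hm hp hc ((kappaHom Q).map x).1 ((kappaHom Q).map y).2.1 +
        Marked.lcompScalar i j hm hp hc ((kappaHom Q).map x).1 ((kappaHom Q).map y).2.2) = _
    rw [kappaHom_fst, kappaHom_fst]
    rfl
  scalar_comp i j hm hp hc x y := by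
    refine (congrArg (fun z => z.2.2) ((kappaHom Q).map_comp i j hm hp hc x y)).trans ?_
    exact add_zero (0 : Marked.Scalars k (-1) _ _)

variable {Q : DGOperad F k}

theorem kappaDeriv_incl {n : ℕ} {a : ℤ} (x : Q.obj n a) :
    (kappaDeriv Q).D (app (incl Q) x) = 0 := rfl

theorem kappaDeriv_scalar_incl {n : ℕ} {a : ℤ} (x : Q.obj n a) :
    (kappaDeriv Q).scalar (app (incl Q) x) = 0 := rfl

theorem kappaDeriv_alpha : (kappaDeriv Q).D (alpha Q) = 0 := rfl

theorem kappaDeriv_scalar_alpha : (kappaDeriv Q).scalar (alpha Q) = 0 := rfl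

theorem kappaDeriv_kappa : (kappaDeriv Q).D (kappa Q) = 0 := rfl

theorem kappaDeriv_scalar_kappa : (kappaDeriv Q).scalar (kappa Q) ⟨rfl, rfl⟩ = 1 := rfl

/-- The elements which have one `κ` less than those of weight `t` with at most `N` copies of
`κ`. -/
def LowWeight (Q : DGOperad F k) (N t : ℕ) {n : ℕ} {a : ℤ} (w : (adjoin Q).obj n a) : Prop :=
  w = 0 ∨ ∃ N' t', N = N' + 1 ∧ t = t' + 1 ∧ Weight Q N' t' w

namespace LowWeight

theorem zero {N t n : ℕ} {a : ℤ} : LowWeight Q N t (0 : (adjoin Q).obj n a) := .inl rfl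

theorem mono {N N' t n : ℕ} {a : ℤ} {w : (adjoin Q).obj n a} (h : N ≤ N')
    (hw : LowWeight Q N t w) : LowWeight Q N' t w := by
  obtain rfl | ⟨M, s, rfl, rfl, hw⟩ := hw
  · exact zero
  · exact .inr ⟨N' - 1, s, by omega, rfl, .mono (by omega) hw⟩

theorem add {N t n : ℕ} {a : ℤ} {w w' : (adjoin Q).obj n a} (hw : LowWeight Q N t w)
    (hw' : LowWeight Q N t w') : LowWeight Q N t (w + w') := by
  obtain rfl | ⟨M, s, rfl, rfl, hw⟩ := hw
  · rwa [zero_add]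
  · obtain rfl | ⟨M', s', h, h', hw'⟩ := hw'
    · rw [add_zero]
      exact .inr ⟨M, s, rfl, rfl, hw⟩
    · obtain rfl : M = M' := by omega
      obtain rfl : s = s' := by omega
      exact .inr ⟨M, s, rfl, rfl, .add hw hw'⟩

theorem smul {N t n : ℕ} {a : ℤ} (c : k) {w : (adjoin Q).obj n a} (hw : LowWeight Q N t w) :
    LowWeight Q N t (c • w) := by
  obtain rfl | ⟨M, s, rfl, rfl, hw⟩ := hw
  · rw [smul_zero]; exact zero
  · exact .inr ⟨M, s, rfl, rfl, .smul c hw⟩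

theorem act {N t n : ℕ} {a : ℤ} (σ : F.perms n) {w : (adjoin Q).obj n a}
    (hw : LowWeight Q N t w) : LowWeight Q N t ((adjoin Q).act σ w) := by
  obtain rfl | ⟨M, s, rfl, rfl, hw⟩ := hw
  · rw [map_zero]; exact zero
  · exact .inr ⟨M, s, rfl, rfl, .act σ hw⟩

theorem comp_left {N t N' t' m n p : ℕ} {a b c : ℤ} (i j : ℕ) (hm : m = i + 1 + j)
    (hp : p = i + n + j) (hc : c = a + b) {x : (adjoin Q).obj m a} {y : (adjoin Q).obj n b}
    (hx : LowWeight Q N t x) (hy : Weight Q N' t' y) :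
    LowWeight Q (N + N') (t + t') ((adjoin Q).comp i j hm hp hc x y) := by
  obtain rfl | ⟨M, s, rfl, rfl, hx⟩ := hx
  · rw [map_zero]; exact zero
  · exact .inr ⟨M + N', s + t', by omega, by omega, .comp i j hm hp hc hx hy⟩

theorem comp_right {N t N' t' m n p : ℕ} {a b c : ℤ} (i j : ℕ) (hm : m = i + 1 + j)
    (hp : p = i + n + j) (hc : c = a + b) {x : (adjoin Q).obj m a} {y : (adjoin Q).obj n b}
    (hx : Weight Q N t x) (hy : LowWeight Q N' t' y) :
    LowWeight Q (N + N') (t + t') ((adjoin Q).comp i j hm hp hc x y) := by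
  obtain rfl | ⟨M, s, rfl, rfl, hy⟩ := hy
  · rw [map_zero]; exact zero
  · exact .inr ⟨N + M, t + s, by omega, by omega, .comp i j hm hp hc hx hy⟩

theorem mark {N t n : ℕ} {a : ℤ} (s : ℕ) {w : (adjoin Q).obj (n + 1) (a - (-1))}
    (hw : LowWeight Q N t w) (i : Idx F n) :
    LowWeight Q N t ((Marked.mark s w : Marked (adjoin Q).toGrOperad (-1) n a) i) := by
  by_cases hs : s ≤ n
  · rw [Marked.mark_eq hs]
    by_cases hi : i = Idx.norm s hs
    · subst hi
      rw [Pi.single_eq_same]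
      exact hw.act _
    · rw [Pi.single_eq_of_ne hi]
      exact zero
  · rw [Marked.mark, dif_neg hs]
    exact zero

theorem sum {N t n : ℕ} {a : ℤ} {ι : Type*} (s : Finset ι) (f : ι → (adjoin Q).obj n a)
    (h : ∀ i ∈ s, LowWeight Q N t (f i)) : LowWeight Q N t (∑ i ∈ s, f i) :=
  Finset.sum_induction f (LowWeight Q N t) (fun _ _ => add) zero h

end LowWeight

theorem Weight.cast {N t m m' : ℕ} {a a' : ℤ} (hm : m = m') (ha : a = a')
    {x : (adjoin Q).obj m a} (hx : Weight Q N t x) : Weight Q N t ((adjoin Q).cast hm ha x) := by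
  subst hm ha
  exact hx

/-- Differentiation removes one κ, so it lowers both the weight and the bound on κ by one. Only κ
itself, which has weight 1, contributes to the scalar part. `LowWeight` avoids truncated
subtraction, which would be wrong when there is no κ to remove. -/
theorem Weight.kappaDeriv {N t n : ℕ} {a : ℤ} {x : (adjoin Q).obj n a} (hx : Weight Q N t x) :
    (∀ i, LowWeight Q N t ((kappaDeriv Q).D x i)) ∧
      ((kappaDeriv Q).scalar x = 0 ∨ (t = 1 ∧ 1 ≤ N)) := by
  induction hx with
  | of x => exact ⟨fun i => .inl rfl, .inl rfl⟩
  | alpha => exact ⟨fun i => .inl rfl, .inl rfl⟩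
  | kappa => exact ⟨fun i => .inl rfl, .inr ⟨rfl, le_rfl⟩⟩
  | mono h _ ih => exact ⟨fun i => (ih.1 i).mono h, ih.2.imp id fun h' => ⟨h'.1, h'.2.trans h⟩⟩
  | zero => exact ⟨fun i => by rw [map_zero]; exact .zero, .inl (map_zero _)⟩
  | add _ _ ih ih' =>
    refine ⟨fun i => by rw [map_add]; exact (ih.1 i).add (ih'.1 i), ?_⟩
    rw [map_add]
    obtain h | h := ih.2
    · rw [h, zero_add]
      exact ih'.2
    · exact .inr h
  | smul c _ ih =>
    refine ⟨fun i => by rw [map_smul]; exact (ih.1 i).smul c, ?_⟩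
    rw [map_smul]
    obtain h | h := ih.2
    · exact .inl (by rw [h, smul_zero])
    · exact .inr h
  | act σ _ ih =>
    refine ⟨fun i => ?_, ?_⟩
    · rw [MarkedDerivation.D_act]
      exact (ih.1 i).act _
    · rw [MarkedDerivation.scalar_act]
      exact ih.2
  | @comp N t N' t' m n p a b c i j hm hp hc x y hx hy ih ih' =>
    refine ⟨fun q => ?_, .inl (MarkedDerivation.scalar_comp _ _ _ _ _ _ _ _)⟩
    rw [MarkedDerivation.D_comp]
    refine LowWeight.add ?_ (LowWeight.add ?_ ?_)
    · rw [Marked.rcomp, Marked.desc_apply, LinearMap.sum_apply, Finset.sum_apply]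
      refine LowWeight.sum _ _ fun r _ => LowWeight.smul _ (LowWeight.mark _ ?_ q)
      exact (ih.1 r).comp_left _ _ _ _ _ hy
    · rw [Marked.lcomp, LinearMap.flip_apply, Marked.desc_apply, LinearMap.sum_apply,
        Finset.sum_apply]
      refine LowWeight.sum _ _ fun r _ => LowWeight.mark _ ?_ q
      exact LowWeight.comp_right _ _ _ _ _ hx (ih'.1 r)
    · obtain h | ⟨h, h'⟩ := ih'.2
      · rw [h, map_zero]
        exact .zero
      · rw [Marked.lcompScalar]
        split_ifs
        -- A nonzero scalar part of y forces weight 1 and a bound of at least one κ. Replacing that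
        -- κ by the mark leaves x, of weight t, whose bound may be weakened to N + N' - 1.
        · refine LowWeight.smul _ (LowWeight.mark _ (.inr ⟨N + N' - 1, t, by omega, by omega, ?_⟩) q)
          exact .cast _ _ (.mono (by omega) hx)
        · exact .zero

theorem Weight.kappaDeriv_zero {N t n : ℕ} {a : ℤ} {x : (adjoin Q).obj n a} (hx : Weight Q N t x)
    (h : N = 0 ∨ t = 0) : (CurvedTwisting.kappaDeriv Q).D x = 0 := by
  funext i
  obtain h' | ⟨N', t', h1, h2, -⟩ := hx.kappaDeriv.1 i
  · exact h'
  · omega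

theorem Weight.kappaDeriv_succ {N t n : ℕ} {a : ℤ} {x : (adjoin Q).obj n a}
    (hx : Weight Q N (t + 1) x) (i : Idx F n) :
    Weight Q (N - 1) t ((CurvedTwisting.kappaDeriv Q).D x i) := by
  obtain h' | ⟨N', t', rfl, h2, h⟩ := hx.kappaDeriv.1 i
  · rw [h']
    exact .zero
  · obtain rfl : t = t' := by omega
    exact h

theorem Weight.kappaDeriv_scalar {N t n : ℕ} {a : ℤ} {x : (adjoin Q).obj n a}
    (hx : Weight Q N t x) (h : N = 0 ∨ t ≠ 1) : (CurvedTwisting.kappaDeriv Q).scalar x = 0 := by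
  obtain h' | h' := hx.kappaDeriv.2
  · exact h'
  · omega

/-! ### The derivative of series -/

/-- The coefficients of series. -/
def coeffHom (Q : DGOperad F k) {n : ℕ} {a : ℤ} (t : ℕ) : (cTw Q).obj n a →ₗ[k] (adjoin Q).obj n a where
  toFun f := coeff f t
  map_add' _ _ := rfl
  map_smul' _ _ := rfl

open Finset in
theorem coeffHom_comp {m n p : ℕ} {a b c : ℤ} (i j : ℕ) (hm : m = i + 1 + j)
    (hp : p = i + n + j) (hc : c = a + b) (f : (cTw Q).obj m a) (g : (cTw Q).obj n b) (t : ℕ) :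
    coeffHom Q t ((cTw Q).comp i j hm hp hc f g) = ∑ q ∈ HasAntidiagonal.antidiagonal t,
      (adjoin Q).comp i j hm hp hc (coeffHom Q q.1 f) (coeffHom Q q.2 g) := rfl

theorem coeffHom_act {n : ℕ} {a : ℤ} (σ : F.perms n) (f : (cTw Q).obj n a) (t : ℕ) :
    coeffHom Q t ((cTw Q).act σ f) = (adjoin Q).act σ (coeffHom Q t f) := rfl

theorem coeffHom_ext {n : ℕ} {a : ℤ} {f g : (cTw Q).obj n a}
    (h : ∀ t, coeffHom Q t f = coeffHom Q t g) : f = g := cTw_ext h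

theorem exists_weight {n : ℕ} {a : ℤ} (f : (cTw Q).obj n a) :
    ∃ N, ∀ t, Weight Q N t (coeffHom Q t f) := f.2

/-- The coefficients of marked series. -/
def markedCoeff (Q : DGOperad F k) {n : ℕ} {a e : ℤ} (t : ℕ) :
    Marked (cTw Q).toGrOperad e n a →ₗ[k] Marked (adjoin Q).toGrOperad e n a :=
  LinearMap.pi fun i => coeffHom Q t ∘ₗ LinearMap.proj i

theorem markedCoeff_ext {n : ℕ} {a e : ℤ} {m m' : Marked (cTw Q).toGrOperad e n a}
    (h : ∀ t, markedCoeff Q t m = markedCoeff Q t m') : m = m' :=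
  funext fun i => coeffHom_ext fun t => congrFun (h t) i

theorem markedCoeff_mark {n : ℕ} {a e : ℤ} (t : ℕ) {s : ℕ} (hs : s ≤ n)
    (w : (cTw Q).obj (n + 1) (a - e)) :
    markedCoeff Q t (Marked.mark s w : Marked (cTw Q).toGrOperad e n a) =
      Marked.mark s (coeffHom Q t w) := by
  rw [Marked.mark_eq hs, Marked.mark_eq hs]
  funext i
  change coeffHom Q t (Pi.single (M := fun _ => (cTw Q).obj (n + 1) (a - e)) (Idx.norm s hs)
    ((cTw Q).act (Idx.std s hs) w) i) = _
  by_cases hi : i = Idx.norm s hs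
  · subst hi
    rw [Pi.single_eq_same, Pi.single_eq_same]
    rfl
  · rw [Pi.single_eq_of_ne hi, Pi.single_eq_of_ne hi, map_zero]

open Finset in
theorem markedCoeff_rcomp {m n p : ℕ} {a b c e : ℤ} (i j : ℕ) (hm : m = i + 1 + j)
    (hp : p = i + n + j) (hc : c = a + b) (t : ℕ) (x : Marked (cTw Q).toGrOperad e m a)
    (g : (cTw Q).obj n b) :
    markedCoeff Q t (Marked.rcomp i j hm hp hc x g) = ∑ q ∈ HasAntidiagonal.antidiagonal t,
      Marked.rcomp i j hm hp hc (markedCoeff Q q.1 x) (coeffHom Q q.2 g) := by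
  induction x using Marked.induction with
  | zero => simp
  | add x x' hx hx' => simp only [map_add, LinearMap.add_apply, hx, hx', sum_add_distrib]
  | mark s hs w =>
    rw [Marked.rcomp_mark _ _ _ _ _ hs, map_smul, markedCoeff_mark _
      (by rw [markPos]; split_ifs <;> omega), coeffHom_comp, map_sum, smul_sum]
    refine sum_congr rfl fun q _ => ?_
    rw [markedCoeff_mark _ hs, Marked.rcomp_mark _ _ _ _ _ hs]

open Finset in
theorem markedCoeff_lcomp {m n p : ℕ} {a b c e : ℤ} (i j : ℕ) (hm : m = i + 1 + j)
    (hp : p = i + n + j) (hc : c = a + b) (t : ℕ) (f : (cTw Q).obj m a)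
    (x : Marked (cTw Q).toGrOperad e n b) :
    markedCoeff Q t (Marked.lcomp i j hm hp hc f x) = ∑ q ∈ HasAntidiagonal.antidiagonal t,
      Marked.lcomp i j hm hp hc (coeffHom Q q.1 f) (markedCoeff Q q.2 x) := by
  induction x using Marked.induction with
  | zero => simp
  | add x x' hx hx' => simp only [map_add, hx, hx', sum_add_distrib]
  | mark s hs w =>
    rw [Marked.lcomp_mark _ _ _ _ _ _ hs, markedCoeff_mark _ (by omega), coeffHom_comp, map_sum]
    refine sum_congr rfl fun q _ => ?_
    rw [markedCoeff_mark _ hs, Marked.lcomp_mark _ _ _ _ _ _ hs]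

theorem markedCoeff_lcompScalar {m n p : ℕ} {a b c e : ℤ} (i j : ℕ) (hm : m = i + 1 + j)
    (hp : p = i + n + j) (hc : c = a + b) (t : ℕ) (f : (cTw Q).obj m a)
    (x : Marked.Scalars k e n b) :
    markedCoeff Q t (Marked.lcompScalar i j hm hp hc f x) =
      Marked.lcompScalar i j hm hp hc (coeffHom Q t f) x := by
  by_cases hn : n = 0 ∧ b = e
  · obtain ⟨rfl, rfl⟩ := hn
    obtain rfl : m = p + 1 := by omega
    obtain rfl : a = c - b := by omega
    rw [Marked.lcompScalar_apply, Marked.lcompScalar_apply, map_smul, markedCoeff_mark _ (by omega)]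
  · rw [Marked.lcompScalar_of_not _ _ _ _ _ hn, Marked.lcompScalar_of_not _ _ _ _ _ hn, map_zero]

/-- The derivative of series with respect to `κ`. -/
def seriesDeriv (Q : DGOperad F k) {n : ℕ} {a : ℤ} :
    (cTw Q).obj n a →ₗ[k] Marked (cTw Q).toGrOperad (-1) n a where
  -- The shift to t + 1 accounts for the κ that is removed: the derivative of a coefficient of
  -- weight t + 1 has weight t.
  toFun f i := ⟨fun t => (kappaDeriv Q).D (coeffHom Q (t + 1) f) i, by
    obtain ⟨N, hN⟩ := exists_weight f
    exact ⟨N - 1, fun t => (hN (t + 1)).kappaDeriv_succ i⟩⟩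
  map_add' f g := markedCoeff_ext fun t => map_add ((kappaDeriv Q).D ∘ₗ coeffHom Q (t + 1)) f g
  map_smul' c f := markedCoeff_ext fun t => map_smul ((kappaDeriv Q).D ∘ₗ coeffHom Q (t + 1)) c f

theorem markedCoeff_seriesDeriv {n : ℕ} {a : ℤ} (f : (cTw Q).obj n a) (t : ℕ) :
    markedCoeff Q t (seriesDeriv Q f) = (kappaDeriv Q).D (coeffHom Q (t + 1) f) := rfl

theorem kappaDeriv_coeffHom_zero {n : ℕ} {a : ℤ} (f : (cTw Q).obj n a) :
    (kappaDeriv Q).D (coeffHom Q 0 f) = 0 := by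
  obtain ⟨N, hN⟩ := exists_weight f
  exact (hN 0).kappaDeriv_zero (.inr rfl)

theorem kappaDeriv_scalar_coeffHom {n : ℕ} {a : ℤ} (f : (cTw Q).obj n a) {t : ℕ} (ht : t ≠ 1) :
    (kappaDeriv Q).scalar (coeffHom Q t f) = 0 := by
  obtain ⟨N, hN⟩ := exists_weight f
  exact (hN t).kappaDeriv_scalar (.inr ht)

open Finset in
/-- The derivative of series with respect to `κ`, as a derivation. -/
def cTwDeriv (Q : DGOperad F k) : MarkedDerivation (cTw Q).toGrOperad (-1) where
  D := seriesDeriv Q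
  scalar := (kappaDeriv Q).scalar ∘ₗ coeffHom Q 1
  D_act σ f := markedCoeff_ext fun t => (kappaDeriv Q).D_act σ (coeffHom Q (t + 1) f)
  scalar_act σ f := (kappaDeriv Q).scalar_act σ (coeffHom Q 1 f)
  D_comp i j hm hp hc f g := by
    refine markedCoeff_ext fun t => ?_
    -- Scalar parts come from coefficients of weight 1 alone, so a single term of the antidiagonal
    -- survives.
    have h3 : ∑ q ∈ HasAntidiagonal.antidiagonal t, (Marked.lcompScalar i j hm hp hc
        (coeffHom Q q.1 f) ((kappaDeriv Q).scalar (coeffHom Q (q.2 + 1) g)) :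
          Marked (adjoin Q).toGrOperad (-1) _ _) = Marked.lcompScalar i j hm hp hc
        (coeffHom Q t f) ((kappaDeriv Q).scalar (coeffHom Q 1 g)) := by
      rw [sum_eq_single (t, 0)]
      · rintro ⟨q, q'⟩ hq hne
        rw [HasAntidiagonal.mem_antidiagonal] at hq
        rw [kappaDeriv_scalar_coeffHom g, map_zero]
        intro h
        obtain rfl : q' = 0 := by simpa using h
        exact hne (Prod.ext hq rfl)
      · intro h
        exact absurd (HasAntidiagonal.mem_antidiagonal.2 (add_zero t)) h
    rw [map_add, map_add, markedCoeff_rcomp, markedCoeff_lcomp, markedCoeff_lcompScalar,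
      markedCoeff_seriesDeriv, coeffHom_comp, map_sum]
    simp only [(kappaDeriv Q).D_comp, markedCoeff_seriesDeriv]
    -- The product in weight t + 1 has one more term than the products in weight t. In the extra
    -- terms a coefficient of weight 0 is differentiated, or its scalar part is taken, so they
    -- vanish.
    rw [sum_add_distrib, sum_add_distrib, Finset.Nat.sum_antidiagonal_succ,
      Finset.Nat.sum_antidiagonal_succ', Finset.Nat.sum_antidiagonal_succ']
    simp only [kappaDeriv_coeffHom_zero, kappaDeriv_scalar_coeffHom g zero_ne_one, map_zero,
      LinearMap.zero_apply, zero_add]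
    rw [h3]
    rfl
  scalar_comp i j hm hp hc f g := by
    rw [LinearMap.comp_apply, coeffHom_comp, map_sum]
    exact sum_eq_zero fun q _ => (kappaDeriv Q).scalar_comp i j hm hp hc _ _

theorem cTwDeriv_D {n : ℕ} {a : ℤ} (f : (cTw Q).obj n a) : (cTwDeriv Q).D f = seriesDeriv Q f := rfl

theorem cTwDeriv_scalar {n : ℕ} {a : ℤ} (f : (cTw Q).obj n a) :
    (cTwDeriv Q).scalar f = (kappaDeriv Q).scalar (coeffHom Q 1 f) := rfl

/-- More than N derivatives kill a series with at most N copies of κ in each term. This is where the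
uniform bound on κ in the definition of cTw is needed: it makes the expansion finite although there
are infinitely many powers of α. -/
theorem cTwDeriv_taylor_eq_zero {R : GrOperad F k} (G : GrHom (cTw Q).toGrOperad R)
    (y : R.obj 0 (-1)) (j : ℕ) : ∀ {N n : ℕ} {a : ℤ} (f : (cTw Q).obj n a),
    (∀ t, Weight Q N t (coeffHom Q t f)) → N < j → (cTwDeriv Q).taylor G y j f = 0 := by
  induction j with
  | zero => exact fun _ _ h => absurd h (Nat.not_lt_zero _)
  | succ j ih =>
    intro N n a f hf hj
    rcases Nat.eq_zero_or_pos N with rfl | hN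
    · refine MarkedDerivation.taylor_eq_zero _ _ _ _ (markedCoeff_ext fun t => ?_) ?_ j
      · exact (hf (t + 1)).kappaDeriv_zero (.inl rfl)
      · exact (hf 1).kappaDeriv_scalar (.inl rfl)
    · rw [MarkedDerivation.taylor_succ, if_neg (by omega), add_zero, fillMark_apply,
        Finset.sum_eq_zero, smul_zero]
      intro i _
      rw [ih (N := N - 1) (cTwDeriv Q |>.D f i) (fun t => (hf (t + 1)).kappaDeriv_succ i) (by omega),
        map_zero]

end Kappa

end

end CurvedTwisting

namespace CurvedTwisting

noncomputable section

/-! ## `cTw(Q)` as a coproduct -/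

section Coproduct

variable {F : Flavor} {k : Type u} [Field k] {Q : DGOperad F k}

/-- The series without `κ`. -/
def noKappa (Q : DGOperad F k) : SubOperad (cTw Q).toGrOperad where
  carrier n a :=
    { carrier := {f | ∀ t, Weight Q 0 t (coeffHom Q t f)}
      zero_mem' := fun t => by rw [map_zero]; exact .zero
      add_mem' := fun hf hg t => by rw [map_add]; exact .add (hf t) (hg t)
      smul_mem' := fun c f hf t => by rw [map_smul]; exact .smul c (hf t) }
  act_mem σ _ hf t := .act σ (hf t)
  comp_mem i j hm hp hc f g hf hg t := by
    rw [coeffHom_comp]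
    refine .sum _ _ fun q hq => ?_
    rw [← Finset.HasAntidiagonal.mem_antidiagonal.1 hq]
    exact .comp i j hm hp hc (hf _) (hg _)

/-- The endomorphism of `Q ∨ [κ] ∨ [α]` which sends `κ` to `0`. -/
def killKappa (Q : DGOperad F k) : GrHom (adjoin Q).toGrOperad (adjoin Q).toGrOperad :=
  adjoin.grLift (incl Q).toGrHom (alpha Q) 0

theorem Weight.killKappa {N t n : ℕ} {a : ℤ} {x : (adjoin Q).obj n a} (hx : Weight Q N t x) :
    Weight Q 0 t ((killKappa Q).map x) := by
  induction hx with
  | of x => exact .of x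
  | alpha => exact .alpha
  | kappa => exact .zero
  | mono _ _ ih => exact ih
  | zero => rw [map_zero]; exact .zero
  | add _ _ ih ih' => rw [map_add]; exact .add ih ih'
  | smul c _ ih => rw [map_smul]; exact .smul c ih
  | act σ _ ih => rw [GrHom.map_act]; exact .act σ ih
  | comp i j hm hp hc _ _ ih ih' => rw [GrHom.map_comp]; exact .comp i j hm hp hc ih ih'

theorem Weight.killKappa_eq {N t n : ℕ} {a : ℤ} {x : (adjoin Q).obj n a} (hx : Weight Q N t x)
    (hN : N = 0) : (CurvedTwisting.killKappa Q).map x = x := by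
  induction hx with
  | of x => rfl
  | alpha => rfl
  | kappa => omega
  | mono h _ ih => exact ih (by omega)
  | zero => exact map_zero _
  | add _ _ ih ih' => rw [map_add, ih hN, ih' hN]
  | smul c _ ih => rw [map_smul, ih hN]
  | act σ _ ih => rw [GrHom.map_act, ih hN]
  | comp i j hm hp hc _ _ ih ih' => rw [GrHom.map_comp, ih (by omega), ih' (by omega)]

/-- The morphism which sends `κ` to `0`, for series. -/
def killKappaHat (Q : DGOperad F k) : GrHom (cTw Q).toGrOperad (noKappa Q).toGrOperad where
  map :=
    { toFun := fun f => ⟨⟨fun t => (killKappa Q).map (coeffHom Q t f), by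
        obtain ⟨N, hN⟩ := exists_weight f
        exact ⟨0, fun t => (hN t).killKappa⟩⟩, by
        obtain ⟨N, hN⟩ := exists_weight f
        exact fun t => (hN t).killKappa⟩
      map_add' := fun f g => Subtype.ext (coeffHom_ext fun t =>
        map_add ((killKappa Q).map ∘ₗ coeffHom Q t) f g)
      map_smul' := fun c f => Subtype.ext (coeffHom_ext fun t =>
        map_smul ((killKappa Q).map ∘ₗ coeffHom Q t) c f) }
  map_act σ f := Subtype.ext (coeffHom_ext fun t => (killKappa Q).map_act σ (coeffHom Q t f))
  map_comp i j hm hp hc f g := Subtype.ext (coeffHom_ext fun t => by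
    change (killKappa Q).map (∑ q ∈ Finset.HasAntidiagonal.antidiagonal t,
      (adjoin Q).comp i j hm hp hc (coeffHom Q q.1 f) (coeffHom Q q.2 g)) =
      ∑ q ∈ Finset.HasAntidiagonal.antidiagonal t, (adjoin Q).comp i j hm hp hc
        ((killKappa Q).map (coeffHom Q q.1 f)) ((killKappa Q).map (coeffHom Q q.2 g))
    rw [map_sum]
    exact Finset.sum_congr rfl fun q _ =>
      (killKappa Q).map_comp i j hm hp hc (coeffHom Q q.1 f) (coeffHom Q q.2 g))

theorem coeffHom_killKappaHat {n : ℕ} {a : ℤ} (f : (cTw Q).obj n a) (t : ℕ) :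
    coeffHom Q t ((killKappaHat Q).map f).1 = (killKappa Q).map (coeffHom Q t f) := rfl

theorem killKappaHat_eq {n : ℕ} {a : ℤ} (f : (noKappa Q).carrier n a) :
    (killKappaHat Q).map f.1 = f :=
  Subtype.ext (coeffHom_ext fun t => (f.2 t).killKappa_eq rfl)

theorem coeffHom_kappaHat (t : ℕ) :
    coeffHom Q t (kappaHat Q) = if t = 1 then kappa Q else 0 := by
  change (Pi.single 1 (kappa Q) : ℕ → _) t = _
  rw [Pi.single_apply]

theorem coeffHom_alphaHat (t : ℕ) :
    coeffHom Q t (alphaHat Q) = if t = 1 then alpha Q else 0 := by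
  change (Pi.single 1 (alpha Q) : ℕ → _) t = _
  rw [Pi.single_apply]

theorem coeffHom_const {n : ℕ} {a : ℤ} (x : Q.obj n a) (t : ℕ) :
    coeffHom Q t (const x) = if t = 0 then app (incl Q) x else 0 := by
  change (Pi.single 0 (app (incl Q) x) : ℕ → _) t = _
  rw [Pi.single_apply]

theorem alphaHat_mem : alphaHat Q ∈ (noKappa Q).carrier 0 0 := fun t => by
  rw [coeffHom_alphaHat]
  split_ifs with h
  · subst h; exact .alpha
  · exact .zero

theorem const_mem {n : ℕ} {a : ℤ} (x : Q.obj n a) : const x ∈ (noKappa Q).carrier n a := fun t => by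
  rw [coeffHom_const]
  split_ifs with h
  · subst h; exact .of x
  · exact .zero

theorem killKappaHat_kappaHat : (killKappaHat Q).map (kappaHat Q) = 0 :=
  Subtype.ext (coeffHom_ext fun t => by
    rw [coeffHom_killKappaHat, coeffHom_kappaHat]
    split_ifs
    · rfl
    · exact map_zero _)

theorem coeffHom_plug_zero {n s : ℕ} {a c : ℤ} (hc : c = a + -1) (w : (cTw Q).obj (n + 1) a) :
    coeffHom Q 0 (plug (cTw Q).toGrOperad hc n s (kappaHat Q) w) = 0 := by
  by_cases hs : s ≤ n
  · rw [← comp_eq_plug _ hc (i := s) (j := n - s) (by omega) (by omega), coeffHom_comp,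
      Finset.Nat.antidiagonal_zero, Finset.sum_singleton, coeffHom_kappaHat, if_neg (by omega),
      map_zero]
  · rw [plug, dif_neg hs]
    rfl

theorem coeffHom_plug_succ {n s : ℕ} {a c : ℤ} (hc : c = a + -1) (w : (cTw Q).obj (n + 1) a)
    (t : ℕ) : coeffHom Q (t + 1) (plug (cTw Q).toGrOperad hc n s (kappaHat Q) w) =
      plug (adjoin Q).toGrOperad hc n s (kappa Q) (coeffHom Q t w) := by
  by_cases hs : s ≤ n
  · rw [← comp_eq_plug _ hc (i := s) (j := n - s) (by omega) (by omega),
      ← comp_eq_plug _ hc (i := s) (j := n - s) (by omega) (by omega), coeffHom_comp,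
      Finset.sum_eq_single (t, 1)]
    · rw [coeffHom_kappaHat, if_pos rfl]
    · rintro ⟨q, q'⟩ hq hne
      rw [Finset.HasAntidiagonal.mem_antidiagonal] at hq
      rw [coeffHom_kappaHat, if_neg, map_zero]
      rintro rfl
      exact hne (Prod.ext (Nat.succ_injective hq) rfl)
    · intro h
      exact absurd (Finset.HasAntidiagonal.mem_antidiagonal.2
        (show ((t, 1) : ℕ × ℕ).1 + (t, 1).2 = t + 1 from rfl)) h
  · rw [plug, dif_neg hs, plug, dif_neg hs]
    rfl

/-- The terms of the Taylor expansion of a series are those of its coefficients. -/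
theorem coeffHom_taylor (j : ℕ) : ∀ {n : ℕ} {a : ℤ} (f : (cTw Q).obj n a) (t : ℕ),
    coeffHom Q t ((cTwDeriv Q).taylor ((noKappa Q).incl.comp (killKappaHat Q)) (kappaHat Q) j f) =
      (kappaDeriv Q).taylor (killKappa Q) (kappa Q) j (coeffHom Q t f) := by
  induction j with
  | zero => exact fun f t => rfl
  | succ j ih =>
    intro n a f t
    rw [MarkedDerivation.taylor_succ, MarkedDerivation.taylor_succ, map_smul, map_add,
      fillMark_apply, fillMark_apply, map_sum]
    congr 2
    · cases t with
      | zero =>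
        rw [Finset.sum_eq_zero fun i _ => coeffHom_plug_zero _ _, Finset.sum_eq_zero]
        intro i _
        rw [kappaDeriv_coeffHom_zero, Pi.zero_apply, map_zero, map_zero]
      | succ t =>
        refine Finset.sum_congr rfl fun i _ => ?_
        rw [coeffHom_plug_succ, ih]
        rfl
    · split_ifs with hj
      · by_cases h : n = 0 ∧ a = -1
        · obtain ⟨rfl, rfl⟩ := h
          rw [scalarValue_apply, scalarValue_apply, map_smul, coeffHom_kappaHat]
          by_cases ht : t = 1
          · subst ht
            rw [if_pos rfl]
            rfl
          · rw [if_neg ht, smul_zero, kappaDeriv_scalar_coeffHom f ht, Pi.zero_apply, zero_smul]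
        · rw [scalarValue_of_not _ _ h, scalarValue_of_not _ _ h, map_zero]
      · exact map_zero _

theorem cTwDeriv_finite {R : GrOperad F k} (G : GrHom (cTw Q).toGrOperad R) (y : R.obj 0 (-1))
    {n : ℕ} {a : ℤ} (f : (cTw Q).obj n a) :
    ∃ K, ∀ j, K ≤ j → (cTwDeriv Q).taylor G y j f = 0 := by
  obtain ⟨N, hN⟩ := exists_weight f
  exact ⟨N + 1, fun j hj => cTwDeriv_taylor_eq_zero G y j f hN (by omega)⟩

theorem cTwDeriv_kappaHat : (cTwDeriv Q).D (kappaHat Q) = 0 := by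
  refine markedCoeff_ext fun t => ?_
  rw [cTwDeriv_D, markedCoeff_seriesDeriv, coeffHom_kappaHat, map_zero]
  split_ifs
  · exact kappaDeriv_kappa
  · exact map_zero _

theorem HasDegree.mem {P : GrOperad F k} {S : SubOperad P} {e : ℤ} {x : P.obj 0 e} {t n : ℕ} {a : ℤ}
    {y : P.obj n a} (hy : HasDegree S x t y) (T : SubOperad P)
    (hS : ∀ {n : ℕ} {a : ℤ} (s : P.obj n a), s ∈ S.carrier n a → s ∈ T.carrier n a)
    (hx : x ∈ T.carrier 0 e) : y ∈ T.carrier n a := by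
  induction hy with
  | of s hs => exact hS s hs
  | gen => exact hx
  | zero => exact Submodule.zero_mem _
  | add _ _ ih ih' => exact Submodule.add_mem _ ih ih'
  | smul c _ ih => exact Submodule.smul_mem _ c ih
  | act σ _ ih => exact T.act_mem σ ih
  | comp i j hm hp hc _ _ ih ih' => exact T.comp_mem i j hm hp hc ih ih'

theorem HasDegree.sum {P : GrOperad F k} {S : SubOperad P} {e : ℤ} {x : P.obj 0 e} {t n : ℕ} {a : ℤ}
    {ι : Type*} (s : Finset ι) (f : ι → P.obj n a) (h : ∀ i ∈ s, HasDegree S x t (f i)) :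
    HasDegree S x t (∑ i ∈ s, f i) := by
  classical
  induction s using Finset.induction_on with
  | empty => simpa using HasDegree.zero
  | insert i s hi ih =>
    rw [Finset.sum_insert hi]
    exact .add (h i (by simp)) (ih fun j hj => h j (by simp [hj]))

/-- The terms of the Taylor expansion are homogeneous in `κ`. -/
theorem hasDegree_taylor (j : ℕ) : ∀ {n : ℕ} {a : ℤ} (f : (cTw Q).obj n a),
    HasDegree (noKappa Q) (kappaHat Q) j
      ((cTwDeriv Q).taylor ((noKappa Q).incl.comp (killKappaHat Q)) (kappaHat Q) j f) := by
  induction j with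
  | zero => exact fun f => .of _ ((killKappaHat Q).map f).2
  | succ j ih =>
    intro n a f
    rw [MarkedDerivation.taylor_succ, fillMark_apply]
    refine .smul _ (.add (.sum _ _ fun i _ => ?_) ?_)
    · have hi := i.emb_le
      rw [← comp_eq_plug _ _ (i := i.emb) (j := n - i.emb) (by omega) (by omega)]
      exact .comp _ _ _ _ _ (ih _) .gen
    · split_ifs with hj
      · subst hj
        by_cases h : n = 0 ∧ a = -1
        · obtain ⟨rfl, rfl⟩ := h
          rw [scalarValue_apply]
          exact .smul _ .gen
        · rw [scalarValue_of_not _ _ h]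
          exact .zero
      · exact .zero

variable [CharZero k]

/-- The elements with finite Taylor expansion. -/
def MarkedDerivation.finite {B R : GrOperad F k} {e : ℤ} (δ : MarkedDerivation B e)
    (G : GrHom B R) (y : R.obj 0 e) : SubOperad B where
  carrier n a :=
    { carrier := {x | ∃ K, ∀ j, K ≤ j → δ.taylor G y j x = 0}
      zero_mem' := ⟨0, fun j _ => map_zero _⟩
      add_mem' := by
        rintro x x' ⟨K, hK⟩ ⟨K', hK'⟩
        exact ⟨K + K', fun j hj => by rw [map_add, hK j (by omega), hK' j (by omega), add_zero]⟩
      smul_mem' := by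
        rintro c x ⟨K, hK⟩
        exact ⟨K, fun j hj => by rw [map_smul, hK j hj, smul_zero]⟩ }
  act_mem := by
    rintro n a σ x ⟨K, hK⟩
    exact ⟨K, fun j hj => by rw [taylor_act, hK j hj, map_zero]⟩
  comp_mem := by
    rintro m n p a b c i j hm hp hc x z ⟨K, hK⟩ ⟨K', hK'⟩
    refine ⟨K + K', fun t ht => ?_⟩
    rw [taylor_comp]
    refine Finset.sum_eq_zero fun q hq => ?_
    rw [Finset.HasAntidiagonal.mem_antidiagonal] at hq
    by_cases hq1 : K ≤ q.1
    · rw [hK _ hq1, map_zero, LinearMap.zero_apply]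
    · rw [hK' q.2 (by omega), map_zero]

theorem kappaDeriv_finite {n : ℕ} {a : ℤ} (x : (adjoin Q).obj n a) :
    ∃ K, ∀ j, K ≤ j → (kappaDeriv Q).taylor (killKappa Q) (kappa Q) j x = 0 := by
  refine adjoin.mem ((kappaDeriv Q).finite (killKappa Q) (kappa Q)) (fun x => ⟨1, fun j hj => ?_⟩)
    ⟨1, fun j hj => ?_⟩ ⟨2, fun j hj => ?_⟩ x
  · obtain ⟨j, rfl⟩ := Nat.exists_eq_add_of_le' hj
    exact MarkedDerivation.taylor_eq_zero _ _ _ _ (kappaDeriv_incl x) (kappaDeriv_scalar_incl x) j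
  · obtain ⟨j, rfl⟩ := Nat.exists_eq_add_of_le' hj
    exact MarkedDerivation.taylor_eq_zero _ _ _ _ kappaDeriv_alpha kappaDeriv_scalar_alpha j
  · obtain ⟨j, rfl⟩ := Nat.exists_eq_add_of_le' hj
    rw [show j + 2 = j + 1 + 1 by omega, MarkedDerivation.taylor_succ, kappaDeriv_kappa, map_zero,
      if_neg (by omega), add_zero, smul_zero]

/-- Taylor's formula for polynomials: expanding at κ = 0 and evaluating at κ is an endomorphism
which fixes Q, α and κ, hence the identity. The formula for series follows coefficientwise. -/
theorem kappaDeriv_taylorHom {n : ℕ} {a : ℤ} (x : (adjoin Q).obj n a) :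
    ((kappaDeriv Q).taylorHom (killKappa Q) (kappa Q) kappaDeriv_finite).map x = x := by
  have h : (kappaDeriv Q).taylorHom (killKappa Q) (kappa Q) kappaDeriv_finite = GrHom.id _ := by
    refine adjoin.grHom_ext (fun x => ?_) ?_ ?_
    · exact MarkedDerivation.taylorHom_of_D_eq_zero _ _ _ _ _ (kappaDeriv_incl x)
        (kappaDeriv_scalar_incl x)
    · exact MarkedDerivation.taylorHom_of_D_eq_zero _ _ _ _ _ kappaDeriv_alpha
        kappaDeriv_scalar_alpha
    · refine (MarkedDerivation.taylorHom_generator _ _ _ _ _ kappaDeriv_kappa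
        kappaDeriv_scalar_kappa).trans ?_
      exact zero_add (kappa Q)
  rw [h]
  rfl

/-- The Taylor formula for series. -/
theorem cTwDeriv_taylorHom {n : ℕ} {a : ℤ} (f : (cTw Q).obj n a) :
    ((cTwDeriv Q).taylorHom ((noKappa Q).incl.comp (killKappaHat Q)) (kappaHat Q)
      (cTwDeriv_finite _ _)).map f = f := by
  obtain ⟨K, hK⟩ := cTwDeriv_finite ((noKappa Q).incl.comp (killKappaHat Q)) (kappaHat Q) f
  rw [MarkedDerivation.taylorHom_eq _ _ _ _ f K hK]
  refine coeffHom_ext fun t => ?_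
  rw [map_sum]
  simp only [coeffHom_taylor]
  rw [← MarkedDerivation.taylorHom_eq _ _ _ kappaDeriv_finite _ K, kappaDeriv_taylorHom]
  intro j hj
  rw [← coeffHom_taylor, hK j hj, map_zero]

/-- `cTw(Q)` is generated by the series without `κ` and `κ`. -/
theorem cTw_mem (S : SubOperad (cTw Q).toGrOperad)
    (h : ∀ {n : ℕ} {a : ℤ} (f : (cTw Q).obj n a), f ∈ (noKappa Q).carrier n a → f ∈ S.carrier n a)
    (hκ : kappaHat Q ∈ S.carrier 0 (-1)) {n : ℕ} {a : ℤ} (f : (cTw Q).obj n a) :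
    f ∈ S.carrier n a := by
  obtain ⟨K, hK⟩ := cTwDeriv_finite ((noKappa Q).incl.comp (killKappaHat Q)) (kappaHat Q) f
  rw [← cTwDeriv_taylorHom f, MarkedDerivation.taylorHom_eq _ _ _ _ f K hK]
  exact Submodule.sum_mem _ fun j _ => (hasDegree_taylor j f).mem S h hκ

/-- `cTw(Q)` is the coproduct of the operad of series without `κ` and the free operad on an element
which is the sum of `κ` and a series without `κ`. -/
theorem isCoproduct_noKappa (ν : (cTw Q).obj 0 (-1)) (hν : ν ∈ (noKappa Q).carrier 0 (-1)) :
    IsCoproduct (noKappa Q) (kappaHat Q + ν) := by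
  intro R g y
  -- Since ν goes to g ν and κ + ν has to go to y, the Taylor expansion is evaluated at y - g ν.
  -- Elements without κ have zero derivative, so the expansion agrees with g on them.
  have hs : ∀ {n : ℕ} {b : ℤ} (s : (noKappa Q).carrier n b),
      ((cTwDeriv Q).taylorHom (g.comp (killKappaHat Q)) (y - g.map ⟨ν, hν⟩)
        (cTwDeriv_finite _ _)).map s.1 = g.map s := by
    intro n b s
    rw [MarkedDerivation.taylorHom_of_D_eq_zero, GrHom.comp_map, killKappaHat_eq]
    · exact markedCoeff_ext fun t => (s.2 (t + 1)).kappaDeriv_zero (.inl rfl)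
    · exact (s.2 1).kappaDeriv_scalar (.inl rfl)
  refine ⟨(cTwDeriv Q).taylorHom (g.comp (killKappaHat Q)) (y - g.map ⟨ν, hν⟩)
    (cTwDeriv_finite _ _), ⟨hs, ?_⟩, ?_⟩
  · rw [map_add, hs ⟨ν, hν⟩, MarkedDerivation.taylorHom_generator _ _ _ _ _ cTwDeriv_kappaHat,
      GrHom.comp_map, killKappaHat_kappaHat, map_zero, zero_add, sub_add_cancel]
    rw [cTwDeriv_scalar, coeffHom_kappaHat, if_pos rfl]
    exact kappaDeriv_scalar_kappa
  · rintro h ⟨h1, h2⟩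
    refine GrHom.ext' fun f => cTw_mem (equalizer h _) (fun f hf => ?_) ?_ f
    · exact (h1 ⟨f, hf⟩).trans (hs ⟨f, hf⟩).symm
    · change h.map (kappaHat Q) = _
      have e1 : h.map (kappaHat Q) = y - g.map ⟨ν, hν⟩ := by
        rw [← h1 ⟨ν, hν⟩, ← h2, map_add, add_sub_cancel_right]
      rw [e1, MarkedDerivation.taylorHom_generator _ _ _ _ _ cTwDeriv_kappaHat,
        GrHom.comp_map, killKappaHat_kappaHat, map_zero, zero_add]
      rw [cTwDeriv_scalar, coeffHom_kappaHat, if_pos rfl]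
      exact kappaDeriv_scalar_kappa

end Coproduct

end

end CurvedTwisting

namespace CurvedTwisting

noncomputable section

/-! ## The right adjoint -/

section RightAdjoint

variable {F : Flavor} {k : Type u} [Field k]

namespace HasDegree

variable {P : GrOperad F k} {S : SubOperad P} {e : ℤ} {x : P.obj 0 e}

theorem mem_of_zero {t n : ℕ} {a : ℤ} {y : P.obj n a} (hy : HasDegree S x t y) (ht : t = 0) :
    y ∈ S.carrier n a := by
  induction hy with
  | of s hs => exact hs
  | gen => omega
  | zero => exact Submodule.zero_mem _
  | add _ _ ih ih' => exact Submodule.add_mem _ (ih ht) (ih' ht)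
  | smul c _ ih => exact Submodule.smul_mem _ c (ih ht)
  | act σ _ ih => exact S.act_mem σ (ih ht)
  | comp i j hm hp hc _ _ ih ih' => exact S.comp_mem i j hm hp hc (ih (by omega)) (ih' (by omega))

theorem map {R : GrOperad F k} {T : SubOperad R} (f : GrHom P R)
    (hf : ∀ {n : ℕ} {a : ℤ} (s : P.obj n a), s ∈ S.carrier n a → f.map s ∈ T.carrier n a)
    {t n : ℕ} {a : ℤ} {y : P.obj n a} (hy : HasDegree S x t y) :
    HasDegree T (f.map x) t (f.map y) := by
  induction hy with
  | of s hs => exact .of _ (hf s hs)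
  | gen => exact .gen
  | zero => rw [map_zero]; exact .zero
  | add _ _ ih ih' => rw [map_add]; exact .add ih ih'
  | smul c _ ih => rw [map_smul]; exact .smul c ih
  | act σ _ ih => rw [f.map_act]; exact .act σ ih
  | comp i j hm hp hc _ _ ih ih' => rw [f.map_comp]; exact .comp i j hm hp hc ih ih'

/-- Elements of degree at most `1` in `x` are of degree at most `1` in `x + ν` for `ν ∈ S`. -/
theorem translate {ν : P.obj 0 e} (hν : ν ∈ S.carrier 0 e) {t n : ℕ} {a : ℤ} {y : P.obj n a}
    (hy : HasDegree S x t y) (ht : t ≤ 1) : ∃ z w : P.obj n a,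
      HasDegree S (x + ν) 0 z ∧ HasDegree S (x + ν) 1 w ∧ y = z + w := by
  induction hy with
  | of s hs => exact ⟨s, 0, .of s hs, .zero, (add_zero s).symm⟩
  | gen => exact ⟨-ν, x + ν, .of _ (Submodule.neg_mem _ hν), .gen, by abel⟩
  | zero => exact ⟨0, 0, .zero, .zero, (add_zero 0).symm⟩
  | add _ _ ih ih' =>
    obtain ⟨z, w, hz, hw, rfl⟩ := ih ht
    obtain ⟨z', w', hz', hw', rfl⟩ := ih' ht
    exact ⟨z + z', w + w', .add hz hz', .add hw hw', by abel⟩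
  | smul c _ ih =>
    obtain ⟨z, w, hz, hw, rfl⟩ := ih ht
    exact ⟨c • z, c • w, .smul c hz, .smul c hw, smul_add c z w⟩
  | act σ _ ih =>
    obtain ⟨z, w, hz, hw, rfl⟩ := ih ht
    exact ⟨P.act σ z, P.act σ w, .act σ hz, .act σ hw, map_add (P.act σ) z w⟩
  | @comp t t' m n p a b c i j hm hp hc y y' hy hy' ih ih' =>
    rcases Nat.eq_zero_or_pos t with ht0 | ht0
    · obtain ⟨z, w, hz, hw, rfl⟩ := ih' (by omega)
      have h := HasDegree.of (x := x + ν) y (hy.mem_of_zero ht0)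
      exact ⟨_, _, .comp i j hm hp hc h hz, .comp i j hm hp hc h hw, map_add _ z w⟩
    · obtain ⟨z, w, hz, hw, rfl⟩ := ih (by omega)
      have h := HasDegree.of (x := x + ν) y' (hy'.mem_of_zero (by omega))
      exact ⟨_, _, .comp i j hm hp hc hz h, .comp i j hm hp hc hw h,
        LinearMap.map_add₂ _ z w y'⟩

end HasDegree

theorem mem_noKappa_cTwMap {Q P : DGOperad F k} (f : Q ⟶ P) {n : ℕ} {a : ℤ} {x : (cTw Q).obj n a}
    (hx : x ∈ (noKappa Q).carrier n a) : app (cTwMap f) x ∈ (noKappa P).carrier n a :=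
  fun t => (hx t).map f

theorem twisted_mem (Q : Under (cInf F k)) (n : ℕ) :
    twisted Q n ∈ (noKappa Q.right).carrier n (-1) := fun t => by
  change Weight Q.right 0 t (twistedTerm n t Q)
  rw [twistedTerm_eq]
  exact twistTerm_weight _ _ _

theorem cTwMap_twisted {Q Q' : Under (cInf F k)} (f : Q ⟶ Q') (n : ℕ) :
    app (cTwMap f.right) (twisted Q n) = twisted Q' n := by
  refine cTw_ext fun t => ?_
  change app (adjoin.lift (f.right ≫ incl Q'.right) (alpha Q'.right)) (twistedTerm n t Q) =
    twistedTerm n t Q'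
  rw [twistedTerm_eq, twistedTerm_eq, twistTerm_map]
  simp only [app_ellOf]

theorem cTwMap_kappaHat {Q P : DGOperad F k} (f : Q ⟶ P) :
    app (cTwMap f) (kappaHat Q) = kappaHat P := by
  refine coeffHom_ext fun t => ?_
  change app (adjoin.lift (f ≫ incl P) (alpha P)) (coeffHom Q t (kappaHat Q)) = _
  rw [coeffHom_kappaHat, coeffHom_kappaHat]
  split_ifs
  · rfl
  · exact map_zero _

variable [CharZero k]

/-- The differential of a series without κ contains κ at most once in each term, so its Taylor
expansion stops after order 1. The two terms are homogeneous in κ, and the linear one is rewritten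
in κ + ν at the cost of a term without κ. -/
theorem noKappa_d {Q : DGOperad F k} {ν : (cTw Q).obj 0 (-1)}
    (hν : ν ∈ (noKappa Q).carrier 0 (-1)) {n : ℕ} {a b : ℤ} (h : b + 1 = a)
    (f : (cTw Q).obj n a) (hf : f ∈ (noKappa Q).carrier n a) : ∃ y z : (cTw Q).obj n b,
      HasDegree (noKappa Q) (kappaHat Q + ν) 0 y ∧ HasDegree (noKappa Q) (kappaHat Q + ν) 1 z ∧
        (cTw Q).d h f = y + z := by
  have hK : ∀ j, 2 ≤ j → (cTwDeriv Q).taylor ((noKappa Q).incl.comp (killKappaHat Q)) (kappaHat Q) j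
      ((cTw Q).d h f) = 0 := fun j hj =>
    cTwDeriv_taylor_eq_zero _ _ j _ (N := 0 + 1) (fun t => (hf t).diff h) (by omega)
  have key := cTwDeriv_taylorHom ((cTw Q).d h f)
  rw [MarkedDerivation.taylorHom_eq _ _ _ _ _ 2 hK, Finset.sum_range_succ,
    Finset.sum_range_one] at key
  obtain ⟨z, w, hz, hw, hzw⟩ := (hasDegree_taylor 1 ((cTw Q).d h f)).translate hν le_rfl
  refine ⟨_, w, .add (.of _ ((hasDegree_taylor 0 ((cTw Q).d h f)).mem_of_zero rfl)) hz, hw, ?_⟩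
  rw [add_assoc, ← hzw, key]

/-- The curved twisting structure on `cTw(Q)`. -/
def cTwCurv (Q : Under (cInf F k)) : Curv F k where
  Q := cTwUnder Q
  Q₀ := noKappa Q.right
  coproduct := by
    rw [ellOf_cTwUnder_zero]
    exact isCoproduct_noKappa _ (twisted_mem Q 0)
  ell_mem n hn := by
    rw [ellOf_cTwUnder_pos Q n hn]
    exact twisted_mem Q n
  d_degree h f hf := by
    rw [ellOf_cTwUnder_zero]
    exact noKappa_d (twisted_mem Q 0) h f hf

theorem cTwMap_ellOf {Q Q' : Under (cInf F k)} (f : Q ⟶ Q') (n : ℕ) :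
    app (cTwMap f.right) (ellOf (cTwUnder Q) n) = ellOf (cTwUnder Q') n := by
  rcases Nat.eq_zero_or_pos n with rfl | hn
  · rw [ellOf_cTwUnder_zero, ellOf_cTwUnder_zero, map_add, cTwMap_kappaHat, cTwMap_twisted]
  · rw [ellOf_cTwUnder_pos _ _ hn, ellOf_cTwUnder_pos _ _ hn, cTwMap_twisted]

variable (F k) in
/-- The right adjoint of the forgetful functor. -/
def cofreeCurv : Under (cInf F k) ⥤ Curv F k where
  obj := cTwCurv
  map {Q Q'} f :=
    { hom := underHom (Q := cTwUnder Q) (Q' := cTwUnder Q') (cTwMap f.right) (cTwMap_ellOf f)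
      map_mem := fun _ hx => mem_noKappa_cTwMap f.right hx }
  map_id Q := Curv.Hom.ext (Under.UnderMorphism.ext ((cTwFunctor F k).map_id Q.right))
  map_comp f g := Curv.Hom.ext (Under.UnderMorphism.ext
    ((cTwFunctor F k).map_comp f.right g.right))

/-- The counit of `cTw(Q)` as a morphism under `cL_∞`, resp. `cA_∞`. -/
def counit (Q : Under (cInf F k)) : cTwUnder Q ⟶ Q :=
  underHom (Q := cTwUnder Q) (cTwCounit Q.right) fun n => by
    refine (congrArg (app (adjoin.lift (𝟙 Q.right) 0)) (coeff_ellOf_cTwUnder Q n 0)).trans ?_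
    rw [if_neg zero_ne_one, add_zero, twistTerm_zero]
    rfl

end RightAdjoint

end

end CurvedTwisting

namespace CurvedTwisting

noncomputable section

/-! ## The unit of the adjunction -/

section Unit

variable {F : Flavor} {k : Type u} [Field k]

/-- The image of a suboperad. -/
def SubOperad.map {P R : GrOperad F k} (f : GrHom P R) (S : SubOperad P) : SubOperad R where
  carrier n a := (S.carrier n a).map f.map
  act_mem := by
    rintro n a σ _ ⟨x, hx, rfl⟩
    exact ⟨P.act σ x, S.act_mem σ hx, f.map_act σ x⟩
  comp_mem := by
    rintro m n p a b c i j hm hp hc _ _ ⟨x, hx, rfl⟩ ⟨y, hy, rfl⟩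
    exact ⟨P.comp i j hm hp hc x y, S.comp_mem i j hm hp hc hx hy, f.map_comp i j hm hp hc x y⟩

namespace Curv

variable (X : Curv F k)

/-- The square-zero extension in which the contraction with `α` takes its values. -/
abbrev contractionTarget (P : DGOperad F k) : GrOperad F k :=
  squareZero (shiftMod (adjoin P).toGrOperad (-1) (fun a => a + 1) fun a => (sub_neg_eq_add a 1).symm)

/-- A derivation is a morphism to a square-zero extension, so the coproduct property allows one to
prescribe it freely on Q_0 and on ℓ_0. -/
theorem exists_contractionHom : ∃ f : GrHom X.Q.right.toGrOperad (contractionTarget X.Q.right),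
    (∀ {n : ℕ} {b : ℤ} (s : X.Q₀.carrier n b), f.map s.1 = (app (incl X.Q.right) s.1, 0)) ∧
      f.map (ellOf X.Q 0) = (app (incl X.Q.right) (ellOf X.Q 0), alpha X.Q.right) :=
  (X.coproduct (contractionTarget X.Q.right)
    ((squareZero.inl _).comp ((incl X.Q.right).toGrHom.comp X.Q₀.incl))
    (app (incl X.Q.right) (ellOf X.Q 0), alpha X.Q.right)).exists

/-- The inclusion into `Q ∨ [κ] ∨ [α]` together with the contraction with `α`. -/
def contractionHom : GrHom X.Q.right.toGrOperad (contractionTarget X.Q.right) :=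
  X.exists_contractionHom.choose

theorem contractionHom_fst {n : ℕ} {a : ℤ} (x : X.Q.right.obj n a) :
    (X.contractionHom.map x).1 = app (incl X.Q.right) x := by
  have h : (squareZero.fst _).comp X.contractionHom = (incl X.Q.right).toGrHom :=
    X.coproduct.hom_ext
      (fun s hs => congrArg Prod.fst (X.exists_contractionHom.choose_spec.1 ⟨s, hs⟩))
      (congrArg Prod.fst X.exists_contractionHom.choose_spec.2)
  exact congrArg (fun f : GrHom _ _ => f.map x) h

/-- The derivation of degree `1` which vanishes on `Q₀` and sends `ℓ_0` to `α`. -/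
def contraction {n : ℕ} {a b : ℤ} (h : a + 1 = b) :
    X.Q.right.obj n a →ₗ[k] (adjoin X.Q.right).obj n b where
  toFun x := (adjoin X.Q.right).castDeg h (X.contractionHom.map x).2
  map_add' x y := by
    rw [map_add]
    exact map_add ((adjoin X.Q.right).castDeg h) (X.contractionHom.map x).2
      (X.contractionHom.map y).2
  map_smul' c x := by
    rw [map_smul]
    exact map_smul ((adjoin X.Q.right).castDeg h) c (X.contractionHom.map x).2

theorem contraction_of_mem {n : ℕ} {a b : ℤ} (h : a + 1 = b) {x : X.Q.right.obj n a}
    (hx : x ∈ X.Q₀.carrier n a) : X.contraction h x = 0 := by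
  subst h
  exact congrArg Prod.snd (X.exists_contractionHom.choose_spec.1 ⟨x, hx⟩)

theorem contraction_ell : X.contraction (by norm_num) (ellOf X.Q 0) = alpha X.Q.right :=
  congrArg Prod.snd X.exists_contractionHom.choose_spec.2

theorem contraction_act {n : ℕ} {a b : ℤ} (h : a + 1 = b) (σ : F.perms n) (x : X.Q.right.obj n a) :
    X.contraction h (X.Q.right.act σ x) = (adjoin X.Q.right).act σ (X.contraction h x) := by
  subst h
  exact congrArg Prod.snd (X.contractionHom.map_act σ x)

theorem contraction_comp {m n p : ℕ} {a b c a' b' c' : ℤ} (i j : ℕ) (hm : m = i + 1 + j)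
    (hp : p = i + n + j) (hc : c = a + b) (hc' : c + 1 = c') (ha' : a + 1 = a') (hb' : b + 1 = b')
    (h₁ : c' = a' + b) (h₂ : c' = a + b') (x : X.Q.right.obj m a) (y : X.Q.right.obj n b) :
    X.contraction hc' (X.Q.right.comp i j hm hp hc x y) =
      (adjoin X.Q.right).comp i j hm hp h₁ (X.contraction ha' x) (app (incl X.Q.right) y) +
        ksign k a • (adjoin X.Q.right).comp i j hm hp h₂ (app (incl X.Q.right) x)
          (X.contraction hb' y) := by
  subst hc' ha' hb'
  refine (congrArg Prod.snd (X.contractionHom.map_comp i j hm hp hc x y)).trans ?_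
  refine (squareZero_comp_snd _ i j hm hp hc (X.contractionHom.map x)
    (X.contractionHom.map y)).trans ?_
  rw [X.contractionHom_fst x, X.contractionHom_fst y,
    ksign_congr (a := a) (b := -1 * a) (by simp)]
  rfl

/-- The derivation `d ι + ι d`, where `ι` is the contraction with `α`. -/
def flow : Flow X.Q.right where
  D {n a} := (adjoin X.Q.right).d (a := a + 1) rfl ∘ₗ X.contraction rfl +
    X.contraction (sub_add_cancel a 1) ∘ₗ X.Q.right.d (b := a - 1) (sub_add_cancel a 1)
  D_act σ x := by
    simp only [LinearMap.add_apply, LinearMap.comp_apply, contraction_act, DGOperad.d_act, map_add]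
  D_comp {m n p a b c} i j hm hp hc x y := by
    simp only [LinearMap.add_apply, LinearMap.comp_apply]
    rw [X.contraction_comp (a' := a + 1) (b' := b + 1) i j hm hp hc rfl rfl rfl (by omega) (by omega),
      X.Q.right.d_comp i j hm hp hc _ (sub_add_cancel a 1) (sub_add_cancel b 1) (by omega) (by omega),
      map_add, map_add, map_smul, map_smul,
      (adjoin X.Q.right).d_comp (a' := a) (b' := b - 1) i j hm hp _ rfl rfl (sub_add_cancel b 1) hc
        (by omega),
      (adjoin X.Q.right).d_comp (a' := a - 1) (b' := b) i j hm hp _ rfl (sub_add_cancel a 1) rfl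
        (by omega) hc,
      X.contraction_comp (a' := a) (b' := b + 1) i j hm hp _ _ (sub_add_cancel a 1) rfl hc (by omega),
      X.contraction_comp (a' := a + 1) (b' := b) i j hm hp _ _ rfl (sub_add_cancel b 1) (by omega) hc]
    have h1 : ksign k (a + 1) = -ksign k a := by
      rw [← add_sub_cancel_right a 1, ksign_sub_one, add_sub_cancel_right, neg_neg]
    -- The graded commutator of two odd derivations is a derivation: the cross terms, with d on one
    -- factor and ι on the other, occur twice with opposite signs.
    rw [h1, ksign_sub_one]
    simp only [map_add, LinearMap.add_apply, smul_add, smul_smul, ksign_mul_self, one_smul,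
      ← (incl X.Q.right).map_d]
    module
  D_d {n a b} h x := by
    obtain rfl : b = a - 1 := by omega
    have key : ∀ {c e : ℤ} (hc : c + 1 = e) (y : X.Q.right.obj n c),
        (adjoin X.Q.right).d (a := c + 1) rfl (X.contraction rfl y) =
          (adjoin X.Q.right).d hc (X.contraction hc y) := by
      rintro c e rfl y
      rfl
    simp only [LinearMap.add_apply, LinearMap.comp_apply, map_add]
    rw [X.Q.right.d_d, map_zero, add_zero, (adjoin X.Q.right).d_d, zero_add]
    exact key h _

theorem flow_D {n : ℕ} {a b c : ℤ} (h : a + 1 = b) (h' : c + 1 = a) (x : X.Q.right.obj n a) :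
    X.flow.D x = (adjoin X.Q.right).d h (X.contraction h x) +
      X.contraction h' (X.Q.right.d h' x) := by
  subst h
  obtain rfl : c = a - 1 := by omega
  rfl

theorem contraction_curvSum : ∀ {F : Flavor} (X : Curv F k) {a b c a' b' c' : ℤ} (hc : c = a + b)
    (hc' : c + 1 = c') (ha' : a + 1 = a') (hb' : b + 1 = b') (h₁ : c' = a' + b) (h₂ : c' = a + b')
    (x : ∀ n, X.Q.right.obj n a) (y : ∀ n, X.Q.right.obj n b) (n : ℕ),
    X.contraction hc' (curvSum X.Q.right.toGrOperad hc x y n) =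
      curvSum (adjoin X.Q.right).toGrOperad h₁ (fun n => X.contraction ha' (x n))
        (fun n => app (incl X.Q.right) (y n)) n +
      ksign k a • curvSum (adjoin X.Q.right).toGrOperad h₂ (fun n => app (incl X.Q.right) (x n))
        (fun n => X.contraction hb' (y n)) n
  | .symmetric, X, _, _, _, _, _, _, hc, hc', ha', hb', h₁, h₂, x, y, n => by
    simp only [curvSum, map_sum, X.contraction_act, compFam,
      X.contraction_comp _ _ _ _ hc hc' ha' hb' h₁ h₂, map_add, map_smul, Finset.sum_add_distrib,
      Finset.smul_sum]
  | .nonsymmetric, X, _, _, _, _, _, _, hc, hc', ha', hb', h₁, h₂, x, y, n => by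
    simp only [curvSum, map_sum, compFam,
      X.contraction_comp _ _ _ _ hc hc' ha' hb' h₁ h₂, Finset.sum_add_distrib, Finset.smul_sum]

theorem contraction_ellOf (n : ℕ) : X.contraction (b := 0) (by norm_num) (ellOf X.Q n) =
    nullary (P := (adjoin X.Q.right).toGrOperad) (alpha X.Q.right) n := by
  cases n with
  | zero => exact X.contraction_ell
  | succ n => exact X.contraction_of_mem _ (X.ell_mem _ n.succ_pos)

/-- As ι sends ℓ_0 to α and kills ℓ_n for n > 0, applying it to the quadratic expression dℓ_n leaves
the terms in which the inner operation is ℓ_0, now replaced by α. The sign of dℓ_n and that of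
passing ι across ℓ cancel. The summand dιℓ_0 = dα is κ. -/
theorem flow_ell (n : ℕ) : X.flow.D (ellOf X.Q n) =
    ellVariation (fun n => app (incl X.Q.right) (ellOf X.Q n)) (alpha X.Q.right) n := by
  rw [X.flow_D (b := 0) (c := -2) (by norm_num) (by norm_num), ellOf_d, map_neg,
    X.contraction_curvSum (a' := 0) (b' := 0) _ _ (by norm_num) (by norm_num) (by norm_num)
      (by norm_num), ksign_of_odd (by decide), neg_one_smul]
  simp only [contraction_ellOf]
  rw [show (fun n => nullary (P := (adjoin X.Q.right).toGrOperad) (alpha X.Q.right) n) =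
    nullary (alpha X.Q.right) from rfl, curvSum_nullary_left, curvSum_nullary_right, zero_add,
    neg_neg, ellVariation, add_comm]
  congr 1
  cases n with
  | zero => rfl
  | succ n => exact map_zero _

/-- The elements of degree `1` in `ℓ_0` contract to elements of degree `1` in `α`. -/
theorem hasDegree_contraction {t n : ℕ} {a b : ℤ} {x : X.Q.right.obj n a}
    (hx : HasDegree X.Q₀ (ellOf X.Q 0) t x) (h : a + 1 = b) (ht : t = 1) :
    HasDegree (X.Q₀.map (incl X.Q.right).toGrHom) (alpha X.Q.right) 1 (X.contraction h x) := by
  induction hx generalizing b with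
  | of => omega
  | gen =>
    obtain rfl : b = 0 := by omega
    rw [X.contraction_ell]
    exact .gen
  | zero => rw [map_zero]; exact .zero
  | add _ _ ih ih' => rw [map_add]; exact .add (ih h ht) (ih' h ht)
  | smul c _ ih => rw [map_smul]; exact .smul c (ih h ht)
  | act σ _ ih => rw [X.contraction_act]; exact .act σ (ih h ht)
  | @comp t t' m n p a' b' c i j hm hp hc y z hy hz ih ih' =>
    rw [X.contraction_comp (a' := a' + 1) (b' := b' + 1) i j hm hp hc h rfl rfl (by omega)
      (by omega)]
    rcases Nat.eq_zero_or_pos t with ht0 | ht0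
    · have hy' := hy.mem_of_zero ht0
      rw [X.contraction_of_mem _ hy', map_zero, LinearMap.zero_apply, zero_add]
      have := HasDegree.comp (S := X.Q₀.map (incl X.Q.right).toGrHom) i j hm hp
        (show b = a' + (b' + 1) by omega)
        (.of _ (Submodule.mem_map_of_mem hy')) (ih' rfl (by omega))
      rw [zero_add] at this
      exact .smul _ this
    · have hz' := hz.mem_of_zero (by omega)
      rw [X.contraction_of_mem _ hz', map_zero, smul_zero, add_zero]
      exact .comp i j hm hp _ (ih rfl (by omega)) (.of _ (Submodule.mem_map_of_mem hz'))

/-- On Q_0 the derivation reduces to ιd, and condition (iii) writes dx as a sum of parts of degrees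
0 and 1 in ℓ_0. The contraction kills the first and turns the ℓ_0 of the second into α, so no κ
arises. -/
theorem flow_mem {n : ℕ} {a : ℤ} {x : X.Q.right.obj n a} (hx : x ∈ X.Q₀.carrier n a) :
    HasDegree (X.Q₀.map (incl X.Q.right).toGrHom) (alpha X.Q.right) 1 (X.flow.D x) := by
  obtain ⟨y, z, hy, hz, h⟩ := X.d_degree (sub_add_cancel a 1) x hx
  rw [X.flow_D rfl (sub_add_cancel a 1), X.contraction_of_mem _ hx, map_zero, zero_add, h, map_add,
    X.contraction_of_mem _ (hy.mem_of_zero rfl), zero_add]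
  exact X.hasDegree_contraction hz _ rfl

theorem hasDegree_flow {t n : ℕ} {a : ℤ} {x : (adjoin X.Q.right).obj n a}
    (hx : HasDegree (X.Q₀.map (incl X.Q.right).toGrHom) (alpha X.Q.right) t x) :
    HasDegree (X.Q₀.map (incl X.Q.right).toGrHom) (alpha X.Q.right) (t + 1) (X.flow.ext x) := by
  induction hx with
  | of s hs =>
    obtain ⟨x, hx, rfl⟩ := hs
    exact X.flow_mem hx
  | gen => rw [X.flow.ext_alpha]; exact .zero
  | zero => rw [map_zero]; exact .zero
  | add _ _ ih ih' => rw [map_add]; exact .add ih ih'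
  | smul c _ ih => rw [map_smul]; exact .smul c ih
  | act σ _ ih => rw [X.flow.ext_act]; exact .act σ ih
  | @comp t t' m n p a b c i j hm hp hc y z hy hz ih ih' =>
    rw [X.flow.ext_comp]
    have h := HasDegree.comp i j hm hp hc ih hz
    rw [add_right_comm] at h
    have h' := HasDegree.comp i j hm hp hc hy ih'
    rw [← add_assoc] at h'
    exact .add h h'

theorem hasDegree_pow {n : ℕ} {a : ℤ} {x : X.Q.right.obj n a} (hx : x ∈ X.Q₀.carrier n a) (t : ℕ) :
    HasDegree (X.Q₀.map (incl X.Q.right).toGrHom) (alpha X.Q.right) t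
      (X.flow.pow t (app (incl X.Q.right) x)) := by
  induction t with
  | zero => exact .of _ (Submodule.mem_map_of_mem hx)
  | succ t ih => exact .smul _ (X.hasDegree_flow ih)

theorem weight_of_hasDegree {t n : ℕ} {a : ℤ} {x : (adjoin X.Q.right).obj n a}
    (hx : HasDegree (X.Q₀.map (incl X.Q.right).toGrHom) (alpha X.Q.right) t x) :
    Weight X.Q.right 0 t x := by
  induction hx with
  | of s hs =>
    obtain ⟨x, -, rfl⟩ := hs
    exact .of x
  | gen => exact .alpha
  | zero => exact .zero
  | add _ _ ih ih' => exact .add ih ih'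
  | smul c _ ih => exact .smul c ih
  | act σ _ ih => exact .act σ ih
  | comp i j hm hp hc _ _ ih ih' => exact .comp i j hm hp hc ih ih'

variable [CharZero k]

/-- The elements with bounded exponential form a suboperad which contains Q_0, where no κ occurs,
and ℓ_0, where at most one occurs. These generate Q. -/
theorem flow_bounded {n : ℕ} {a : ℤ} (x : X.Q.right.obj n a) :
    x ∈ X.flow.bounded.carrier n a :=
  X.coproduct.mem X.flow.bounded (fun _ hs => ⟨0, fun t => X.weight_of_hasDegree (X.hasDegree_pow hs t)⟩)
    (X.flow.mem_bounded_ell (ellOf X.Q) X.flow_ell 0) x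

/-- The unit of the adjunction, as a morphism of dg operads. -/
def unitHom : X.Q.right ⟶ cTw X.Q.right := X.flow.exp X.flow_bounded

theorem unitHom_ell (n : ℕ) : app X.unitHom (ellOf X.Q n) = ellOf (cTwUnder X.Q) n :=
  cTw_ext (Q := X.Q.right) fun t => (X.flow.pow_ell (ellOf X.Q) X.flow_ell n t).trans
    (coeff_ellOf_cTwUnder X.Q n t).symm

/-- The unit of the adjunction. -/
def unit : X ⟶ cTwCurv X.Q where
  hom := underHom (Q' := cTwUnder X.Q) X.unitHom X.unitHom_ell
  map_mem _ hx t := X.weight_of_hasDegree (X.hasDegree_pow hx t)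

/-- The counit reads off the term of weight 0, and the exponential of a derivation starts with the
identity. -/
theorem unit_counit : X.unit.hom ≫ counit X.Q = 𝟙 X.Q :=
  Under.UnderMorphism.ext (hom_ext' fun _ => rfl)

end Curv

end Unit

end

end CurvedTwisting

namespace CurvedTwisting

noncomputable section

/-! ## The adjunction -/

section Adjunction

variable {F : Flavor} {k : Type u} [Field k]

/-! ### Naturality of the unit -/

namespace Curv

variable {X Y : Curv F k} (f : X ⟶ Y)

/-- The morphism `f ∨ 1` induced by a morphism `f` of curved twisting structures. -/
def adjoinMap : adjoin X.Q.right ⟶ adjoin Y.Q.right :=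
  adjoin.lift (f.hom.right ≫ incl Y.Q.right) (alpha Y.Q.right)

/-- The elements on which the contraction is compatible with `f`. -/
def contractionNatural : SubOperad X.Q.right.toGrOperad where
  carrier n a :=
    { carrier := {x | ∀ b (h : a + 1 = b), Y.contraction h (app f.hom.right x) =
        app (adjoinMap f) (X.contraction h x)}
      zero_mem' := fun b h => by simp only [map_zero]
      add_mem' := fun hx hy b h => by rw [map_add, map_add, map_add, map_add, hx b h, hy b h]
      smul_mem' := fun c x hx b h => by rw [map_smul, map_smul, map_smul, map_smul, hx b h] }
  act_mem σ x hx b h := by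
    rw [f.hom.right.map_act, contraction_act, contraction_act, (adjoinMap f).map_act, hx b h]
  comp_mem {m n p a b c} i j hm hp hc x y hx hy e h := by
    rw [f.hom.right.map_comp,
      contraction_comp (a' := a + 1) (b' := b + 1) _ i j hm hp hc h rfl rfl (by omega) (by omega),
      contraction_comp (a' := a + 1) (b' := b + 1) _ i j hm hp hc h rfl rfl (by omega) (by omega),
      hx _ rfl, hy _ rfl, map_add, map_smul, (adjoinMap f).map_comp, (adjoinMap f).map_comp]
    rfl

/-- Both sides are derivations along the same morphism. They vanish on Q_0 because f maps it to the
corresponding suboperad, and both send ℓ_0 to α. -/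
theorem contraction_naturality {n : ℕ} {a b : ℤ} (h : a + 1 = b) (x : X.Q.right.obj n a) :
    Y.contraction h (app f.hom.right x) = app (adjoinMap f) (X.contraction h x) := by
  refine X.coproduct.mem (contractionNatural f) (fun s hs b h => ?_) (fun b h => ?_) x b h
  · rw [X.contraction_of_mem h hs, Y.contraction_of_mem h (f.map_mem s hs), map_zero]
  · obtain rfl : b = 0 := by omega
    rw [app_ellOf, X.contraction_ell, Y.contraction_ell]
    rfl

theorem flow_naturality {n : ℕ} {a : ℤ} (x : X.Q.right.obj n a) :
    Y.flow.D (app f.hom.right x) = app (adjoinMap f) (X.flow.D x) := by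
  rw [X.flow_D rfl (sub_add_cancel a 1), Y.flow_D rfl (sub_add_cancel a 1), map_add,
    (adjoinMap f).map_d, contraction_naturality, ← f.hom.right.map_d, contraction_naturality]

/-- The elements on which the extended flow is compatible with `f`. -/
def flowNatural : SubOperad (adjoin X.Q.right).toGrOperad where
  carrier n a :=
    { carrier := {x | Y.flow.ext (app (adjoinMap f) x) = app (adjoinMap f) (X.flow.ext x)}
      zero_mem' := by simp only [Set.mem_ofPred_eq, map_zero]
      add_mem' := fun {x y} hx hy => by
        simp only [Set.mem_ofPred_eq, map_add] at hx hy ⊢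
        rw [hx, hy]
      smul_mem' := fun c x hx => by
        simp only [Set.mem_ofPred_eq, map_smul] at hx ⊢
        rw [hx] }
  act_mem {n a} σ x hx := by
    change Y.flow.ext (app (adjoinMap f) _) = app (adjoinMap f) (X.flow.ext _)
    have hx' : Y.flow.ext (app (adjoinMap f) x) = app (adjoinMap f) (X.flow.ext x) := hx
    rw [(adjoinMap f).map_act, X.flow.ext_act, Y.flow.ext_act, (adjoinMap f).map_act, hx']
  comp_mem {m n p a b c} i j hm hp hc x y hx hy := by
    change Y.flow.ext (app (adjoinMap f) _) = app (adjoinMap f) (X.flow.ext _)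
    have hx' : Y.flow.ext (app (adjoinMap f) x) = app (adjoinMap f) (X.flow.ext x) := hx
    have hy' : Y.flow.ext (app (adjoinMap f) y) = app (adjoinMap f) (X.flow.ext y) := hy
    rw [(adjoinMap f).map_comp, X.flow.ext_comp, Y.flow.ext_comp, map_add, (adjoinMap f).map_comp,
      (adjoinMap f).map_comp, hx', hy']

theorem flow_ext_naturality {n : ℕ} {a : ℤ} (x : (adjoin X.Q.right).obj n a) :
    Y.flow.ext (app (adjoinMap f) x) = app (adjoinMap f) (X.flow.ext x) := by
  refine adjoin.mem (flowNatural f) (fun x => flow_naturality f x) ?_ ?_ x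
  · exact (map_zero (app (adjoinMap f))).symm
  · change Y.flow.ext (app (adjoinMap f) (kappa X.Q.right)) = _
    rw [X.flow.ext_kappa, map_zero]
    exact Y.flow.ext_kappa

theorem flow_pow_naturality (t : ℕ) {n : ℕ} {a : ℤ} (x : (adjoin X.Q.right).obj n a) :
    Y.flow.pow t (app (adjoinMap f) x) = app (adjoinMap f) (X.flow.pow t x) := by
  induction t with
  | zero => rfl
  | succ t ih => rw [Flow.pow_succ, Flow.pow_succ, ih, flow_ext_naturality, map_smul]

variable [CharZero k]

theorem unitHom_naturality : f.hom.right ≫ Y.unitHom = X.unitHom ≫ cTwMap f.hom.right :=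
  hom_ext' fun x => cTw_ext fun t =>
    flow_pow_naturality f t (app (incl X.Q.right) x)

end Curv

/-! ### Filtrations on iterated twisting -/

section Comultiplication

variable {Q : DGOperad F k}

/-- `BiOrder Q s t x`: a composite of elements of `cTw(Q)` and `t` copies of `α'` and `κ'`, of total
filtration degree at least `s`. -/
inductive BiOrder (Q : DGOperad F k) :
    ℕ → ℕ → ∀ {n : ℕ} {a : ℤ}, (adjoin (cTw Q)).obj n a → Prop
  | of {s n a} (f : (cTw Q).obj n a) : Order s f → BiOrder Q s 0 (app (incl (cTw Q)) f)
  | alpha : BiOrder Q 1 1 (alpha (cTw Q))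
  | kappa : BiOrder Q 1 1 (kappa (cTw Q))
  | mono {s s' t n a} {x : (adjoin (cTw Q)).obj n a} : s' ≤ s → BiOrder Q s t x → BiOrder Q s' t x
  | zero {s t n a} : BiOrder Q s t (0 : (adjoin (cTw Q)).obj n a)
  | add {s t n a} {x y : (adjoin (cTw Q)).obj n a} :
      BiOrder Q s t x → BiOrder Q s t y → BiOrder Q s t (x + y)
  | smul {s t n a} (c : k) {x : (adjoin (cTw Q)).obj n a} : BiOrder Q s t x → BiOrder Q s t (c • x)
  | act {s t n a} (σ : F.perms n) {x : (adjoin (cTw Q)).obj n a} :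
      BiOrder Q s t x → BiOrder Q s t ((adjoin (cTw Q)).act σ x)
  | comp {s t s' t' m n p a b c} (i j : ℕ) (hm : m = i + 1 + j) (hp : p = i + n + j)
      (hc : c = a + b) {x : (adjoin (cTw Q)).obj m a} {y : (adjoin (cTw Q)).obj n b} :
      BiOrder Q s t x → BiOrder Q s' t' y →
      BiOrder Q (s + s') (t + t') ((adjoin (cTw Q)).comp i j hm hp hc x y)

namespace BiOrder

theorem totalOrder {s t n : ℕ} {a : ℤ} {x : (adjoin (cTw Q)).obj n a} (hx : BiOrder Q s t x) :
    TotalOrder Q s x := by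
  induction hx with
  | of f hf => exact .of f hf
  | alpha => exact .alpha
  | kappa => exact .kappa
  | mono h _ ih => exact .mono h ih
  | zero => rw [← map_zero (app (incl (cTw Q)))]; exact .of 0 fun _ _ => rfl
  | add _ _ ih ih' => exact .add ih ih'
  | smul c _ ih => exact .smul c ih
  | act σ _ ih => exact .act σ ih
  | comp i j hm hp hc _ _ ih ih' => exact .comp i j hm hp hc ih ih'

theorem sum {s t n : ℕ} {a : ℤ} {ι : Type*} (S : Finset ι) (f : ι → (adjoin (cTw Q)).obj n a)
    (h : ∀ i ∈ S, BiOrder Q s t (f i)) : BiOrder Q s t (∑ i ∈ S, f i) := by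
  classical
  induction S using Finset.induction_on with
  | empty => simpa using BiOrder.zero
  | insert i S hi ih =>
    rw [Finset.sum_insert hi]
    exact .add (h i (by simp)) (ih fun j hj => h j (by simp [hj]))

theorem diff {s t n : ℕ} {a b : ℤ} (h : b + 1 = a) {x : (adjoin (cTw Q)).obj n a}
    (hx : BiOrder Q s t x) : BiOrder Q s t ((adjoin (cTw Q)).d h x) := by
  induction hx generalizing b with
  | of f hf =>
    rw [← (incl (cTw Q)).map_d h f]
    refine .of _ fun t ht => ?_
    change (adjoin Q).d h (coeff f t) = 0
    rw [hf t ht, map_zero]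
  | alpha =>
    obtain rfl : b = -1 := by omega
    exact .kappa
  | kappa =>
    have : (adjoin (cTw Q)).d h (CurvedTwisting.kappa (cTw Q)) = 0 := (adjoin (cTw Q)).d_d _ h _
    rw [this]
    exact .zero
  | mono hs _ ih => exact .mono hs (ih h)
  | zero => rw [map_zero]; exact .zero
  | add _ _ ih ih' => rw [map_add]; exact .add (ih h) (ih' h)
  | smul c _ ih => rw [map_smul]; exact .smul c (ih h)
  | act σ _ ih => rw [(adjoin (cTw Q)).d_act]; exact .act σ (ih h)
  | @comp s t s' t' m n p a' b' c i j hm hp hc x y hx hy ih ih' =>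
    rw [(adjoin (cTw Q)).d_comp i j hm hp hc h (a' := a' - 1) (b' := b' - 1) (by omega) (by omega)
      (by omega) (by omega)]
    exact .add (.comp i j hm hp _ (ih _) hy) (.smul _ (.comp i j hm hp _ hx (ih' _)))

/-- The morphism which sends `α` and `κ` to `0` kills the elements whose total filtration degree
exceeds the number of `α'` and `κ'`. -/
theorem counit_eq_zero {s t n : ℕ} {a : ℤ} {x : (adjoin (cTw Q)).obj n a} (hx : BiOrder Q s t x)
    (hst : t < s) : app (adjoin.lift (cTwCounit Q ≫ incl Q) (CurvedTwisting.alpha Q)) x = 0 := by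
  induction hx with
  | of f hf =>
    change app (incl Q) (app (adjoin.lift (𝟙 Q) 0) (coeff f 0)) = 0
    rw [hf 0 hst, map_zero, map_zero]
  | alpha => omega
  | kappa => omega
  | mono h _ ih => exact ih (by omega)
  | zero => exact map_zero _
  | add _ _ ih ih' => rw [map_add, ih hst, ih' hst, add_zero]
  | smul c _ ih => rw [map_smul, ih hst, smul_zero]
  | act σ _ ih => rw [GrHom.map_act, ih hst, map_zero]
  | @comp s t s' t' m n p a' b' c i j hm hp hc x y hx hy ih ih' =>
    rw [GrHom.map_comp]
    by_cases h : t < s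
    · rw [ih h, map_zero, LinearMap.zero_apply]
    · rw [ih' (by omega), map_zero]

end BiOrder

theorem order_kappaHat : Order 1 (kappaHat Q) := fun t ht =>
  (coeffHom_kappaHat t).trans (if_neg (by omega))

theorem order_taylor {s : ℕ} (j : ℕ) {n : ℕ} {a : ℤ} {f : (cTw Q).obj n a} (hf : Order s f) :
    Order s ((cTwDeriv Q).taylor ((noKappa Q).incl.comp (killKappaHat Q)) (kappaHat Q) j f) := by
  intro t ht
  have h : coeffHom Q t f = 0 := hf t ht
  refine (coeffHom_taylor j f t).trans ?_
  rw [h, map_zero]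

theorem order_deriv {s n : ℕ} {a : ℤ} {f : (cTw Q).obj n a} (hf : Order s f) (i : Idx F n) :
    Order (s - 1) ((cTwDeriv Q).D f i) := by
  intro t ht
  have h : coeffHom Q (t + 1) f = 0 := hf (t + 1) (by omega)
  change (kappaDeriv Q).D (coeffHom Q (t + 1) f) i = 0
  rw [h, map_zero]
  rfl

theorem d_alphaHat :
    (cTw Q).d (show (-1 : ℤ) + 1 = 0 by norm_num) (alphaHat Q) = kappaHat Q := by
  refine coeffHom_ext fun t => ?_
  change (adjoin Q).d _ (coeffHom Q t (alphaHat Q)) = _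
  rw [coeffHom_alphaHat, coeffHom_kappaHat]
  split_ifs
  · rfl
  · exact map_zero _

end Comultiplication

/-! ### The flow on cTw(Q) and the comultiplication -/

section Triangle

variable [CharZero k] (Q : Under (cInf F k))

/-- The contraction of the curved twisting structure on `cTw(Q)`: it sends `κ` to `α'`. -/
def cTwContraction {n : ℕ} {a b : ℤ} (h : a + 1 = b) :
    (cTw Q.right).obj n a →ₗ[k] (adjoin (cTw Q.right)).obj n b :=
  (cTwCurv Q).contraction h

theorem cTwContraction_of_mem {n : ℕ} {a b : ℤ} (h : a + 1 = b) {f : (cTw Q.right).obj n a}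
    (hf : f ∈ (noKappa Q.right).carrier n a) : cTwContraction Q h f = 0 :=
  (cTwCurv Q).contraction_of_mem h hf

theorem cTwContraction_comp {m n p : ℕ} {a b c a' b' c' : ℤ} (i j : ℕ) (hm : m = i + 1 + j)
    (hp : p = i + n + j) (hc : c = a + b) (hc' : c + 1 = c') (ha' : a + 1 = a') (hb' : b + 1 = b')
    (h₁ : c' = a' + b) (h₂ : c' = a + b') (f : (cTw Q.right).obj m a) (g : (cTw Q.right).obj n b) :
    cTwContraction Q hc' ((cTw Q.right).comp i j hm hp hc f g) =
      (adjoin (cTw Q.right)).comp i j hm hp h₁ (cTwContraction Q ha' f) (app (incl (cTw Q.right)) g) +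
        ksign k a • (adjoin (cTw Q.right)).comp i j hm hp h₂ (app (incl (cTw Q.right)) f)
          (cTwContraction Q hb' g) :=
  (cTwCurv Q).contraction_comp i j hm hp hc hc' ha' hb' h₁ h₂ f g

theorem cTwContraction_kappaHat :
    cTwContraction Q (by norm_num) (kappaHat Q.right) = alpha (cTw Q.right) := by
  have h : cTwContraction Q (by norm_num) (ellOf (cTwUnder Q) 0) = alpha (cTw Q.right) :=
    (cTwCurv Q).contraction_ell
  have h' : cTwContraction Q (b := 0) (by norm_num) (ellOf (cTwUnder Q) 0) =
    cTwContraction Q (by norm_num) (kappaHat Q.right + twisted Q 0) :=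
    congrArg (cTwContraction Q _) (ellOf_cTwUnder_zero Q)
  rw [h', map_add, cTwContraction_of_mem Q _ (twisted_mem Q 0), add_zero] at h
  exact h

/-- The flow of the curved twisting structure on `cTw(Q)`. -/
def cTwFlow : Flow (cTw Q.right) := (cTwCurv Q).flow

theorem cTwFlow_D {n : ℕ} {a b c : ℤ} (h : a + 1 = b) (h' : c + 1 = a) (f : (cTw Q.right).obj n a) :
    (cTwFlow Q).D f = (adjoin (cTw Q.right)).d h (cTwContraction Q h f) +
      cTwContraction Q h' ((cTw Q.right).d h' f) :=
  (cTwCurv Q).flow_D h h' f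

theorem cTwFlow_const {n : ℕ} {a : ℤ} (x : Q.right.obj n a) : (cTwFlow Q).D (const x) = 0 := by
  have h : (cTw Q.right).d (sub_add_cancel a 1) (const x) =
      const (Q.right.d (sub_add_cancel a 1) x) := by
    refine coeffHom_ext fun t => ?_
    change (adjoin Q.right).d _ (coeffHom Q.right t (const x)) = _
    rw [coeffHom_const, coeffHom_const]
    split_ifs
    · exact ((incl Q.right).map_d _ x).symm
    · exact map_zero _
  rw [cTwFlow_D Q rfl (sub_add_cancel a 1), h, cTwContraction_of_mem Q _ (const_mem _),
    cTwContraction_of_mem Q _ (const_mem _), map_zero, add_zero]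

theorem cTwFlow_alphaHat : (cTwFlow Q).D (alphaHat Q.right) = alpha (cTw Q.right) := by
  rw [cTwFlow_D Q (b := 1) (c := -1) (by norm_num) (by norm_num), d_alphaHat,
    cTwContraction_kappaHat, cTwContraction_of_mem Q _ alphaHat_mem, map_zero, zero_add]

theorem cTwFlow_kappaHat : (cTwFlow Q).D (kappaHat Q.right) = kappa (cTw Q.right) := by
  rw [← d_alphaHat, (cTwFlow Q).D_d, cTwFlow_alphaHat]
  rfl

/-- The contraction is known on series without κ and on κ only, so continuity is proved through the
Taylor terms. Such a term is a derivative, of order s - 1 if s > 0, with a κ plugged in. The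
contraction acts on the derivative, covered by induction, or turns that κ into α'; in both cases the
total order stays at least s. -/
theorem biOrder_contraction_taylor (j : ℕ) : ∀ {s n : ℕ} {a b : ℤ} (h : a + 1 = b)
    (f : (cTw Q.right).obj n a), Order s f → BiOrder Q.right s 1 (cTwContraction Q h
      ((cTwDeriv Q.right).taylor ((noKappa Q.right).incl.comp (killKappaHat Q.right))
        (kappaHat Q.right) j f)) := by
  induction j with
  | zero =>
    intro s n a b h f _
    rw [MarkedDerivation.taylor_zero, GrHom.comp_map, cTwContraction_of_mem Q h
      (f := (noKappa Q.right).incl.map ((killKappaHat Q.right).map f)) ((killKappaHat Q.right).map f).2]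
    exact .zero
  | succ j ih =>
    intro s n a b h f hf
    rw [MarkedDerivation.taylor_succ, fillMark_apply, map_smul, map_add, map_sum]
    refine .smul _ (.add (.sum _ _ fun i _ => ?_) ?_)
    · have hi := i.emb_le
      rw [← comp_eq_plug _ _ (i := i.emb) (j := n - i.emb) (by omega) (by omega),
        cTwContraction_comp Q (a' := b + 1) (b' := 0) _ _ _ _ _ h (by omega) (by norm_num)
          (by omega) (by omega), cTwContraction_kappaHat]
      refine .mono (s := s - 1 + 1) (by omega) (.add ?_ (.smul _ ?_))
      · exact .comp _ _ _ _ _ (ih _ _ (order_deriv hf i)) (.of _ order_kappaHat)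
      · exact .comp _ _ _ _ _ (.of _ (order_taylor j (order_deriv hf i))) .alpha
    · split_ifs with hj
      · by_cases hna : n = 0 ∧ a = -1
        · obtain ⟨rfl, rfl⟩ := hna
          obtain rfl : b = 0 := by omega
          rw [scalarValue_apply, map_smul, cTwContraction_kappaHat, cTwDeriv_scalar]
          by_cases hs : s ≤ 1
          · exact .smul _ (.mono hs .alpha)
          · have h0 : coeffHom Q.right 1 f = 0 := hf 1 (by omega)
            rw [h0, map_zero, Pi.zero_apply, zero_smul]
            exact .zero
        · rw [scalarValue_of_not _ _ hna, map_zero]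
          exact .zero
      · rw [map_zero]
        exact .zero

theorem biOrder_contraction {s n : ℕ} {a b : ℤ} (h : a + 1 = b) (f : (cTw Q.right).obj n a)
    (hf : Order s f) : BiOrder Q.right s 1 (cTwContraction Q h f) := by
  obtain ⟨K, hK⟩ := cTwDeriv_finite ((noKappa Q.right).incl.comp (killKappaHat Q.right))
    (kappaHat Q.right) f
  have key := cTwDeriv_taylorHom f
  rw [MarkedDerivation.taylorHom_eq _ _ _ _ f K hK] at key
  rw [← key, map_sum]
  exact .sum _ _ fun j _ => biOrder_contraction_taylor Q j h f hf

theorem biOrder_flow {s t n : ℕ} {a : ℤ} {x : (adjoin (cTw Q.right)).obj n a}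
    (hx : BiOrder Q.right s t x) : BiOrder Q.right s (t + 1) ((cTwFlow Q).ext x) := by
  induction hx with
  | @of s n a f hf =>
    rw [Flow.ext_incl, cTwFlow_D Q rfl (sub_add_cancel a 1)]
    refine .add (.diff _ (biOrder_contraction Q _ f hf)) (biOrder_contraction Q _ _ fun t ht => ?_)
    change (adjoin Q.right).d _ (coeff f t) = 0
    rw [hf t ht, map_zero]
  | alpha => rw [Flow.ext_alpha]; exact .zero
  | kappa => rw [Flow.ext_kappa]; exact .zero
  | mono h _ ih => exact .mono h ih
  | zero => rw [map_zero]; exact .zero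
  | add _ _ ih ih' => rw [map_add]; exact .add ih ih'
  | smul c _ ih => rw [map_smul]; exact .smul c ih
  | act σ _ ih => rw [Flow.ext_act]; exact .act σ ih
  | @comp s t s' t' m n p a b c i j hm hp hc y z hy hz ih ih' =>
    rw [Flow.ext_comp]
    have h := BiOrder.comp i j hm hp hc ih hz
    have h' := BiOrder.comp i j hm hp hc hy ih'
    rw [add_right_comm] at h
    rw [← add_assoc t t' 1] at h'
    exact .add h h'

theorem biOrder_pow {s n : ℕ} {a : ℤ} {f : (cTw Q.right).obj n a} (hf : Order s f) (t : ℕ) :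
    BiOrder Q.right s t ((cTwFlow Q).pow t (app (incl (cTw Q.right)) f)) := by
  induction t with
  | zero => exact .of f hf
  | succ t ih => exact .smul _ (biOrder_flow Q ih)

/-- The comultiplication of `cTw`. -/
def comult : cTw Q.right ⟶ cTw (cTw Q.right) := (cTwCurv Q).unitHom

theorem coeffHom_comult {n : ℕ} {a : ℤ} (f : (cTw Q.right).obj n a) (t : ℕ) :
    coeffHom (cTw Q.right) t (app (comult Q) f) =
      (cTwFlow Q).pow t (app (incl (cTw Q.right)) f) := rfl

/-- If D² f = 0, the exponential of D on f is f + D f. This applies to the elements of Q, to α and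
to κ. -/
theorem coeffHom_comult_linear {n : ℕ} {a : ℤ} (f : (cTw Q.right).obj n a)
    (y : (adjoin (cTw Q.right)).obj n a) (hf : (cTwFlow Q).D f = y) (hy : (cTwFlow Q).ext y = 0)
    (t : ℕ) : coeffHom (cTw Q.right) t (app (comult Q) f) =
      (if t = 1 then y else 0) + if t = 0 then app (incl (cTw Q.right)) f else 0 := by
  rw [coeffHom_comult]
  match t with
  | 0 => rw [if_neg (by omega), if_pos rfl, zero_add]; rfl
  | t + 1 =>
    have h : ∀ t, (cTwFlow Q).pow (t + 2) (app (incl (cTw Q.right)) f) = 0 := by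
      intro t
      induction t with
      | zero => rw [Flow.pow_succ, Flow.pow_succ, Flow.pow_zero, Flow.ext_incl, hf, map_smul, hy,
          smul_zero, smul_zero]
      | succ t ih => rw [Flow.pow_succ, ih, map_zero, smul_zero]
    match t with
    | 0 =>
      rw [if_pos rfl, if_neg (by omega), add_zero, Flow.pow_succ, Flow.pow_zero, Flow.ext_incl, hf,
        zero_add, Nat.cast_one, inv_one, one_smul]
    | t + 1 => rw [h, if_neg (by omega), if_neg (by omega), add_zero]

theorem comult_const {n : ℕ} {a : ℤ} (x : Q.right.obj n a) :
    app (comult Q) (const x) = const (const x) := by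
  refine coeffHom_ext fun t => ?_
  rw [coeffHom_comult_linear Q _ 0 (cTwFlow_const Q x) (map_zero _), ite_self, zero_add,
    coeffHom_const]

theorem comult_alphaHat : app (comult Q) (alphaHat Q.right) =
    alphaHat (cTw Q.right) + const (alphaHat Q.right) := by
  refine coeffHom_ext fun t => ?_
  rw [coeffHom_comult_linear Q _ _ (cTwFlow_alphaHat Q) (Flow.ext_alpha _), map_add,
    coeffHom_alphaHat, coeffHom_const]

theorem comult_kappaHat : app (comult Q) (kappaHat Q.right) =
    kappaHat (cTw Q.right) + const (kappaHat Q.right) := by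
  refine coeffHom_ext fun t => ?_
  rw [coeffHom_comult_linear Q _ _ (cTwFlow_kappaHat Q) (Flow.ext_kappa _), map_add,
    coeffHom_kappaHat, coeffHom_const]

theorem isComultiplication_comult : IsComultiplication (comult Q) where
  const := comult_const Q
  alpha := comult_alphaHat Q
  kappa := comult_kappaHat Q
  continuous _ _ hf t := (biOrder_pow Q hf t).totalOrder

end Triangle

end Adjunction

end

end CurvedTwisting

namespace CurvedTwisting

noncomputable section

section Adjunction

variable {F : Flavor} {k : Type u} [Field k]

/-! ### Polynomials in α and κ as a dense part of the series -/

section Polynomials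

variable {Q : DGOperad F k}

variable (Q) in
/-- The inclusion of `Q` in `cTw(Q)`. -/
def constHom : Q ⟶ cTw Q where
  map :=
    { toFun := const
      map_add' := fun x y => coeffHom_ext fun t => by
        rw [map_add, coeffHom_const, coeffHom_const, coeffHom_const, map_add]
        split_ifs
        · rfl
        · exact (add_zero 0).symm
      map_smul' := fun c x => coeffHom_ext fun t => by
        rw [RingHom.id_apply, map_smul, coeffHom_const, coeffHom_const, map_smul]
        split_ifs
        · rfl
        · exact (smul_zero c).symm }
  map_act σ x := coeffHom_ext fun t => by
    rw [coeffHom_act]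
    change coeffHom Q t (const _) = (adjoin Q).act σ (coeffHom Q t (const x))
    rw [coeffHom_const, coeffHom_const, (incl Q).map_act]
    split_ifs
    · rfl
    · exact (map_zero _).symm
  map_comp i j hm hp hc x y := coeffHom_ext fun t => by
    rw [coeffHom_comp]
    change coeffHom Q t (const _) =
      ∑ q ∈ Finset.HasAntidiagonal.antidiagonal t, (adjoin Q).comp i j hm hp hc
      (coeffHom Q q.1 (const x)) (coeffHom Q q.2 (const y))
    simp only [coeffHom_const]
    split_ifs with ht
    · subst ht
      rw [Finset.Nat.antidiagonal_zero, Finset.sum_singleton, if_pos rfl, if_pos rfl,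
        (incl Q).map_comp]
    · refine (Finset.sum_eq_zero fun q hq => ?_).symm
      rw [Finset.HasAntidiagonal.mem_antidiagonal] at hq
      by_cases hq1 : q.1 = 0
      · rw [if_neg (c := q.2 = 0) (by omega), map_zero]
      · rw [if_neg hq1, map_zero, LinearMap.zero_apply]
  map_d h x := coeffHom_ext fun t => by
    change coeffHom Q t (const _) = (adjoin Q).d h (coeffHom Q t (const x))
    rw [coeffHom_const, coeffHom_const, (incl Q).map_d]
    split_ifs
    · rfl
    · exact (map_zero _).symm

variable (Q) in
/-- The inclusion of polynomials in series. -/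
def polyHom : adjoin Q ⟶ cTw Q := adjoin.lift (constHom Q) (alphaHat Q)

theorem coeffHom_polyHom {N s n : ℕ} {a : ℤ} {x : (adjoin Q).obj n a} (hx : Weight Q N s x) (t : ℕ) :
    coeffHom Q t (app (polyHom Q) x) = if t = s then x else 0 := by
  induction hx generalizing t with
  | of x => exact coeffHom_const x t
  | alpha => exact coeffHom_alphaHat t
  | kappa =>
    have h : app (polyHom Q) (kappa Q) = kappaHat Q :=
      ((polyHom Q).map_d _ (alpha Q)).trans d_alphaHat
    rw [h, coeffHom_kappaHat]
  | mono _ _ ih => exact ih t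
  | zero => rw [map_zero, map_zero, ite_self]
  | add _ _ ih ih' =>
    rw [map_add, map_add, ih, ih']
    split_ifs
    · rfl
    · exact add_zero 0
  | smul c _ ih =>
    rw [map_smul, map_smul, ih]
    split_ifs
    · rfl
    · exact smul_zero c
  | act σ _ ih =>
    rw [GrHom.map_act, coeffHom_act, ih]
    split_ifs
    · rfl
    · exact map_zero _
  | @comp N s N' s' m n p a b c i j hm hp hc x y hx hy ih ih' =>
    rw [GrHom.map_comp, coeffHom_comp]
    simp only [ih, ih']
    split_ifs with ht
    · rw [Finset.sum_eq_single (s, s'), if_pos rfl, if_pos rfl]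
      · rintro ⟨q, q'⟩ hq hne
        by_cases h1 : q = s
        · rw [if_neg (c := q' = s') (fun h2 => hne (by rw [h1, h2])), map_zero]
        · rw [if_neg (c := q = s) h1, map_zero, LinearMap.zero_apply]
      · intro h
        exact absurd (Finset.HasAntidiagonal.mem_antidiagonal.2 ht.symm) h
    · refine Finset.sum_eq_zero fun q hq => ?_
      rw [Finset.HasAntidiagonal.mem_antidiagonal] at hq
      by_cases h1 : q.1 = s
      · rw [if_neg (c := q.2 = s') (by omega), map_zero]
      · rw [if_neg h1, map_zero, LinearMap.zero_apply]

theorem coeff_eq_coeffHom {n : ℕ} {a : ℤ} (f : (cTw Q).obj n a) (t : ℕ) :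
    coeff f t = coeffHom Q t f := rfl

/-- A series differs from its partial sums by a series of high order. -/
theorem order_sub_polyHom {n : ℕ} {a : ℤ} (f : (cTw Q).obj n a) (t : ℕ) :
    Order t (f - ∑ s ∈ Finset.range t, app (polyHom Q) (coeffHom Q s f)) := by
  obtain ⟨N, hN⟩ := exists_weight f
  intro r hr
  rw [coeff_eq_coeffHom, map_sub, map_sum]
  simp only [fun s => coeffHom_polyHom (hN s) r]
  rw [Finset.sum_ite_eq, if_pos (Finset.mem_range.2 hr), sub_self]

theorem cTwMap_const {P : DGOperad F k} (f : Q ⟶ P) {n : ℕ} {a : ℤ} (x : Q.obj n a) :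
    app (cTwMap f) (const x) = const (app f x) := by
  refine coeffHom_ext fun t => ?_
  change app (adjoin.lift (f ≫ incl P) (alpha P)) (coeffHom Q t (const x)) = _
  rw [coeffHom_const, coeffHom_const]
  split_ifs
  · rfl
  · exact map_zero _

theorem cTwMap_alphaHat {P : DGOperad F k} (f : Q ⟶ P) :
    app (cTwMap f) (alphaHat Q) = alphaHat P := by
  refine coeffHom_ext fun t => ?_
  change app (adjoin.lift (f ≫ incl P) (alpha P)) (coeffHom Q t (alphaHat Q)) = _
  rw [coeffHom_alphaHat, coeffHom_alphaHat]
  split_ifs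
  · rfl
  · exact map_zero _

theorem cTwCounit_const {n : ℕ} {a : ℤ} (x : Q.obj n a) : app (cTwCounit Q) (const x) = x := rfl

theorem cTwCounit_alphaHat : app (cTwCounit Q) (alphaHat Q) = 0 :=
  map_zero (app (adjoin.lift (𝟙 Q) 0))

theorem cTwCounit_kappaHat : app (cTwCounit Q) (kappaHat Q) = 0 :=
  map_zero (app (adjoin.lift (𝟙 Q) 0))

theorem cTwCounit_naturality {P : DGOperad F k} (f : Q ⟶ P) :
    cTwMap f ≫ cTwCounit P = cTwCounit Q ≫ f :=
  hom_ext' fun x => adjoin.hom_ext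
    (f := adjoin.lift (f ≫ incl P) (alpha P) ≫ adjoin.lift (𝟙 P) 0)
    (g := adjoin.lift (𝟙 Q) 0 ≫ f) (fun _ => rfl) (map_zero (app f)).symm (coeffHom Q 0 x)

end Polynomials

/-! ### The second triangle identity and the induced comonad -/

variable [CharZero k]

/-- On polynomials both sides are dg morphisms which agree on Q and α, and hence on κ = dα. A dg
morphism out of series is not determined by this; the passage to the limit uses the filtration
estimates for the comultiplication. -/
theorem comult_cTwMap_counit (Q : Under (cInf F k)) :
    comult Q ≫ cTwMap (cTwCounit Q.right) = 𝟙 (cTw Q.right) := by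
  have hpoly : ∀ {n : ℕ} {a : ℤ} (x : (adjoin Q.right).obj n a),
      app (comult Q ≫ cTwMap (cTwCounit Q.right)) (app (polyHom Q.right) x) =
        app (polyHom Q.right) x := by
    refine adjoin.hom_ext (f := polyHom Q.right ≫ comult Q ≫ cTwMap (cTwCounit Q.right))
      (g := polyHom Q.right) (fun x => ?_) ?_
    · change app (cTwMap (cTwCounit Q.right)) (app (comult Q) (const x)) = const x
      rw [comult_const, cTwMap_const, cTwCounit_const]
    · change app (cTwMap (cTwCounit Q.right)) (app (comult Q) (alphaHat Q.right)) =
        alphaHat Q.right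
      rw [comult_alphaHat, map_add, cTwMap_const, cTwMap_alphaHat, cTwCounit_alphaHat]
      exact (congrArg _ (map_zero (app (constHom Q.right)))).trans (add_zero _)
  refine hom_ext' fun f => coeffHom_ext fun t => ?_
  -- In the coefficient of weight t only t copies of α' and κ' are available, so a remainder of
  -- order t + 1 must involve α or κ in each term, and the counit kills it.
  have h := (biOrder_pow Q (order_sub_polyHom f (t + 1)) t).counit_eq_zero (Nat.lt_succ_self t)
  have h' : coeffHom Q.right t (app (comult Q ≫ cTwMap (cTwCounit Q.right))
      (f - ∑ s ∈ Finset.range (t + 1), app (polyHom Q.right) (coeffHom Q.right s f))) = 0 := h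
  rw [map_sub, map_sub, map_sum, Finset.sum_congr rfl fun s _ => hpoly (coeffHom Q.right s f),
    sub_eq_zero] at h'
  rw [h']
  have h'' := order_sub_polyHom f (t + 1) t (Nat.lt_succ_self t)
  rw [coeff_eq_coeffHom, map_sub, sub_eq_zero] at h''
  exact h''.symm

variable (F k) in
/-- The forgetful functor is left adjoint to `cTw`. -/
def curvAdjunction : Curv.forget F k ⊣ cofreeCurv F k :=
  Adjunction.mkOfUnitCounit
    { unit :=
        { app := fun X => X.unit
          naturality := fun _ _ f => Curv.Hom.ext (Under.UnderMorphism.ext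
            (Curv.unitHom_naturality f)) }
      counit :=
        { app := counit
          naturality := fun _ _ f => Under.UnderMorphism.ext (cTwCounit_naturality f.right) }
      left_triangle := by
        ext X : 2
        exact (Category.id_comp _).trans X.unit_counit
      right_triangle := by
        ext Q : 2
        refine Curv.Hom.ext (Under.UnderMorphism.ext ?_)
        exact (Category.id_comp _).trans (comult_cTwMap_counit Q) }

variable (F k) in
/-- The comonad of the adjunction is `cTw` as a functor. -/
def curvComonadIso : (curvAdjunction F k).toComonad.toFunctor ⋙ Under.forget (cInf F k) ≅
    Under.forget (cInf F k) ⋙ cTwFunctor F k :=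
  NatIso.ofComponents (fun Q => Iso.refl (cTw Q.right)) fun _ =>
    (Category.comp_id _).trans (Category.id_comp _).symm

theorem transportedComult_eq (Q : Under (cInf F k)) :
    transportedComult (curvAdjunction F k).toComonad (curvComonadIso F k) Q = comult Q := by
  have h : cTwMap (𝟙 (cTw Q.right)) = 𝟙 (cTw (cTw Q.right)) := (cTwFunctor F k).map_id _
  refine Eq.trans (b := 𝟙 (cTw Q.right) ≫ comult Q ≫ 𝟙 (cTw (cTw Q.right)) ≫
    cTwMap (𝟙 (cTw Q.right))) rfl ?_
  rw [h, Category.id_comp, Category.id_comp, Category.comp_id]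

variable (F k) in
/-- The comonad of the adjunction is the curved twisting comonad. -/
def curvComonad : CTwComonad (curvAdjunction F k).toComonad where
  iso := curvComonadIso F k
  ell_zero := ellOf_cTwUnder_zero
  ell_pos := ellOf_cTwUnder_pos
  counit Q := (Category.id_comp _).symm
  comult Q := by
    rw [transportedComult_eq]
    exact isComultiplication_comult Q

end Adjunction

end

end CurvedTwisting

namespace CurvedTwisting

noncomputable section

/-! ## Comonadicity -/

section Comonadic

variable {F : Flavor} {k : Type u} [Field k] [CharZero k]

/-! ### Evaluating series at α = 0 and a prescribed κ -/

section Evaluation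

variable {P : DGOperad F k} {S : GrOperad F k} (g : GrHom P.toGrOperad S) (b : S.obj 0 (-1))

theorem exists_evaluation : ∃ h : GrHom (cTw P).toGrOperad S,
    (∀ {n : ℕ} {a : ℤ} (f : (noKappa P).carrier n a), h.map f.1 = g.map (app (cTwCounit P) f.1)) ∧
      h.map (kappaHat P) = b := by
  -- With ν = 0 the free generator is κ itself, and α can be sent to 0 on the complement by the
  -- counit.
  have h := (isCoproduct_noKappa (0 : (cTw P).obj 0 (-1)) (Submodule.zero_mem _) S
    (g.comp ((cTwCounit P).toGrHom.comp (noKappa P).incl)) b).exists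
  rwa [add_zero] at h

/-- The morphism out of `cTw(P)` which is `g` on `P`, sends `α` to `0` and `κ` to `b`. -/
def evaluation : GrHom (cTw P).toGrOperad S := (exists_evaluation g b).choose

theorem evaluation_of_mem {n : ℕ} {a : ℤ} {f : (cTw P).obj n a} (hf : f ∈ (noKappa P).carrier n a) :
    (evaluation g b).map f = g.map (app (cTwCounit P) f) :=
  (exists_evaluation g b).choose_spec.1 ⟨f, hf⟩

theorem evaluation_kappaHat : (evaluation g b).map (kappaHat P) = b :=
  (exists_evaluation g b).choose_spec.2

theorem evaluation_unique {h : GrHom (cTw P).toGrOperad S}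
    (hg : ∀ {n : ℕ} {a : ℤ} (f : (cTw P).obj n a), f ∈ (noKappa P).carrier n a →
      h.map f = g.map (app (cTwCounit P) f))
    (hb : h.map (kappaHat P) = b) : h = evaluation g b :=
  GrHom.ext' fun f => cTw_mem (equalizer h (evaluation g b))
    (fun _ hf => (hg _ hf).trans (evaluation_of_mem g b hf).symm)
    (hb.trans (evaluation_kappaHat g b).symm) f

theorem comp_evaluation {R : GrOperad F k} (h : GrHom S R) :
    h.comp (evaluation g b) = evaluation (h.comp g) (h.map b) :=
  evaluation_unique _ _
    (fun _ hf => congrArg h.map (evaluation_of_mem g b hf))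
    (congrArg h.map (evaluation_kappaHat g b))

theorem evaluation_cTwMap {R : DGOperad F k} (ρ : R ⟶ P) :
    (evaluation g b).comp (cTwMap ρ).toGrHom = evaluation (g.comp ρ.toGrHom) b :=
  evaluation_unique _ _
    (fun f hf => (evaluation_of_mem g b (mem_noKappa_cTwMap ρ hf)).trans
      (congrArg (fun h : cTw R ⟶ P => g.map (app h f)) (cTwCounit_naturality ρ)))
    ((congrArg (evaluation g b).map (cTwMap_kappaHat ρ)).trans (evaluation_kappaHat g b))

theorem evaluation_ell {Q : Under (cInf F k)} (g : GrHom Q.right.toGrOperad S) :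
    (evaluation g b).map (ellOf (cTwUnder Q) 0) = b + g.map (ellOf Q 0) := by
  have h : app (cTwCounit Q.right) (twisted Q 0) = ellOf Q 0 := by
    have h0 : app (cTwCounit Q.right) (ellOf (cTwUnder Q) 0) = ellOf Q 0 := app_ellOf (counit Q) 0
    have h1 : app (cTwCounit Q.right) (ellOf (cTwUnder Q) 0) =
        app (cTwCounit Q.right) (kappaHat Q.right + twisted Q 0) :=
      congrArg (app (cTwCounit Q.right)) (ellOf_cTwUnder_zero Q)
    rw [← h0, h1, map_add, cTwCounit_kappaHat, zero_add]
  have h2 : (evaluation g b).map (ellOf (cTwUnder Q) 0) =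
      (evaluation g b).map (kappaHat Q.right + twisted Q 0) :=
    congrArg (evaluation g b).map (ellOf_cTwUnder_zero Q)
  rw [h2, map_add, evaluation_kappaHat, evaluation_of_mem g b (twisted_mem Q 0), h]

end Evaluation

theorem comult_mem {Q : Under (cInf F k)} {n : ℕ} {a : ℤ} {f : (cTw Q.right).obj n a}
    (hf : f ∈ (noKappa Q.right).carrier n a) :
    app (comult Q) f ∈ (noKappa (cTw Q.right)).carrier n a :=
  (cTwCurv Q).unit.map_mem f hf

theorem cTwCounit_comult {Q : Under (cInf F k)} {n : ℕ} {a : ℤ} (f : (cTw Q.right).obj n a) :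
    app (cTwCounit (cTw Q.right)) (app (comult Q) f) = f := rfl

/-- The elements of `Q₀` are those without `κ` after twisting. -/
theorem Curv.mem_of_unit_mem (X : Curv F k) {n : ℕ} {a : ℤ} {x : X.Q.right.obj n a}
    (hx : app X.unitHom x ∈ (noKappa X.Q.right).carrier n a) : x ∈ X.Q₀.carrier n a := by
  -- After the unit, evaluating at κ = -ℓ_0 fixes Q_0 and sends ℓ_0 to -ℓ_0 + ℓ_0 = 0, so all its
  -- values lie in Q_0. If the unit of x contains no κ, the value of κ is irrelevant and the
  -- evaluation returns x.
  have key : ∀ {n : ℕ} {a : ℤ} (x : X.Q.right.obj n a),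
      (evaluation (GrHom.id X.Q.right.toGrOperad) (-ellOf X.Q 0)).map (app X.unitHom x) ∈
        X.Q₀.carrier n a := by
    refine X.coproduct.mem (X.Q₀.comap ((evaluation (GrHom.id X.Q.right.toGrOperad)
      (-ellOf X.Q 0)).comp X.unitHom.toGrHom)) (fun s hs => ?_) ?_
    · have h : (evaluation (GrHom.id X.Q.right.toGrOperad) (-ellOf X.Q 0)).map
          (app X.unitHom s) = s := evaluation_of_mem _ _ (X.unit.map_mem s hs)
      change _ ∈ X.Q₀.carrier _ _
      exact h.symm ▸ hs
    · have h : (evaluation (GrHom.id X.Q.right.toGrOperad) (-ellOf X.Q 0)).map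
          (app X.unitHom (ellOf X.Q 0)) = 0 := by
        refine (congrArg _ (X.unitHom_ell 0)).trans ((evaluation_ell _ _).trans ?_)
        exact neg_add_cancel (ellOf X.Q 0)
      change _ ∈ X.Q₀.carrier 0 (-1)
      exact h.symm ▸ Submodule.zero_mem _
  have h := evaluation_of_mem (GrHom.id X.Q.right.toGrOperad) (-ellOf X.Q 0) hx
  have h' : (GrHom.id X.Q.right.toGrOperad).map (app (cTwCounit X.Q.right) (app X.unitHom x)) = x :=
    rfl
  rw [h'] at h
  exact h ▸ key x

/-! ### The curved twisting structure of a coalgebra -/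

section Coalgebra

variable (A : Under (cInf F k)) (ρ : A ⟶ cTwUnder A)

/-- The structure morphism of a coalgebra, as a morphism of dg operads. -/
def coaction : A.right ⟶ cTw A.right := ρ.right

theorem coaction_ell (n : ℕ) : app (coaction A ρ) (ellOf A n) = ellOf (cTwUnder A) n :=
  app_ellOf ρ n

/-- The suboperad of the elements whose twist does not contain `κ`. -/
def coalgebraSub : SubOperad A.right.toGrOperad :=
  (noKappa A.right).comap (coaction A ρ).toGrHom

theorem mem_coalgebraSub {n : ℕ} {a : ℤ} {x : A.right.obj n a} :
    x ∈ (coalgebraSub A ρ).carrier n a ↔ app (coaction A ρ) x ∈ (noKappa A.right).carrier n a :=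
  Iff.rfl

/-- The retraction onto the suboperad, which sends `ℓ_0` to `0`. -/
def retraction : GrHom A.right.toGrOperad A.right.toGrOperad :=
  (evaluation (GrHom.id A.right.toGrOperad) (-ellOf A 0)).comp (coaction A ρ).toGrHom

theorem retraction_ell : (retraction A ρ).map (ellOf A 0) = 0 := by
  refine (congrArg (evaluation (GrHom.id A.right.toGrOperad) (-ellOf A 0)).map
    (coaction_ell A ρ 0)).trans ((evaluation_ell _ _).trans ?_)
  exact neg_add_cancel (ellOf A 0)

/-- The case of the cofree coalgebra cTw(A), where the coproduct decomposition is already known: the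
map fixes the series without κ and kills ℓ_0. -/
theorem evaluation_comult_mem {n : ℕ} {a : ℤ} (f : (cTw A.right).obj n a) :
    (evaluation (GrHom.id (cTw A.right).toGrOperad) (-ellOf (cTwUnder A) 0)).map
      (app (comult A) f) ∈ (noKappa A.right).carrier n a := by
  refine (cTwCurv A).coproduct.mem ((noKappa A.right).comap
    ((evaluation (GrHom.id (cTw A.right).toGrOperad) (-ellOf (cTwUnder A) 0)).comp
      (comult A).toGrHom)) (fun s hs => ?_) ?_ f
  · have h : (evaluation (GrHom.id (cTw A.right).toGrOperad) (-ellOf (cTwUnder A) 0)).map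
        (app (comult A) s) = s := evaluation_of_mem _ _ (comult_mem hs)
    change _ ∈ (noKappa A.right).carrier _ _
    exact h.symm ▸ hs
  · have h : (evaluation (GrHom.id (cTw A.right).toGrOperad) (-ellOf (cTwUnder A) 0)).map
        (app (comult A) (ellOf (cTwUnder A) 0)) = 0 := by
      refine (congrArg _ ((cTwCurv A).unitHom_ell 0)).trans
        ((evaluation_ell (Q := cTwUnder A) _ _).trans ?_)
      exact neg_add_cancel (ellOf (cTwUnder A) 0)
    change _ ∈ (noKappa A.right).carrier 0 (-1)
    exact h.symm ▸ Submodule.zero_mem _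

variable {A ρ}

theorem counit_coaction (hε : coaction A ρ ≫ cTwCounit A.right = 𝟙 A.right) {n : ℕ} {a : ℤ}
    (x : A.right.obj n a) : app (cTwCounit A.right) (app (coaction A ρ) x) = x :=
  congrArg (fun f : A.right ⟶ A.right => app f x) hε

theorem evaluation_coaction_of_mem (hε : coaction A ρ ≫ cTwCounit A.right = 𝟙 A.right)
    {S : GrOperad F k} (g : GrHom A.right.toGrOperad S) (b : S.obj 0 (-1)) {n : ℕ} {a : ℤ}
    {x : A.right.obj n a} (hx : x ∈ (coalgebraSub A ρ).carrier n a) :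
    (evaluation g b).map (app (coaction A ρ) x) = g.map x := by
  rw [evaluation_of_mem g b hx, counit_coaction hε]

theorem evaluation_coaction_ell {S : GrOperad F k} (g : GrHom A.right.toGrOperad S)
    (b : S.obj 0 (-1)) : (evaluation g b).map (app (coaction A ρ) (ellOf A 0)) =
      b + g.map (ellOf A 0) :=
  (congrArg (evaluation g b).map (coaction_ell A ρ 0)).trans (evaluation_ell b g)

theorem retraction_of_mem (hε : coaction A ρ ≫ cTwCounit A.right = 𝟙 A.right) {n : ℕ} {a : ℤ}
    {x : A.right.obj n a} (hx : x ∈ (coalgebraSub A ρ).carrier n a) :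
    (retraction A ρ).map x = x :=
  evaluation_coaction_of_mem hε _ _ hx

/-- The coassociativity of a coalgebra, evaluated. -/
theorem evaluation_coassoc (hδ : coaction A ρ ≫ comult A = coaction A ρ ≫ cTwMap (coaction A ρ))
    {S : GrOperad F k} (G : GrHom (cTw A.right).toGrOperad S) (b : S.obj 0 (-1)) {n : ℕ} {a : ℤ}
    (x : A.right.obj n a) :
    (evaluation (G.comp (coaction A ρ).toGrHom) b).map (app (coaction A ρ) x) =
      (evaluation G b).map (app (comult A) (app (coaction A ρ) x)) := by
  rw [← evaluation_cTwMap]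
  exact congrArg (fun f : A.right ⟶ cTw (cTw A.right) => (evaluation G b).map (app f x)) hδ.symm

/-- Pushing ρ through the evaluation and using coassociativity replaces ρ after the retraction by
the retraction of cTw(A) after ρ. The cofree case applies to the latter. -/
theorem retraction_mem (hδ : coaction A ρ ≫ comult A = coaction A ρ ≫ cTwMap (coaction A ρ))
    {n : ℕ} {a : ℤ} (x : A.right.obj n a) :
    (retraction A ρ).map x ∈ (coalgebraSub A ρ).carrier n a := by
  rw [mem_coalgebraSub]
  have h : app (coaction A ρ) ((retraction A ρ).map x) =
      (evaluation (GrHom.id (cTw A.right).toGrOperad) (-ellOf (cTwUnder A) 0)).map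
        (app (comult A) (app (coaction A ρ) x)) := by
    refine Eq.trans ?_ (evaluation_coassoc hδ (GrHom.id (cTw A.right).toGrOperad)
      (-ellOf (cTwUnder A) 0) x)
    have h1 := comp_evaluation (GrHom.id A.right.toGrOperad) (-ellOf A 0) (coaction A ρ).toGrHom
    have h2 : (coaction A ρ).toGrHom.map (-ellOf A 0) = -ellOf (cTwUnder A) 0 :=
      (map_neg (app (coaction A ρ)) (ellOf A 0)).trans (congrArg Neg.neg (coaction_ell A ρ 0))
    rw [h2] at h1
    exact congrArg (fun f : GrHom (cTw A.right).toGrOperad (cTw A.right).toGrOperad =>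
      f.map (app (coaction A ρ) x)) h1
  rw [h]
  exact evaluation_comult_mem A _

/-- A coalgebra is recovered from the retraction and `ℓ_0`. -/
theorem evaluation_retraction (hε : coaction A ρ ≫ cTwCounit A.right = 𝟙 A.right)
    (hδ : coaction A ρ ≫ comult A = coaction A ρ ≫ cTwMap (coaction A ρ)) {n : ℕ} {a : ℤ}
    (x : A.right.obj n a) :
    (evaluation (retraction A ρ) (ellOf A 0)).map (app (coaction A ρ) x) = x := by
  -- The comultiplication sends κ to κ' + κ, and the nested evaluations send κ' to ℓ_0 and κ to
  -- -ℓ_0. The sum is 0, so the composite is the counit.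
  have h : (evaluation (evaluation (GrHom.id A.right.toGrOperad) (-ellOf A 0)) (ellOf A 0)).comp
      (comult A).toGrHom = (cTwCounit A.right).toGrHom := by
    refine (evaluation_unique (GrHom.id A.right.toGrOperad) 0 (fun f hf => ?_) ?_).trans
      (evaluation_unique (GrHom.id A.right.toGrOperad) 0 (fun f hf => rfl) cTwCounit_kappaHat).symm
    · change (evaluation _ _).map (app (comult A) f) = _
      rw [evaluation_of_mem _ _ (comult_mem hf), cTwCounit_comult, evaluation_of_mem _ _ hf]
    · change (evaluation _ _).map (app (comult A) (kappaHat A.right)) = _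
      rw [comult_kappaHat, map_add, evaluation_kappaHat, evaluation_of_mem _ _ (const_mem _),
        cTwCounit_const, evaluation_kappaHat, add_neg_cancel]
  refine (evaluation_coassoc hδ _ _ x).trans ?_
  refine (congrArg (fun f : GrHom (cTw A.right).toGrOperad A.right.toGrOperad =>
    f.map (app (coaction A ρ) x)) h).trans ?_
  exact counit_coaction hε x

/-- The required morphism is ρ followed by g after the retraction on the coefficients, with α = 0
and κ = y. It is unique because any h can be composed with the reconstruction of the identity in
`evaluation_retraction`, which involves only the values of h on the suboperad and on ℓ_0. -/
theorem isCoproduct_coalgebraSub (hε : coaction A ρ ≫ cTwCounit A.right = 𝟙 A.right)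
    (hδ : coaction A ρ ≫ comult A = coaction A ρ ≫ cTwMap (coaction A ρ)) :
    IsCoproduct (coalgebraSub A ρ) (ellOf A 0) := by
  intro R g y
  have hπ : ((coalgebraSub A ρ).codRestrict (retraction A ρ) (retraction_mem hδ)).map (ellOf A 0) =
      0 := Subtype.ext (retraction_ell A ρ)
  refine ⟨(evaluation (g.comp ((coalgebraSub A ρ).codRestrict (retraction A ρ)
    (retraction_mem hδ))) y).comp (coaction A ρ).toGrHom, ⟨fun s => ?_, ?_⟩, ?_⟩
  · refine (evaluation_coaction_of_mem hε _ _ s.2).trans (congrArg g.map ?_)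
    exact Subtype.ext (retraction_of_mem hε s.2)
  · refine (evaluation_coaction_ell _ _).trans ?_
    rw [GrHom.comp_map, hπ, map_zero, add_zero]
  · rintro h ⟨hS, hx⟩
    refine GrHom.ext' fun x => ?_
    have h1 := comp_evaluation (retraction A ρ) (ellOf A 0) h
    have h2 : h.comp (retraction A ρ) = g.comp ((coalgebraSub A ρ).codRestrict (retraction A ρ)
        (retraction_mem hδ)) := GrHom.ext' fun z => hS ⟨_, retraction_mem hδ z⟩
    rw [h2, hx] at h1
    refine (congrArg h.map (evaluation_retraction hε hδ x)).symm.trans ?_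
    exact congrArg (fun f : GrHom (cTw A.right).toGrOperad R => f.map (app (coaction A ρ) x)) h1

/-- The curved twisting structure of a coalgebra. -/
def coalgebraCurv (hε : coaction A ρ ≫ cTwCounit A.right = 𝟙 A.right)
    (hδ : coaction A ρ ≫ comult A = coaction A ρ ≫ cTwMap (coaction A ρ)) : Curv F k where
  Q := A
  Q₀ := coalgebraSub A ρ
  coproduct := isCoproduct_coalgebraSub hε hδ
  ell_mem n hn := by
    rw [mem_coalgebraSub]
    have h := (coaction_ell A ρ n).trans (ellOf_cTwUnder_pos A n hn)
    exact h.symm ▸ twisted_mem A n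
  d_degree {n a b} h x hx := by
    -- Condition (iii) is transported from cTw(A). The evaluation along the retraction at κ = ℓ_0 is
    -- a left inverse of ρ, sends series without κ to the suboperad and ℓ_0 to ℓ_0, so it preserves
    -- the degree in ℓ_0.
    obtain ⟨y, z, hy, hz, hd⟩ := (cTwCurv A).d_degree h _ hx
    have hE : (evaluation (retraction A ρ) (ellOf A 0)).map (ellOf (cTwUnder A) 0) = ellOf A 0 := by
      rw [evaluation_ell, retraction_ell, add_zero]
    have hmem : ∀ {n : ℕ} {a : ℤ} (s : (cTw A.right).obj n a), s ∈ (noKappa A.right).carrier n a →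
        (evaluation (retraction A ρ) (ellOf A 0)).map s ∈ (coalgebraSub A ρ).carrier n a := by
      intro n a s hs
      rw [evaluation_of_mem _ _ hs]
      exact retraction_mem hδ _
    have hy' := HasDegree.map (evaluation (retraction A ρ) (ellOf A 0)) hmem hy
    have hz' := HasDegree.map (evaluation (retraction A ρ) (ellOf A 0)) hmem hz
    have e : (evaluation (retraction A ρ) (ellOf A 0)).map (ellOf (cTwCurv A).Q 0) = ellOf A 0 := hE
    rw [e] at hy' hz'
    refine ⟨_, _, hy', hz', ?_⟩
    refine (evaluation_retraction hε hδ (A.right.d h x)).symm.trans ?_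
    refine (congrArg (evaluation (retraction A ρ) (ellOf A 0)).map
      (((coaction A ρ).map_d h x).trans hd)).trans ?_
    exact map_add (evaluation (retraction A ρ) (ellOf A 0)).map y z

/-- The coaction of a coalgebra as a morphism of curved twisting structures. -/
def coactionCurv (hε : coaction A ρ ≫ cTwCounit A.right = 𝟙 A.right)
    (hδ : coaction A ρ ≫ comult A = coaction A ρ ≫ cTwMap (coaction A ρ)) :
    coalgebraCurv hε hδ ⟶ cTwCurv A where
  hom := ρ
  map_mem _ hx := hx

/-- The unit at the curved twisting structure of a coalgebra. -/
def coalgebraUnit (hε : coaction A ρ ≫ cTwCounit A.right = 𝟙 A.right)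
    (hδ : coaction A ρ ≫ comult A = coaction A ρ ≫ cTwMap (coaction A ρ)) :
    A.right ⟶ cTw A.right :=
  (coalgebraCurv hε hδ).unitHom

/-- By construction ρ is a morphism of curved twisting structures to the cofree one, and naturality
of the unit along it gives δρ = cTw(ρ) ∘ unit. Applying cTw of the counit leaves ρ on the left by
the triangle identity, and the unit on the right by the counit law of the coalgebra. -/
theorem coalgebraUnit_eq (hε : coaction A ρ ≫ cTwCounit A.right = 𝟙 A.right)
    (hδ : coaction A ρ ≫ comult A = coaction A ρ ≫ cTwMap (coaction A ρ)) :
    coalgebraUnit hε hδ = coaction A ρ := by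
  have h : coaction A ρ ≫ comult A = coalgebraUnit hε hδ ≫ cTwMap (coaction A ρ) :=
    Curv.unitHom_naturality (coactionCurv hε hδ)
  have hc : cTwMap (coaction A ρ) ≫ cTwMap (cTwCounit A.right) = 𝟙 (cTw A.right) := by
    refine ((cTwFunctor F k).map_comp _ _).symm.trans ?_
    rw [hε]
    exact (cTwFunctor F k).map_id A.right
  rw [← Category.comp_id (coalgebraUnit hε hδ), ← hc, ← Category.assoc, ← h, Category.assoc,
    comult_cTwMap_counit, Category.comp_id]

theorem coalgebraUnit_comm (hε : coaction A ρ ≫ cTwCounit A.right = 𝟙 A.right)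
    (hδ : coaction A ρ ≫ comult A = coaction A ρ ≫ cTwMap (coaction A ρ)) :
    coalgebraUnit hε hδ ≫ cTwMap (𝟙 A.right) = 𝟙 A.right ≫ coaction A ρ := by
  have h : cTwMap (𝟙 A.right) = 𝟙 (cTw A.right) := (cTwFunctor F k).map_id _
  rw [h, coalgebraUnit_eq, Category.comp_id, Category.id_comp]

end Coalgebra

variable (F k) in
-- Morphisms on both sides are morphisms under cL_∞, resp. cA_∞, with an extra property, whence
-- faithfulness. Fullness holds because Q_0 is recovered from the unit as the preimage of the series
-- without κ, and every coaction is the unit of the structure it defines.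
theorem comparison_isEquivalence : (Comonad.comparison (curvAdjunction F k)).IsEquivalence where
  faithful :=
    ⟨fun {X Y f g} h => Curv.Hom.ext (congrArg Comonad.Coalgebra.Hom.f h)⟩
  full :=
    ⟨fun {X Y} g => by
      have hg : X.unitHom ≫ cTwMap g.f.right = g.f.right ≫ Y.unitHom :=
        congrArg CommaMorphism.right g.h
      refine ⟨⟨g.f, fun x hx => Y.mem_of_unit_mem ?_⟩, ?_⟩
      · have h := congrArg (fun f : X.Q.right ⟶ cTw Y.Q.right => app f x) hg
        have h' : app Y.unitHom (app g.f.right x) = app (cTwMap g.f.right) (app X.unitHom x) := h.symm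
        exact h'.symm ▸ mem_noKappa_cTwMap g.f.right (X.unit.map_mem x hx)
      · ext
        rfl⟩
  essSurj :=
    ⟨fun A => by
      have hε : coaction A.A A.a ≫ cTwCounit A.A.right = 𝟙 A.A.right :=
        congrArg CommaMorphism.right A.counit
      have hδ : coaction A.A A.a ≫ comult A.A = coaction A.A A.a ≫ cTwMap (coaction A.A A.a) :=
        congrArg CommaMorphism.right A.coassoc
      refine ⟨coalgebraCurv hε hδ, ⟨Comonad.Coalgebra.isoMk (Iso.refl A.A) ?_⟩⟩
      exact Under.UnderMorphism.ext (coalgebraUnit_comm (ρ := A.a) hε hδ)⟩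

end Comonadic

end

end CurvedTwisting

/-- For symmetric operads under `cL_∞` and for nonsymmetric operads under `cA_∞`, the forgetful
functor from curved twisting structures has a right adjoint, the comparison functor to coalgebras
over the induced comonad is an equivalence, and this comonad is the curved twisting comonad. -/
theorem theorem1p2 (k : Type u) [Field k] [CharZero k] (F : CurvedTwisting.Flavor) :
    ∃ (R : Under (CurvedTwisting.cInf F k) ⥤ CurvedTwisting.Curv F k)
      (adj : CurvedTwisting.Curv.forget F k ⊣ R),
      (Comonad.comparison adj).IsEquivalence ∧
        Nonempty (CurvedTwisting.CTwComonad adj.toComonad) :=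
  ⟨CurvedTwisting.cofreeCurv F k, CurvedTwisting.curvAdjunction F k,
    CurvedTwisting.comparison_isEquivalence F k, ⟨CurvedTwisting.curvComonad F k⟩⟩
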